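/- **Setting.** For each sample size $n$ we observe $X_i=\mu_n(i/n)+Z_i$, $i=1,\dots,n$. *Noise.* $Z_i=g(\varepsilon_i,\varepsilon_{i-1},\dots)$ with $g$ measurable and $(\varepsilon_i)_{i\in\mathbb Z}$ i.i.d. real innovations; $E Z_1=0$, $E|Z_1|^r<\infty$ for some $r>4$, and $\sum_{i\ge 0}\|Z_i-Z_{i,\{0\}}\|_4<\infty$, where $Z_{i,\{0\}}$ is $Z_i$ with $\varepsilon_0$ replaced by an independent copy. Put $\gamma_k=\mathrm{Cov}(Z_0,Z_k)$ and $v=\sum_{k\in\mathbb Z}\gamma_k$; for the integer $q\ge 1$ below, $\sum_{k}|k|^q|\gamma_k|<\infty$. *Mean.* $\mu_n=c_n+s_n$ with $c_n$ continuous on $[0,1]$ and $s_n(x)=\sum_{j=0}^{J_n}\xi_{n,j}\mathbf 1(T_{n,j}/n\le x<T_{n,j+1}/n)$, where $1=T_{n,0}<\dots<T_{n,J_n+1}=n+1$ are integers and $\xi_{n,j}\ne\xi_{n,j+1}$ for $0\le j<J_n$; moreover $J_n\asymp1$, $\max_{0\le j<J_n}|\xi_{n,j}-\xi_{n,j+1}|\asymp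 1$ and $\sup_{0\le x'<x\le1}|c_n(x)-c_n(x')|/(x-x')\asymp1$. A pair (noise, sequence of means) with these properties is called a *mechanism*. *Kernel.* $K:\mathbb R\to\mathbb R$ is bounded, even, continuous on $(-1,1)$, $K(0)=1$, $K(t)=0$ for $|t|\ge1$, and $\{K(t)-K(0)\}/|t|^q\to B\neq0$ as $t\downarrow0$. Put $\kappa=\int_{-1}^1K(t)\,dt$. *Tuning.* $m=m_n$, $\ell=\ell_n\in\{1,\dots,n\}$, $h=h_n\in\{1,\dots,n\}$ are integers and $d_j=d_{n,j}$, $0\le j\le m$, are reals, all deterministic and not depending on the mechanism, with $\sum_{j=0}^m d_j=0$, $\sum_{j=0}^m d_j^2=1$, $m\to\infty$, $1/\ell+(\ell+mh)/n\to0$. With $\delta_s=\sum_{j=|s|}^m d_jd_{j-|s|}$, both $\sum_{j=0}^m|d_j|$ and $\sum_{|s|\le m}|\delta_s|$ are bounded in $n$. *Estimator.* $\hat v=\sum_{|k|<\ell}K(k/\ell)\,\frac1n\sum_{i=mh+|k|+1}^nD_iD_{i-|k|}$, where $D_i=\sum_{j=0}^md_jX_{i-jh}$, and $\mathrm{MSE}(\hat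 v)=E(\hat v-v)^2$. *Terminology.* $\hat v$ is *inconsistent* if $\mathrm{MSE}(\hat v)\not\to0$ for some mechanism; *rate optimal* if $\mathrm{MSE}(\hat v)=O(n^{-2q/(1+2q)})$ for every mechanism, and *rate suboptimal* otherwise. *The lower bound holds* if for some mechanism there is $c>0$ with $\mathrm{MSE}(\hat v)\ge c\,n^{-2q/(1+2q)}$ for all large $n$. $\hat v$ *attains the optimal rate* if it is rate optimal and $\mathrm{MSE}(\hat v)\asymp n^{-2q/(1+2q)}$ for some mechanism. *Conditions.* (U) $2\sum_{s=1}^{\lfloor \ell/h\rfloor}\delta_sK(sh/\ell)\to\Omega_\infty\ne0$. (A) There are $c',c''>0$ with $-c''/m\le\delta_s\le-c'/m$ for all $1\le|s|\le m$ (and all large $n$). (T) For an integer $q'\ge1$, $\{K(1)-K(1-t)\}/|t|^{q'}\to B'\ne0$ as $t\downarrow0$. **Theorem.** 1. Suppose $h/\ell\to0$. (a) Under (U), $\hat v$ is inconsistent. (b) Under (A), if $K$ is non-increasing on $[0,1]$, then $\hat v$ is inconsistent if $\ell/h\gtrsim m$, and rate suboptimal if $\ell/h\ll m$. 2. Suppose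 $h/\ell\to\lambda_\infty\in(0,1)$. (a) Under (U), $\hat v$ is inconsistent. (b) Under (A), if $K$ is strictly decreasing on $[0,1]$, then $\hat v$ is rate suboptimal. 3. Suppose $h/\ell\to1$, $|h-\ell|=O(1)$, (A) and (T). (a) If $q=1$ and $\kappa\ne0$, or if $\ell^q\gg m\ell^{q'}$, then $\hat v$ is rate suboptimal. (b) If $q>1$ and $\ell^q\lesssim m\ell^{q'}$, then the lower bound holds; $\hat v$ attains the optimal rate if $\ell\asymp n^{1/(1+2q)}$ and $n^{(q-q')/(1+2q)}\lesssim m\lesssim n^{(q-1)/(1+2q)}$; and, if $\kappa\neq0$, $\hat v$ is rate suboptimal unless these relations hold. 4. Suppose $h/\ell\to\lambda_\infty\in(1,\infty)$ and (A). (a) If $q=1$ and $\kappa\ne0$, then $\hat v$ is rate suboptimal. (b) If $q>1$, then the lower bound holds; $\hat v$ attains the optimal rate if $\ell\asymp n^{1/(1+2q)}$ and $m\lesssim n^{(q-1)/(1+2q)}$; and, if $\kappa\ne0$, $\hat v$ is rate suboptimal unless these relations hold. 5. Suppose $h/\ell\to\infty$. (a) If $q=1$ and $\kappa\ne0$, then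 $\hat v$ is rate suboptimal. (b) If $q>1$, then the lower bound holds; $\hat v$ attains the optimal rate if $\ell\asymp n^{1/(1+2q)}$ and $n^{1/(1+2q)}\ll mh\lesssim n^{q/(1+2q)}$; and, if $\kappa\ne0$ and (A) holds, $\hat v$ is rate suboptimal unless these relations hold. -/

import Mathlib

open MeasureTheory ProbabilityTheory Filter Asymptotics
open scoped Topology

namespace DiffLRV

noncomputable section

/-! ### Kernels -/

/-- A kernel: `K 0 = 1`, even, vanishing for `|t| ≥ 1`, continuous on `(-1,1)`, bounded. -/
structure IsKernel (K : ℝ → ℝ) : Prop where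
  zero : K 0 = 1
  even : ∀ t, K (-t) = K t
  support : ∀ t, 1 ≤ |t| → K t = 0
  continuousOn : ContinuousOn K (Set.Ioo (-1) 1)
  bounded : ∃ A : ℝ, ∀ t, |K t| ≤ A

/-- Near-origin property: `(K t - K 0) / |t| ^ q → B ≠ 0` as `t ↓ 0`, with `q ≥ 1`. -/
def NearOrigin (K : ℝ → ℝ) (q : ℕ) : Prop :=
  1 ≤ q ∧ ∃ B : ℝ, B ≠ 0 ∧ Tendsto (fun t : ℝ => (K t - K 0) / |t| ^ q) (𝓝[>] 0) (𝓝 B)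

/-- Near-boundary property: `(K 1 - K (1 - t)) / |t| ^ q' → B' ≠ 0` as `t ↓ 0`, with `q' ≥ 1`. -/
def NearBoundary (K : ℝ → ℝ) (q' : ℕ) : Prop :=
  1 ≤ q' ∧ ∃ B' : ℝ, B' ≠ 0 ∧
    Tendsto (fun t : ℝ => (K 1 - K (1 - t)) / |t| ^ q') (𝓝[>] 0) (𝓝 B')

/-- `κ = ∫_{-1}^1 K(t) dt`. -/
def kappa (K : ℝ → ℝ) : ℝ := ∫ t in (-1 : ℝ)..1, K t

/-! ### Tuning parameters and the estimator -/

/-- The user's choices as functions of the sample size `n`: order of differencing `m`,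
bandwidth `ℓ`, lag `h`, and difference sequence `d n 0, …, d n (m n)`. They are fixed before
the data generating mechanism, so they cannot depend on unknowns. -/
structure Tuning where
  m : ℕ → ℕ
  ℓ : ℕ → ℕ
  h : ℕ → ℕ
  d : ℕ → ℕ → ℝ

/-- `δ_s = ∑_{j=|s|}^m d_j d_{j-|s|}`; the sum is empty, hence `0`, for `|s| > m`. -/
def delta (m : ℕ) (d : ℕ → ℝ) (s : ℤ) : ℝ :=
  ∑ j ∈ Finset.Icc s.natAbs m, d j * d (j - s.natAbs)

/-- `D_i = ∑_{j=0}^m d_j X_{i-jh}` -/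
def diffStat (m h : ℕ) (d : ℕ → ℝ) (X : ℤ → ℝ) (i : ℤ) : ℝ :=
  ∑ j ∈ Finset.range (m + 1), d j * X (i - j * h)

/-- `γ̂_k^D = n⁻¹ ∑_{i=mh+|k|+1}^n D_i D_{i-|k|}` -/
def gammaHat (n m h : ℕ) (d : ℕ → ℝ) (X : ℤ → ℝ) (k : ℤ) : ℝ :=
  (1 / (n : ℝ)) * ∑ i ∈ Finset.Icc ((m : ℤ) * h + |k| + 1) (n : ℤ),
    diffStat m h d X i * diffStat m h d X (i - |k|)

/-- `v̂ = ∑_{|k|<ℓ} K(k/ℓ) γ̂_k^D` -/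
def vHat (K : ℝ → ℝ) (t : Tuning) (n : ℕ) (X : ℤ → ℝ) : ℝ :=
  ∑ k ∈ Finset.Ioo (-(t.ℓ n : ℤ)) (t.ℓ n : ℤ),
    K ((k : ℝ) / (t.ℓ n : ℝ)) * gammaHat n (t.m n) (t.h n) (t.d n) X k

namespace Tuning

/-- `λ_n = h_n / ℓ_n` -/
def ratio (t : Tuning) (n : ℕ) : ℝ := (t.h n : ℝ) / (t.ℓ n : ℝ)

/-- Standing conditions in the divergent-`m` regime. -/
structure Admissible (t : Tuning) : Prop where
  bandwidth_mem : ∀ᶠ n in atTop, 1 ≤ t.ℓ n ∧ t.ℓ n ≤ n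
  lag_mem : ∀ᶠ n in atTop, 1 ≤ t.h n ∧ t.h n ≤ n
  sum_zero : ∀ᶠ n in atTop, ∑ j ∈ Finset.range (t.m n + 1), t.d n j = 0
  normalized : ∀ᶠ n in atTop, ∑ j ∈ Finset.range (t.m n + 1), t.d n j ^ 2 = 1
  summable_d : ∃ A : ℝ, ∀ᶠ n in atTop, ∑ j ∈ Finset.range (t.m n + 1), |t.d n j| ≤ A
  summable_delta : ∃ A : ℝ, ∀ᶠ n in atTop,
    ∑ s ∈ Finset.Icc (-(t.m n : ℤ)) (t.m n : ℤ), |delta (t.m n) (t.d n) s| ≤ A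
  order_tendsto : Tendsto t.m atTop atTop
  bandwidth_tendsto : Tendsto t.ℓ atTop atTop
  negligible : Tendsto (fun n => ((t.ℓ n : ℝ) + (t.m n : ℝ) * (t.h n : ℝ)) / (n : ℝ)) atTop (𝓝 0)

/-- Unambiguity: `2 ∑_{s=1}^{⌊1/λ⌋} δ_s K(λ s) → Ω_∞ ≠ 0`. -/
def Unambiguous (K : ℝ → ℝ) (t : Tuning) : Prop :=
  ∃ Ω : ℝ, Ω ≠ 0 ∧
    Tendsto (fun n => 2 * ∑ s ∈ Finset.Icc 1 ⌊1 / t.ratio n⌋₊,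
      delta (t.m n) (t.d n) (s : ℤ) * K (t.ratio n * s)) atTop (𝓝 Ω)

/-- Approximately uncorrelated differencing: `-c''/m ≤ δ_s ≤ -c'/m` for `1 ≤ |s| ≤ m`. -/
def ApproxUncorrelated (t : Tuning) : Prop :=
  ∃ c' c'' : ℝ, 0 < c' ∧ 0 < c'' ∧ ∀ᶠ n in atTop, ∀ s : ℤ, 1 ≤ |s| → |s| ≤ (t.m n : ℤ) →
    -c'' / (t.m n : ℝ) ≤ delta (t.m n) (t.d n) s ∧ delta (t.m n) (t.d n) s ≤ -c' / (t.m n : ℝ)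

end Tuning

/-! ### Noise: causal functionals of i.i.d. innovations -/

/-- The noise `Z_i = g(ε_i, ε_{i-1}, …)` is given by the common law `ν` of the i.i.d.
innovations and the measurable function `g`. -/
structure Noise where
  ν : Measure ℝ
  isProb : IsProbabilityMeasure ν
  g : (ℕ → ℝ) → ℝ
  measurable_g : Measurable g

attribute [instance] Noise.isProb

namespace Noise

/-- The joint law of the i.i.d. innovations `(ε_i)_{i ∈ ℤ}`. -/
def P (N : Noise) : Measure (ℤ → ℝ) := Measure.infinitePi (fun _ : ℤ => N.ν)

/-- `Z_i` as a function of the innovations. -/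
def Z (N : Noise) (i : ℤ) (ε : ℤ → ℝ) : ℝ := N.g (fun k : ℕ => ε (i - k))

/-- `θ_{p,i} = ‖Z_i - Z_{i,{0}}‖_p`, where `Z_{i,{0}}` is `Z_i` with `ε_0` replaced by an
independent copy (the second component of `ω`). -/
def theta (N : Noise) (p : ENNReal) (i : ℕ) : ENNReal :=
  eLpNorm (fun ω : (ℤ → ℝ) × ℝ => N.Z i ω.1 - N.Z i (Function.update ω.1 0 ω.2)) p (N.P.prod N.ν)

/-- Autocovariance `γ_k = Cov(Z_0, Z_k)`. -/
def gam (N : Noise) (k : ℤ) : ℝ := covariance (N.Z 0) (N.Z k) N.P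

/-- Long-run variance `v = ∑_k γ_k`. -/
def lrv (N : Noise) : ℝ := ∑' k : ℤ, N.gam k

/-- Weak dependence: mean zero, a finite moment of order `r > 4`, and `Θ_4 < ∞`.
Strict stationarity is automatic for `Z_i = g(ε_i, ε_{i-1}, …)`. -/
structure WeakDep (N : Noise) : Prop where
  moment : ∃ r : ℝ, 4 < r ∧ MemLp (N.Z 1) (ENNReal.ofReal r) N.P
  mean_zero : ∫ ε, N.Z 1 ε ∂N.P = 0
  dep : ∑' i : ℕ, N.theta 4 i < ⊤

/-- `u_q = ∑_k |k|^q |γ_k| < ∞` -/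
def FiniteU (N : Noise) (q : ℕ) : Prop := Summable (fun k : ℤ => |(k : ℝ)| ^ q * |N.gam k|)

end Noise

/-! ### Mean functions -/

/-- A mean function `μ = c + s` at a fixed sample size: the continuous part `c`, the number `J`
of discontinuities, their times `T 1, …, T J` and the levels `ξ 0, …, ξ J`. -/
structure MeanFn where
  c : ℝ → ℝ
  J : ℕ
  T : ℕ → ℕ
  ξ : ℕ → ℝ

namespace MeanFn

/-- `c` is continuous on `[0,1]`, `1 = T_0 < T_1 < … < T_J < T_{J+1} = n+1`, `ξ_{j+1} ≠ ξ_j`. -/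
structure Valid (M : MeanFn) (n : ℕ) : Prop where
  cont : ContinuousOn M.c (Set.Icc 0 1)
  first : M.T 0 = 1
  last : M.T (M.J + 1) = n + 1
  mono : ∀ j ≤ M.J, M.T j < M.T (j + 1)
  jump : ∀ j < M.J, M.ξ (j + 1) ≠ M.ξ j

/-- `μ(x) = c(x) + ∑_{j=0}^J ξ_j 1(T_j/n ≤ x < T_{j+1}/n)` -/
def eval (M : MeanFn) (n : ℕ) (x : ℝ) : ℝ :=
  M.c x + ∑ j ∈ Finset.range (M.J + 1),
    (Set.Ico ((M.T j : ℝ) / n) ((M.T (j + 1) : ℝ) / n)).indicator (fun _ => M.ξ j) x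

/-- The difference quotients of `c` on `[0,1]`; their supremum is `𝒞`. -/
def slopes (M : MeanFn) : Set ℝ :=
  {r | ∃ x' x : ℝ, 0 ≤ x' ∧ x' < x ∧ x ≤ 1 ∧ r = |(M.c x - M.c x') / (x - x')|}

/-- `𝒮`, the largest jump of the step part (`0` if there is none). -/
def maxStep (M : MeanFn) : ℝ := ⨆ j : Fin M.J, |M.ξ j - M.ξ (j + 1)|

end MeanFn

/-- A sequence of mean functions with `𝒥, 𝒮, 𝒞 ≍ 1`. -/
def MildMean (M : ℕ → MeanFn) : Prop :=
  (∀ n, 1 ≤ n → (M n).Valid n) ∧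
  ∃ A : ℝ, 0 < A ∧ ∀ᶠ n in atTop,
    (1 / A ≤ ((M n).J : ℝ) ∧ ((M n).J : ℝ) ≤ A) ∧
    (1 / A ≤ (M n).maxStep ∧ (M n).maxStep ≤ A) ∧
    (∃ C : ℝ, IsLUB (M n).slopes C ∧ 1 / A ≤ C ∧ C ≤ A)

/-! ### Data generating mechanisms and risk -/

/-- A data generating mechanism: a noise process and, for each `n`, a mean function. -/
structure DGM where
  noise : Noise
  mean : ℕ → MeanFn

/-- The class of data generating mechanisms over which the worst case is taken. -/
structure DGM.InClass (G : DGM) (q : ℕ) : Prop where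
  weakDep : G.noise.WeakDep
  finiteU : G.noise.FiniteU q
  mild : MildMean G.mean

/-- The observations `X_i = μ(i/n) + Z_i`. -/
def DGM.X (G : DGM) (n : ℕ) (ε : ℤ → ℝ) (i : ℤ) : ℝ :=
  (G.mean n).eval n ((i : ℝ) / (n : ℝ)) + G.noise.Z i ε

/-- `MSE_μ(v̂) = E (v̂ - v)²` at sample size `n`. -/
def mse (K : ℝ → ℝ) (t : Tuning) (G : DGM) (n : ℕ) : ℝ :=
  ∫ ε, (vHat K t n (G.X n ε) - G.noise.lrv) ^ 2 ∂G.noise.P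

/-- The optimal rate `n^{-2q/(1+2q)}`. -/
def optRate (q : ℕ) (n : ℕ) : ℝ := (n : ℝ) ^ (-(2 * (q : ℝ)) / (1 + 2 * (q : ℝ)))

/-- `v̂` is inconsistent in `L²`: under some mechanism of the class its MSE does not vanish. -/
def Inconsistent (K : ℝ → ℝ) (q : ℕ) (t : Tuning) : Prop :=
  ∃ G : DGM, G.InClass q ∧ ¬ Tendsto (mse K t G) atTop (𝓝 0)

/-- `v̂` is rate optimal: its MSE is `O(n^{-2q/(1+2q)})` under every mechanism of the class. -/
def RateOptimal (K : ℝ → ℝ) (q : ℕ) (t : Tuning) : Prop :=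
  ∀ G : DGM, G.InClass q → mse K t G =O[atTop] optRate q

/-- `v̂` is rate suboptimal: it is not rate optimal. -/
def RateSuboptimal (K : ℝ → ℝ) (q : ℕ) (t : Tuning) : Prop := ¬ RateOptimal K q t

/-- The worst-case MSE of `v̂` is at least of the order `n^{-2q/(1+2q)}`. -/
def NoBetterThanOpt (K : ℝ → ℝ) (q : ℕ) (t : Tuning) : Prop :=
  ∃ G : DGM, G.InClass q ∧ optRate q =O[atTop] mse K t G

/-- The worst-case MSE of `v̂` is exactly of the order `n^{-2q/(1+2q)}`. -/
def AttainsOpt (K : ℝ → ℝ) (q : ℕ) (t : Tuning) : Prop :=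
  RateOptimal K q t ∧ ∃ G : DGM, G.InClass q ∧ mse K t G =Θ[atTop] optRate q

/-- `n^{a/(1+2q)}` -/
def nPow (q : ℕ) (a : ℝ) (n : ℕ) : ℝ := (n : ℝ) ^ (a / (1 + 2 * (q : ℝ)))

end

end DiffLRV

/-! The estimator is a quadratic form in the differenced data, so its risk is variance plus squared
bias, and the bias is a noise part plus a mean part (`mse_eq`). With x = n^{1/(1+2q)} (`scale`) one
has n = x^{1+2q}, the optimal rate is x^{-2q}, and every claim compares ℓ, m and h with powers of x.

Four effects compete. The variance is of order ℓ/n. Smoothing by the kernel costs ℓ^{-q}.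
Differencing kills the level of the mean but leaves energy O(mh), which costs up to ℓmh/n. Finally
the differences are correlated: δ_0 = 1 while all δ_s sum to zero, so the weight of γ_u in the
expectation (`wt`) contains K((u+sh)/ℓ) with s ≠ 0. This last effect is harmful for h below ℓ, a
boundary effect of order 1/(mℓ^{q'}) for h near ℓ, and gone once h exceeds ℓ by a factor.

Upper bounds. The Efron–Stein inequality (`variance_le_of_resample`), applied to linear forms, to
their squares and to quadratic forms, bounds the variance through the dependence measure
(`variance_quadratic_le`). Differencing multiplies the dependence constant only by ∑|d_j|, so m → ∞
does no harm. Together with `meanEnergy_le` and bounds on `offDiag` this gives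
`rateOptimal_of_offDiag`.

Lower bounds. The test noises are finite moving averages of random signs. Projecting the estimator
on products of two signs and using Bessel's inequality gives variance of order ℓ/n
(`variance_vHat_ge`). The coefficients are chosen so that the leading bias terms share one sign and
cannot cancel (`exists_moment`, `exists_boundaryMoment`, `exists_moment_boundaryMoment`). One
mechanism then has risk at least ℓ/n + ρ² (`RiskLowerBound`), and with ρ = ℓ^{-q} the optimal rate
forces ℓ ≍ x.

The mean is tested with a unit step. At the last observation it is invisible up to 1/n. In
mid-sample (`meanBias_mid_ge`), polarising D_i D_k turns its bias into κℓ times the energy minus a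
sum over increments, and both are governed by the overlap sums ∑ δ_s (k - |s|h)₊. Comparing the two
means isolates the mean bias, so under approximate uncorrelatedness a rate optimal choice with ℓ ≪
mh has ℓmh ≲ x^{1+q}.

Consequences. If h ≳ ℓ and ℓ ≍ x, the last bound reads m ≲ x^{q-1}, which excludes q = 1; if h ≫ ℓ,
already ℓh ≲ x² excludes q = 1. If h/ℓ has a limit below 1, then under unambiguity the bias for
independent signs tends to Ω ≠ 0. For monotone kernels and approximately uncorrelated differencing
the weight of γ_0 drops by at least the order ℓ/(mh), or by a constant if m ≲ ℓ/h; combined with ℓmh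
≲ x^{1+q} and x ≲ ℓ, rate optimality would bound ℓ. -/

namespace DiffLRV

noncomputable section

/-! ### The Efron–Stein inequality on an infinite product -/

section EfronStein

variable {ν : Measure ℝ} [IsProbabilityMeasure ν]

/-- The configuration that agrees with `ε` on `S` and with `ω` off `S`. -/
def mix (S : Finset ℤ) (ε ω : ℤ → ℝ) : ℤ → ℝ := fun i => if i ∈ S then ε i else ω i

lemma measurable_mix (S : Finset ℤ) :
    Measurable (fun p : (ℤ → ℝ) × (ℤ → ℝ) => mix S p.1 p.2) := by
  refine measurable_pi_iff.2 fun i => ?_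
  by_cases h : i ∈ S
  · simp only [mix, h, if_true]; fun_prop
  · simp only [mix, h, if_false]; fun_prop

/-- The finer σ-algebra on the first factor is the point: it makes `avgOff` measurable with respect
to the coordinates in `S` alone, as a conditional expectation must be. -/
lemma measurable_mix_cylinder (S : Finset ℤ) :
    Measurable[(cylinderEvents (X := fun _ : ℤ => ℝ) (S : Set ℤ)).prod MeasurableSpace.pi,
      MeasurableSpace.pi] (fun p : (ℤ → ℝ) × (ℤ → ℝ) => mix S p.1 p.2) := by
  refine (@measurable_pi_iff _ _ _ ((cylinderEvents (X := fun _ : ℤ => ℝ) (S : Set ℤ)).prod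
    MeasurableSpace.pi) _ _).2 fun i => ?_
  by_cases h : i ∈ S
  · simp only [mix, h, if_true]
    exact (measurable_cylinderEvent_apply (X := fun _ : ℤ => ℝ) (Finset.mem_coe.2 h)).comp
      (@measurable_fst _ _ (cylinderEvents (X := fun _ : ℤ => ℝ) (S : Set ℤ)) _)
  · simp only [mix, h, if_false]
    exact (measurable_pi_apply i).comp
      (@measurable_snd _ _ (cylinderEvents (X := fun _ : ℤ => ℝ) (S : Set ℤ)) _)

/-- A box pulls back to a product of two boxes, one over its coordinates in `S` and one over the
others; the product law is determined by boxes. -/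
lemma measurePreserving_mix (S : Finset ℤ) :
    MeasurePreserving (fun p : (ℤ → ℝ) × (ℤ → ℝ) => mix S p.1 p.2)
      ((Measure.infinitePi fun _ : ℤ => ν).prod (Measure.infinitePi fun _ : ℤ => ν))
      (Measure.infinitePi fun _ : ℤ => ν) := by
  refine ⟨measurable_mix S, Measure.eq_infinitePi _ fun s t ht => ?_⟩
  rw [Measure.map_apply (measurable_mix S)
    (MeasurableSet.pi s.countable_toSet fun i _ => ht i)]
  have : (fun p : (ℤ → ℝ) × (ℤ → ℝ) => mix S p.1 p.2) ⁻¹' ((s : Set ℤ).pi t) =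
      (((s.filter (· ∈ S) : Finset ℤ) : Set ℤ).pi t) ×ˢ
        (((s.filter (· ∉ S) : Finset ℤ) : Set ℤ).pi t) := by
    ext p
    simp only [Set.mem_preimage, Set.mem_pi, Finset.mem_coe, mix, Set.mem_prod, Finset.mem_filter]
    constructor
    · intro h
      exact ⟨fun i hi => by simpa [hi.2] using h i hi.1, fun i hi => by simpa [hi.2] using h i hi.1⟩
    · rintro ⟨h1, h2⟩ i hi
      by_cases hS : i ∈ S
      · simpa [hS] using h1 i ⟨hi, hS⟩
      · simpa [hS] using h2 i ⟨hi, hS⟩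
  rw [this, Measure.prod_prod, Measure.infinitePi_pi _ fun i _ => ht i,
    Measure.infinitePi_pi _ fun i _ => ht i, Finset.prod_filter_mul_prod_filter_not]

lemma measurable_update_prod (j : ℤ) :
    Measurable (fun p : (ℤ → ℝ) × ℝ => Function.update p.1 j p.2) := by
  refine measurable_pi_iff.2 fun i => ?_
  by_cases h : i = j
  · subst h; simp only [Function.update_self]; fun_prop
  · simp only [Function.update_of_ne h]; fun_prop

lemma measurePreserving_update (j : ℤ) :
    MeasurePreserving (fun p : (ℤ → ℝ) × ℝ => Function.update p.1 j p.2)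
      ((Measure.infinitePi fun _ : ℤ => ν).prod ν) (Measure.infinitePi fun _ : ℤ => ν) := by
  refine ⟨measurable_update_prod j, Measure.eq_infinitePi _ fun s t ht => ?_⟩
  rw [Measure.map_apply (measurable_update_prod j)
    (MeasurableSet.pi s.countable_toSet fun i _ => ht i)]
  have : (fun p : (ℤ → ℝ) × ℝ => Function.update p.1 j p.2) ⁻¹' ((s : Set ℤ).pi t) =
      (((s.erase j : Finset ℤ) : Set ℤ).pi t) ×ˢ (if j ∈ s then t j else Set.univ) := by
    ext p
    simp only [Set.mem_preimage, Set.mem_pi, Finset.mem_coe, Set.mem_prod, Finset.mem_erase]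
    constructor
    · intro h
      refine ⟨fun i hi => by simpa [Function.update_of_ne hi.1] using h i hi.2, ?_⟩
      split_ifs with hj
      · simpa using h j hj
      · trivial
    · rintro ⟨h1, h2⟩ i hi
      by_cases hij : i = j
      · subst hij; simpa [hi] using h2
      · simpa [Function.update_of_ne hij] using h1 i ⟨hij, hi⟩
  rw [this, Measure.prod_prod, Measure.infinitePi_pi _ fun i _ => ht i]
  by_cases hj : j ∈ s
  · simp only [hj, if_true]
    rw [mul_comm, Finset.mul_prod_erase s (fun i => ν (t i)) hj]
  · simp [hj]

/-- Integrating out the coordinates off `S`. -/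
def avgOff (ν : Measure ℝ) (S : Finset ℤ) (f : (ℤ → ℝ) → ℝ) (ε : ℤ → ℝ) : ℝ :=
  ∫ ω, f (mix S ε ω) ∂(Measure.infinitePi fun _ : ℤ => ν)

lemma stronglyMeasurable_avgOff (S : Finset ℤ) {f : (ℤ → ℝ) → ℝ} (hf : Measurable f) :
    StronglyMeasurable[cylinderEvents (X := fun _ : ℤ => ℝ) (S : Set ℤ)] (avgOff ν S f) := by
  have h := (hf.comp (measurable_mix_cylinder S))
  exact @StronglyMeasurable.integral_prod_right' _ _ _
    (cylinderEvents (X := fun _ : ℤ => ℝ) (S : Set ℤ)) _ _ _ _ _ _ h.stronglyMeasurable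

/-- Such an event factors through the restriction to `S`, which `mix` leaves untouched. It allows an
indicator to pass under the integral over `ω`. -/
lemma mem_iff_of_cylinderEvents {S : Finset ℤ} {A : Set (ℤ → ℝ)}
    (hA : MeasurableSet[cylinderEvents (X := fun _ : ℤ => ℝ) (S : Set ℤ)] A) (ε ω : ℤ → ℝ) :
    mix S ε ω ∈ A ↔ ε ∈ A := by
  have hle : cylinderEvents (X := fun _ : ℤ => ℝ) (S : Set ℤ) ≤
      MeasurableSpace.comap (S.restrict : (ℤ → ℝ) → _) MeasurableSpace.pi := by
    refine iSup₂_le fun i hi => ?_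
    rintro _ ⟨B, hB, rfl⟩
    exact ⟨(fun x : S → ℝ => x ⟨i, hi⟩) ⁻¹' B, measurable_pi_apply _ hB, rfl⟩
  obtain ⟨B, -, rfl⟩ := hle A hA
  have : S.restrict (mix S ε ω) = S.restrict ε := by
    ext i; simp [mix, i.2]
  simp only [Set.mem_preimage, this]

lemma integrable_comp_mix (S : Finset ℤ) {f : (ℤ → ℝ) → ℝ}
    (hf : Integrable f (Measure.infinitePi fun _ : ℤ => ν)) :
    Integrable (fun p : (ℤ → ℝ) × (ℤ → ℝ) => f (mix S p.1 p.2))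
      ((Measure.infinitePi fun _ : ℤ => ν).prod (Measure.infinitePi fun _ : ℤ => ν)) :=
  (measurePreserving_mix S).integrable_comp_of_integrable hf

/-- Tested against an event of the coordinates in `S`, both sides are the integral of the localised
`f`, because `mix` preserves the law. The explicit version is needed to write martingale increments
as averages of resampling differences. -/
lemma avgOff_ae_eq_condExp (S : Finset ℤ) {f : (ℤ → ℝ) → ℝ} (hf : Measurable f)
    (hfi : Integrable f (Measure.infinitePi fun _ : ℤ => ν)) :
    avgOff ν S f =ᵐ[Measure.infinitePi fun _ : ℤ => ν]
      (Measure.infinitePi fun _ : ℤ => ν)[f | cylinderEvents (X := fun _ : ℤ => ℝ) (S : Set ℤ)] := by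
  have hintg := integrable_comp_mix S hfi
  have havg : Integrable (avgOff ν S f) (Measure.infinitePi fun _ : ℤ => ν) := hintg.integral_prod_left
  refine ae_eq_condExp_of_forall_setIntegral_eq cylinderEvents_le_pi hfi
    (fun A _ _ => havg.integrableOn) (fun A hA _ => ?_)
    (stronglyMeasurable_avgOff S hf).aestronglyMeasurable
  have hA' : MeasurableSet A := cylinderEvents_le_pi _ hA
  rw [← integral_indicator hA', ← integral_indicator hA']
  have h1 : ∀ ε, A.indicator (avgOff ν S f) ε =
      ∫ ω, A.indicator f (mix S ε ω) ∂(Measure.infinitePi fun _ : ℤ => ν) := by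
    intro ε
    by_cases h : ε ∈ A
    · simp only [Set.indicator, mem_iff_of_cylinderEvents hA, h, if_true, avgOff]
    · simp only [Set.indicator, mem_iff_of_cylinderEvents hA, h, if_false, integral_zero]
  simp_rw [h1]
  rw [← integral_prod (fun p : (ℤ → ℝ) × (ℤ → ℝ) => A.indicator f (mix S p.1 p.2))
    (integrable_comp_mix S (hfi.indicator hA'))]
  have h2 := (measurePreserving_mix (ν := ν) S).map_eq
  conv_rhs => rw [← h2]
  rw [integral_map (measurable_mix S).aemeasurable]
  rw [h2]
  exact (hfi.indicator hA').aestronglyMeasurable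

/-- The effect on `f` of replacing the `j`-th coordinate by an independent copy. -/
def resampleDiff (f : (ℤ → ℝ) → ℝ) (j : ℤ) (p : (ℤ → ℝ) × ℝ) : ℝ :=
  f p.1 - f (Function.update p.1 j p.2)

lemma measurable_resampleDiff {f : (ℤ → ℝ) → ℝ} (hf : Measurable f) (j : ℤ) :
    Measurable (resampleDiff f j) :=
  (hf.comp measurable_fst).sub (hf.comp (measurable_update_prod j))

/-- Averaging over coordinate `j` as well is the same as first replacing it by an independent copy,
so the martingale increment is a mean of resampling differences. -/
lemma avgOff_insert_sub_avgOff {S : Finset ℤ} {j : ℤ} (hj : j ∉ S) {f : (ℤ → ℝ) → ℝ}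
    (hfi : Integrable f (Measure.infinitePi fun _ : ℤ => ν)) :
    ∀ᵐ ε ∂(Measure.infinitePi fun _ : ℤ => ν),
      avgOff ν (insert j S) f ε - avgOff ν S f ε =
        ∫ p : (ℤ → ℝ) × ℝ, resampleDiff f j (mix (insert j S) ε p.1, p.2)
          ∂((Measure.infinitePi fun _ : ℤ => ν).prod ν) := by
  filter_upwards [(integrable_comp_mix (insert j S) hfi).prod_right_ae,
    (integrable_comp_mix S hfi).prod_right_ae] with ε h1 h2
  have hmix : ∀ p : (ℤ → ℝ) × ℝ, Function.update (mix (insert j S) ε p.1) j p.2 =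
      mix S ε (Function.update p.1 j p.2) := by
    intro p
    ext i
    by_cases hij : i = j
    · subst hij; simp [mix, hj]
    · simp [mix, hij]
  have hmp := measurePreserving_update (ν := ν) j
  have e1 : avgOff ν (insert j S) f ε = ∫ p : (ℤ → ℝ) × ℝ, f (mix (insert j S) ε p.1)
      ∂((Measure.infinitePi fun _ : ℤ => ν).prod ν) := by
    rw [integral_fun_fst (fun ω => f (mix (insert j S) ε ω))]
    simp [avgOff]
  have h2' : Integrable (fun p : (ℤ → ℝ) × ℝ => f (mix S ε (Function.update p.1 j p.2)))
      ((Measure.infinitePi fun _ : ℤ => ν).prod ν) := hmp.integrable_comp_of_integrable h2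
  have e2 : avgOff ν S f ε = ∫ p : (ℤ → ℝ) × ℝ, f (mix S ε (Function.update p.1 j p.2))
      ∂((Measure.infinitePi fun _ : ℤ => ν).prod ν) := by
    rw [avgOff]
    conv_lhs => rw [← hmp.map_eq]
    rw [integral_map hmp.measurable.aemeasurable]
    rw [hmp.map_eq]
    exact h2.aestronglyMeasurable
  rw [e1, e2, ← integral_sub _ h2']
  · simp only [resampleDiff, hmix]
  · exact h1.comp_fst ν

/-- Jensen for the inner average, then Fubini and the invariance of the law under `mix`. -/
lemma eLpNorm_avgOff_insert_sub_le {S : Finset ℤ} {j : ℤ} (hj : j ∉ S) {f : (ℤ → ℝ) → ℝ}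
    (hf : Measurable f) (hfi : Integrable f (Measure.infinitePi fun _ : ℤ => ν)) :
    eLpNorm (fun ε => avgOff ν (insert j S) f ε - avgOff ν S f ε) 2
        (Measure.infinitePi fun _ : ℤ => ν) ≤
      eLpNorm (resampleDiff f j) 2 ((Measure.infinitePi fun _ : ℤ => ν).prod ν) := by
  set P := Measure.infinitePi fun _ : ℤ => ν with hP
  have hR := measurable_resampleDiff hf j
  have hm : Measurable (fun x : (ℤ → ℝ) × ((ℤ → ℝ) × ℝ) =>
      resampleDiff f j (mix (insert j S) x.1 x.2.1, x.2.2)) := by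
    refine hR.comp (Measurable.prodMk ?_ (by fun_prop))
    exact (measurable_mix (insert j S)).comp (by fun_prop : Measurable
      fun x : (ℤ → ℝ) × ((ℤ → ℝ) × ℝ) => (x.1, x.2.1))
  rw [eLpNorm_congr_ae (avgOff_insert_sub_avgOff hj hfi)]
  have key : ∀ g : (ℤ → ℝ) → ℝ, eLpNorm g 2 P = (∫⁻ x, ‖g x‖ₑ ^ (2:ℝ) ∂P) ^ (1 / (2:ℝ)) := by
    intro g; rw [eLpNorm_eq_lintegral_rpow_enorm_toReal (by norm_num) (by norm_num)]; simp
  rw [key, eLpNorm_eq_lintegral_rpow_enorm_toReal (by norm_num) (by norm_num)]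
  simp only [ENNReal.toReal_ofNat]
  gcongr
  calc ∫⁻ ε, ‖∫ p : (ℤ → ℝ) × ℝ, resampleDiff f j (mix (insert j S) ε p.1, p.2) ∂(P.prod ν)‖ₑ ^ (2:ℝ) ∂P
      ≤ ∫⁻ ε, ∫⁻ p : (ℤ → ℝ) × ℝ,
          ‖resampleDiff f j (mix (insert j S) ε p.1, p.2)‖ₑ ^ (2:ℝ) ∂(P.prod ν) ∂P := by
        refine lintegral_mono fun ε => ?_
        have hmε : Measurable (fun p : (ℤ → ℝ) × ℝ =>
            resampleDiff f j (mix (insert j S) ε p.1, p.2)) := hm.comp (measurable_prodMk_left (x := ε))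
        -- Jensen in the form L¹ ≤ L² on a probability space.
        have h1 : eLpNorm (fun p : (ℤ → ℝ) × ℝ =>
            resampleDiff f j (mix (insert j S) ε p.1, p.2)) 1 (P.prod ν) ≤ eLpNorm (fun p : (ℤ → ℝ) × ℝ =>
            resampleDiff f j (mix (insert j S) ε p.1, p.2)) 2 (P.prod ν) :=
          eLpNorm_le_eLpNorm_of_exponent_le (by norm_num) hmε.aestronglyMeasurable
        rw [eLpNorm_one_eq_lintegral_enorm,
          eLpNorm_eq_lintegral_rpow_enorm_toReal (by norm_num) (by norm_num)] at h1
        simp only [ENNReal.toReal_ofNat] at h1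
        calc _ ≤ ((∫⁻ p : (ℤ → ℝ) × ℝ,
          ‖resampleDiff f j (mix (insert j S) ε p.1, p.2)‖ₑ ^ (2:ℝ) ∂(P.prod ν)) ^ (1 / (2:ℝ))) ^ (2:ℝ) := by
              gcongr
              exact (enorm_integral_le_lintegral_enorm _).trans h1
          _ = _ := by rw [← ENNReal.rpow_mul]; norm_num
    _ = ∫⁻ x : ((ℤ → ℝ) × (ℤ → ℝ)) × ℝ,
          ‖resampleDiff f j (mix (insert j S) x.1.1 x.1.2, x.2)‖ₑ ^ (2:ℝ) ∂((P.prod P).prod ν) := by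
        have hm2 : Measurable (fun x : ((ℤ → ℝ) × (ℤ → ℝ)) × ℝ =>
            ‖resampleDiff f j (mix (insert j S) x.1.1 x.1.2, x.2)‖ₑ ^ (2:ℝ)) := by
          refine Measurable.pow_const (Measurable.enorm (hR.comp (Measurable.prodMk ?_ (by fun_prop)))) _
          exact (measurable_mix (insert j S)).comp measurable_fst
        rw [lintegral_prod _ hm2.aemeasurable, lintegral_prod _ hm2.lintegral_prod_right'.aemeasurable]
        refine lintegral_congr fun ε => ?_
        rw [lintegral_prod]
        exact ((hm.comp (measurable_prodMk_left (x := ε))).enorm.pow_const _).aemeasurable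
    _ = ∫⁻ p, ‖resampleDiff f j p‖ₑ ^ (2:ℝ) ∂(P.prod ν) := by
        have hmp := ((measurePreserving_mix (ν := ν) (insert j S)).prod (MeasurePreserving.id ν))
        exact hmp.lintegral_comp (f := fun p => ‖resampleDiff f j p‖ₑ ^ (2:ℝ)) (hR.enorm.pow_const _)

/-- Law of total variance: revealing coordinate `j` adds the expected conditional variance, which is
the mean square of the martingale increment. -/
lemma variance_condExp_insert_le {S : Finset ℤ} {j : ℤ} (hj : j ∉ S) {f : (ℤ → ℝ) → ℝ}
    (hf : Measurable f) (hf2 : MemLp f 2 (Measure.infinitePi fun _ : ℤ => ν)) {c : ℝ} (hc : 0 ≤ c)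
    (hcj : eLpNorm (resampleDiff f j) 2 ((Measure.infinitePi fun _ : ℤ => ν).prod ν) ≤
      ENNReal.ofReal c) :
    Var[(Measure.infinitePi fun _ : ℤ => ν)[f | cylinderEvents (X := fun _ : ℤ => ℝ)
        ((insert j S : Finset ℤ) : Set ℤ)]; Measure.infinitePi fun _ : ℤ => ν] ≤
      Var[(Measure.infinitePi fun _ : ℤ => ν)[f | cylinderEvents (X := fun _ : ℤ => ℝ)
        (S : Set ℤ)]; Measure.infinitePi fun _ : ℤ => ν] + c ^ 2 := by
  set P := Measure.infinitePi fun _ : ℤ => ν with hP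
  set m := cylinderEvents (X := fun _ : ℤ => ℝ) (S : Set ℤ) with hm
  set m' := cylinderEvents (X := fun _ : ℤ => ℝ) ((insert j S : Finset ℤ) : Set ℤ) with hm'
  have hmm' : m ≤ m' := cylinderEvents_mono (by simp)
  have hm0 : m ≤ MeasurableSpace.pi := cylinderEvents_le_pi
  have hm0' : m' ≤ MeasurableSpace.pi := cylinderEvents_le_pi
  have hfi : Integrable f P := hf2.integrable one_le_two
  have hX : MemLp (P[f | m']) 2 P := hf2.condExp one_le_two
  have tower : P[P[f | m'] | m] =ᵐ[P] P[f | m] := condExp_condExp_of_le hmm' hm0'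
  have htot := integral_condVar_add_variance_condExp hm0 hX
  rw [variance_congr tower] at htot
  have hintg : ∫ x, Var[P[f | m']; P | m] x ∂P =
      ∫ x, (avgOff ν (insert j S) f x - avgOff ν S f x) ^ 2 ∂P := by
    rw [condVar, integral_condExp hm0]
    refine integral_congr_ae ?_
    filter_upwards [tower, avgOff_ae_eq_condExp (ν := ν) S hf hfi,
      avgOff_ae_eq_condExp (ν := ν) (insert j S) hf hfi] with x h1 h2 h3
    change (P[f | m'] x - P[P[f | m'] | m] x) ^ 2 = _
    rw [h1, h2, h3]
  have hle := (eLpNorm_avgOff_insert_sub_le hj hf hfi).trans hcj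
  have hD : MemLp (fun ε => avgOff ν (insert j S) f ε - avgOff ν S f ε) 2 P :=
    ⟨(((stronglyMeasurable_avgOff (insert j S) hf).mono hm0').sub
      ((stronglyMeasurable_avgOff S hf).mono hm0)).aestronglyMeasurable,
      hle.trans_lt ENNReal.ofReal_lt_top⟩
  have h2 : ∫ x, (avgOff ν (insert j S) f x - avgOff ν S f x) ^ 2 ∂P ≤ c ^ 2 := by
    have h3 := hD.eLpNorm_eq_integral_rpow_norm (by norm_num) (by norm_num)
    rw [h3] at hle
    rw [ENNReal.ofReal_le_ofReal_iff hc] at hle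
    simp only [ENNReal.toReal_ofNat, Real.rpow_two, Real.norm_eq_abs, sq_abs] at hle
    have h0 : 0 ≤ ∫ x, (avgOff ν (insert j S) f x - avgOff ν S f x) ^ 2 ∂P :=
      integral_nonneg fun x => sq_nonneg _
    calc _ = ((∫ x, (avgOff ν (insert j S) f x - avgOff ν S f x) ^ 2 ∂P) ^ (2:ℝ)⁻¹) ^ 2 := by
          rw [← Real.rpow_natCast, ← Real.rpow_mul h0]; norm_num
      _ ≤ c ^ 2 := by gcongr
  linarith

lemma variance_condExp_cylinderEvents_le (S : Finset ℤ) {f : (ℤ → ℝ) → ℝ}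
    (hf : Measurable f) (hf2 : MemLp f 2 (Measure.infinitePi fun _ : ℤ => ν)) {c : ℤ → ℝ}
    (hc : ∀ j, 0 ≤ c j)
    (hcj : ∀ j, eLpNorm (resampleDiff f j) 2 ((Measure.infinitePi fun _ : ℤ => ν).prod ν) ≤
      ENNReal.ofReal (c j)) :
    Var[(Measure.infinitePi fun _ : ℤ => ν)[f | cylinderEvents (X := fun _ : ℤ => ℝ)
        (S : Set ℤ)]; Measure.infinitePi fun _ : ℤ => ν] ≤ ∑ j ∈ S, c j ^ 2 := by
  classical
  induction S using Finset.induction_on with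
  | empty =>
    have h0 : cylinderEvents (X := fun _ : ℤ => ℝ) ((∅ : Finset ℤ) : Set ℤ) = ⊥ := by
      simp [cylinderEvents]
    rw [h0, condExp_bot, variance_eq_integral aemeasurable_const]
    simp
  | insert j S hj ih =>
    rw [Finset.sum_insert hj]
    have := variance_condExp_insert_le hj hf hf2 (hc j) (hcj j)
    linarith

/-- The filtration generated by the coordinates in `[-n, n]`. -/
def symmFiltration : Filtration ℕ (MeasurableSpace.pi : MeasurableSpace (ℤ → ℝ)) where
  seq n := cylinderEvents (X := fun _ : ℤ => ℝ) ((Finset.Icc (-(n : ℤ)) n : Finset ℤ) : Set ℤ)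
  mono' := fun a b hab => cylinderEvents_mono (by
    intro i hi
    simp only [Finset.coe_Icc, Set.mem_Icc] at hi ⊢
    constructor <;> linarith [hi.1, hi.2, (Nat.cast_le (α := ℤ)).2 hab])
  le' := fun _ => cylinderEvents_le_pi

/-- **Efron–Stein inequality** for square integrable functions of i.i.d. variables indexed by
the integers. -/
theorem variance_le_of_resample {f : (ℤ → ℝ) → ℝ}
    (hf : Measurable f) (hf2 : MemLp f 2 (Measure.infinitePi fun _ : ℤ => ν)) {c : ℤ → ℝ}
    (hc : ∀ j, 0 ≤ c j)
    (hcj : ∀ j, eLpNorm (resampleDiff f j) 2 ((Measure.infinitePi fun _ : ℤ => ν).prod ν) ≤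
      ENNReal.ofReal (c j)) {V : ℝ} (hV : ∀ S : Finset ℤ, ∑ j ∈ S, c j ^ 2 ≤ V) :
    Var[f; Measure.infinitePi fun _ : ℤ => ν] ≤ V := by
  set P := Measure.infinitePi fun _ : ℤ => ν with hP
  have hfi : Integrable f P := hf2.integrable one_le_two
  -- Coordinate `i` is revealed at time `|i|`, so Lévy's upward theorem returns `f` itself in the
  -- limit.
  have hsup : (MeasurableSpace.pi : MeasurableSpace (ℤ → ℝ)) ≤ ⨆ n, symmFiltration n := by
    refine iSup_le fun i => ?_
    refine le_trans ?_ (le_iSup (fun n => (symmFiltration n : MeasurableSpace (ℤ → ℝ))) i.natAbs)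
    refine le_iSup₂_of_le (f := fun (i : ℤ) (_ : i ∈ _) =>
      MeasurableSpace.comap (fun σ : ℤ → ℝ => σ i) inferInstance) i ?_ le_rfl
    simp only [Finset.coe_Icc, Set.mem_Icc]
    omega
  have hlim := hfi.tendsto_ae_condExp (ℱ := symmFiltration) (hf.mono hsup le_rfl).stronglyMeasurable
  have hV0 : 0 ≤ V := by simpa using hV ∅
  have hvar : ∀ n, ∫⁻ x, ENNReal.ofReal ((P[f | symmFiltration n] x - ∫ x, f x ∂P) ^ 2) ∂P ≤
      ENNReal.ofReal V := by
    intro n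
    have h1 := (variance_condExp_cylinderEvents_le (ν := ν) (Finset.Icc (-(n : ℤ)) n) hf hf2 hc hcj).trans
      (hV _)
    have hX : MemLp (P[f | symmFiltration n]) 2 P := hf2.condExp one_le_two
    change Var[P[f | symmFiltration n]; P] ≤ V at h1
    rw [variance_eq_integral hX.aemeasurable, integral_condExp (symmFiltration.le n)] at h1
    rw [← ofReal_integral_eq_lintegral_ofReal]
    · exact ENNReal.ofReal_le_ofReal h1
    · exact (hX.sub (memLp_const _)).integrable_sq
    · exact ae_of_all _ fun x => sq_nonneg _
  -- Almost sure convergence and a uniform variance bound suffice by Fatou; no L² convergence is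
  -- needed.
  have hfatou : ∫⁻ x, ENNReal.ofReal ((f x - ∫ x, f x ∂P) ^ 2) ∂P ≤ ENNReal.ofReal V := by
    calc ∫⁻ x, ENNReal.ofReal ((f x - ∫ x, f x ∂P) ^ 2) ∂P
        = ∫⁻ x, liminf (fun n => ENNReal.ofReal
            ((P[f | symmFiltration n] x - ∫ x, f x ∂P) ^ 2)) atTop ∂P := by
          refine lintegral_congr_ae ?_
          filter_upwards [hlim] with x hx
          refine (Tendsto.liminf_eq ?_).symm
          exact ENNReal.tendsto_ofReal ((hx.sub_const _).pow 2)
      _ ≤ liminf (fun n => ∫⁻ x, ENNReal.ofReal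
            ((P[f | symmFiltration n] x - ∫ x, f x ∂P) ^ 2) ∂P) atTop := by
          refine lintegral_liminf_le fun n => ?_
          have : Measurable (P[f | symmFiltration n]) :=
            (stronglyMeasurable_condExp.mono (symmFiltration.le n)).measurable
          exact ((this.sub_const _).pow_const 2).ennreal_ofReal
      _ ≤ ENNReal.ofReal V := by
          refine liminf_le_of_frequently_le' (Frequently.of_forall hvar)
  rw [variance_eq_integral hf.aemeasurable]
  rw [← ofReal_integral_eq_lintegral_ofReal] at hfatou
  · exact (ENNReal.ofReal_le_ofReal_iff hV0).1 hfatou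
  · exact (hf2.sub (memLp_const _)).integrable_sq
  · exact ae_of_all _ fun x => sq_nonneg _

end EfronStein
end
end DiffLRV

namespace DiffLRV

noncomputable section

/-! ### Moment bounds under the functional dependence measure -/

/-- Young's inequality for the convolution of a summable and a square summable sequence:
Cauchy–Schwarz with weights `ϑ (t - j)`, whose row and column sums are at most `Θ`. -/
lemma sum_sq_conv_le {ϑ β : ℤ → ℝ} {Θ : ℝ} (hϑ : ∀ j, 0 ≤ ϑ j)
    (hΘ : ∀ S : Finset ℤ, ∑ j ∈ S, ϑ j ≤ Θ) (I S : Finset ℤ) :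
    ∑ j ∈ S, (∑ t ∈ I, |β t| * ϑ (t - j)) ^ 2 ≤ Θ ^ 2 * ∑ t ∈ I, β t ^ 2 := by
  have hΘ0 : 0 ≤ Θ := by simpa using hΘ ∅
  have h1 : ∀ j, ∑ t ∈ I, ϑ (t - j) ≤ Θ := by
    intro j
    rw [← Finset.sum_image (f := ϑ) (g := fun t => t - j) (by intro a _ b _ h; simpa using h)]
    exact hΘ _
  have h2 : ∀ t, ∑ j ∈ S, ϑ (t - j) ≤ Θ := by
    intro t
    rw [← Finset.sum_image (f := ϑ) (g := fun j => t - j) (by intro a _ b _ h; simpa using h)]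
    exact hΘ _
  calc ∑ j ∈ S, (∑ t ∈ I, |β t| * ϑ (t - j)) ^ 2
      ≤ ∑ j ∈ S, Θ * ∑ t ∈ I, β t ^ 2 * ϑ (t - j) := by
        refine Finset.sum_le_sum fun j _ => ?_
        calc (∑ t ∈ I, |β t| * ϑ (t - j)) ^ 2
            ≤ (∑ t ∈ I, ϑ (t - j)) * ∑ t ∈ I, β t ^ 2 * ϑ (t - j) := by
              refine Finset.sum_sq_le_sum_mul_sum_of_sq_le_mul I (fun t _ => hϑ _)
                (fun t _ => mul_nonneg (sq_nonneg _) (hϑ _)) fun t _ => ?_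
              rw [mul_pow, sq_abs]; exact le_of_eq (by ring)
          _ ≤ _ := by
              refine mul_le_mul_of_nonneg_right (h1 j) ?_
              exact Finset.sum_nonneg fun t _ => mul_nonneg (sq_nonneg _) (hϑ _)
    _ = Θ * ∑ t ∈ I, β t ^ 2 * ∑ j ∈ S, ϑ (t - j) := by
        rw [← Finset.mul_sum, Finset.sum_comm]
        simp_rw [Finset.mul_sum]
    _ ≤ Θ * ∑ t ∈ I, β t ^ 2 * Θ := by
        gcongr with t _
        exact h2 t
    _ = _ := by rw [← Finset.sum_mul]; ring

set_option linter.unusedSectionVars false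

/-- A centred process with finite fourth moments whose dependence on the innovations is controlled
by a summable sequence `ϑ`. -/
structure ShortMemory (ν : Measure ℝ) (Y : ℤ → (ℤ → ℝ) → ℝ) (ϑ : ℤ → ℝ) (Θ : ℝ) : Prop where
  meas : ∀ t, Measurable (Y t)
  memLp : ∀ t, MemLp (Y t) 4 (Measure.infinitePi fun _ : ℤ => ν)
  mean : ∀ t, ∫ ε, Y t ε ∂(Measure.infinitePi fun _ : ℤ => ν) = 0
  nonneg : ∀ j, 0 ≤ ϑ j
  osc : ∀ t j, eLpNorm (resampleDiff (Y t) j) 4 ((Measure.infinitePi fun _ : ℤ => ν).prod ν) ≤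
    ENNReal.ofReal (ϑ (t - j))
  sum_le : ∀ S : Finset ℤ, ∑ j ∈ S, ϑ j ≤ Θ

variable {ν : Measure ℝ} [IsProbabilityMeasure ν]

namespace ShortMemory

variable {Y : ℤ → (ℤ → ℝ) → ℝ} {ϑ : ℤ → ℝ} {Θ : ℝ}

lemma bound_nonneg (hY : ShortMemory ν Y ϑ Θ) : 0 ≤ Θ := by simpa using hY.sum_le ∅

lemma measurable_sum (hY : ShortMemory ν Y ϑ Θ) (I : Finset ℤ) (β : ℤ → ℝ) :
    Measurable (fun ε => ∑ t ∈ I, β t * Y t ε) :=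
  Finset.measurable_sum _ fun t _ => (hY.meas t).const_mul _

lemma memLp_sum (hY : ShortMemory ν Y ϑ Θ) (I : Finset ℤ) (β : ℤ → ℝ) :
    MemLp (fun ε => ∑ t ∈ I, β t * Y t ε) 4 (Measure.infinitePi fun _ : ℤ => ν) :=
  memLp_finsetSum I fun t _ => (hY.memLp t).const_mul _

lemma integral_sum (hY : ShortMemory ν Y ϑ Θ) (I : Finset ℤ) (β : ℤ → ℝ) :
    ∫ ε, ∑ t ∈ I, β t * Y t ε ∂(Measure.infinitePi fun _ : ℤ => ν) = 0 := by
  rw [integral_finsetSum _ fun t _ => ((hY.memLp t).const_mul _).integrable (by norm_num)]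
  simp [integral_const_mul, hY.mean]

lemma osc_sum (hY : ShortMemory ν Y ϑ Θ) (I : Finset ℤ) (β : ℤ → ℝ) (j : ℤ) :
    eLpNorm (resampleDiff (fun ε => ∑ t ∈ I, β t * Y t ε) j) 4
      ((Measure.infinitePi fun _ : ℤ => ν).prod ν) ≤
      ENNReal.ofReal (∑ t ∈ I, |β t| * ϑ (t - j)) := by
  have h : resampleDiff (fun ε => ∑ t ∈ I, β t * Y t ε) j =
      ∑ t ∈ I, (β t) • resampleDiff (Y t) j := by
    ext p
    simp [resampleDiff, Finset.sum_apply, mul_sub, Finset.sum_sub_distrib]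
  rw [h]
  refine (eLpNorm_sum_le (fun t _ => ?_) (by norm_num)).trans ?_
  · exact ((measurable_resampleDiff (hY.meas t) j).const_smul _).aestronglyMeasurable
  rw [ENNReal.ofReal_sum_of_nonneg fun t _ => mul_nonneg (abs_nonneg _) (hY.nonneg _)]
  refine Finset.sum_le_sum fun t _ => ?_
  rw [eLpNorm_const_smul, ENNReal.ofReal_mul (abs_nonneg _)]
  gcongr
  · rw [Real.enorm_eq_ofReal_abs]
  · exact hY.osc t j

lemma variance_sum_le (hY : ShortMemory ν Y ϑ Θ) (I : Finset ℤ) (β : ℤ → ℝ) :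
    Var[fun ε => ∑ t ∈ I, β t * Y t ε; Measure.infinitePi fun _ : ℤ => ν] ≤
      Θ ^ 2 * ∑ t ∈ I, β t ^ 2 := by
  refine variance_le_of_resample (c := fun j => ∑ t ∈ I, |β t| * ϑ (t - j)) (hY.measurable_sum I β)
    ((hY.memLp_sum I β).mono_exponent (by norm_num))
    (fun j => Finset.sum_nonneg fun t _ => mul_nonneg (abs_nonneg _) (hY.nonneg _))
    (fun j => ?_) (fun S => sum_sq_conv_le hY.nonneg hY.sum_le I S)
  refine le_trans ?_ (hY.osc_sum I β j)
  exact eLpNorm_le_eLpNorm_of_exponent_le (by norm_num)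
    (measurable_resampleDiff (hY.measurable_sum I β) j).aestronglyMeasurable

end ShortMemory

instance holderTriple_four : ENNReal.HolderTriple 4 4 2 := by
  constructor
  have : (4 : ENNReal) = 2 * 2 := by norm_num
  rw [this, ENNReal.mul_inv (by simp) (by simp), ← mul_add, ENNReal.inv_two_add_inv_two, mul_one]

lemma eLpNorm_mul_two_le {α : Type*} {mα : MeasurableSpace α} {μ : Measure α} {f g : α → ℝ}
    (hf : AEStronglyMeasurable f μ) (hg : AEStronglyMeasurable g μ) :
    eLpNorm (fun x => f x * g x) 2 μ ≤ eLpNorm f 4 μ * eLpNorm g 4 μ := by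
  have h : eLpNorm (f • g) 2 μ ≤ eLpNorm f 4 μ * eLpNorm g 4 μ :=
    eLpNorm_smul_le_mul_eLpNorm hg hf
  exact h

lemma memLp_mul_two {α : Type*} {mα : MeasurableSpace α} {μ : Measure α} {f g : α → ℝ}
    (hf : MemLp f 4 μ) (hg : MemLp g 4 μ) : MemLp (fun x => f x * g x) 2 μ :=
  hg.mul (p := 4) (q := 4) (r := 2) hf

lemma eLpNorm_four_pow {α : Type*} {mα : MeasurableSpace α} {μ : Measure α} {f : α → ℝ}
    (hf : MemLp f 4 μ) : (eLpNorm f 4 μ).toReal ^ 4 = ∫ x, f x ^ 4 ∂μ := by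
  have h0 : 0 ≤ ∫ x, f x ^ 4 ∂μ := integral_nonneg fun x => by positivity
  have h := hf.eLpNorm_eq_integral_rpow_norm (by norm_num) (by norm_num)
  have h2 : ∀ x, ‖f x‖ ^ (4:ℝ) = f x ^ 4 := by
    intro x
    rw [show (4:ℝ) = ((4:ℕ):ℝ) by norm_num, Real.rpow_natCast, Real.norm_eq_abs]
    exact Even.pow_abs (by decide) _
  simp only [ENNReal.toReal_ofNat, h2] at h
  rw [h, ENNReal.toReal_ofReal (by positivity), ← Real.rpow_natCast, ← Real.rpow_mul h0]
  norm_num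

lemma eLpNorm_comp_update {f : (ℤ → ℝ) → ℝ} (hf : Measurable f) (p : ENNReal) (j : ℤ) :
    eLpNorm (fun x : (ℤ → ℝ) × ℝ => f (Function.update x.1 j x.2)) p
      ((Measure.infinitePi fun _ : ℤ => ν).prod ν) =
    eLpNorm f p (Measure.infinitePi fun _ : ℤ => ν) :=
  eLpNorm_comp_measurePreserving hf.aestronglyMeasurable (measurePreserving_update j)

lemma eLpNorm_comp_fst {f : (ℤ → ℝ) → ℝ} (hf : Measurable f) (p : ENNReal) :
    eLpNorm (fun x : (ℤ → ℝ) × ℝ => f x.1) p ((Measure.infinitePi fun _ : ℤ => ν).prod ν) =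
    eLpNorm f p (Measure.infinitePi fun _ : ℤ => ν) :=
  eLpNorm_comp_measurePreserving hf.aestronglyMeasurable measurePreserving_fst

/-- A fourth moment bound: Efron–Stein applied to a function and to its square. -/
lemma eLpNorm_four_le_of_resample {f : (ℤ → ℝ) → ℝ} (hf : Measurable f)
    (hf4 : MemLp f 4 (Measure.infinitePi fun _ : ℤ => ν))
    (hmean : ∫ ε, f ε ∂(Measure.infinitePi fun _ : ℤ => ν) = 0) {c : ℤ → ℝ}
    (hc : ∀ j, 0 ≤ c j)
    (hcj : ∀ j, eLpNorm (resampleDiff f j) 4 ((Measure.infinitePi fun _ : ℤ => ν).prod ν) ≤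
      ENNReal.ofReal (c j)) {V : ℝ} (hV : ∀ S : Finset ℤ, ∑ j ∈ S, c j ^ 2 ≤ V) :
    eLpNorm f 4 (Measure.infinitePi fun _ : ℤ => ν) ≤ ENNReal.ofReal (3 * √V) := by
  set P := Measure.infinitePi fun _ : ℤ => ν with hP
  have hV0 : 0 ≤ V := by simpa using hV ∅
  set x := (eLpNorm f 4 P).toReal with hx
  have hx0 : 0 ≤ x := ENNReal.toReal_nonneg
  have hfx : eLpNorm f 4 P = ENNReal.ofReal x := (ENNReal.ofReal_toReal hf4.2.ne).symm
  have hf2 : MemLp f 2 P := hf4.mono_exponent (by norm_num)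
  have hsq2 : MemLp (fun ε => f ε ^ 2) 2 P := by
    simpa only [sq] using memLp_mul_two hf4 hf4
  have hv1 : Var[f; P] ≤ V := by
    refine variance_le_of_resample hf hf2 hc (fun j => le_trans ?_ (hcj j)) hV
    exact eLpNorm_le_eLpNorm_of_exponent_le (by norm_num)
      (measurable_resampleDiff hf j).aestronglyMeasurable
  -- Resampling changes f² by (f + f')(f - f'), and f + f' has fourth norm at most 2x. The bound
  -- involves the unknown but finite x, and closes on itself below.
  have hv2 : Var[fun ε => f ε ^ 2; P] ≤ (2 * x) ^ 2 * V := by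
    refine variance_le_of_resample (c := fun j => (2 * x) * c j) (hf.pow_const 2) hsq2
      (fun j => mul_nonneg (by positivity) (hc j)) (fun j => ?_) (fun S => ?_)
    · have hsum : eLpNorm (fun p : (ℤ → ℝ) × ℝ => f p.1 + f (Function.update p.1 j p.2)) 4
          (P.prod ν) ≤ ENNReal.ofReal (2 * x) := by
        refine (eLpNorm_add_le (f := fun p : (ℤ → ℝ) × ℝ => f p.1)
          (g := fun p : (ℤ → ℝ) × ℝ => f (Function.update p.1 j p.2))
          (hf.comp measurable_fst).aestronglyMeasurable
          (hf.comp (measurable_update_prod j)).aestronglyMeasurable (by norm_num)).trans ?_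
        rw [eLpNorm_comp_update hf, eLpNorm_comp_fst hf, ← hP, hfx, ← ENNReal.ofReal_add hx0 hx0,
          two_mul]
      have heq : resampleDiff (fun ε => f ε ^ 2) j = fun p =>
          (f p.1 + f (Function.update p.1 j p.2)) * resampleDiff f j p := by
        ext p; simp only [resampleDiff]; ring
      rw [heq, ENNReal.ofReal_mul (by positivity)]
      refine (eLpNorm_mul_two_le ?_ (measurable_resampleDiff hf j).aestronglyMeasurable).trans ?_
      · exact ((hf.comp measurable_fst).add (hf.comp (measurable_update_prod j))).aestronglyMeasurable
      · gcongr
        exact hcj j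
    · simp_rw [mul_pow, ← Finset.mul_sum]
      rw [← mul_pow]
      exact mul_le_mul_of_nonneg_left (hV S) (by positivity)
  rw [variance_eq_sub hf2] at hv1
  rw [variance_eq_sub hsq2] at hv2
  have h4 := eLpNorm_four_pow hf4
  rw [← hx] at h4
  simp only [Pi.pow_apply, ← pow_mul, hmean] at hv1 hv2
  norm_num at hv1 hv2
  rw [← h4] at hv2
  set y := ∫ ε, f ε ^ 2 ∂P
  have hy0 : 0 ≤ y := integral_nonneg fun _ => sq_nonneg _
  -- E f⁴ = Var(f²) + (E f²)² gives x⁴ ≤ 4x²V + V², hence x² ≤ (2 + √5)V; 9 is a convenient larger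
  -- constant.
  have hx2 : x ^ 2 ≤ 9 * V := by
    by_contra hcon
    push Not at hcon
    nlinarith [mul_nonneg hV0 (sq_nonneg x), sq_nonneg x]
  rw [hfx]
  refine ENNReal.ofReal_le_ofReal ?_
  have : (3 * √V) ^ 2 = 9 * V := by rw [mul_pow, Real.sq_sqrt hV0]; norm_num
  exact abs_le_of_sq_le_sq' (this ▸ hx2) (by positivity) |>.2

namespace ShortMemory

variable {Y : ℤ → (ℤ → ℝ) → ℝ} {ϑ : ℤ → ℝ} {Θ : ℝ}

lemma eLpNorm_four_sum_le (hY : ShortMemory ν Y ϑ Θ) (I : Finset ℤ) (β : ℤ → ℝ) {ρ : ℝ}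
    (hρ : ∑ t ∈ I, β t ^ 2 ≤ ρ ^ 2) (hρ0 : 0 ≤ ρ) :
    eLpNorm (fun ε => ∑ t ∈ I, β t * Y t ε) 4 (Measure.infinitePi fun _ : ℤ => ν) ≤
      ENNReal.ofReal (3 * (Θ * ρ)) := by
  refine (eLpNorm_four_le_of_resample (c := fun j => ∑ t ∈ I, |β t| * ϑ (t - j))
    (hY.measurable_sum I β) (hY.memLp_sum I β) (hY.integral_sum I β)
    (fun j => Finset.sum_nonneg fun t _ => mul_nonneg (abs_nonneg _) (hY.nonneg _))
    (hY.osc_sum I β) (V := (Θ * ρ) ^ 2) (fun S => ?_)).trans ?_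
  · refine (sum_sq_conv_le hY.nonneg hY.sum_le I S).trans ?_
    rw [mul_pow]
    gcongr
  · rw [Real.sqrt_sq (mul_nonneg hY.bound_nonneg hρ0)]

/-- Variance of a quadratic form whose rows and columns have square sums at most `ρ ^ 2`. -/
lemma variance_quadratic_le (hY : ShortMemory ν Y ϑ Θ) (I : Finset ℤ) (A : ℤ → ℤ → ℝ) {ρ : ℝ}
    (hρ0 : 0 ≤ ρ) (hrow : ∀ i ∈ I, ∑ t ∈ I, A i t ^ 2 ≤ ρ ^ 2)
    (hcol : ∀ t ∈ I, ∑ i ∈ I, A i t ^ 2 ≤ ρ ^ 2) :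
    Var[fun ε => ∑ i ∈ I, ∑ t ∈ I, A i t * (Y i ε * Y t ε); Measure.infinitePi fun _ : ℤ => ν] ≤
      36 * Θ ^ 4 * ρ ^ 2 * I.card := by
  set P := Measure.infinitePi fun _ : ℤ => ν with hP
  have hΘ := hY.bound_nonneg
  set c : ℤ → ℝ := fun j => 6 * (Θ * ρ) * ∑ t ∈ I, |(1:ℝ)| * ϑ (t - j) with hc
  have hmeas : Measurable (fun ε => ∑ i ∈ I, ∑ t ∈ I, A i t * (Y i ε * Y t ε)) :=
    Finset.measurable_sum _ fun i _ => Finset.measurable_sum _ fun t _ =>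
      ((hY.meas i).mul (hY.meas t)).const_mul _
  have hmem : MemLp (fun ε => ∑ i ∈ I, ∑ t ∈ I, A i t * (Y i ε * Y t ε)) 2 P :=
    memLp_finsetSum I fun i _ => memLp_finsetSum I fun t _ =>
      (memLp_mul_two (hY.memLp i) (hY.memLp t)).const_mul _
  refine variance_le_of_resample (c := c) hmeas hmem (fun j => ?_) (fun j => ?_) (fun S => ?_)
  · exact mul_nonneg (by positivity)
      (Finset.sum_nonneg fun t _ => mul_nonneg (abs_nonneg _) (hY.nonneg _))
  -- Product rule: the left factor is changed with the right one at the old point, then the right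
  -- factor with the left one at the new point. Rows of `A` enter the first sum, columns the second,
  -- and each inner linear form has fourth norm at most 3Θρ.
  · have heq : resampleDiff (fun ε => ∑ i ∈ I, ∑ t ∈ I, A i t * (Y i ε * Y t ε)) j =
        (∑ i ∈ I, fun p => resampleDiff (Y i) j p * ∑ t ∈ I, A i t * Y t p.1) +
        ∑ t ∈ I, fun p => resampleDiff (Y t) j p *
          ∑ i ∈ I, A i t * Y i (Function.update p.1 j p.2) := by
      ext p
      simp only [resampleDiff, Pi.add_apply, Finset.sum_apply, Finset.mul_sum]
      rw [Finset.sum_comm (s := I) (t := I) (f := fun x i => (Y x p.1 - Y x (Function.update p.1 j p.2))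
        * (A i x * Y i (Function.update p.1 j p.2))), ← Finset.sum_add_distrib,
        ← Finset.sum_sub_distrib]
      refine Finset.sum_congr rfl fun i _ => ?_
      rw [← Finset.sum_add_distrib, ← Finset.sum_sub_distrib]
      refine Finset.sum_congr rfl fun t _ => ?_
      ring
    have hR : ∀ i, Measurable (resampleDiff (Y i) j) := fun i => measurable_resampleDiff (hY.meas i) j
    have hW1 : ∀ i, Measurable (fun p : (ℤ → ℝ) × ℝ => ∑ t ∈ I, A i t * Y t p.1) := fun i =>
      (hY.measurable_sum I (A i)).comp measurable_fst
    have hW2 : ∀ t, Measurable (fun p : (ℤ → ℝ) × ℝ =>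
        ∑ i ∈ I, A i t * Y i (Function.update p.1 j p.2)) := fun t =>
      (hY.measurable_sum I fun i => A i t).comp (measurable_update_prod j)
    rw [heq]
    have b1 : ∀ i ∈ I, eLpNorm (fun p => resampleDiff (Y i) j p * ∑ t ∈ I, A i t * Y t p.1) 2
        (P.prod ν) ≤ ENNReal.ofReal (3 * (Θ * ρ) * ϑ (i - j)) := by
      intro i hi
      refine (eLpNorm_mul_two_le (hR i).aestronglyMeasurable (hW1 i).aestronglyMeasurable).trans ?_
      rw [mul_comm (3 * (Θ * ρ)), ENNReal.ofReal_mul (hY.nonneg _)]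
      gcongr
      · exact hY.osc i j
      · rw [eLpNorm_comp_fst (hY.measurable_sum I (A i))]
        exact hY.eLpNorm_four_sum_le I (A i) (hrow i hi) hρ0
    have b2 : ∀ t ∈ I, eLpNorm (fun p => resampleDiff (Y t) j p *
          ∑ i ∈ I, A i t * Y i (Function.update p.1 j p.2)) 2
        (P.prod ν) ≤ ENNReal.ofReal (3 * (Θ * ρ) * ϑ (t - j)) := by
      intro t ht
      refine (eLpNorm_mul_two_le (hR t).aestronglyMeasurable (hW2 t).aestronglyMeasurable).trans ?_
      rw [mul_comm (3 * (Θ * ρ)), ENNReal.ofReal_mul (hY.nonneg _)]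
      gcongr
      · exact hY.osc t j
      · rw [eLpNorm_comp_update (hY.measurable_sum I fun i => A i t)]
        exact hY.eLpNorm_four_sum_le I (fun i => A i t) (hcol t ht) hρ0
    have hnn : ∀ i ∈ I, 0 ≤ 3 * (Θ * ρ) * ϑ (i - j) := fun i _ =>
      mul_nonneg (by positivity) (hY.nonneg _)
    refine (eLpNorm_add_le ?_ ?_ (by norm_num)).trans ?_
    · exact Finset.aestronglyMeasurable_sum I fun i _ => ((hR i).mul (hW1 i)).aestronglyMeasurable
    · exact Finset.aestronglyMeasurable_sum I fun i _ => ((hR i).mul (hW2 i)).aestronglyMeasurable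
    calc _ ≤ ENNReal.ofReal (∑ i ∈ I, 3 * (Θ * ρ) * ϑ (i - j)) +
          ENNReal.ofReal (∑ i ∈ I, 3 * (Θ * ρ) * ϑ (i - j)) := by
          rw [ENNReal.ofReal_sum_of_nonneg hnn]
          gcongr
          · refine (eLpNorm_sum_le (fun i _ => ((hR i).mul (hW1 i)).aestronglyMeasurable)
              (by norm_num)).trans (Finset.sum_le_sum b1)
          · refine (eLpNorm_sum_le (fun i _ => ((hR i).mul (hW2 i)).aestronglyMeasurable)
              (by norm_num)).trans (Finset.sum_le_sum b2)
      _ = ENNReal.ofReal (c j) := by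
          rw [← ENNReal.ofReal_add (Finset.sum_nonneg hnn) (Finset.sum_nonneg hnn), hc]
          congr 1
          simp only [abs_one, one_mul, ← Finset.mul_sum]
          ring
  · have := sum_sq_conv_le (β := fun _ => 1) hY.nonneg hY.sum_le I S
    simp only [hc, mul_pow, ← Finset.mul_sum] at this ⊢
    simp only [one_pow, Finset.sum_const, nsmul_eq_mul, mul_one] at this
    calc _ ≤ 6 ^ 2 * (Θ ^ 2 * ρ ^ 2) * (Θ ^ 2 * I.card) := by gcongr
      _ = _ := by ring

end ShortMemory

end
end DiffLRV

namespace DiffLRV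

noncomputable section

/-! ### Double sums and the quadratic form of the estimator -/

/-- Pairs are grouped by their difference. The lemma serves the differencing sequence, the moving
average coefficients and, with constant `d`, the counting of pairs. -/
lemma sum_sum_eq_sum_delta (m : ℕ) (d : ℕ → ℝ) (F : ℤ → ℝ) :
    ∑ i ∈ Finset.range (m + 1), ∑ j ∈ Finset.range (m + 1), d i * d j * F ((i : ℤ) - j) =
      ∑ s ∈ Finset.Icc (-(m : ℤ)) m, delta m d s * F s := by
  rw [← Finset.sum_product', ← Finset.sum_fiberwise_of_maps_to (t := Finset.Icc (-(m : ℤ)) m)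
    (g := fun p : ℕ × ℕ => (p.1 : ℤ) - p.2)]
  · refine Finset.sum_congr rfl fun s hs => ?_
    rw [Finset.mem_Icc] at hs
    rw [delta, Finset.sum_mul]
    rcases le_total 0 s with h0 | h0
    · refine Finset.sum_bij' (fun p _ => p.1) (fun j _ => (j, j - s.natAbs)) ?_ ?_ ?_ ?_ ?_
      · intro p hp
        simp only [Finset.mem_filter, Finset.mem_product, Finset.mem_range, Finset.mem_Icc] at hp ⊢
        omega
      · intro j hj
        simp only [Finset.mem_filter, Finset.mem_product, Finset.mem_range, Finset.mem_Icc] at hj ⊢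
        omega
      · intro p hp
        simp only [Finset.mem_filter, Finset.mem_product, Finset.mem_range] at hp
        ext <;> simp; omega
      · intro j hj; rfl
      · intro p hp
        simp only [Finset.mem_filter, Finset.mem_product, Finset.mem_range] at hp
        have : p.1 - s.natAbs = p.2 := by omega
        rw [this, hp.2]
    · refine Finset.sum_bij' (fun p _ => p.2) (fun j _ => (j - s.natAbs, j)) ?_ ?_ ?_ ?_ ?_
      · intro p hp
        simp only [Finset.mem_filter, Finset.mem_product, Finset.mem_range, Finset.mem_Icc] at hp ⊢
        omega
      · intro j hj
        simp only [Finset.mem_filter, Finset.mem_product, Finset.mem_range, Finset.mem_Icc] at hj ⊢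
        omega
      · intro p hp
        simp only [Finset.mem_filter, Finset.mem_product, Finset.mem_range] at hp
        ext <;> simp; omega
      · intro j hj; rfl
      · intro p hp
        simp only [Finset.mem_filter, Finset.mem_product, Finset.mem_range] at hp
        have : p.2 - s.natAbs = p.1 := by omega
        rw [this, hp.2]; ring
  · intro p hp
    simp only [Finset.mem_product, Finset.mem_range, Finset.mem_Icc] at hp ⊢
    omega

lemma delta_neg (m : ℕ) (d : ℕ → ℝ) (s : ℤ) : delta m d (-s) = delta m d s := by
  simp [delta]

lemma delta_zero (m : ℕ) (d : ℕ → ℝ) : delta m d 0 = ∑ j ∈ Finset.range (m + 1), d j ^ 2 := by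
  simp only [delta, Int.natAbs_zero, Nat.sub_zero]
  refine Finset.sum_congr ?_ fun j _ => (sq _).symm
  ext j; simp

lemma delta_eq_zero {m : ℕ} {s : ℤ} (h : (m : ℤ) < |s|) (d : ℕ → ℝ) : delta m d s = 0 := by
  have : Finset.Icc s.natAbs m = ∅ := Finset.Icc_eq_empty (by rw [Int.abs_eq_natAbs] at h; omega)
  simp [delta, this]

/-- For a differencing sequence the right side is zero. With δ_0 = 1 the remaining δ_s then sum to
-1: differences can never be exactly uncorrelated. -/
lemma sum_delta (m : ℕ) (d : ℕ → ℝ) :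
    ∑ s ∈ Finset.Icc (-(m : ℤ)) m, delta m d s = (∑ j ∈ Finset.range (m + 1), d j) ^ 2 := by
  have := sum_sum_eq_sum_delta m d fun _ => 1
  simp only [mul_one] at this
  rw [← this, sq, Finset.sum_mul_sum]

/-- The observations that enter the estimator are the differenced data on `[mh + 1, n]`. -/
abbrev win (n m h : ℕ) : Finset ℤ := Finset.Icc ((m : ℤ) * h + 1) n

/-- Lags `k` and `-k` together run over all ordered pairs of the window at distance |k|. Pairs at
distance at least ℓ may be added freely because the kernel vanishes there. -/
lemma vHat_eq_quadratic {K : ℝ → ℝ} (hK : IsKernel K) (t : Tuning) {n : ℕ} (hℓ : 1 ≤ t.ℓ n)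
    (X : ℤ → ℝ) :
    vHat K t n X = (1 / (n : ℝ)) * ∑ i ∈ win n (t.m n) (t.h n), ∑ k ∈ win n (t.m n) (t.h n),
      K (((i - k : ℤ) : ℝ) / (t.ℓ n : ℝ)) * (diffStat (t.m n) (t.h n) (t.d n) X i *
        diffStat (t.m n) (t.h n) (t.d n) X k) := by
  set D := diffStat (t.m n) (t.h n) (t.d n) X
  set ℓ := t.ℓ n
  set a : ℤ := (t.m n : ℤ) * t.h n with ha
  have hℓ' : (0 : ℝ) < ℓ := by exact_mod_cast hℓ
  have hzero : ∀ k : ℤ, (ℓ : ℤ) ≤ |k| → K ((k : ℝ) / ℓ) = 0 := by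
    intro k hk
    refine hK.support _ ?_
    rw [abs_div, abs_of_pos hℓ', le_div_iff₀ hℓ', one_mul, ← Int.cast_abs]
    exact_mod_cast hk
  simp only [vHat, gammaHat]
  rw [← Finset.sum_product', Finset.mul_sum]
  have hfil : ∑ p ∈ (win n (t.m n) (t.h n)) ×ˢ (win n (t.m n) (t.h n)),
      (1 / (n : ℝ)) * (K (((p.1 - p.2 : ℤ) : ℝ) / ℓ) * (D p.1 * D p.2)) =
      ∑ p ∈ ((win n (t.m n) (t.h n)) ×ˢ (win n (t.m n) (t.h n))).filter
        (fun p => p.1 - p.2 ∈ Finset.Ioo (-(ℓ : ℤ)) ℓ),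
      (1 / (n : ℝ)) * (K (((p.1 - p.2 : ℤ) : ℝ) / ℓ) * (D p.1 * D p.2)) := by
    symm
    refine Finset.sum_filter_of_ne fun p _ hp => ?_
    by_contra hcon
    refine hp ?_
    rw [hzero _ (by simp only [Finset.mem_Ioo] at hcon; rw [le_abs]; omega)]
    simp
  rw [hfil, ← Finset.sum_fiberwise_of_maps_to (t := Finset.Ioo (-(ℓ : ℤ)) ℓ)
    (g := fun p : ℤ × ℤ => p.1 - p.2)
    (fun p hp => (Finset.mem_filter.1 hp).2)]
  refine Finset.sum_congr rfl fun k hk => ?_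
  rw [Finset.mem_Ioo] at hk
  rw [← mul_assoc, mul_comm (K _), mul_assoc, Finset.mul_sum, Finset.mul_sum]
  rcases le_total 0 k with h0 | h0
  · refine Finset.sum_bij' (fun i _ => (i, i - |k|)) (fun p _ => p.1) ?_ ?_ ?_ ?_ ?_
    · intro i hi
      simp only [Finset.mem_filter, Finset.mem_product, Finset.mem_Icc, Finset.mem_Ioo, ← ha] at hi ⊢
      rw [abs_of_nonneg h0] at *
      omega
    · intro p hp
      simp only [Finset.mem_filter, Finset.mem_product, Finset.mem_Icc, Finset.mem_Ioo, ← ha] at hp ⊢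
      rw [abs_of_nonneg h0]
      omega
    · intro i hi; rfl
    · intro p hp
      simp only [Finset.mem_filter, Finset.mem_product, Finset.mem_Icc, Finset.mem_Ioo, ← ha] at hp
      rw [abs_of_nonneg h0]
      ext <;> simp; omega
    · intro i hi
      simp [abs_of_nonneg h0]
      exact Or.inl rfl
  · refine Finset.sum_bij' (fun i _ => (i - |k|, i)) (fun p _ => p.2) ?_ ?_ ?_ ?_ ?_
    · intro i hi
      simp only [Finset.mem_filter, Finset.mem_product, Finset.mem_Icc, Finset.mem_Ioo, ← ha] at hi ⊢
      rw [abs_of_nonpos h0] at *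
      omega
    · intro p hp
      simp only [Finset.mem_filter, Finset.mem_product, Finset.mem_Icc, Finset.mem_Ioo, ← ha] at hp ⊢
      rw [abs_of_nonpos h0]
      omega
    · intro i hi; rfl
    · intro p hp
      simp only [Finset.mem_filter, Finset.mem_product, Finset.mem_Icc, Finset.mem_Ioo, ← ha] at hp
      rw [abs_of_nonpos h0]
      ext <;> simp; omega
    · intro i hi
      simp [abs_of_nonpos h0, mul_comm]
      exact Or.inl rfl

/-- An interval of N integers contains N - |k| ordered pairs with difference k. The assumption on
`F` removes the lags where this count would be negative. -/
lemma sum_sum_Icc_sub (a : ℤ) (N : ℕ) (F : ℤ → ℝ) (hF : ∀ k : ℤ, (N : ℤ) ≤ |k| → F k = 0) :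
    ∑ i ∈ Finset.Icc (a + 1) (a + N), ∑ j ∈ Finset.Icc (a + 1) (a + N), F (i - j) =
      ∑' k : ℤ, ((N : ℝ) - |(k : ℝ)|) * F k := by
  rcases Nat.eq_zero_or_pos N with rfl | hN
  · have : ∀ k, F k = 0 := fun k => hF k (by simp)
    simp [this]
  obtain ⟨M, rfl⟩ : ∃ M, N = M + 1 := ⟨N - 1, by omega⟩
  have himg : ∀ G : ℤ → ℝ, ∑ i ∈ Finset.Icc (a + 1) (a + (M + 1 : ℕ)), G i =
      ∑ i ∈ Finset.range (M + 1), G (a + 1 + i) := by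
    intro G
    refine Finset.sum_bij' (fun i _ => (i - a - 1).toNat) (fun i _ => a + 1 + i) ?_ ?_ ?_ ?_ ?_
    · intro i hi; simp only [Finset.mem_Icc, Finset.mem_range] at hi ⊢; omega
    · intro i hi; simp only [Finset.mem_Icc, Finset.mem_range] at hi ⊢; omega
    · intro i hi; simp only [Finset.mem_Icc] at hi; omega
    · intro i hi; simp only [Finset.mem_range] at hi; omega
    · intro i hi
      simp only [Finset.mem_Icc] at hi
      congr 1; omega
  rw [himg]
  simp_rw [himg]
  have h1 := sum_sum_eq_sum_delta M (fun _ => 1) F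
  simp only [one_mul] at h1
  have h2 : ∀ i j : ℕ, a + 1 + (i : ℤ) - (a + 1 + j) = (i : ℤ) - j := fun i j => by ring
  simp_rw [h2]
  rw [h1, tsum_eq_sum (s := Finset.Icc (-(M : ℤ)) M)]
  · refine Finset.sum_congr rfl fun k hk => ?_
    rw [Finset.mem_Icc] at hk
    have hle : k.natAbs ≤ M := by omega
    have : delta M (fun _ => 1) k = ((M + 1 : ℕ) : ℝ) - |(k : ℝ)| := by
      simp only [delta, mul_one, Finset.sum_const, Nat.card_Icc, nsmul_eq_mul]
      rw [Nat.cast_sub (by omega), Nat.cast_natAbs, Int.cast_abs]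
    rw [this]
  · intro k hk
    rw [hF k (by rw [Finset.mem_Icc] at hk; rw [le_abs]; push_cast; omega), mul_zero]

/-- The weight of `γ_u` in the expectation of the estimator. -/
def wt (K : ℝ → ℝ) (n m ℓ h : ℕ) (d : ℕ → ℝ) (u : ℤ) : ℝ :=
  ∑ s ∈ Finset.Icc (-(m : ℤ)) m, delta m d s *
    (K (((u + s * h : ℤ) : ℝ) / ℓ) * (((n : ℝ) - m * h - |((u + s * h : ℤ) : ℝ)|) / n))

lemma kernel_eq_zero {K : ℝ → ℝ} (hK : IsKernel K) {ℓ : ℕ} (hℓ : 1 ≤ ℓ) {k : ℤ}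
    (hk : (ℓ : ℤ) ≤ |k|) : K ((k : ℝ) / ℓ) = 0 := by
  have hℓ' : (0 : ℝ) < ℓ := by exact_mod_cast hℓ
  refine hK.support _ ?_
  rw [abs_div, abs_of_pos hℓ', le_div_iff₀ hℓ', one_mul, ← Int.cast_abs]
  exact_mod_cast hk

/-- Substituting u = k - sh moves the shift from the autocovariance to the kernel. The condition mh
+ ℓ ≤ n makes the kernel vanish before the pair count changes sign. -/
lemma sum_kernel_autocov {K : ℝ → ℝ} (hK : IsKernel K) {n m ℓ h : ℕ} (hℓ : 1 ≤ ℓ)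
    (hn : m * h + ℓ ≤ n) (d : ℕ → ℝ) (γ : ℤ → ℝ) :
    (1 / (n : ℝ)) * ∑ i ∈ win n m h, ∑ k ∈ win n m h, K (((i - k : ℤ) : ℝ) / ℓ) *
        (∑ s ∈ Finset.Icc (-(m : ℤ)) m, delta m d s * γ (i - k - s * h)) =
      ∑' u : ℤ, wt K n m ℓ h d u * γ u := by
  obtain ⟨N, hN⟩ : ∃ N, n = m * h + N := ⟨n - m * h, by omega⟩
  have hwin : win n m h = Finset.Icc ((m : ℤ) * h + 1) ((m : ℤ) * h + N) := by
    rw [hN]; rfl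
  have hNr : (N : ℝ) = (n : ℝ) - m * h := by rw [hN]; push_cast; ring
  rw [hwin, sum_sum_Icc_sub ((m : ℤ) * h) N (fun k => K ((k : ℝ) / ℓ) *
    (∑ s ∈ Finset.Icc (-(m : ℤ)) m, delta m d s * γ (k - s * h)))
    (fun k hk => by rw [kernel_eq_zero hK hℓ (by omega), zero_mul])]
  set c : ℤ → ℝ := fun k => K ((k : ℝ) / ℓ) * (((n : ℝ) - m * h - |(k : ℝ)|) / n) with hc
  have hc0 : ∀ k : ℤ, k ∉ Finset.Ioo (-(ℓ : ℤ)) ℓ → c k = 0 := by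
    intro k hk
    rw [hc]; simp only
    rw [kernel_eq_zero hK hℓ (by rw [Finset.mem_Ioo] at hk; rw [le_abs]; omega), zero_mul]
  rw [← tsum_mul_left]
  have hsum : ∀ s : ℤ, Summable (fun k : ℤ => c k * γ (k - s * h)) := fun s =>
    summable_of_ne_finset_zero (s := Finset.Ioo (-(ℓ : ℤ)) ℓ) fun k hk => by rw [hc0 k hk, zero_mul]
  have hsum' : ∀ s : ℤ, Summable (fun u : ℤ => c (u + s * h) * γ u) := by
    intro s
    have := (Equiv.addRight (s * (h : ℤ))).summable_iff.2 (hsum s)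
    refine this.congr fun u => ?_
    simp
  calc _ = ∑' k : ℤ, ∑ s ∈ Finset.Icc (-(m : ℤ)) m, delta m d s * (c k * γ (k - s * h)) := by
        refine tsum_congr fun k => ?_
        rw [hc, hNr]
        simp only [Finset.mul_sum]
        refine Finset.sum_congr rfl fun s _ => ?_
        ring
    _ = ∑ s ∈ Finset.Icc (-(m : ℤ)) m, delta m d s * ∑' k : ℤ, c k * γ (k - s * h) := by
        rw [Summable.tsum_finsetSum fun s _ => (hsum s).mul_left _]
        simp_rw [tsum_mul_left]
    _ = ∑ s ∈ Finset.Icc (-(m : ℤ)) m, delta m d s * ∑' u : ℤ, c (u + s * h) * γ u := by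
        refine Finset.sum_congr rfl fun s _ => ?_
        rw [← (Equiv.addRight (s * (h : ℤ))).tsum_eq]
        simp
    _ = _ := by
        simp_rw [← tsum_mul_left]
        rw [← Summable.tsum_finsetSum fun s _ => (hsum' s).mul_left _]
        refine tsum_congr fun u => ?_
        rw [wt, Finset.sum_mul]
        refine Finset.sum_congr rfl fun s _ => ?_
        simp only [hc]; ring

end
end DiffLRV

namespace DiffLRV

noncomputable section

/-! ### Second order structure of the noise -/

namespace Noise

variable (N : Noise)

instance : IsProbabilityMeasure N.P := by unfold P; infer_instance

lemma measurable_Z (i : ℤ) : Measurable (N.Z i) :=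
  N.measurable_g.comp (measurable_pi_iff.2 fun _ => measurable_pi_apply _)

lemma Z_shift (i a : ℤ) (ε : ℤ → ℝ) : N.Z i (fun j => ε (j + a)) = N.Z (i + a) ε := by
  simp only [Z]
  congr 1
  ext k
  congr 1
  ring

lemma measurePreserving_shift (a : ℤ) :
    MeasurePreserving (fun (ε : ℤ → ℝ) (j : ℤ) => ε (j + a)) N.P N.P := by
  refine ⟨measurable_pi_iff.2 fun _ => measurable_pi_apply _, ?_⟩
  exact Measure.map_infinitePi_infinitePi_of_inj (P := fun _ : ℤ => N.ν) (f := fun j : ℤ => j + a)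
    (add_left_injective a)

lemma Z_eq_comp_shift (i a : ℤ) : N.Z (i + a) = N.Z i ∘ fun (ε : ℤ → ℝ) (j : ℤ) => ε (j + a) := by
  ext ε; exact (N.Z_shift i a ε).symm

variable {N}

lemma WeakDep.memLp (hN : N.WeakDep) (i : ℤ) : MemLp (N.Z i) 4 N.P := by
  obtain ⟨r, hr, hmem⟩ := hN.moment
  have h4 : (4 : ENNReal) ≤ ENNReal.ofReal r := by
    rw [show (4 : ENNReal) = ENNReal.ofReal 4 by norm_num]
    exact ENNReal.ofReal_le_ofReal hr.le
  have := hmem.mono_exponent h4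
  rw [show i = 1 + (i - 1) by ring, N.Z_eq_comp_shift]
  exact this.comp_measurePreserving (N.measurePreserving_shift _)

lemma WeakDep.integral_Z (hN : N.WeakDep) (i : ℤ) : ∫ ε, N.Z i ε ∂N.P = 0 := by
  have hmp := N.measurePreserving_shift (i - 1)
  rw [← hN.mean_zero]
  conv_rhs => rw [← hmp.map_eq]
  rw [integral_map hmp.measurable.aemeasurable (N.measurable_Z 1).aestronglyMeasurable]
  simp only [N.Z_shift]
  ring_nf

lemma WeakDep.integral_mul (hN : N.WeakDep) (s t : ℤ) :
    ∫ ε, N.Z s ε * N.Z t ε ∂N.P = N.gam (t - s) := by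
  rw [gam, covariance_eq_sub ((hN.memLp 0).mono_exponent (by norm_num))
    ((hN.memLp _).mono_exponent (by norm_num)), hN.integral_Z, zero_mul, sub_zero]
  have hmp := N.measurePreserving_shift s
  conv_rhs => rw [← hmp.map_eq]
  rw [integral_map hmp.measurable.aemeasurable
    ((N.measurable_Z 0).mul (N.measurable_Z (t - s))).aestronglyMeasurable]
  simp only [Pi.mul_apply, N.Z_shift]
  congr 2
  ext ε
  congr 2 <;> ring_nf

lemma FiniteU.summable {q : ℕ} (h : N.FiniteU q) : Summable fun k : ℤ => |N.gam k| := by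
  rw [FiniteU, ← Finset.summable_compl_iff {0}] at h
  rw [← Finset.summable_compl_iff {0}]
  refine Summable.of_nonneg_of_le (fun _ => abs_nonneg _) (fun k => ?_) h
  have hk : (k : ℤ) ≠ 0 := by simpa using k.2
  have : (1 : ℝ) ≤ |((k : ℤ) : ℝ)| ^ q := by
    refine one_le_pow₀ ?_
    rw [← Int.cast_abs]
    exact_mod_cast Int.one_le_abs hk
  exact le_mul_of_one_le_left (abs_nonneg _) this

lemma resampleDiff_Z (i j : ℤ) (p : (ℤ → ℝ) × ℝ) :
    resampleDiff (N.Z i) j p = resampleDiff (N.Z (i - j)) 0 (fun k => p.1 (k + j), p.2) := by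
  have h : Function.update (fun k => p.1 (k + j)) 0 p.2 =
      fun k => Function.update p.1 j p.2 (k + j) := by
    ext k
    by_cases hk : k = 0
    · subst hk; simp
    · rw [Function.update_of_ne hk, Function.update_of_ne (by omega)]
  simp only [resampleDiff, h, N.Z_shift]
  congr 2 <;> ring_nf

/-- The dependence measure as a function on the integers. -/
def depMeasure (N : Noise) (k : ℤ) : ℝ := if 0 ≤ k then (N.theta 4 k.toNat).toReal else 0

lemma WeakDep.shortMemory (hN : N.WeakDep) :
    ShortMemory N.ν N.Z N.depMeasure (∑' i : ℕ, N.theta 4 i).toReal where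
  meas := N.measurable_Z
  memLp := hN.memLp
  mean := hN.integral_Z
  nonneg := fun j => by unfold depMeasure; split_ifs <;> simp
  osc := fun t j => by
    have h : resampleDiff (N.Z t) j = resampleDiff (N.Z (t - j)) 0 ∘
        Prod.map (fun (ε : ℤ → ℝ) (k : ℤ) => ε (k + j)) id := by
      ext p; exact resampleDiff_Z t j p
    have hmp := (N.measurePreserving_shift j).prod (MeasurePreserving.id N.ν)
    rw [h]
    refine (eLpNorm_comp_measurePreserving (measurable_resampleDiff
      (N.measurable_Z (t - j)) 0).aestronglyMeasurable hmp).trans_le ?_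
    by_cases h0 : 0 ≤ t - j
    · simp only [depMeasure, h0, if_true]
      rw [ENNReal.ofReal_toReal]
      · rw [theta, Int.toNat_of_nonneg h0]; rfl
      · exact (lt_of_le_of_lt (ENNReal.le_tsum _) hN.dep).ne
    -- Causality: at a negative time the noise does not depend on the innovation at time 0.
    · have : resampleDiff (N.Z (t - j)) 0 = 0 := by
        ext p
        simp only [resampleDiff, Z, Pi.zero_apply, sub_eq_zero]
        congr 1
        ext k
        rw [Function.update_of_ne (by omega)]
      rw [this]; simp
  sum_le := fun S => by
    have hfin := hN.dep.ne
    have h1 : ∑ j ∈ S, N.depMeasure j = ∑ j ∈ S.filter (0 ≤ ·), (N.theta 4 j.toNat).toReal := by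
      rw [Finset.sum_filter]; rfl
    rw [h1, ← ENNReal.toReal_sum fun j _ => (lt_of_le_of_lt (ENNReal.le_tsum _) hN.dep).ne]
    refine ENNReal.toReal_mono hfin ?_
    rw [← Finset.sum_image (f := fun i : ℕ => N.theta 4 i) (g := Int.toNat)]
    · exact ENNReal.sum_le_tsum _
    · intro a ha b hb hab
      simp only [Finset.mem_coe, Finset.mem_filter] at ha hb
      omega

end Noise

lemma diffStat_add (m h : ℕ) (d : ℕ → ℝ) (X Y : ℤ → ℝ) (i : ℤ) :
    diffStat m h d (fun j => X j + Y j) i = diffStat m h d X i + diffStat m h d Y i := by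
  simp [diffStat, mul_add, Finset.sum_add_distrib]

/-- Differencing convolves the dependence sequence with |d|, so its mass grows by the factor ∑|d_j|.
As this stays bounded, all variance bounds are uniform in the diverging order m. -/
lemma ShortMemory.diffStat {ν : Measure ℝ} [IsProbabilityMeasure ν] {Y : ℤ → (ℤ → ℝ) → ℝ}
    {ϑ : ℤ → ℝ} {Θ : ℝ} (hY : ShortMemory ν Y ϑ Θ) (m h : ℕ) (d : ℕ → ℝ) :
    ShortMemory ν (fun i ε => diffStat m h d (fun j => Y j ε) i)
      (fun k => ∑ j ∈ Finset.range (m + 1), |d j| * ϑ (k - j * h))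
      ((∑ j ∈ Finset.range (m + 1), |d j|) * Θ) where
  meas := fun t => Finset.measurable_sum _ fun j _ => (hY.meas _).const_mul _
  memLp := fun t => memLp_finsetSum _ fun j _ => (hY.memLp _).const_mul _
  mean := fun t => by
    simp only [DiffLRV.diffStat]
    rw [integral_finsetSum _ fun j _ => ((hY.memLp _).const_mul _).integrable (by norm_num)]
    simp [integral_const_mul, hY.mean]
  nonneg := fun k => Finset.sum_nonneg fun j _ => mul_nonneg (abs_nonneg _) (hY.nonneg _)
  osc := fun t j => by
    have hh : resampleDiff (fun ε => DiffLRV.diffStat m h d (fun j => Y j ε) t) j =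
        ∑ a ∈ Finset.range (m + 1), (d a) • resampleDiff (Y (t - a * h)) j := by
      ext p
      simp [resampleDiff, DiffLRV.diffStat, Finset.sum_apply, mul_sub, Finset.sum_sub_distrib]
    rw [hh]
    refine (eLpNorm_sum_le (fun a _ => ?_) (by norm_num)).trans ?_
    · exact ((measurable_resampleDiff (hY.meas _) j).const_smul _).aestronglyMeasurable
    rw [ENNReal.ofReal_sum_of_nonneg fun t _ => mul_nonneg (abs_nonneg _) (hY.nonneg _)]
    refine Finset.sum_le_sum fun a _ => ?_
    rw [eLpNorm_const_smul, ENNReal.ofReal_mul (abs_nonneg _)]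
    gcongr
    · rw [Real.enorm_eq_ofReal_abs]
    · have := hY.osc (t - a * h) j
      rwa [show t - a * h - j = t - j - a * h by ring] at this
  sum_le := fun S => by
    rw [Finset.sum_comm, Finset.sum_mul]
    refine Finset.sum_le_sum fun a _ => ?_
    rw [← Finset.mul_sum]
    refine mul_le_mul_of_nonneg_left ?_ (abs_nonneg _)
    rw [← Finset.sum_image (f := ϑ) (g := fun t : ℤ => t - a * h)
      (by intro a _ b _ h; simpa using h)]
    exact hY.sum_le _

lemma Noise.WeakDep.integral_diffStat_mul {N : Noise} (hN : N.WeakDep) (m h : ℕ) (d : ℕ → ℝ)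
    (i k : ℤ) :
    ∫ ε, diffStat m h d (fun j => N.Z j ε) i * diffStat m h d (fun j => N.Z j ε) k ∂N.P =
      ∑ s ∈ Finset.Icc (-(m : ℤ)) m, delta m d s * N.gam (i - k - s * h) := by
  rw [← sum_sum_eq_sum_delta m d fun s => N.gam (i - k - s * h)]
  simp only [diffStat, Finset.sum_mul_sum]
  have hintg : ∀ a b : ℕ, Integrable (fun ε => d a * N.Z (i - a * h) ε * (d b * N.Z (k - b * h) ε)) N.P := by
    intro a b
    refine (memLp_mul_two ((hN.memLp (i - a * h)).const_mul (d a))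
      ((hN.memLp (k - b * h)).const_mul (d b))).integrable (by norm_num)
  rw [integral_finsetSum _ fun a _ => integrable_finsetSum _ fun b _ => hintg a b]
  refine Finset.sum_congr rfl fun a _ => ?_
  rw [integral_finsetSum _ fun b _ => hintg a b]
  refine Finset.sum_congr rfl fun b _ => ?_
  calc _ = ∫ ε, d a * d b * (N.Z (k - b * h) ε * N.Z (i - a * h) ε) ∂N.P := by
        congr 1; ext ε; ring
    _ = _ := by
        rw [integral_const_mul, hN.integral_mul]
        congr 2; ring

end
end DiffLRV

namespace DiffLRV

noncomputable section

/-! ### Bias and variance of the estimator -/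

lemma sum_window_le {F : ℝ → ℝ} {A : ℝ} (hA : ∀ x, F x ≤ A)
    (hF : ∀ x, 1 ≤ |x| → F x = 0) {ℓ : ℕ} (hℓ : 1 ≤ ℓ) (I : Finset ℤ) (i : ℤ) :
    ∑ t ∈ I, F (((i - t : ℤ) : ℝ) / ℓ) ≤ A * (2 * ℓ) := by
  have hℓ' : (0 : ℝ) < ℓ := by exact_mod_cast hℓ
  have hA0 : 0 ≤ A := (hF 1 (by simp)) ▸ hA 1
  have h1 : ∑ t ∈ I, F (((i - t : ℤ) : ℝ) / ℓ) ≤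
      ∑ t ∈ I.filter (fun t => t ∈ Finset.Ioo (i - ℓ) (i + ℓ)), A := by
    rw [Finset.sum_filter]
    refine Finset.sum_le_sum fun t _ => ?_
    split_ifs with h
    · exact hA _
    · refine (hF _ ?_).le
      rw [abs_div, abs_of_pos hℓ', le_div_iff₀ hℓ', one_mul, ← Int.cast_abs]
      have : (ℓ : ℤ) ≤ |i - t| := by rw [Finset.mem_Ioo] at h; rw [le_abs]; omega
      exact_mod_cast this
  refine h1.trans ?_
  rw [Finset.sum_const, nsmul_eq_mul, mul_comm]
  refine mul_le_mul_of_nonneg_left ?_ hA0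
  have h2 : (I.filter (fun t => t ∈ Finset.Ioo (i - ℓ) (i + ℓ))).card ≤ 2 * ℓ := by
    refine (Finset.card_le_card (t := Finset.Ioo (i - ℓ) (i + ℓ)) ?_).trans ?_
    · intro t ht; exact (Finset.mem_filter.1 ht).2
    · rw [Int.card_Ioo]; omega
  exact_mod_cast h2

lemma kernel_swap {K : ℝ → ℝ} (hK : IsKernel K) (i t : ℤ) (x : ℝ) :
    K (((i - t : ℤ) : ℝ) / x) = K (((t - i : ℤ) : ℝ) / x) := by
  rw [← hK.even]
  congr 1
  push_cast
  ring

/-- The contribution of the mean function to the bias. -/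
def meanBias (K : ℝ → ℝ) (t : Tuning) (n : ℕ) (μ : ℤ → ℝ) : ℝ :=
  (1 / (n : ℝ)) * ∑ i ∈ win n (t.m n) (t.h n), ∑ k ∈ win n (t.m n) (t.h n),
      K (((i - k : ℤ) : ℝ) / (t.ℓ n : ℝ)) * (diffStat (t.m n) (t.h n) (t.d n) μ i *
        diffStat (t.m n) (t.h n) (t.d n) μ k)

/-- The energy of the differenced mean. -/
def meanEnergy (t : Tuning) (n : ℕ) (μ : ℤ → ℝ) : ℝ :=
  ∑ i ∈ win n (t.m n) (t.h n), diffStat (t.m n) (t.h n) (t.d n) μ i ^ 2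

/-- The mean vector `μ(i/n)` of the observations. -/
def DGM.mu (G : DGM) (n : ℕ) (i : ℤ) : ℝ := (G.mean n).eval n ((i : ℝ) / (n : ℝ))

/-- The contribution of the noise to the bias. -/
def noiseBias (K : ℝ → ℝ) (t : Tuning) (n : ℕ) (N : Noise) : ℝ :=
  ∑' u : ℤ, (wt K n (t.m n) (t.ℓ n) (t.h n) (t.d n) u - 1) * N.gam u

/-- Schur's test: the kernel matrix is symmetric and its rows have absolute sums at most 2Aℓ. -/
lemma abs_meanBias_le {K : ℝ → ℝ} (hK : IsKernel K) {A : ℝ} (hA : ∀ x, |K x| ≤ A) (t : Tuning)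
    {n : ℕ} (hℓ : 1 ≤ t.ℓ n) (μ : ℤ → ℝ) :
    |meanBias K t n μ| ≤ 2 * A * t.ℓ n * meanEnergy t n μ / n := by
  set D := diffStat (t.m n) (t.h n) (t.d n) μ with hD
  set I := win n (t.m n) (t.h n) with hI
  set ℓ := t.ℓ n with hℓdef
  have hrow : ∀ i, ∑ k ∈ I, |K (((i - k : ℤ) : ℝ) / ℓ)| ≤ A * (2 * ℓ) := fun i =>
    sum_window_le (F := fun x => |K x|) hA (fun x hx => by rw [hK.support x hx, abs_zero]) hℓ I i
  have h1 : |∑ i ∈ I, ∑ k ∈ I, K (((i - k : ℤ) : ℝ) / ℓ) * (D i * D k)| ≤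
      2 * A * ℓ * ∑ i ∈ I, D i ^ 2 := by
    calc |∑ i ∈ I, ∑ k ∈ I, K (((i - k : ℤ) : ℝ) / ℓ) * (D i * D k)|
        ≤ ∑ i ∈ I, ∑ k ∈ I, |K (((i - k : ℤ) : ℝ) / ℓ)| * ((D i ^ 2 + D k ^ 2) / 2) := by
          refine (Finset.abs_sum_le_sum_abs _ _).trans (Finset.sum_le_sum fun i _ => ?_)
          refine (Finset.abs_sum_le_sum_abs _ _).trans (Finset.sum_le_sum fun k _ => ?_)
          rw [abs_mul]
          gcongr
          rw [abs_le]
          constructor <;> nlinarith [sq_nonneg (D i + D k), sq_nonneg (D i - D k)]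
      _ = (∑ i ∈ I, ∑ k ∈ I, |K (((i - k : ℤ) : ℝ) / ℓ)| * D i ^ 2) / 2 +
          (∑ i ∈ I, ∑ k ∈ I, |K (((i - k : ℤ) : ℝ) / ℓ)| * D k ^ 2) / 2 := by
          simp only [Finset.sum_div, ← Finset.sum_add_distrib]
          refine Finset.sum_congr rfl fun i _ => Finset.sum_congr rfl fun k _ => ?_
          ring
      _ = ∑ i ∈ I, (∑ k ∈ I, |K (((i - k : ℤ) : ℝ) / ℓ)|) * D i ^ 2 := by
          rw [Finset.sum_comm (f := fun i k => |K (((i - k : ℤ) : ℝ) / ℓ)| * D k ^ 2)]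
          have : ∀ i k : ℤ, K (((k - i : ℤ) : ℝ) / ℓ) = K (((i - k : ℤ) : ℝ) / ℓ) := fun i k =>
            kernel_swap hK _ _ _
          simp only [this, add_halves, Finset.sum_mul]
      _ ≤ ∑ i ∈ I, (A * (2 * ℓ)) * D i ^ 2 := by
          gcongr with i _
          exact hrow i
      _ = _ := by rw [← Finset.mul_sum]; ring
  rw [meanBias, abs_mul, abs_of_nonneg (by positivity : (0:ℝ) ≤ 1 / n), meanEnergy]
  calc _ ≤ (1 / (n : ℝ)) * (2 * A * ℓ * ∑ i ∈ I, D i ^ 2) := by gcongr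
    _ = _ := by ring

lemma summable_wt_mul {K : ℝ → ℝ} (hK : IsKernel K) {n m ℓ h : ℕ} (hℓ : 1 ≤ ℓ) (d : ℕ → ℝ)
    (γ : ℤ → ℝ) : Summable fun u : ℤ => wt K n m ℓ h d u * γ u := by
  refine summable_of_ne_finset_zero (s := Finset.Ioo (-((ℓ : ℤ) + m * h)) (ℓ + m * h)) fun u hu => ?_
  have : wt K n m ℓ h d u = 0 := by
    refine Finset.sum_eq_zero fun s hs => ?_
    rw [kernel_eq_zero hK hℓ, zero_mul, mul_zero]
    rw [Finset.mem_Icc] at hs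
    rw [Finset.mem_Ioo] at hu
    have h0 : (0 : ℤ) ≤ h := by positivity
    rw [le_abs]
    rcases le_or_gt u 0 with hu0 | hu0
    · right
      have : u ≤ -(ℓ + m * h) := by
        by_contra hcon; exact hu ⟨by omega, by nlinarith [(by positivity : (0:ℤ) ≤ m * h)]⟩
      nlinarith
    · left
      have : ℓ + m * h ≤ u := by
        by_contra hcon; exact hu ⟨by nlinarith [(by positivity : (0:ℤ) ≤ m * h)], by omega⟩
      nlinarith
  rw [this, zero_mul]

/-- The differenced noise. -/
def diffNoise (t : Tuning) (N : Noise) (n : ℕ) (i : ℤ) (ε : ℤ → ℝ) : ℝ :=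
  diffStat (t.m n) (t.h n) (t.d n) (fun j => N.Z j ε) i

lemma shortMemory_diffNoise (t : Tuning) {G : DGM} (hN : G.noise.WeakDep) {n : ℕ} : ShortMemory G.noise.ν (diffNoise t G.noise n)
    (fun k => ∑ j ∈ Finset.range (t.m n + 1), |t.d n j| * G.noise.depMeasure (k - j * t.h n))
    ((∑ j ∈ Finset.range (t.m n + 1), |t.d n j|) * (∑' i : ℕ, G.noise.theta 4 i).toReal) :=
  hN.shortMemory.diffStat (t.m n) (t.h n) (t.d n)

/-- The parts quadratic, linear and constant in the noise. The two cross terms agree because K is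
even, whence the factor 2. -/
lemma vHat_decomp {K : ℝ → ℝ} (hK : IsKernel K) (t : Tuning) {G : DGM} {n : ℕ}
    (hℓ : 1 ≤ t.ℓ n) (ε : ℤ → ℝ) :
    vHat K t n (G.X n ε) =
      (∑ i ∈ win n (t.m n) (t.h n), ∑ k ∈ win n (t.m n) (t.h n),
        (1 / (n : ℝ) * K (((i - k : ℤ) : ℝ) / (t.ℓ n : ℝ))) *
          (diffNoise t G.noise n i ε * diffNoise t G.noise n k ε)) +
      (∑ i ∈ win n (t.m n) (t.h n), (2 / (n : ℝ) * ∑ k ∈ win n (t.m n) (t.h n),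
        K (((i - k : ℤ) : ℝ) / (t.ℓ n : ℝ)) * diffStat (t.m n) (t.h n) (t.d n) (G.mu n) k) *
          diffNoise t G.noise n i ε) +
      meanBias K t n (G.mu n) := by
  rw [vHat_eq_quadratic hK t hℓ, meanBias]
  have hX : ∀ i, diffStat (t.m n) (t.h n) (t.d n) (G.X n ε) i =
      diffStat (t.m n) (t.h n) (t.d n) (G.mu n) i + diffNoise t G.noise n i ε := fun i =>
    diffStat_add _ _ _ (G.mu n) (fun j => G.noise.Z j ε) i
  simp only [hX]
  set I := win n (t.m n) (t.h n)
  set D := diffStat (t.m n) (t.h n) (t.d n) (G.mu n)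
  set Y := fun i => diffNoise t G.noise n i ε
  change 1 / (n : ℝ) * ∑ i ∈ I, ∑ k ∈ I, K (((i - k : ℤ) : ℝ) / (t.ℓ n : ℝ)) *
    ((D i + Y i) * (D k + Y k)) = (∑ i ∈ I, ∑ k ∈ I, (1 / (n : ℝ) *
      K (((i - k : ℤ) : ℝ) / (t.ℓ n : ℝ))) * (Y i * Y k)) +
    (∑ i ∈ I, (2 / (n : ℝ) * ∑ k ∈ I, K (((i - k : ℤ) : ℝ) / (t.ℓ n : ℝ)) * D k) * Y i) +
    1 / (n : ℝ) * ∑ i ∈ I, ∑ k ∈ I, K (((i - k : ℤ) : ℝ) / (t.ℓ n : ℝ)) * (D i * D k)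
  have hsw : ∑ i ∈ I, ∑ k ∈ I, K (((i - k : ℤ) : ℝ) / (t.ℓ n : ℝ)) * (D i * Y k) =
      ∑ i ∈ I, ∑ k ∈ I, K (((i - k : ℤ) : ℝ) / (t.ℓ n : ℝ)) * (D k * Y i) := by
    rw [Finset.sum_comm]
    refine Finset.sum_congr rfl fun i _ => Finset.sum_congr rfl fun k _ => ?_
    rw [kernel_swap hK]
  have hlin : ∑ i ∈ I, (2 / (n : ℝ) * ∑ k ∈ I, K (((i - k : ℤ) : ℝ) / (t.ℓ n : ℝ)) * D k) * Y i =
      1 / (n : ℝ) * (∑ i ∈ I, ∑ k ∈ I, K (((i - k : ℤ) : ℝ) / (t.ℓ n : ℝ)) * (D i * Y k) +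
        ∑ i ∈ I, ∑ k ∈ I, K (((i - k : ℤ) : ℝ) / (t.ℓ n : ℝ)) * (D k * Y i)) := by
    rw [hsw, ← two_mul, ← mul_assoc, Finset.mul_sum]
    refine Finset.sum_congr rfl fun i _ => ?_
    rw [Finset.mul_sum, Finset.mul_sum, Finset.sum_mul]
    refine Finset.sum_congr rfl fun k _ => ?_
    ring
  rw [hlin]
  simp only [Finset.mul_sum, ← Finset.sum_add_distrib, ← mul_add]
  refine Finset.sum_congr rfl fun i _ => Finset.sum_congr rfl fun k _ => ?_
  ring

lemma memLp_vHat {K : ℝ → ℝ} (hK : IsKernel K) (t : Tuning) {G : DGM}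
    (hN : G.noise.WeakDep) {n : ℕ} (hℓ : 1 ≤ t.ℓ n) : MemLp (fun ε => vHat K t n (G.X n ε)) 2 G.noise.P := by
  have hS := shortMemory_diffNoise (n := n) t hN
  simp only [vHat_decomp hK t hℓ]
  refine ((memLp_finsetSum _ fun i _ => memLp_finsetSum _ fun k _ =>
    (memLp_mul_two (hS.memLp i) (hS.memLp k)).const_mul _).add
      ((hS.memLp_sum _ _).mono_exponent (by norm_num))).add (memLp_const _)

lemma integral_vHat {K : ℝ → ℝ} (hK : IsKernel K) (t : Tuning) {G : DGM}
    (hN : G.noise.WeakDep) {n : ℕ} (hℓ : 1 ≤ t.ℓ n) (hn : t.m n * t.h n + t.ℓ n ≤ n) :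
    ∫ ε, vHat K t n (G.X n ε) ∂G.noise.P =
      (∑' u : ℤ, wt K n (t.m n) (t.ℓ n) (t.h n) (t.d n) u * G.noise.gam u) +
        meanBias K t n (G.mu n) := by
  have hS := shortMemory_diffNoise (n := n) t hN
  simp only [vHat_decomp hK t hℓ]
  have hintg : ∀ i k : ℤ, Integrable (fun ε => (1 / (n : ℝ) *
      K (((i - k : ℤ) : ℝ) / (t.ℓ n : ℝ))) *
          (diffNoise t G.noise n i ε * diffNoise t G.noise n k ε)) G.noise.P := fun i k =>
    ((memLp_mul_two (hS.memLp i) (hS.memLp k)).const_mul _).integrable (by norm_num)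
  have hint2 : Integrable (fun ε => ∑ i ∈ win n (t.m n) (t.h n), ∑ k ∈ win n (t.m n) (t.h n),
      (1 / (n : ℝ) * K (((i - k : ℤ) : ℝ) / (t.ℓ n : ℝ))) *
          (diffNoise t G.noise n i ε * diffNoise t G.noise n k ε)) G.noise.P :=
    integrable_finsetSum _ fun i _ => integrable_finsetSum _ fun k _ => hintg i k
  have hint3 := (hS.memLp_sum (win n (t.m n) (t.h n)) fun i => (2 / (n : ℝ) * ∑ k ∈ win n (t.m n) (t.h n),
        K (((i - k : ℤ) : ℝ) / (t.ℓ n : ℝ)) * diffStat (t.m n) (t.h n) (t.d n) (G.mu n) k)).integrable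
        (by norm_num)
  rw [integral_add, integral_add hint2 hint3]
  rotate_left
  · exact hint2.add hint3
  · exact integrable_const _
  have h0 := hS.integral_sum (win n (t.m n) (t.h n)) fun i => (2 / (n : ℝ) * ∑ k ∈ win n (t.m n) (t.h n),
        K (((i - k : ℤ) : ℝ) / (t.ℓ n : ℝ)) * diffStat (t.m n) (t.h n) (t.d n) (G.mu n) k)
  change ∫ ε, _ ∂G.noise.P = 0 at h0
  rw [h0, integral_const, add_zero]
  simp only [probReal_univ, one_smul]
  congr 1
  rw [← sum_kernel_autocov hK hℓ hn,
    integral_finsetSum _ fun i _ => integrable_finsetSum _ fun k _ => hintg i k, Finset.mul_sum]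
  refine Finset.sum_congr rfl fun i _ => ?_
  rw [integral_finsetSum _ fun k _ => hintg i k, Finset.mul_sum]
  refine Finset.sum_congr rfl fun k _ => ?_
  rw [integral_const_mul]
  unfold diffNoise
  rw [hN.integral_diffStat_mul, mul_assoc]

lemma bias_eq {K : ℝ → ℝ} (hK : IsKernel K) (t : Tuning) {G : DGM}
    (hN : G.noise.WeakDep) {n : ℕ} {q : ℕ} (hU : G.noise.FiniteU q) (hℓ : 1 ≤ t.ℓ n)
    (hn : t.m n * t.h n + t.ℓ n ≤ n) :
    ∫ ε, vHat K t n (G.X n ε) ∂G.noise.P - G.noise.lrv =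
      noiseBias K t n G.noise + meanBias K t n (G.mu n) := by
  rw [integral_vHat hK t hN hℓ hn, noiseBias, Noise.lrv]
  simp only [sub_mul, one_mul]
  rw [Summable.tsum_sub (summable_wt_mul hK hℓ _ _) hU.summable.of_abs]
  ring

lemma mse_eq {K : ℝ → ℝ} (hK : IsKernel K) (t : Tuning) {G : DGM}
    (hN : G.noise.WeakDep) {n : ℕ} {q : ℕ} (hU : G.noise.FiniteU q) (hℓ : 1 ≤ t.ℓ n)
    (hn : t.m n * t.h n + t.ℓ n ≤ n) :
    mse K t G n = Var[fun ε => vHat K t n (G.X n ε); G.noise.P] +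
      (noiseBias K t n G.noise + meanBias K t n (G.mu n)) ^ 2 := by
  have hmem := memLp_vHat hK t hN hℓ
  rw [mse, ← bias_eq hK t hN hU hℓ hn, variance_eq_sub hmem]
  simp only [sub_sq]
  rw [integral_add, integral_sub, integral_const, integral_mul_const, integral_const_mul]
  · simp only [probReal_univ, one_smul, Pi.pow_apply]
    ring
  · exact hmem.integrable_sq
  · exact ((hmem.integrable (by norm_num)).const_mul _).mul_const _
  · exact hmem.integrable_sq.sub (((hmem.integrable (by norm_num)).const_mul _).mul_const _)
  · exact integrable_const _

/-- In the quadratic part every row has square sum at most 2A²ℓ/n², and there are at most n rows,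
which gives ℓ/n. The linear part costs a further factor ℓ · energy / n, the scale of the mean bias.
-/
lemma variance_vHat_le {K : ℝ → ℝ} (hK : IsKernel K) (t : Tuning) {G : DGM}
    (hN : G.noise.WeakDep) {n : ℕ} {A : ℝ} (hA : ∀ x, |K x| ≤ A) (hn1 : 1 ≤ n) (hℓ : 1 ≤ t.ℓ n) {Θ : ℝ}
    (hΘ : (∑ j ∈ Finset.range (t.m n + 1), |t.d n j|) * (∑' i : ℕ, G.noise.theta 4 i).toReal ≤ Θ) :
    Var[fun ε => vHat K t n (G.X n ε); G.noise.P] ≤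
      144 * Θ ^ 4 * A ^ 2 * (t.ℓ n / n) +
        32 * Θ ^ 2 * A ^ 2 * (t.ℓ n / n) * (t.ℓ n * meanEnergy t n (G.mu n) / n) := by
  have hS := shortMemory_diffNoise (n := n) t hN
  have hnr : (0 : ℝ) < n := by exact_mod_cast hn1
  set I := win n (t.m n) (t.h n) with hI
  set ℓ := t.ℓ n with hℓdef
  set D := diffStat (t.m n) (t.h n) (t.d n) (G.mu n) with hD
  have hΘ0 := hS.bound_nonneg
  set Θ' := (∑ j ∈ Finset.range (t.m n + 1), |t.d n j|) * (∑' i : ℕ, G.noise.theta 4 i).toReal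
  have hA0 : 0 ≤ A := (abs_nonneg _).trans (hA 0)
  have hK2 : ∀ i, ∑ k ∈ I, K (((i - k : ℤ) : ℝ) / ℓ) ^ 2 ≤ A ^ 2 * (2 * ℓ) := fun i =>
    sum_window_le (F := fun x => K x ^ 2) (fun x => by rw [← sq_abs]; gcongr; exact hA x)
      (fun x hx => by rw [hK.support x hx]; norm_num) hℓ I i
  have hcard : (I.card : ℝ) ≤ n := by
    have : I.card ≤ n := by
      rw [hI, Int.card_Icc]
      have : (0 : ℤ) ≤ (t.m n : ℤ) * t.h n := by positivity
      omega
    exact_mod_cast this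
  set Q : (ℤ → ℝ) → ℝ := fun ε => ∑ i ∈ I, ∑ k ∈ I, (1 / (n : ℝ) * K (((i - k : ℤ) : ℝ) / (ℓ : ℝ))) *
          (diffNoise t G.noise n i ε * diffNoise t G.noise n k ε) with hQ
  set β : ℤ → ℝ := fun i => 2 / (n : ℝ) * ∑ k ∈ I, K (((i - k : ℤ) : ℝ) / (ℓ : ℝ)) * D k with hβ
  set L : (ℤ → ℝ) → ℝ := fun ε => ∑ i ∈ I, β i * diffNoise t G.noise n i ε with hL
  have hQm : MemLp Q 2 G.noise.P := memLp_finsetSum _ fun i _ => memLp_finsetSum _ fun k _ =>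
    (memLp_mul_two (hS.memLp i) (hS.memLp k)).const_mul _
  have hLm : MemLp L 2 G.noise.P := (hS.memLp_sum I β).mono_exponent (by norm_num)
  have hdec : (fun ε => vHat K t n (G.X n ε)) = fun ε => (Q + L) ε + meanBias K t n (G.mu n) := by
    ext ε; exact vHat_decomp hK t hℓ ε
  have hVQ : Var[Q; G.noise.P] ≤ 36 * Θ' ^ 4 * (√(2 * A ^ 2 * ℓ) / n) ^ 2 * I.card := by
    have hρ : (√(2 * A ^ 2 * ℓ) / n) ^ 2 = (1 / (n : ℝ)) ^ 2 * (A ^ 2 * (2 * ℓ)) := by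
      rw [div_pow, Real.sq_sqrt (by positivity)]; ring
    refine hS.variance_quadratic_le I (fun i k => 1 / (n : ℝ) * K (((i - k : ℤ) : ℝ) / (ℓ : ℝ)))
      (by positivity) (fun i _ => ?_) (fun k _ => ?_)
    · simp only [mul_pow _ (K _), ← Finset.mul_sum]
      rw [hρ]
      gcongr
      exact hK2 i
    · simp only [mul_pow _ (K _), ← Finset.mul_sum]
      rw [hρ]
      gcongr
      simp only [kernel_swap hK _ k]
      exact hK2 k
  have hVQ' : Var[Q; G.noise.P] ≤ 72 * Θ ^ 4 * A ^ 2 * (ℓ / n) := by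
    refine hVQ.trans ?_
    rw [div_pow, Real.sq_sqrt (by positivity)]
    calc _ ≤ 36 * Θ ^ 4 * ((2 * A ^ 2 * ℓ) / (n : ℝ) ^ 2) * n := by gcongr
      _ = _ := by field_simp; ring
  have hβ2 : ∑ i ∈ I, β i ^ 2 ≤ 16 * A ^ 2 * (ℓ / n) * (ℓ * meanEnergy t n (G.mu n) / n) := by
    calc ∑ i ∈ I, β i ^ 2 ≤ ∑ i ∈ I, (2 / (n : ℝ)) ^ 2 * ((2 * ℓ) * ∑ k ∈ I,
          K (((i - k : ℤ) : ℝ) / (ℓ : ℝ)) ^ 2 * D k ^ 2) := by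
          refine Finset.sum_le_sum fun i _ => ?_
          rw [hβ]; simp only
          rw [mul_pow]
          gcongr
          -- Cauchy–Schwarz against the indicator of the support of the kernel, so that the price is
          -- 2ℓ and not the length of the window.
          set F : ℝ → ℝ := fun x => if |x| < 1 then 1 else 0 with hF
          have hFs : ∑ k ∈ I, F (((i - k : ℤ) : ℝ) / ℓ) ≤ 1 * (2 * ℓ) :=
            sum_window_le (fun x => by simp only [hF]; split_ifs <;> norm_num)
              (fun x hx => by simp only [hF]; rw [if_neg (not_lt.2 hx)]) hℓ I i
          rw [one_mul] at hFs
          refine (Finset.sum_sq_le_sum_mul_sum_of_sq_le_mul I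
            (f := fun k => F (((i - k : ℤ) : ℝ) / ℓ))
            (g := fun k => K (((i - k : ℤ) : ℝ) / (ℓ : ℝ)) ^ 2 * D k ^ 2) (fun k _ => ?_)
            (fun k _ => by positivity) (fun k _ => ?_)).trans ?_
          · simp only [hF]; split_ifs <;> norm_num
          · simp only [hF]
            split_ifs with hx
            · rw [one_mul, mul_pow]
            · rw [hK.support _ (not_lt.1 hx)]; norm_num
          · refine mul_le_mul_of_nonneg_right hFs (Finset.sum_nonneg fun k _ => by positivity)
      _ = (2 / (n : ℝ)) ^ 2 * (2 * ℓ) * ∑ k ∈ I, (∑ i ∈ I, K (((k - i : ℤ) : ℝ) / (ℓ : ℝ)) ^ 2) *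
            D k ^ 2 := by
          rw [← Finset.mul_sum, ← Finset.mul_sum, Finset.sum_comm, ← mul_assoc]
          simp only [Finset.sum_mul]
          congr 1
          refine Finset.sum_congr rfl fun k _ => Finset.sum_congr rfl fun i _ => ?_
          rw [kernel_swap hK]
      _ ≤ (2 / (n : ℝ)) ^ 2 * (2 * ℓ) * ∑ k ∈ I, (A ^ 2 * (2 * ℓ)) * D k ^ 2 := by
          gcongr with k _
          exact hK2 k
      _ = _ := by rw [← Finset.mul_sum, meanEnergy]; field_simp; ring
  have hE0 : 0 ≤ meanEnergy t n (G.mu n) := Finset.sum_nonneg fun _ _ => sq_nonneg _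
  have hVL : Var[L; G.noise.P] ≤ 16 * Θ ^ 2 * A ^ 2 * (ℓ / n) * (ℓ * meanEnergy t n (G.mu n) / n) := by
    refine (hS.variance_sum_le I β).trans ?_
    calc _ ≤ Θ ^ 2 * (16 * A ^ 2 * (ℓ / n) * (ℓ * meanEnergy t n (G.mu n) / n)) := by
          gcongr
      _ = _ := by ring
  rw [hdec, variance_add_const (hQm.add hLm).aestronglyMeasurable]
  -- The parallelogram law avoids the covariance of the quadratic and the linear part.
  have hsum : Var[Q + L; G.noise.P] ≤ 2 * Var[Q; G.noise.P] + 2 * Var[L; G.noise.P] := by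
    have h1 := variance_add hQm hLm
    have h2 := variance_sub hQm hLm
    have h3 := variance_nonneg (Q - L) G.noise.P
    linarith
  linarith

end
end DiffLRV

namespace DiffLRV

noncomputable section

/-! ### The differenced mean -/

/-- The unit step at `T`. -/
def stepFn (T : ℤ) (k : ℤ) : ℝ := if T ≤ k then 1 else 0

lemma diffStat_congr {n m h : ℕ} (d : ℕ → ℝ) {X Y : ℤ → ℝ}
    (hXY : ∀ k : ℤ, 1 ≤ k → k ≤ n → X k = Y k) {i : ℤ} (hi : i ∈ win n m h) :
    diffStat m h d X i = diffStat m h d Y i := by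
  rw [Finset.mem_Icc] at hi
  refine Finset.sum_congr rfl fun j hj => ?_
  have hj' : (j : ℤ) ≤ m := by exact_mod_cast Nat.lt_succ_iff.1 (Finset.mem_range.1 hj)
  have h1 : (j : ℤ) * h ≤ m * h := mul_le_mul_of_nonneg_right hj' (by positivity)
  have h2 : (0 : ℤ) ≤ j * h := by positivity
  rw [hXY _ (by linarith) (by linarith)]

lemma diffStat_sum {α : Type*} (m h : ℕ) (d : ℕ → ℝ) (S : Finset α) (X : α → ℤ → ℝ) (a : α → ℝ)
    (i : ℤ) : diffStat m h d (fun k => ∑ b ∈ S, a b * X b k) i =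
      ∑ b ∈ S, a b * diffStat m h d (X b) i := by
  simp only [diffStat, Finset.mul_sum]
  rw [Finset.sum_comm]
  refine Finset.sum_congr rfl fun b _ => Finset.sum_congr rfl fun j _ => ?_
  ring

lemma diffStat_const {m : ℕ} (h : ℕ) {d : ℕ → ℝ} (hd : ∑ j ∈ Finset.range (m + 1), d j = 0) (a : ℝ)
    (i : ℤ) : diffStat m h d (fun _ => a) i = 0 := by
  rw [diffStat, ← Finset.sum_mul, hd, zero_mul]

lemma diffStat_stepFn_of_lt {m h : ℕ} (d : ℕ → ℝ) {T i : ℤ} (hi : i < T) :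
    diffStat m h d (stepFn T) i = 0 := by
  refine Finset.sum_eq_zero fun j _ => ?_
  have : ¬ T ≤ i - j * h := by
    have : (0 : ℤ) ≤ j * h := by positivity
    linarith
  rw [stepFn, if_neg this, mul_zero]

lemma diffStat_stepFn_of_ge {m h : ℕ} {d : ℕ → ℝ} (hd : ∑ j ∈ Finset.range (m + 1), d j = 0)
    {T i : ℤ} (hi : T + m * h ≤ i) : diffStat m h d (stepFn T) i = 0 := by
  rw [← diffStat_const h hd 1 i]
  refine Finset.sum_congr rfl fun j hj => ?_
  have hj' : (j : ℤ) ≤ m := by exact_mod_cast Nat.lt_succ_iff.1 (Finset.mem_range.1 hj)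
  have h1 : (j : ℤ) * h ≤ m * h := mul_le_mul_of_nonneg_right hj' (by positivity)
  rw [stepFn, if_pos (by linarith)]

lemma abs_diffStat_stepFn_le (m h : ℕ) (d : ℕ → ℝ) (T i : ℤ) :
    |diffStat m h d (stepFn T) i| ≤ ∑ j ∈ Finset.range (m + 1), |d j| := by
  refine (Finset.abs_sum_le_sum_abs _ _).trans (Finset.sum_le_sum fun j _ => ?_)
  rw [abs_mul]
  refine mul_le_of_le_one_right (abs_nonneg _) ?_
  unfold stepFn; split_ifs <;> simp

lemma sum_sq_diffStat_stepFn_le {m h : ℕ} {d : ℕ → ℝ}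
    (hd : ∑ j ∈ Finset.range (m + 1), d j = 0) (T : ℤ) (I : Finset ℤ) :
    ∑ i ∈ I, diffStat m h d (stepFn T) i ^ 2 ≤
      (∑ j ∈ Finset.range (m + 1), |d j|) ^ 2 * (m * h) := by
  set A := ∑ j ∈ Finset.range (m + 1), |d j|
  have h1 : ∀ i ∈ I, diffStat m h d (stepFn T) i ^ 2 ≤
      if i ∈ Finset.Ico T (T + m * h) then A ^ 2 else 0 := by
    intro i _
    split_ifs with hi
    · exact sq_le_sq' (neg_le_of_abs_le (abs_diffStat_stepFn_le m h d T i))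
        (le_of_abs_le (abs_diffStat_stepFn_le m h d T i))
    · rw [Finset.mem_Ico, not_and_or, not_le, not_lt] at hi
      rcases hi with hi | hi
      · rw [diffStat_stepFn_of_lt d hi]; norm_num
      · rw [diffStat_stepFn_of_ge hd hi]; norm_num
  refine (Finset.sum_le_sum h1).trans ?_
  rw [← Finset.sum_filter, Finset.sum_const, nsmul_eq_mul, mul_comm]
  refine mul_le_mul_of_nonneg_left ?_ (sq_nonneg _)
  have : (I.filter (fun i => i ∈ Finset.Ico T (T + m * h))).card ≤ m * h := by
    refine (Finset.card_le_card (t := Finset.Ico T (T + m * h)) ?_).trans ?_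
    · intro i hi; exact (Finset.mem_filter.1 hi).2
    · rw [Int.card_Ico]
      have : (T + m * h - T : ℤ) = ((m * h : ℕ) : ℤ) := by push_cast; ring
      rw [this, Int.toNat_natCast]
  exact_mod_cast this

lemma sum_range_mul_sub (J : ℕ) (ξ e : ℕ → ℝ) :
    ∑ j ∈ Finset.range (J + 1), ξ j * (e j - e (j + 1)) =
      ξ 0 * e 0 + ∑ j ∈ Finset.range J, (ξ (j + 1) - ξ j) * e (j + 1) - ξ J * e (J + 1) := by
  induction J with
  | zero => simp; ring
  | succ J ih => rw [Finset.sum_range_succ, ih, Finset.sum_range_succ _ J]; ring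

/-- Abel summation turns levels into jumps. The end points T_0 = 1 and T_{J+1} = n + 1 lie at the
borders of the design, so only a constant, which differencing annihilates, and the interior jumps
remain. -/
lemma MeanFn.Valid.eval_eq {M : MeanFn} {n : ℕ} (hM : M.Valid n) {k : ℤ} (hk1 : 1 ≤ k)
    (hkn : k ≤ n) : M.eval n ((k : ℝ) / n) = M.c ((k : ℝ) / n) + (M.ξ 0 +
      ∑ j ∈ Finset.range M.J, (M.ξ (j + 1) - M.ξ j) * stepFn (M.T (j + 1)) k) := by
  have hn : (0 : ℝ) < n := by
    have : (0 : ℤ) < n := by linarith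
    exact_mod_cast this
  have hcmp : ∀ a : ℕ, ((a : ℝ) / n ≤ (k : ℝ) / n ↔ (a : ℤ) ≤ k) := by
    intro a
    rw [div_le_div_iff_of_pos_right hn, show (a : ℝ) = ((a : ℤ) : ℝ) by simp, Int.cast_le]
  have h1 : ∀ j ∈ Finset.range (M.J + 1),
      (Set.Ico ((M.T j : ℝ) / n) ((M.T (j + 1) : ℝ) / n)).indicator (fun _ => M.ξ j) ((k : ℝ) / n) =
      M.ξ j * (stepFn (M.T j) k - stepFn (M.T (j + 1)) k) := by
    intro j hj
    have hT : ((M.T j : ℕ) : ℤ) < M.T (j + 1) := by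
      exact_mod_cast hM.mono j (Nat.lt_succ_iff.1 (Finset.mem_range.1 hj))
    simp only [Set.indicator, Set.mem_Ico, hcmp, ← not_le, stepFn]
    by_cases ha : ((M.T j : ℕ) : ℤ) ≤ k <;> by_cases hb : ((M.T (j + 1) : ℕ) : ℤ) ≤ k
    · simp [ha, hb]
    · simp [ha, hb]
    · exact absurd (hT.le.trans hb) ha
    · simp [ha, hb]
  rw [MeanFn.eval, Finset.sum_congr rfl h1, sum_range_mul_sub M.J M.ξ fun j => stepFn (M.T j) k]
  have e0 : stepFn (M.T 0) k = 1 := by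
    rw [stepFn, if_pos]; rw [hM.first]; exact_mod_cast hk1
  have e1 : stepFn (M.T (M.J + 1)) k = 0 := by
    rw [stepFn, if_neg]; rw [hM.last]; push_cast; omega
  rw [e0, e1]
  ring

/-- The energy of a mildly varying mean is of order `mh` after differencing. -/
lemma meanEnergy_le {t : Tuning} (ht : t.Admissible) {G : DGM} (hG : MildMean G.mean) :
    ∃ C : ℝ, 0 ≤ C ∧ ∀ᶠ n in atTop, meanEnergy t n (G.mu n) ≤ C * ((t.m n : ℝ) * t.h n) := by
  obtain ⟨hval, A, hA0, hA⟩ := hG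
  obtain ⟨B, hB⟩ := ht.summable_d
  refine ⟨2 * (B * A) ^ 2 + 2 * (A ^ 4 * B ^ 2), by positivity, ?_⟩
  filter_upwards [hA, hB, ht.sum_zero, ht.negligible.eventually (gt_mem_nhds zero_lt_one),
    eventually_ge_atTop 1] with n hAn hBn hd hneg hn1
  obtain ⟨⟨-, hJ⟩, ⟨-, hS⟩, C, hC, -, hCA⟩ := hAn
  have hM := hval n hn1
  have hn : (0 : ℝ) < n := by exact_mod_cast hn1
  set m := t.m n
  set h := t.h n
  set d := t.d n
  set M := G.mean n with hMdef
  have hmh : (m : ℝ) * h ≤ n := by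
    rw [div_lt_one hn] at hneg
    have : (0 : ℝ) ≤ t.ℓ n := by positivity
    linarith
  have hB0 : 0 ≤ B := (Finset.sum_nonneg fun j _ => abs_nonneg (d j)).trans hBn
  set S : ℤ → ℝ := fun k => ∑ j ∈ Finset.range M.J, (M.ξ (j + 1) - M.ξ j) * stepFn (M.T (j + 1)) k
  have hdec : ∀ i ∈ win n m h, diffStat m h d (G.mu n) i =
      diffStat m h d (fun k : ℤ => M.c ((k : ℝ) / n)) i + diffStat m h d S i := by
    intro i hi
    rw [diffStat_congr d (X := G.mu n) (Y := fun k : ℤ => M.c ((k : ℝ) / n) + (M.ξ 0 + S k))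
      (fun k hk1 hkn => hM.eval_eq hk1 hkn) hi, diffStat_add m h d _ (fun k => M.ξ 0 + S k),
      diffStat_add m h d (fun _ => M.ξ 0) S, diffStat_const h hd, zero_add]
  have hstep : ∀ j < M.J, (M.ξ (j + 1) - M.ξ j) ^ 2 ≤ A ^ 2 := by
    intro j hj
    have hle : |M.ξ j - M.ξ (j + 1)| ≤ M.maxStep :=
      le_ciSup (f := fun j : Fin M.J => |M.ξ j - M.ξ (j + 1)|) (Set.finite_range _).bddAbove ⟨j, hj⟩
    rw [← sq_abs, abs_sub_comm]
    gcongr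
    exact hle.trans hS
  -- A differenced unit step is supported on [T, T + mh) and bounded by ∑|d_j| ≤ B. Cauchy–Schwarz
  -- over the J ≤ A jumps costs a factor J, the sum over jumps another.
  have hSsum : ∑ i ∈ win n m h, diffStat m h d S i ^ 2 ≤ A ^ 4 * B ^ 2 * ((m : ℝ) * h) := by
    calc ∑ i ∈ win n m h, diffStat m h d S i ^ 2
        ≤ ∑ i ∈ win n m h, (M.J : ℝ) * ∑ j ∈ Finset.range M.J,
            A ^ 2 * diffStat m h d (stepFn (M.T (j + 1))) i ^ 2 := by
          refine Finset.sum_le_sum fun i _ => ?_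
          rw [diffStat_sum m h d (Finset.range M.J) (fun j => stepFn (M.T (j + 1)))
            (fun j => M.ξ (j + 1) - M.ξ j) i]
          refine (sq_sum_le_card_mul_sum_sq).trans ?_
          rw [Finset.card_range]
          gcongr with j hj
          rw [mul_pow]
          exact mul_le_mul_of_nonneg_right (hstep j (Finset.mem_range.1 hj)) (sq_nonneg _)
      _ = (M.J : ℝ) * ∑ j ∈ Finset.range M.J,
            A ^ 2 * ∑ i ∈ win n m h, diffStat m h d (stepFn (M.T (j + 1))) i ^ 2 := by
          rw [← Finset.mul_sum, Finset.sum_comm]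
          simp only [Finset.mul_sum]
      _ ≤ (M.J : ℝ) * ∑ j ∈ Finset.range M.J, A ^ 2 * (B ^ 2 * (m * h)) := by
          gcongr with j _
          refine (sum_sq_diffStat_stepFn_le hd _ _).trans ?_
          gcongr
      _ = (M.J : ℝ) ^ 2 * (A ^ 2 * (B ^ 2 * (m * h))) := by
          rw [Finset.sum_const, Finset.card_range, nsmul_eq_mul]; ring
      _ ≤ A ^ 2 * (A ^ 2 * (B ^ 2 * (m * h))) := by gcongr
      _ = _ := by ring
  -- Since ∑ d_j = 0, the value at i can be subtracted at every lag, and the Lipschitz bound applies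
  -- over a distance of at most mh/n. Summed over at most n indices this gives (BA)²(mh)²/n, which
  -- is at most (BA)²mh.
  have hcb : ∀ i ∈ win n m h, diffStat m h d (fun k : ℤ => M.c ((k : ℝ) / n)) i ^ 2 ≤
      (B * (A * ((m : ℝ) * h / n))) ^ 2 := by
    intro i hi
    rw [Finset.mem_Icc] at hi
    refine sq_le_sq' ?_ ?_
    all_goals
      have hb : |diffStat m h d (fun k : ℤ => M.c ((k : ℝ) / n)) i| ≤ B * (A * ((m : ℝ) * h / n)) := by
        have hz := diffStat_const h hd (M.c ((i : ℝ) / n)) i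
        rw [← sub_zero (diffStat m h d _ i), ← hz, diffStat, diffStat, ← Finset.sum_sub_distrib]
        refine (Finset.abs_sum_le_sum_abs _ _).trans ?_
        calc _ ≤ ∑ j ∈ Finset.range (m + 1), |d j| * (A * ((m : ℝ) * h / n)) := by
              refine Finset.sum_le_sum fun j hj => ?_
              rw [← mul_sub, abs_mul]
              gcongr
              have hj' : (j : ℤ) ≤ m := by exact_mod_cast Nat.lt_succ_iff.1 (Finset.mem_range.1 hj)
              have h1 : (j : ℤ) * h ≤ m * h := mul_le_mul_of_nonneg_right hj' (by positivity)
              have h2 : (0 : ℤ) ≤ j * h := by positivity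
              rcases h2.eq_or_lt with h0 | h0
              · rw [← h0, sub_zero, sub_self, abs_zero]; positivity
              have h1r : (j : ℝ) * h ≤ m * h := by exact_mod_cast h1
              have h0r : (0 : ℝ) < (j : ℝ) * h := by exact_mod_cast h0
              have hir : (m : ℝ) * h + 1 ≤ i := by exact_mod_cast hi.1
              have hir2 : (i : ℝ) ≤ n := by exact_mod_cast hi.2
              have hsl := hC.1 (⟨((i - j * h : ℤ) : ℝ) / n, (i : ℝ) / n, by
                push_cast; apply div_nonneg _ hn.le; linarith, by
                push_cast; gcongr; linarith, by rw [div_le_one hn]; exact hir2, rfl⟩ :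
                |(M.c ((i : ℝ) / n) - M.c (((i - j * h : ℤ) : ℝ) / n)) /
                  ((i : ℝ) / n - ((i - j * h : ℤ) : ℝ) / n)| ∈ M.slopes)
              have hden : (i : ℝ) / n - ((i - j * h : ℤ) : ℝ) / n = (j : ℝ) * h / n := by
                push_cast; ring
              rw [hden, abs_div, abs_of_pos (by positivity : (0 : ℝ) < (j : ℝ) * h / n),
                div_le_iff₀ (by positivity)] at hsl
              rw [abs_sub_comm]
              refine hsl.trans ?_
              gcongr
          _ ≤ _ := by
              rw [← Finset.sum_mul]
              gcongr
      have := abs_le.1 hb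
      linarith [this.1, this.2]
  have hcsum : ∑ i ∈ win n m h, diffStat m h d (fun k : ℤ => M.c ((k : ℝ) / n)) i ^ 2 ≤
      (B * A) ^ 2 * ((m : ℝ) * h) := by
    refine (Finset.sum_le_sum hcb).trans ?_
    rw [Finset.sum_const, nsmul_eq_mul]
    have hcard : ((win n m h).card : ℝ) ≤ n := by
      have : (win n m h).card ≤ n := by
        rw [Int.card_Icc]
        have : (0 : ℤ) ≤ (m : ℤ) * h := by positivity
        omega
      exact_mod_cast this
    calc _ ≤ (n : ℝ) * (B * (A * ((m : ℝ) * h / n))) ^ 2 := by gcongr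
      _ = (B * A) ^ 2 * ((m : ℝ) * h) * ((m : ℝ) * h / n) := by field_simp
      _ ≤ (B * A) ^ 2 * ((m : ℝ) * h) * 1 := by
          gcongr
          rwa [div_le_one hn]
      _ = _ := by ring
  rw [meanEnergy]
  calc ∑ i ∈ win n m h, diffStat m h d (G.mu n) i ^ 2
      ≤ ∑ i ∈ win n m h, (2 * diffStat m h d (fun k : ℤ => M.c ((k : ℝ) / n)) i ^ 2 +
          2 * diffStat m h d S i ^ 2) := by
        refine Finset.sum_le_sum fun i hi => ?_
        rw [hdec i hi]
        nlinarith [sq_nonneg (diffStat m h d (fun k : ℤ => M.c ((k : ℝ) / n)) i - diffStat m h d S i)]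
    _ ≤ _ := by
        rw [Finset.sum_add_distrib, ← Finset.mul_sum, ← Finset.mul_sum]
        linarith

end
end DiffLRV

namespace DiffLRV

noncomputable section

/-! ### The rate scale `n^{1/(1+2 * q)}` -/

/-- `n^{1/(1+2 * q)}`, the order of the optimal bandwidth. -/
def scale (q n : ℕ) : ℝ := nPow q 1 n

lemma scale_pos (q : ℕ) {n : ℕ} (hn : 1 ≤ n) : 0 < scale q n := by
  have : (0 : ℝ) < n := by exact_mod_cast hn
  exact Real.rpow_pos_of_pos this _

lemma scale_rpow (q : ℕ) (a : ℝ) (n : ℕ) : scale q n ^ a = nPow q a n := by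
  rw [scale, nPow, nPow, ← Real.rpow_mul (Nat.cast_nonneg n)]
  congr 1
  ring

lemma nPow_natCast (q a n : ℕ) : nPow q (a : ℝ) n = scale q n ^ a := by
  rw [← scale_rpow, Real.rpow_natCast]

lemma nPow_sub (q a b : ℕ) {n : ℕ} (hn : 1 ≤ n) :
    nPow q ((a : ℝ) - b) n = scale q n ^ a / scale q n ^ b := by
  rw [← scale_rpow, Real.rpow_sub (scale_pos q hn), Real.rpow_natCast, Real.rpow_natCast]

lemma scale_pow_eq (q n : ℕ) : scale q n ^ (1 + 2 * q) = n := by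
  rw [← nPow_natCast, nPow]
  push_cast
  rw [div_self (by positivity), Real.rpow_one]

lemma optRate_eq (q : ℕ) {n : ℕ} (hn : 1 ≤ n) : optRate q n = 1 / scale q n ^ (2 * q) := by
  have : (0 : ℝ) < n := by exact_mod_cast hn
  rw [optRate, ← nPow_natCast, nPow, one_div, ← Real.rpow_neg this.le]
  congr 1
  push_cast
  ring

lemma tendsto_scale (q : ℕ) : Tendsto (scale q) atTop atTop := by
  have h : (0 : ℝ) < 1 / (1 + 2 * (q : ℝ)) := by positivity
  exact (tendsto_rpow_atTop h).comp tendsto_natCast_atTop_atTop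

lemma Tuning.Admissible.eventually_basic {t : Tuning} (ht : t.Admissible) :
    ∀ᶠ n in atTop, 1 ≤ n ∧ 1 ≤ t.ℓ n ∧ 1 ≤ t.h n ∧ 1 ≤ t.m n ∧ t.m n * t.h n + t.ℓ n ≤ n := by
  filter_upwards [ht.bandwidth_mem, ht.lag_mem, ht.order_tendsto.eventually_ge_atTop 1,
    eventually_ge_atTop 1, ht.negligible.eventually (gt_mem_nhds zero_lt_one)] with n h1 h2 h3 h4 h5
  refine ⟨h4, h1.1, h2.1, h3, ?_⟩
  have hn : (0 : ℝ) < n := by exact_mod_cast h4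
  rw [div_lt_one hn] at h5
  have : t.ℓ n + t.m n * t.h n < n := by exact_mod_cast h5
  omega

lemma abs_noiseBias_le {K : ℝ → ℝ} {q : ℕ} {t : Tuning} {n : ℕ} {N : Noise}
    (hU : N.FiniteU q) {C : ℝ}
    (hC : ∀ u : ℤ, |wt K n (t.m n) (t.ℓ n) (t.h n) (t.d n) u - 1| ≤ C * (1 + |(u : ℝ)| ^ q)) :
    |noiseBias K t n N| ≤ C * ∑' u : ℤ, (|N.gam u| + |(u : ℝ)| ^ q * |N.gam u|) := by
  have hU' : Summable fun u : ℤ => |(u : ℝ)| ^ q * |N.gam u| := hU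
  have hs : Summable fun u : ℤ => |N.gam u| + |(u : ℝ)| ^ q * |N.gam u| := hU.summable.add hU'
  have hle : ∀ u : ℤ, |(wt K n (t.m n) (t.ℓ n) (t.h n) (t.d n) u - 1) * N.gam u| ≤
      C * (|N.gam u| + |(u : ℝ)| ^ q * |N.gam u|) := by
    intro u
    rw [abs_mul]
    calc _ ≤ C * (1 + |(u : ℝ)| ^ q) * |N.gam u| := by gcongr; exact hC u
      _ = _ := by ring
  have hsum : Summable fun u : ℤ =>
      |(wt K n (t.m n) (t.ℓ n) (t.h n) (t.d n) u - 1) * N.gam u| :=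
    Summable.of_nonneg_of_le (fun _ => abs_nonneg _) hle (hs.mul_left C)
  have h1 : |noiseBias K t n N| ≤ ∑' u : ℤ,
      |(wt K n (t.m n) (t.ℓ n) (t.h n) (t.d n) u - 1) * N.gam u| := by
    have := norm_tsum_le_tsum_norm (f := fun u : ℤ =>
      (wt K n (t.m n) (t.ℓ n) (t.h n) (t.d n) u - 1) * N.gam u) hsum
    rw [noiseBias]
    simpa only [Real.norm_eq_abs] using this
  rw [← tsum_mul_left]
  exact h1.trans (Summable.tsum_le_tsum hle hsum (hs.mul_left C))

/-- A sufficient condition for rate optimality. -/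
theorem rateOptimal_of_bounds {K : ℝ → ℝ} (hK : IsKernel K) {q : ℕ} {t : Tuning}
    (ht : t.Admissible)
    (hw : ∃ C : ℝ, ∀ᶠ n in atTop, ∀ u : ℤ, |wt K n (t.m n) (t.ℓ n) (t.h n) (t.d n) u - 1| ≤
      C / scale q n ^ q * (1 + |(u : ℝ)| ^ q))
    (hℓ : ∃ C : ℝ, ∀ᶠ n in atTop, (t.ℓ n : ℝ) ≤ C * scale q n)
    (hmh : ∃ C : ℝ, ∀ᶠ n in atTop, (t.ℓ n : ℝ) * (t.m n * t.h n) / n ≤ C / scale q n ^ q) :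
    RateOptimal K q t := by
  intro G hG
  obtain ⟨A, hA⟩ := hK.bounded
  obtain ⟨C₁, hC₁⟩ := hw
  obtain ⟨C₂, hC₂⟩ := hℓ
  obtain ⟨C₃, hC₃⟩ := hmh
  obtain ⟨C₄, hC₄0, hC₄⟩ := meanEnergy_le ht hG.mild
  obtain ⟨B, hB⟩ := ht.summable_d
  set U := ∑' u : ℤ, (|G.noise.gam u| + |(u : ℝ)| ^ q * |G.noise.gam u|)
  set θ := (∑' i : ℕ, G.noise.theta 4 i).toReal
  have hθ : 0 ≤ θ := ENNReal.toReal_nonneg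
  set b := C₁ * U + 2 * A * C₄ * C₃ with hb
  refine IsBigO.of_bound ((144 * (B * θ) ^ 4 * A ^ 2 +
    32 * (B * θ) ^ 2 * A ^ 2 * (C₄ * |C₃|)) * |C₂| + b ^ 2) ?_
  filter_upwards [hC₁, hC₂, hC₃, hC₄, hB, ht.eventually_basic,
    (tendsto_scale q).eventually_ge_atTop 1] with n h1 h2 h3 h4 h5 h6 hx1
  obtain ⟨hn1, hℓ1, hh1, hm1, hn⟩ := h6
  have hn0 : (0 : ℝ) < n := by exact_mod_cast hn1
  set x := scale q n with hx
  have hx0 : 0 < x := by linarith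
  have hA0 : 0 ≤ A := (abs_nonneg _).trans (hA 0)
  have hmse := mse_eq hK t hG.weakDep hG.finiteU hℓ1 hn
  have hvar := variance_vHat_le hK t hG.weakDep hA hn1 hℓ1 (Θ := B * θ) (by gcongr)
  have hE : (t.ℓ n : ℝ) * meanEnergy t n (G.mu n) / n ≤ C₄ * (C₃ / x ^ q) := by
    calc (t.ℓ n : ℝ) * meanEnergy t n (G.mu n) / n
        ≤ (t.ℓ n : ℝ) * (C₄ * ((t.m n : ℝ) * t.h n)) / n := by gcongr
      _ = C₄ * ((t.ℓ n : ℝ) * (t.m n * t.h n) / n) := by ring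
      _ ≤ _ := by gcongr
  have hbias : |noiseBias K t n G.noise + meanBias K t n (G.mu n)| ≤ b / x ^ q := by
    refine (abs_add_le _ _).trans ?_
    have e1 := abs_noiseBias_le hG.finiteU h1
    have e2 := abs_meanBias_le hK hA t hℓ1 (G.mu n)
    have e3 : 2 * A * (t.ℓ n) * meanEnergy t n (G.mu n) / n ≤ 2 * A * (C₄ * (C₃ / x ^ q)) := by
      calc _ = 2 * A * ((t.ℓ n) * meanEnergy t n (G.mu n) / n) := by ring
        _ ≤ _ := by gcongr
    calc _ ≤ C₁ / x ^ q * U + 2 * A * (C₄ * (C₃ / x ^ q)) := add_le_add e1 (e2.trans e3)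
      _ = _ := by rw [hb]; ring
  have hb2 : (noiseBias K t n G.noise + meanBias K t n (G.mu n)) ^ 2 ≤ b ^ 2 * (1 / x ^ (2 * q)) := by
    calc _ = |noiseBias K t n G.noise + meanBias K t n (G.mu n)| ^ 2 := (sq_abs _).symm
      _ ≤ (b / x ^ q) ^ 2 := by gcongr
      _ = _ := by rw [div_pow, ← pow_mul, mul_comm q 2]; ring
  have hℓn : (t.ℓ n : ℝ) / n ≤ |C₂| * (1 / x ^ (2 * q)) := by
    rw [← scale_pow_eq q n, ← hx]
    calc (t.ℓ n : ℝ) / x ^ (1 + 2 * q) ≤ |C₂| * x / x ^ (1 + 2 * q) := by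
          gcongr; exact h2.trans (by gcongr; exact le_abs_self _)
      _ = _ := by rw [pow_add, pow_one]; field_simp
  -- As x ≥ 1, the mean effect is also bounded, so the cross term of the variance is O(ℓ/n) like the
  -- rest.
  have hE' : (t.ℓ n : ℝ) * meanEnergy t n (G.mu n) / n ≤ C₄ * |C₃| := by
    refine hE.trans ?_
    gcongr
    calc C₃ / x ^ q ≤ |C₃| / x ^ q := by gcongr; exact le_abs_self _
      _ ≤ |C₃| := div_le_self (abs_nonneg _) (one_le_pow₀ hx1)
  have hmse0 : 0 ≤ mse K t G n := integral_nonneg fun _ => sq_nonneg _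
  rw [Real.norm_of_nonneg hmse0, optRate_eq q hn1, ← hx, Real.norm_of_nonneg (by positivity), hmse]
  have hE0 : 0 ≤ (t.ℓ n : ℝ) * meanEnergy t n (G.mu n) / n := by
    have : 0 ≤ meanEnergy t n (G.mu n) := Finset.sum_nonneg fun _ _ => sq_nonneg _
    positivity
  calc _ ≤ (144 * (B * θ) ^ 4 * A ^ 2 * (t.ℓ n / n) +
        32 * (B * θ) ^ 2 * A ^ 2 * (t.ℓ n / n) * (C₄ * |C₃|)) + b ^ 2 * (1 / x ^ (2 * q)) := by
        refine add_le_add (hvar.trans ?_) hb2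
        gcongr
    _ = (144 * (B * θ) ^ 4 * A ^ 2 + 32 * (B * θ) ^ 2 * A ^ 2 * (C₄ * |C₃|)) * (t.ℓ n / n) +
          b ^ 2 * (1 / x ^ (2 * q)) := by ring
    _ ≤ (144 * (B * θ) ^ 4 * A ^ 2 + 32 * (B * θ) ^ 2 * A ^ 2 * (C₄ * |C₃|)) *
          (|C₂| * (1 / x ^ (2 * q))) + b ^ 2 * (1 / x ^ (2 * q)) := by gcongr
    _ = _ := by ring

end
end DiffLRV

namespace DiffLRV

noncomputable section

/-! ### Kernel bounds and upper bounds on the bias -/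

/-- The local expansion covers |t| < ε; beyond ε boundedness suffices because |t|^q ≥ ε^q. A bound
for all t is needed since u/ℓ ranges over the whole line. -/
lemma IsKernel.abs_sub_one_le {K : ℝ → ℝ} (hK : IsKernel K) {q : ℕ} (hq : NearOrigin K q) :
    ∃ C : ℝ, 0 ≤ C ∧ ∀ t, |K t - 1| ≤ C * |t| ^ q := by
  obtain ⟨hq1, B, -, hB⟩ := hq
  obtain ⟨A, hA⟩ := hK.bounded
  have hA0 : 0 ≤ A := (abs_nonneg _).trans (hA 0)
  have hev : ∀ᶠ t in 𝓝[>] (0 : ℝ), |(K t - K 0) / |t| ^ q| < |B| + 1 :=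
    hB.abs.eventually (gt_mem_nhds (by linarith))
  obtain ⟨ε, hε, hεt⟩ := (mem_nhdsGT_iff_exists_Ioo_subset).1 hev
  have hε0 : 0 < ε := hε
  have hpos : ∀ t, 0 < t → |K t - 1| ≤ (|B| + 1 + (A + 1) / ε ^ q) * |t| ^ q := by
    intro t ht0
    rcases lt_or_ge t ε with h | h
    · have := hεt ⟨ht0, h⟩
      simp only [Set.mem_ofPred_eq] at this
      rw [abs_div, abs_of_nonneg (by positivity : (0:ℝ) ≤ |t| ^ q), div_lt_iff₀ (by positivity),
        hK.zero] at this
      refine this.le.trans (mul_le_mul_of_nonneg_right ?_ (by positivity))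
      have : 0 ≤ (A + 1) / ε ^ q := by positivity
      linarith
    · have h1 : |K t - 1| ≤ A + 1 := (abs_sub _ _).trans (by simpa using hA t)
      have h2 : 1 ≤ |t| ^ q / ε ^ q := by
        rw [one_le_div (by positivity), abs_of_pos ht0]
        gcongr
      calc |K t - 1| ≤ (A + 1) * (|t| ^ q / ε ^ q) := h1.trans (le_mul_of_one_le_right (by positivity) h2)
        _ = (A + 1) / ε ^ q * |t| ^ q := by ring
        _ ≤ _ := by gcongr; linarith [abs_nonneg B]
  refine ⟨|B| + 1 + (A + 1) / ε ^ q, by positivity, fun t => ?_⟩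
  rcases lt_trichotomy t 0 with h | h | h
  · have := hpos (-t) (by linarith)
    rwa [hK.even, abs_neg] at this
  · rw [h, hK.zero]; simp; positivity
  · exact hpos t h

lemma IsKernel.abs_le_near_one {K : ℝ → ℝ} (hK : IsKernel K) {q' : ℕ} (hq : NearBoundary K q') :
    ∃ C : ℝ, 0 ≤ C ∧ ∀ t, 0 ≤ t → |K (1 - t)| ≤ C * t ^ q' := by
  obtain ⟨hq1, B, -, hB⟩ := hq
  obtain ⟨A, hA⟩ := hK.bounded
  have hA0 : 0 ≤ A := (abs_nonneg _).trans (hA 0)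
  have hK1 : K 1 = 0 := hK.support 1 (by simp)
  have hev : ∀ᶠ t in 𝓝[>] (0 : ℝ), |(K 1 - K (1 - t)) / |t| ^ q'| < |B| + 1 :=
    hB.abs.eventually (gt_mem_nhds (by linarith))
  obtain ⟨ε, hε, hεt⟩ := (mem_nhdsGT_iff_exists_Ioo_subset).1 hev
  have hε0 : 0 < ε := hε
  refine ⟨|B| + 1 + A / ε ^ q', by positivity, fun t ht => ?_⟩
  rcases ht.eq_or_lt with h0 | ht0
  · rw [← h0, sub_zero, hK1]; simp; positivity
  rcases lt_or_ge t ε with h | h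
  · have := hεt ⟨ht0, h⟩
    simp only [Set.mem_ofPred_eq] at this
    rw [abs_div, abs_of_nonneg (by positivity : (0:ℝ) ≤ |t| ^ q'), div_lt_iff₀ (by positivity),
      hK1, zero_sub, abs_neg, abs_of_pos ht0] at this
    refine this.le.trans (mul_le_mul_of_nonneg_right ?_ (by positivity))
    have : 0 ≤ A / ε ^ q' := by positivity
    linarith
  · have h2 : 1 ≤ t ^ q' / ε ^ q' := by
      rw [one_le_div (by positivity)]
      gcongr
    calc |K (1 - t)| ≤ A * (t ^ q' / ε ^ q') := (hA _).trans (le_mul_of_one_le_right (by positivity) h2)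
      _ = A / ε ^ q' * t ^ q' := by ring
      _ ≤ _ := by gcongr; linarith [abs_nonneg B]

/-- The off-diagonal part of the weights. -/
def offDiag (K : ℝ → ℝ) (m ℓ h : ℕ) (d : ℕ → ℝ) (u : ℤ) : ℝ :=
  ∑ s ∈ (Finset.Icc (-(m : ℤ)) m).erase 0, |delta m d s| * |K (((u + s * h : ℤ) : ℝ) / ℓ)|

lemma wt_eq {K : ℝ → ℝ} {n m ℓ h : ℕ} {d : ℕ → ℝ} (u : ℤ) (hd : ∑ j ∈ Finset.range (m + 1), d j ^ 2 = 1) :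
    wt K n m ℓ h d u = K ((u : ℝ) / ℓ) * (((n : ℝ) - m * h - |(u : ℝ)|) / n) +
      ∑ s ∈ (Finset.Icc (-(m : ℤ)) m).erase 0, delta m d s *
    (K (((u + s * h : ℤ) : ℝ) / ℓ) * (((n : ℝ) - m * h - |((u + s * h : ℤ) : ℝ)|) / n)) := by
  rw [wt, ← Finset.add_sum_erase _ _ (show (0 : ℤ) ∈ Finset.Icc (-(m : ℤ)) m by simp), delta_zero, hd]
  simp

lemma factor_mem {K : ℝ → ℝ} (hK : IsKernel K) {n m ℓ h : ℕ} (hℓ : 1 ≤ ℓ)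
    (hn : m * h + ℓ ≤ n) {k : ℤ} (hk : K ((k : ℝ) / ℓ) ≠ 0) :
    0 ≤ ((n : ℝ) - m * h - |(k : ℝ)|) / n ∧ ((n : ℝ) - m * h - |(k : ℝ)|) / n ≤ 1 := by
  have hlt : |k| < (ℓ : ℤ) := by
    by_contra hcon
    exact hk (kernel_eq_zero hK hℓ (not_lt.1 hcon))
  have hltr : |(k : ℝ)| < ℓ := by rw [← Int.cast_abs]; exact_mod_cast hlt
  have hnr : (m : ℝ) * h + ℓ ≤ n := by exact_mod_cast hn
  have hn0 : (0 : ℝ) < n := by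
    have : 0 < n := by omega
    exact_mod_cast this
  constructor
  · apply div_nonneg _ hn0.le; linarith
  · rw [div_le_one hn0]
    have : (0 : ℝ) ≤ m * h := by positivity
    linarith [abs_nonneg (k : ℝ)]

/-- Wherever the kernel does not vanish the edge factor lies in [0, 1] and can be dropped. -/
lemma abs_wt_sub_le {K : ℝ → ℝ} (hK : IsKernel K) {n m ℓ h : ℕ} (hℓ : 1 ≤ ℓ)
    (hn : m * h + ℓ ≤ n) {d : ℕ → ℝ} (hd : ∑ j ∈ Finset.range (m + 1), d j ^ 2 = 1) (u : ℤ) :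
    |wt K n m ℓ h d u - K ((u : ℝ) / ℓ) * (((n : ℝ) - m * h - |(u : ℝ)|) / n)| ≤
      offDiag K m ℓ h d u := by
  rw [wt_eq u hd, add_sub_cancel_left]
  refine (Finset.abs_sum_le_sum_abs _ _).trans (Finset.sum_le_sum fun s _ => ?_)
  rw [abs_mul, abs_mul]
  refine mul_le_mul_of_nonneg_left ?_ (abs_nonneg _)
  by_cases hk : K (((u + s * h : ℤ) : ℝ) / ℓ) = 0
  · rw [hk]; simp
  · obtain ⟨h0, h1⟩ := factor_mem hK hℓ hn hk
    exact mul_le_of_le_one_right (abs_nonneg _) (abs_le.2 ⟨by linarith, h1⟩)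

lemma abs_intCast_le_one_add_pow (u : ℤ) {q : ℕ} (hq : 1 ≤ q) : |(u : ℝ)| ≤ 1 + |(u : ℝ)| ^ q := by
  rcases le_total |(u : ℝ)| 1 with h | h
  · have : (0 : ℝ) ≤ |(u : ℝ)| ^ q := by positivity
    linarith
  · have := pow_le_pow_right₀ h hq
    rw [pow_one] at this
    linarith

/-- Rate optimality when `ℓ` is of the optimal order, the mean effect is of the right order, and the
off-diagonal weights are small. -/
theorem rateOptimal_of_offDiag {K : ℝ → ℝ} (hK : IsKernel K) {q : ℕ} (hq : NearOrigin K q)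
    {t : Tuning} (ht : t.Admissible)
    (hℓ : ∃ C : ℝ, ∀ᶠ n in atTop, (t.ℓ n : ℝ) ≤ C * scale q n)
    (hℓ' : ∃ C : ℝ, 0 ≤ C ∧ ∀ᶠ n in atTop, scale q n ≤ C * t.ℓ n)
    (hmh : ∃ C : ℝ, ∀ᶠ n in atTop, (t.ℓ n : ℝ) * (t.m n * t.h n) / n ≤ C / scale q n ^ q)
    (hoff : ∃ C : ℝ, ∀ᶠ n in atTop, ∀ u : ℤ, offDiag K (t.m n) (t.ℓ n) (t.h n) (t.d n) u ≤
      C / scale q n ^ q * (1 + |(u : ℝ)| ^ q)) : RateOptimal K q t := by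
  refine rateOptimal_of_bounds hK ht ?_ hℓ hmh
  obtain ⟨A, hA⟩ := hK.bounded
  have hA0 : 0 ≤ A := (abs_nonneg _).trans (hA 0)
  obtain ⟨C₁, hC₁0, hC₁⟩ := hK.abs_sub_one_le hq
  obtain ⟨C₂, hC₂0, hC₂⟩ := hℓ'
  obtain ⟨C₃, hC₃⟩ := hmh
  obtain ⟨C₄, hC₄⟩ := hoff
  refine ⟨C₁ * C₂ ^ q + 2 * A * C₃ + C₄, ?_⟩
  filter_upwards [hC₂, hC₃, hC₄, ht.eventually_basic, ht.normalized] with n h2 h3 h4 h5 hd u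
  obtain ⟨hn1, hℓ1, hh1, hm1, hn⟩ := h5
  have hx0 := scale_pos q hn1
  set x := scale q n
  have hℓ0 : (0 : ℝ) < t.ℓ n := by exact_mod_cast hℓ1
  have hn0 : (0 : ℝ) < n := by exact_mod_cast hn1
  have hmh1 : (1 : ℝ) ≤ (t.m n : ℝ) * t.h n := by exact_mod_cast Nat.mul_pos hm1 hh1
  set W : ℝ := 1 + |(u : ℝ)| ^ q with hW
  have hW1 : 1 ≤ W := by have : (0:ℝ) ≤ |(u : ℝ)| ^ q := by positivity
                         linarith
  have e1 : |K ((u : ℝ) / t.ℓ n) - 1| ≤ C₁ * C₂ ^ q / x ^ q * W := by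
    calc |K ((u : ℝ) / t.ℓ n) - 1| ≤ C₁ * |(u : ℝ) / t.ℓ n| ^ q := hC₁ _
      _ = C₁ * (1 / (t.ℓ n : ℝ)) ^ q * |(u : ℝ)| ^ q := by
          rw [abs_div, abs_of_pos hℓ0, div_pow, div_pow, one_pow]; ring
      _ ≤ C₁ * (C₂ / x) ^ q * W := by
          have h1 : 1 / (t.ℓ n : ℝ) ≤ C₂ / x := by
            rw [div_le_div_iff₀ hℓ0 hx0, one_mul]; exact h2
          have h2 : |(u : ℝ)| ^ q ≤ W := by rw [hW]; linarith
          have h3 := pow_le_pow_left₀ (by positivity) h1 q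
          exact mul_le_mul (mul_le_mul_of_nonneg_left h3 hC₁0) h2 (by positivity) (by positivity)
      _ = _ := by rw [div_pow]; ring
  have e2 : |K ((u : ℝ) / t.ℓ n) * (((t.m n : ℝ) * t.h n + |(u : ℝ)|) / n)| ≤
      2 * A * C₃ / x ^ q * W := by
    rw [abs_mul, abs_of_nonneg (by positivity : (0 : ℝ) ≤ ((t.m n : ℝ) * t.h n + |(u : ℝ)|) / n)]
    have hu := abs_intCast_le_one_add_pow u hq.1
    have h3' : (t.m n : ℝ) * t.h n / n ≤ C₃ / x ^ q := by
      refine le_trans ?_ h3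
      have : (1 : ℝ) ≤ t.ℓ n := by exact_mod_cast hℓ1
      exact div_le_div_of_nonneg_right (le_mul_of_one_le_left (by positivity) this) hn0.le
    calc |K ((u : ℝ) / t.ℓ n)| * (((t.m n : ℝ) * t.h n + |(u : ℝ)|) / n)
        ≤ A * ((2 * ((t.m n : ℝ) * t.h n) * W) / n) := by
          gcongr
          · exact hA _
          · nlinarith
      _ = 2 * A * ((t.m n : ℝ) * t.h n / n) * W := by ring
      _ ≤ 2 * A * (C₃ / x ^ q) * W := by gcongr
      _ = _ := by ring
  have e3 := (abs_wt_sub_le hK hℓ1 hn hd u).trans (h4 u)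
  -- Three sources of bias: the correlation of the differences, the smoothing by the kernel, and the
  -- mh + |u| pairs lost at the edge.
  have hdec : wt K n (t.m n) (t.ℓ n) (t.h n) (t.d n) u - 1 =
      (wt K n (t.m n) (t.ℓ n) (t.h n) (t.d n) u -
        K ((u : ℝ) / t.ℓ n) * (((n : ℝ) - t.m n * t.h n - |(u : ℝ)|) / n)) +
      (K ((u : ℝ) / t.ℓ n) - 1) -
      K ((u : ℝ) / t.ℓ n) * (((t.m n : ℝ) * t.h n + |(u : ℝ)|) / n) := by
    field_simp
    ring
  rw [hdec]
  refine (abs_sub _ _).trans ((add_le_add_left (abs_add_le _ _) _).trans ?_)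
  calc _ ≤ C₄ / x ^ q * W + C₁ * C₂ ^ q / x ^ q * W + 2 * A * C₃ / x ^ q * W := by
        gcongr
    _ = _ := by ring

/-- Off-diagonal weights when `h` exceeds `ℓ` by a fixed factor. -/
lemma offDiag_le_of_gap {K : ℝ → ℝ} (hK : IsKernel K) {A : ℝ} (hA : ∀ x, |K x| ≤ A) {m ℓ h q : ℕ}
    (hℓ : 1 ≤ ℓ) {d : ℕ → ℝ} {e : ℝ} (he : 0 < e) (hh : (1 + e) * ℓ ≤ h) (u : ℤ) :
    offDiag K m ℓ h d u ≤ A * (∑ s ∈ Finset.Icc (-(m : ℤ)) m, |delta m d s|) *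
      (1 / (e * ℓ)) ^ q * |(u : ℝ)| ^ q := by
  have hℓ0 : (0 : ℝ) < ℓ := by exact_mod_cast hℓ
  have hA0 : 0 ≤ A := (abs_nonneg _).trans (hA 0)
  have hS0 : 0 ≤ ∑ s ∈ Finset.Icc (-(m : ℤ)) m, |delta m d s| :=
    Finset.sum_nonneg fun _ _ => abs_nonneg _
  -- For |u| < eℓ every shift by a nonzero multiple of h leaves the support of the kernel. Otherwise
  -- (|u|/(eℓ))^q ≥ 1 pays for the trivial bound.
  by_cases hu : |(u : ℝ)| < e * ℓ
  · have : offDiag K m ℓ h d u = 0 := by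
      refine Finset.sum_eq_zero fun s hs => ?_
      have hs0 : s ≠ 0 := (Finset.mem_erase.1 hs).1
      rw [kernel_eq_zero hK hℓ, abs_zero, mul_zero]
      have h1 : (1 : ℝ) ≤ |(s : ℝ)| := by
        rw [← Int.cast_abs]; exact_mod_cast Int.one_le_abs hs0
      have h2 : (ℓ : ℝ) ≤ |((u + s * h : ℤ) : ℝ)| := by
        push_cast
        have h3 : |(s : ℝ) * h| ≤ |(u : ℝ) + s * h| + |(u : ℝ)| := by
          calc |(s : ℝ) * h| = |((u : ℝ) + s * h) - u| := by ring_nf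
            _ ≤ _ := abs_sub _ _
        rw [abs_mul, abs_of_nonneg (by positivity : (0:ℝ) ≤ h)] at h3
        nlinarith
      rw [← Int.cast_abs] at h2
      exact_mod_cast h2
    rw [this]; positivity
  · push Not at hu
    have h1 : 1 ≤ (1 / (e * ℓ)) ^ q * |(u : ℝ)| ^ q := by
      rw [← mul_pow]
      refine one_le_pow₀ ?_
      rw [one_div_mul_eq_div, one_le_div (by positivity)]
      exact hu
    calc offDiag K m ℓ h d u ≤ ∑ s ∈ (Finset.Icc (-(m : ℤ)) m).erase 0, |delta m d s| * A := by
          refine Finset.sum_le_sum fun s _ => ?_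
          gcongr
          exact hA _
      _ ≤ ∑ s ∈ Finset.Icc (-(m : ℤ)) m, |delta m d s| * A :=
          Finset.sum_le_sum_of_subset_of_nonneg (Finset.erase_subset _ _) fun s _ _ => by positivity
      _ = A * (∑ s ∈ Finset.Icc (-(m : ℤ)) m, |delta m d s|) := by rw [← Finset.sum_mul, mul_comm]
      _ ≤ _ := by rw [mul_assoc (A * _)]; exact le_mul_of_one_le_right (by positivity) h1

lemma add_abs_pow_le {C : ℝ} (hC : 0 ≤ C) (u : ℤ) {p q : ℕ} (hpq : p ≤ q) :
    (C + |(u : ℝ)|) ^ p ≤ (C + 1) ^ p * (1 + |(u : ℝ)| ^ q) := by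
  have h0 : (0 : ℝ) ≤ |(u : ℝ)| ^ q := by positivity
  rcases le_total |(u : ℝ)| 1 with h | h
  · calc (C + |(u : ℝ)|) ^ p ≤ (C + 1) ^ p := by gcongr
      _ ≤ _ := le_mul_of_one_le_right (by positivity) (by linarith)
  · calc (C + |(u : ℝ)|) ^ p ≤ ((C + 1) * |(u : ℝ)|) ^ p := by gcongr; nlinarith
      _ = (C + 1) ^ p * |(u : ℝ)| ^ p := mul_pow _ _ _
      _ ≤ (C + 1) ^ p * |(u : ℝ)| ^ q := by gcongr
      _ ≤ _ := by gcongr; linarith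

/-- Off-diagonal weights when `h` is close to `ℓ`. -/
lemma offDiag_le_of_near {K : ℝ → ℝ} (hK : IsKernel K) {A : ℝ} (hA : ∀ x, |K x| ≤ A) {m ℓ h q q' : ℕ}
    {C : ℝ} (hC0 : 0 ≤ C) (hC : ∀ t, 0 ≤ t → |K (1 - t)| ≤ C * t ^ q')
    (hℓ : 1 ≤ ℓ) {d : ℕ → ℝ} {a : ℝ} (ha : ∀ s : ℤ, |s| = 1 → |delta m d s| ≤ a)
    {C' : ℝ} (hC' : 0 ≤ C') (hh : (ℓ : ℝ) - h ≤ C') (hh' : (3 / 4 : ℝ) * ℓ ≤ h) (u : ℤ) :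
    offDiag K m ℓ h d u ≤ (A * (∑ s ∈ Finset.Icc (-(m : ℤ)) m, |delta m d s|) * (2 / ℓ) ^ q +
      2 * (a * (C * ((C' + 1) ^ min q q' / (ℓ : ℝ) ^ min q q')))) * (1 + |(u : ℝ)| ^ q) := by
  have hℓ0 : (0 : ℝ) < ℓ := by exact_mod_cast hℓ
  have hA0 : 0 ≤ A := (abs_nonneg _).trans (hA 0)
  have ha0 : 0 ≤ a := (abs_nonneg _).trans (ha 1 (by simp))
  have hS0 : 0 ≤ ∑ s ∈ Finset.Icc (-(m : ℤ)) m, |delta m d s| :=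
    Finset.sum_nonneg fun _ _ => abs_nonneg _
  set p := min q q'
  set R := C * ((C' + 1) ^ p / (ℓ : ℝ) ^ p) * (1 + |(u : ℝ)| ^ q) with hR
  have hR0 : 0 ≤ R := by positivity
  -- For |u| ≥ ℓ/2 the factor (2|u|/ℓ)^q pays for the trivial bound. For smaller u, |s| ≥ 2 gives |u
  -- + sh| ≥ 3ℓ/2 - ℓ/2 = ℓ, so only s = ±1 survive, and inside the support they meet the kernel
  -- within (C' + |u|)/ℓ of its boundary.
  rcases le_or_gt (ℓ : ℝ) (2 * |(u : ℝ)|) with hu | hu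
  · have h1 : 1 ≤ (2 / (ℓ : ℝ)) ^ q * |(u : ℝ)| ^ q := by
      rw [← mul_pow]
      refine one_le_pow₀ ?_
      rw [div_mul_eq_mul_div, one_le_div (by positivity)]
      exact hu
    calc offDiag K m ℓ h d u ≤ ∑ s ∈ (Finset.Icc (-(m : ℤ)) m).erase 0, |delta m d s| * A := by
          refine Finset.sum_le_sum fun s _ => ?_
          gcongr
          exact hA _
      _ ≤ ∑ s ∈ Finset.Icc (-(m : ℤ)) m, |delta m d s| * A :=
          Finset.sum_le_sum_of_subset_of_nonneg (Finset.erase_subset _ _) fun s _ _ => by positivity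
      _ = A * (∑ s ∈ Finset.Icc (-(m : ℤ)) m, |delta m d s|) := by rw [← Finset.sum_mul, mul_comm]
      _ ≤ A * (∑ s ∈ Finset.Icc (-(m : ℤ)) m, |delta m d s|) * ((2 / (ℓ : ℝ)) ^ q * |(u : ℝ)| ^ q) :=
          le_mul_of_one_le_right (by positivity) h1
      _ ≤ A * (∑ s ∈ Finset.Icc (-(m : ℤ)) m, |delta m d s|) * (2 / (ℓ : ℝ)) ^ q * (1 + |(u : ℝ)| ^ q) := by
          rw [← mul_assoc]; gcongr; linarith
      _ ≤ _ := by
          refine mul_le_mul_of_nonneg_right ?_ (by positivity)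
          exact le_add_of_nonneg_right (by positivity)
  · have hterm : ∀ s ∈ (Finset.Icc (-(m : ℤ)) m).erase 0,
        |delta m d s| * |K (((u + s * h : ℤ) : ℝ) / ℓ)| ≤
          if s ∈ ({-1, 1} : Finset ℤ) then a * R else 0 := by
      intro s hs
      have hs0 : s ≠ 0 := (Finset.mem_erase.1 hs).1
      set y : ℝ := ((u + s * h : ℤ) : ℝ) with hy
      have h3 : |(s : ℝ)| * h ≤ |y| + |(u : ℝ)| := by
        calc |(s : ℝ)| * h = |(s : ℝ) * h| := by rw [abs_mul, abs_of_nonneg (by positivity : (0:ℝ) ≤ h)]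
          _ = |y - u| := by rw [hy]; push_cast; ring_nf
          _ ≤ _ := abs_sub _ _
      split_ifs with hs1
      · have hs2 : |s| = 1 := by
          simp only [Finset.mem_insert, Finset.mem_singleton] at hs1
          rcases hs1 with rfl | rfl <;> rfl
        refine mul_le_mul (ha s hs2) ?_ (abs_nonneg _) ha0
        have hs3 : |(s : ℝ)| = 1 := by rw [← Int.cast_abs, hs2]; simp
        rw [hs3, one_mul] at h3
        rcases le_or_gt 1 |y / ℓ| with h1 | h1
        · rw [hK.support _ h1, abs_zero]; exact hR0
        have hKy : |K (y / ℓ)| = |K (1 - (1 - |y / ℓ|))| := by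
          rw [sub_sub_cancel]
          rcases abs_choice (y / ℓ) with h | h <;> rw [h]
          rw [hK.even]
        have hτ : 1 - |y / ℓ| ≤ (C' + |(u : ℝ)|) / ℓ := by
          rw [abs_div, abs_of_pos hℓ0, le_div_iff₀ hℓ0, sub_mul, one_mul, div_mul_cancel₀ _ hℓ0.ne']
          linarith
        have hτ0 : 0 ≤ 1 - |y / ℓ| := by linarith
        have hτ1 : 1 - |y / ℓ| ≤ 1 := by linarith [abs_nonneg (y / ℓ)]
        rw [hKy]
        calc _ ≤ C * (1 - |y / ℓ|) ^ q' := hC _ hτ0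
          -- The exponent is lowered to min(q, q') because only the growth |u|^q is covered by the
          -- moment condition on the autocovariances.
          _ ≤ C * (1 - |y / ℓ|) ^ p := by
              have := pow_le_pow_of_le_one hτ0 hτ1 (min_le_right q q')
              gcongr
          _ ≤ C * ((C' + |(u : ℝ)|) / ℓ) ^ p := by gcongr
          _ = C * (1 / (ℓ : ℝ) ^ p) * (C' + |(u : ℝ)|) ^ p := by rw [div_pow]; ring
          _ ≤ C * (1 / (ℓ : ℝ) ^ p) * ((C' + 1) ^ p * (1 + |(u : ℝ)| ^ q)) := by
              gcongr
              exact add_abs_pow_le hC' u (min_le_left q q')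
          _ = R := by rw [hR]; ring
      · have hs2 : (2 : ℝ) ≤ |(s : ℝ)| := by
          rw [← Int.cast_abs]
          have : 2 ≤ |s| := by
            simp only [Finset.mem_insert, Finset.mem_singleton, not_or] at hs1
            rw [le_abs]; omega
          exact_mod_cast this
        rw [hK.support, abs_zero, mul_zero]
        rw [abs_div, abs_of_pos hℓ0, one_le_div hℓ0]
        nlinarith
    calc offDiag K m ℓ h d u ≤ ∑ s ∈ (Finset.Icc (-(m : ℤ)) m).erase 0,
          (if s ∈ ({-1, 1} : Finset ℤ) then a * R else 0) := Finset.sum_le_sum hterm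
      _ ≤ ∑ s ∈ ({-1, 1} : Finset ℤ), a * R := by
          rw [← Finset.sum_filter]
          refine Finset.sum_le_sum_of_subset_of_nonneg ?_ fun _ _ _ => by positivity
          intro s hs; exact (Finset.mem_filter.1 hs).2
      _ = 2 * (a * R) := by rw [Finset.sum_pair (by norm_num)]; ring
      _ = 2 * (a * (C * ((C' + 1) ^ p / (ℓ : ℝ) ^ p))) * (1 + |(u : ℝ)| ^ q) := by rw [hR]; ring
      _ ≤ _ := by
          refine mul_le_mul_of_nonneg_right ?_ (by positivity)
          exact le_add_of_nonneg_left (by positivity)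

end
end DiffLRV

namespace DiffLRV

noncomputable section

/-! ### Moving averages of random signs -/

/-- The law of a random sign. -/
def signLaw : Measure ℝ := (2⁻¹ : ENNReal) • Measure.dirac 1 + (2⁻¹ : ENNReal) • Measure.dirac (-1)

instance : IsProbabilityMeasure signLaw := by
  constructor
  simp [signLaw, ENNReal.inv_two_add_inv_two]

/-- The sign function with values in `{1, -1}`. -/
def sgn (x : ℝ) : ℝ := if 0 ≤ x then 1 else -1

lemma measurable_sgn : Measurable sgn :=
  Measurable.ite measurableSet_Ici measurable_const measurable_const

lemma sgn_mul_self (x : ℝ) : sgn x * sgn x = 1 := by unfold sgn; split_ifs <;> norm_num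

lemma abs_sgn (x : ℝ) : |sgn x| = 1 := by unfold sgn; split_ifs <;> norm_num

lemma sgn_neg_sgn (x : ℝ) : sgn (-sgn x) = -sgn x := by unfold sgn; split_ifs <;> first | (simp_all; done) | (norm_num at *)

lemma map_neg_sgn : signLaw.map (fun x => -sgn x) = signLaw := by
  have hm : Measurable fun x => -sgn x := measurable_sgn.neg
  rw [signLaw, Measure.map_add _ _ hm, Measure.map_smul, Measure.map_smul,
    Measure.map_dirac' hm, Measure.map_dirac' hm]
  have h1 : -sgn 1 = -1 := by simp [sgn]
  have h2 : -sgn (-1) = 1 := by norm_num [sgn]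
  rw [h1, h2, add_comm]

/-- The moving average `Z_i = ∑_{p ≤ M} ψ_p e_{i-p}` of independent random signs. -/
def maNoise (M : ℕ) (ψ : ℕ → ℝ) : Noise where
  ν := signLaw
  isProb := inferInstance
  g y := ∑ p ∈ Finset.range (M + 1), ψ p * sgn (y p)
  measurable_g := Finset.measurable_sum _ fun p _ =>
    (measurable_sgn.comp (measurable_pi_apply p)).const_mul _

/-- The `a`-th sign. -/
def sg (a : ℤ) (ε : ℤ → ℝ) : ℝ := sgn (ε a)

lemma measurable_sg (a : ℤ) : Measurable (sg a) := measurable_sgn.comp (measurable_pi_apply a)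

lemma sg_mul_self (a : ℤ) (ε : ℤ → ℝ) : sg a ε * sg a ε = 1 := sgn_mul_self _

lemma abs_sg (a : ℤ) (ε : ℤ → ℝ) : |sg a ε| = 1 := abs_sgn _

/-- Flip the sign of the `a`-th coordinate. -/
def flipAt (a : ℤ) (ε : ℤ → ℝ) : ℤ → ℝ := fun i => if i = a then -sgn (ε i) else ε i

lemma sg_flipAt_self (a : ℤ) (ε : ℤ → ℝ) : sg a (flipAt a ε) = -sg a ε := by
  simp [sg, flipAt, sgn_neg_sgn]

lemma sg_flipAt_of_ne {a b : ℤ} (h : b ≠ a) (ε : ℤ → ℝ) : sg b (flipAt a ε) = sg b ε := by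
  simp [sg, flipAt, h]

section

variable {M : ℕ} {ψ : ℕ → ℝ}

/-- A coordinatewise map under which the law of a sign is invariant. The flip passes through `sgn`,
so sign identities hold at every configuration and not only almost surely. -/
lemma measurePreserving_flipAt (a : ℤ) :
    MeasurePreserving (flipAt a) (maNoise M ψ).P (maNoise M ψ).P := by
  have hm : ∀ i : ℤ, Measurable fun x : ℝ => if i = a then -sgn x else x := by
    intro i; split_ifs
    · exact measurable_sgn.neg
    · exact measurable_id
  refine ⟨measurable_pi_iff.2 fun i => (hm i).comp (measurable_pi_apply i), ?_⟩
  have := Measure.infinitePi_map_pi (μ := fun _ : ℤ => signLaw)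
    (f := fun i x => if i = a then -sgn x else x) hm
  refine this.trans ?_
  rw [Noise.P]
  congr 1
  ext1 i
  by_cases h : i = a
  · simp only [h, if_true]; exact map_neg_sgn
  · simp only [h, if_false]; exact Measure.map_id

/-- A parity argument: every vanishing product moment of signs below is found by flipping a
coordinate that occurs exactly once. -/
lemma integral_eq_zero_of_flipAt {f : (ℤ → ℝ) → ℝ} (hf : Measurable f) (a : ℤ)
    (h : ∀ ε, f (flipAt a ε) = -f ε) : ∫ ε, f ε ∂(maNoise M ψ).P = 0 := by
  have hmp := measurePreserving_flipAt (M := M) (ψ := ψ) a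
  have h1 : ∫ ε, f ε ∂(maNoise M ψ).P = ∫ ε, f (flipAt a ε) ∂(maNoise M ψ).P := by
    conv_lhs => rw [← hmp.map_eq]
    rw [integral_map hmp.measurable.aemeasurable hf.aestronglyMeasurable]
  simp only [h, integral_neg] at h1
  linarith

lemma integral_sg (a : ℤ) : ∫ ε, sg a ε ∂(maNoise M ψ).P = 0 :=
  integral_eq_zero_of_flipAt (measurable_sg a) a (sg_flipAt_self a)

lemma integral_sg_mul (a b : ℤ) :
    ∫ ε, sg a ε * sg b ε ∂(maNoise M ψ).P = if a = b then 1 else 0 := by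
  split_ifs with h
  · subst h; simp [sg_mul_self]
  · refine integral_eq_zero_of_flipAt ((measurable_sg a).mul (measurable_sg b)) a fun ε => ?_
    rw [sg_flipAt_self, sg_flipAt_of_ne (Ne.symm h)]; ring

lemma integral_sg_mul_three (s : ℤ) {a b : ℤ} (hab : a ≠ b) :
    ∫ ε, sg s ε * (sg a ε * sg b ε) ∂(maNoise M ψ).P = 0 := by
  have hm := (measurable_sg s).mul ((measurable_sg a).mul (measurable_sg b))
  by_cases h : s = a
  · refine integral_eq_zero_of_flipAt hm b fun ε => ?_
    rw [sg_flipAt_self, sg_flipAt_of_ne hab, sg_flipAt_of_ne (h ▸ hab)]; ring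
  · refine integral_eq_zero_of_flipAt hm a fun ε => ?_
    rw [sg_flipAt_self, sg_flipAt_of_ne hab.symm, sg_flipAt_of_ne h]; ring

lemma integral_sg_mul_four (s r : ℤ) {a b : ℤ} (hab : a ≠ b) :
    ∫ ε, sg s ε * sg r ε * (sg a ε * sg b ε) ∂(maNoise M ψ).P =
      (if s = a then if r = b then 1 else 0 else 0) + (if s = b then if r = a then 1 else 0 else 0) := by
  have hm := ((measurable_sg s).mul (measurable_sg r)).mul ((measurable_sg a).mul (measurable_sg b))
  have key : ∀ c d : ℤ, c ≠ d → ∀ ε, sg c ε * sg d ε * (sg c ε * sg d ε) = 1 := by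
    intro c d _ ε
    calc _ = (sg c ε * sg c ε) * (sg d ε * sg d ε) := by ring
      _ = 1 := by rw [sg_mul_self, sg_mul_self, one_mul]
  by_cases ha : s ≠ a ∧ r ≠ a
  · rw [if_neg ha.1, if_neg ha.2]
    simp only [ite_self, add_zero]
    refine integral_eq_zero_of_flipAt hm a fun ε => ?_
    rw [sg_flipAt_self, sg_flipAt_of_ne hab.symm, sg_flipAt_of_ne ha.1, sg_flipAt_of_ne ha.2]; ring
  by_cases hb : s ≠ b ∧ r ≠ b
  · rw [if_neg hb.1, if_neg hb.2]
    simp only [ite_self, add_zero]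
    refine integral_eq_zero_of_flipAt hm b fun ε => ?_
    rw [sg_flipAt_self, sg_flipAt_of_ne hab, sg_flipAt_of_ne hb.1, sg_flipAt_of_ne hb.2]; ring
  rw [not_and_or, not_ne_iff, not_ne_iff] at ha hb
  rcases ha with rfl | rfl <;> rcases hb with rfl | rfl
  · exact absurd rfl hab
  · simp [key _ _ hab, hab]
  · have : ∀ ε, sg s ε * sg r ε * (sg r ε * sg s ε) = 1 := fun ε => by
      rw [mul_comm (sg r ε) (sg s ε)]; exact key _ _ hab.symm ε
    simp [this, hab.symm]
  · exact absurd rfl hab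

lemma maNoise_Z (i : ℤ) (ε : ℤ → ℝ) :
    (maNoise M ψ).Z i ε = ∑ p ∈ Finset.range (M + 1), ψ p * sg (i - p) ε := rfl

lemma abs_maNoise_Z_le (i : ℤ) (ε : ℤ → ℝ) :
    |(maNoise M ψ).Z i ε| ≤ ∑ p ∈ Finset.range (M + 1), |ψ p| := by
  rw [maNoise_Z]
  refine (Finset.abs_sum_le_sum_abs _ _).trans (Finset.sum_le_sum fun p _ => ?_)
  rw [abs_mul, abs_sg, mul_one]

lemma memLp_sg (a : ℤ) (p : ENNReal) : MemLp (sg a) p (maNoise M ψ).P :=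
  MemLp.of_bound (measurable_sg a).aestronglyMeasurable 1
    (ae_of_all _ fun ε => by rw [Real.norm_eq_abs, abs_sg])

lemma weakDep_maNoise : (maNoise M ψ).WeakDep where
  moment := ⟨5, by norm_num, MemLp.of_bound
    ((maNoise M ψ).measurable_Z 1).aestronglyMeasurable _
    (ae_of_all _ fun ε => by rw [Real.norm_eq_abs]; exact abs_maNoise_Z_le 1 ε)⟩
  mean_zero := by
    simp only [maNoise_Z]
    rw [integral_finsetSum _ fun p _ => ((memLp_sg _ 1).integrable le_rfl).const_mul _]
    simp [integral_const_mul, integral_sg]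
  dep := by
    rw [tsum_eq_sum (s := Finset.range (M + 1))]
    · refine ENNReal.sum_lt_top.2 fun i _ => ?_
      rw [Noise.theta]
      refine (MemLp.of_bound (C := 2 * ∑ p ∈ Finset.range (M + 1), |ψ p|) ?_ ?_).2
      · exact (measurable_resampleDiff ((maNoise M ψ).measurable_Z i) 0).aestronglyMeasurable
      · refine ae_of_all _ fun ω => ?_
        rw [Real.norm_eq_abs]
        refine (abs_sub _ _).trans ?_
        rw [two_mul]
        exact add_le_add (abs_maNoise_Z_le _ _) (abs_maNoise_Z_le _ _)
    · intro i hi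
      have : (fun ω : (ℤ → ℝ) × ℝ => (maNoise M ψ).Z i ω.1 -
          (maNoise M ψ).Z i (Function.update ω.1 0 ω.2)) = 0 := by
        ext ω
        simp only [maNoise_Z, Pi.zero_apply, sub_eq_zero]
        refine Finset.sum_congr rfl fun p hp => ?_
        rw [Finset.mem_range] at hi hp
        rw [sg, sg, Function.update_of_ne (by omega)]
      rw [Noise.theta, this]
      simp

/-- Autocovariances are the same functional of ψ as the δ_s are of the differencing sequence, so the
lemmas on `delta` serve both. -/
lemma gam_maNoise (k : ℤ) : (maNoise M ψ).gam k = delta M ψ k := by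
  have hN := weakDep_maNoise (M := M) (ψ := ψ)
  have h := hN.integral_mul 0 k
  rw [sub_zero] at h
  rw [← h]
  simp only [maNoise_Z, Finset.sum_mul_sum]
  have h2 : ∀ p p' : ℕ, Integrable (fun ε => ψ p * sg (0 - p) ε * (ψ p' * sg (k - p') ε))
      (maNoise M ψ).P := fun p p' =>
    (memLp_mul_two ((memLp_sg _ 4).const_mul _) ((memLp_sg _ 4).const_mul _)).integrable (by norm_num)
  rw [integral_finsetSum _ fun p _ => integrable_finsetSum _ fun p' _ => h2 p p']
  calc _ = ∑ p ∈ Finset.range (M + 1), ∑ p' ∈ Finset.range (M + 1), ψ p * ψ p' *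
        (if ((p : ℤ) - p') = -k then 1 else 0) := by
        refine Finset.sum_congr rfl fun p _ => ?_
        rw [integral_finsetSum _ fun p' _ => h2 p p']
        refine Finset.sum_congr rfl fun p' _ => ?_
        calc _ = ∫ ε, ψ p * ψ p' * (sg (0 - p) ε * sg (k - p') ε) ∂(maNoise M ψ).P := by
              congr 1; ext ε; ring
          _ = _ := by
              rw [integral_const_mul, integral_sg_mul]
              congr 1
              have : (0 - (p : ℤ) = k - p') ↔ ((p : ℤ) - p' = -k) := by omega
              simp only [this]
    _ = delta M ψ k := by
        rw [sum_sum_eq_sum_delta M ψ fun s => if s = -k then 1 else 0]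
        simp only [mul_ite, mul_one, mul_zero]
        rw [Finset.sum_ite_eq']
        split_ifs with hk
        · exact delta_neg M ψ k
        · rw [delta_eq_zero]
          rw [Finset.mem_Icc] at hk
          rw [lt_abs]; omega

lemma finiteU_maNoise (q : ℕ) : (maNoise M ψ).FiniteU q := by
  refine summable_of_ne_finset_zero (s := Finset.Icc (-(M : ℤ)) M) fun k hk => ?_
  rw [gam_maNoise, delta_eq_zero, abs_zero, mul_zero]
  rw [Finset.mem_Icc] at hk
  rw [lt_abs]; omega

lemma noiseBias_maNoise (K : ℝ → ℝ) (t : Tuning) (n : ℕ) :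
    noiseBias K t n (maNoise M ψ) = ∑ u ∈ Finset.Icc (-(M : ℤ)) M,
      (wt K n (t.m n) (t.ℓ n) (t.h n) (t.d n) u - 1) * delta M ψ u := by
  rw [noiseBias, tsum_eq_sum (s := Finset.Icc (-(M : ℤ)) M)]
  · simp only [gam_maNoise]
  · intro k hk
    rw [gam_maNoise, delta_eq_zero, mul_zero]
    rw [Finset.mem_Icc] at hk
    rw [lt_abs]; omega

end

/-! ### A lower bound for the variance -/

/-- Bessel's inequality, from the square of `f` minus its projection. Applied to products of two
distinct signs, it bounds the variance from below without computing it. -/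
lemma sum_sq_integral_le {α : Type*} {mα : MeasurableSpace α} {μ : Measure α} {ι : Type*}
    [DecidableEq ι] (S : Finset ι) {φ : ι → α → ℝ} (hφ : ∀ i, MemLp (φ i) 2 μ)
    (hon : ∀ i ∈ S, ∀ j ∈ S, ∫ x, φ i x * φ j x ∂μ = if i = j then 1 else 0)
    {f : α → ℝ} (hf : MemLp f 2 μ) :
    ∑ i ∈ S, (∫ x, f x * φ i x ∂μ) ^ 2 ≤ ∫ x, f x ^ 2 ∂μ := by
  set c : ι → ℝ := fun i => ∫ x, f x * φ i x ∂μ with hc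
  have hfφ : ∀ i, Integrable (fun x => f x * φ i x) μ := fun i => hf.integrable_mul (hφ i)
  have hφφ : ∀ i j, Integrable (fun x => φ i x * φ j x) μ := fun i j => (hφ i).integrable_mul (hφ j)
  have h0 : 0 ≤ ∫ x, (f x - ∑ i ∈ S, c i * φ i x) ^ 2 ∂μ := integral_nonneg fun _ => sq_nonneg _
  have hexp : ∀ x, (f x - ∑ i ∈ S, c i * φ i x) ^ 2 = f x ^ 2 - ∑ i ∈ S, 2 * c i * (f x * φ i x) +
      ∑ i ∈ S, ∑ j ∈ S, c i * c j * (φ i x * φ j x) := by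
    intro x
    rw [sub_sq, sq (∑ i ∈ S, c i * φ i x), Finset.sum_mul_sum, Finset.mul_sum]
    congr 1
    · congr 1
      exact Finset.sum_congr rfl fun i _ => by ring
    · exact Finset.sum_congr rfl fun i _ => Finset.sum_congr rfl fun j _ => by ring
  simp only [hexp] at h0
  have i0 : Integrable (fun x => f x ^ 2 - ∑ i ∈ S, 2 * c i * (f x * φ i x)) μ :=
    hf.integrable_sq.sub (integrable_finsetSum _ fun i _ => (hfφ i).const_mul _)
  have i1 : Integrable (fun x => ∑ i ∈ S, 2 * c i * (f x * φ i x)) μ :=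
    integrable_finsetSum _ fun i _ => (hfφ i).const_mul _
  have i2 : Integrable (fun x => ∑ i ∈ S, ∑ j ∈ S, c i * c j * (φ i x * φ j x)) μ :=
    integrable_finsetSum _ fun i _ => integrable_finsetSum _ fun j _ => (hφφ i j).const_mul _
  rw [integral_add i0 i2, integral_sub hf.integrable_sq i1,
    integral_finsetSum _ fun i _ => (hfφ i).const_mul _,
    integral_finsetSum _ fun i _ => integrable_finsetSum _ fun j _ => (hφφ i j).const_mul _] at h0
  have e1 : ∑ i ∈ S, ∫ x, 2 * c i * (f x * φ i x) ∂μ = 2 * ∑ i ∈ S, c i ^ 2 := by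
    rw [Finset.mul_sum]
    refine Finset.sum_congr rfl fun i _ => ?_
    rw [integral_const_mul, hc]; ring
  have e2 : ∑ i ∈ S, ∫ x, ∑ j ∈ S, c i * c j * (φ i x * φ j x) ∂μ = ∑ i ∈ S, c i ^ 2 := by
    refine Finset.sum_congr rfl fun i hi => ?_
    rw [integral_finsetSum _ fun j _ => (hφφ i j).const_mul _]
    calc _ = ∑ j ∈ S, c i * c j * (if i = j then 1 else 0) :=
          Finset.sum_congr rfl fun j hj => by rw [integral_const_mul, hon i hi j hj]
      _ = _ := by simp [hi, sq]
  rw [e1, e2] at h0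
  linarith

end
end DiffLRV

/-! ### Projection of the estimator on products of two signs. -/

namespace DiffLRV

noncomputable section

/-- The coefficient of the sign at `a` in the differenced moving average at `i`. -/
def loading (m h : ℕ) (d : ℕ → ℝ) (M : ℕ) (ψ : ℕ → ℝ) (i a : ℤ) : ℝ :=
  ∑ j ∈ Finset.range (m + 1), ∑ p ∈ Finset.range (M + 1),
    d j * ψ p * (if i - j * h - p = a then 1 else 0)

section

variable {M : ℕ} {ψ : ℕ → ℝ}

lemma diffNoise_maNoise (t : Tuning) (n : ℕ) (i : ℤ) (ε : ℤ → ℝ) :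
    diffNoise t (maNoise M ψ) n i ε = ∑ x ∈ Finset.range (t.m n + 1) ×ˢ Finset.range (M + 1),
      t.d n x.1 * ψ x.2 * sg (i - x.1 * t.h n - x.2) ε := by
  rw [Finset.sum_product]
  simp only [diffNoise, diffStat, maNoise_Z, Finset.mul_sum, mul_assoc]

lemma loading_eq (m h : ℕ) (d : ℕ → ℝ) (i a : ℤ) :
    loading m h d M ψ i a = ∑ x ∈ Finset.range (m + 1) ×ˢ Finset.range (M + 1),
      d x.1 * ψ x.2 * (if i - x.1 * h - x.2 = a then 1 else 0) := by
  rw [Finset.sum_product, loading]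

lemma integrable_sg_mul_four (s r a b : ℤ) :
    Integrable (fun ε => sg s ε * sg r ε * (sg a ε * sg b ε)) (maNoise M ψ).P :=
  (memLp_mul_two (memLp_sg s 4) (memLp_sg r 4)).integrable_mul
    (memLp_mul_two (memLp_sg a 4) (memLp_sg b 4))

lemma integrable_sg_mul_three (s a b : ℤ) :
    Integrable (fun ε => sg s ε * (sg a ε * sg b ε)) (maNoise M ψ).P :=
  (memLp_sg s 2).integrable_mul (memLp_mul_two (memLp_sg a 4) (memLp_sg b 4))

lemma integral_diffNoise_mul_sg (t : Tuning) (n : ℕ) (i : ℤ) {a b : ℤ} (hab : a ≠ b) :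
    ∫ ε, diffNoise t (maNoise M ψ) n i ε * (sg a ε * sg b ε) ∂(maNoise M ψ).P = 0 := by
  simp only [diffNoise_maNoise, Finset.sum_mul]
  rw [integral_finsetSum]
  · refine Finset.sum_eq_zero fun x _ => ?_
    simp only [mul_assoc]
    rw [integral_const_mul, integral_const_mul, integral_sg_mul_three _ hab]
    simp
  · intro x _
    simp only [mul_assoc]
    exact ((integrable_sg_mul_three _ _ _).const_mul _).const_mul _

lemma integral_diffNoise_mul_diffNoise_mul_sg (t : Tuning) (n : ℕ) (i k : ℤ) {a b : ℤ}
    (hab : a ≠ b) :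
    ∫ ε, diffNoise t (maNoise M ψ) n i ε * diffNoise t (maNoise M ψ) n k ε *
        (sg a ε * sg b ε) ∂(maNoise M ψ).P =
      loading (t.m n) (t.h n) (t.d n) M ψ i a * loading (t.m n) (t.h n) (t.d n) M ψ k b +
        loading (t.m n) (t.h n) (t.d n) M ψ i b * loading (t.m n) (t.h n) (t.d n) M ψ k a := by
  set R := Finset.range (t.m n + 1) ×ˢ Finset.range (M + 1)
  have hre : ∀ (x y : ℕ × ℕ) (ε : ℤ → ℝ),
      t.d n x.1 * ψ x.2 * sg (i - x.1 * t.h n - x.2) ε *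
        (t.d n y.1 * ψ y.2 * sg (k - y.1 * t.h n - y.2) ε) * (sg a ε * sg b ε) =
      (t.d n x.1 * ψ x.2 * (t.d n y.1 * ψ y.2)) * (sg (i - x.1 * t.h n - x.2) ε *
        sg (k - y.1 * t.h n - y.2) ε * (sg a ε * sg b ε)) := fun x y ε => by ring
  have hI : ∀ x y : ℕ × ℕ, Integrable (fun ε => (t.d n x.1 * ψ x.2 * (t.d n y.1 * ψ y.2)) *
      (sg (i - x.1 * t.h n - x.2) ε * sg (k - y.1 * t.h n - y.2) ε * (sg a ε * sg b ε)))
      (maNoise M ψ).P := fun x y => (integrable_sg_mul_four _ _ _ _).const_mul _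
  simp only [diffNoise_maNoise, Finset.sum_mul_sum, loading_eq]
  simp only [Finset.sum_mul, hre]
  rw [integral_finsetSum _ fun x _ => integrable_finsetSum _ fun y _ => hI x y,
    ← Finset.sum_add_distrib]
  refine Finset.sum_congr rfl fun x _ => ?_
  rw [integral_finsetSum _ fun y _ => hI x y, ← Finset.sum_add_distrib]
  refine Finset.sum_congr rfl fun y _ => ?_
  rw [integral_const_mul, integral_sg_mul_four _ _ hab]
  split_ifs <;> ring

/-- The assumptions on `a` place every index a + jh + p with a nonzero loading inside the window, so
nothing is truncated. -/
lemma sum_loading_mul {n m h : ℕ} (d : ℕ → ℝ) {a : ℤ} (ha : (m : ℤ) * h + 1 ≤ a)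
    (ha' : a + m * h + M ≤ n) (F : ℤ → ℝ) :
    ∑ i ∈ win n m h, loading m h d M ψ i a * F i =
      ∑ j ∈ Finset.range (m + 1), ∑ p ∈ Finset.range (M + 1), d j * ψ p * F (a + j * h + p) := by
  simp only [loading, Finset.sum_mul]
  rw [Finset.sum_comm]
  refine Finset.sum_congr rfl fun j hj => ?_
  rw [Finset.sum_comm]
  refine Finset.sum_congr rfl fun p hp => ?_
  rw [Finset.mem_range] at hj hp
  have h0 : (j : ℤ) * h ≤ m * h := by
    have : j * h ≤ m * h := Nat.mul_le_mul_right _ (by omega)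
    exact_mod_cast this
  have h1 : (0 : ℤ) ≤ (j : ℤ) * h := by positivity
  rw [Finset.sum_eq_single (a + j * h + p)]
  · rw [if_pos (by ring), mul_one]
  · intro i _ hi
    rw [if_neg (fun hcon => hi (by rw [← hcon]; ring))]
    simp
  · intro hcon
    exact absurd (Finset.mem_Icc.2 ⟨by omega, by omega⟩) hcon

/-- By parity only the part quadratic in the noise sees a product of two distinct signs; the mean
function drops out. The factor 2 counts the two ways of matching the pair of noise factors with a
and b. -/
lemma integral_vHat_mul_sg {K : ℝ → ℝ} (hK : IsKernel K) (t : Tuning) (μ : ℕ → MeanFn) {n : ℕ}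
    (hℓ : 1 ≤ t.ℓ n) {a b : ℤ} (hab : a ≠ b)
    (ha : (t.m n : ℤ) * t.h n + 1 ≤ a) (ha' : a + t.m n * t.h n + M ≤ n)
    (hb : (t.m n : ℤ) * t.h n + 1 ≤ b) (hb' : b + t.m n * t.h n + M ≤ n) :
    ∫ ε, vHat K t n (DGM.X ⟨maNoise M ψ, μ⟩ n ε) * (sg a ε * sg b ε) ∂(maNoise M ψ).P =
      2 / n * ∑ s ∈ Finset.Icc (-(t.m n : ℤ)) (t.m n), delta (t.m n) (t.d n) s *
        ∑ u ∈ Finset.Icc (-(M : ℤ)) M, delta M ψ u *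
          K (((a - b + u + s * t.h n : ℤ) : ℝ) / t.ℓ n) := by
  have hN : (maNoise M ψ).WeakDep := weakDep_maNoise
  set G : DGM := ⟨maNoise M ψ, μ⟩ with hG
  have hS := shortMemory_diffNoise (G := G) (n := n) t hN
  set I := win n (t.m n) (t.h n)
  have hsg : MemLp (fun ε => sg a ε * sg b ε) 2 (maNoise M ψ).P :=
    memLp_mul_two (memLp_sg a 4) (memLp_sg b 4)
  have hQ : ∀ i k : ℤ, Integrable (fun ε => 1 / (n : ℝ) * K (((i - k : ℤ) : ℝ) / (t.ℓ n : ℝ)) *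
      (diffNoise t G.noise n i ε * diffNoise t G.noise n k ε * (sg a ε * sg b ε)))
      (maNoise M ψ).P := fun i k =>
    ((memLp_mul_two (hS.memLp i) (hS.memLp k)).integrable_mul hsg).const_mul _
  have hL : ∀ (c : ℝ) (i : ℤ), Integrable (fun ε => c *
      (diffNoise t G.noise n i ε * (sg a ε * sg b ε))) (maNoise M ψ).P := fun c i =>
    (MemLp.integrable_mul (p := 2) (q := 2)
      ((hS.memLp i).mono_exponent (by norm_num)) hsg).const_mul _
  simp only [vHat_decomp hK t hℓ, add_mul, Finset.sum_mul]
  simp only [mul_assoc (1 / (n : ℝ) * K _), mul_assoc (2 / (n : ℝ) * Finset.sum _ _)]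
  rw [integral_add, integral_add]
  rotate_left
  · exact integrable_finsetSum _ fun i _ => integrable_finsetSum _ fun k _ => hQ i k
  · exact integrable_finsetSum _ fun i _ => hL _ i
  · exact (integrable_finsetSum _ fun i _ => integrable_finsetSum _ fun k _ => hQ i k).add
      (integrable_finsetSum _ fun i _ => hL _ i)
  · exact (hsg.integrable (by norm_num)).const_mul _
  rw [integral_const_mul, integral_sg_mul, if_neg hab, mul_zero, add_zero,
    integral_finsetSum _ fun i _ => hL _ i,
    integral_finsetSum _ fun i _ => integrable_finsetSum _ fun k _ => hQ i k]
  have hlin : ∑ i ∈ I, ∫ ε, 2 / (n : ℝ) * (∑ k ∈ I, K (((i - k : ℤ) : ℝ) / (t.ℓ n : ℝ)) *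
      diffStat (t.m n) (t.h n) (t.d n) (G.mu n) k) *
        (diffNoise t G.noise n i ε * (sg a ε * sg b ε)) ∂(maNoise M ψ).P = 0 := by
    refine Finset.sum_eq_zero fun i _ => ?_
    rw [integral_const_mul]
    have := integral_diffNoise_mul_sg (M := M) (ψ := ψ) t n i hab
    rw [show G.noise = maNoise M ψ from rfl, this, mul_zero]
  rw [hlin, add_zero]
  set α := loading (t.m n) (t.h n) (t.d n) M ψ with hα
  have h1 : ∑ i ∈ I, ∫ ε, ∑ k ∈ I, 1 / (n : ℝ) * K (((i - k : ℤ) : ℝ) / (t.ℓ n : ℝ)) *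
      (diffNoise t G.noise n i ε * diffNoise t G.noise n k ε * (sg a ε * sg b ε)) ∂(maNoise M ψ).P =
      ∑ i ∈ I, ∑ k ∈ I, 1 / (n : ℝ) * K (((i - k : ℤ) : ℝ) / (t.ℓ n : ℝ)) * (α i a * α k b) +
      ∑ i ∈ I, ∑ k ∈ I, 1 / (n : ℝ) * K (((i - k : ℤ) : ℝ) / (t.ℓ n : ℝ)) * (α i b * α k a) := by
    rw [← Finset.sum_add_distrib]
    refine Finset.sum_congr rfl fun i _ => ?_
    rw [integral_finsetSum _ fun k _ => hQ i k, ← Finset.sum_add_distrib]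
    refine Finset.sum_congr rfl fun k _ => ?_
    rw [integral_const_mul]
    have := integral_diffNoise_mul_diffNoise_mul_sg (M := M) (ψ := ψ) t n i k hab
    rw [show G.noise = maNoise M ψ from rfl, this, mul_add]
  have h2 : ∑ i ∈ I, ∑ k ∈ I, 1 / (n : ℝ) * K (((i - k : ℤ) : ℝ) / (t.ℓ n : ℝ)) * (α i b * α k a) =
      ∑ i ∈ I, ∑ k ∈ I, 1 / (n : ℝ) * K (((i - k : ℤ) : ℝ) / (t.ℓ n : ℝ)) * (α i a * α k b) := by
    rw [Finset.sum_comm]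
    refine Finset.sum_congr rfl fun i _ => Finset.sum_congr rfl fun k _ => ?_
    rw [kernel_swap hK k i, mul_comm (α k b)]
  have h3 : ∑ i ∈ I, ∑ k ∈ I, 1 / (n : ℝ) * K (((i - k : ℤ) : ℝ) / (t.ℓ n : ℝ)) * (α i a * α k b) =
      1 / n * ∑ i ∈ I, α i a * ∑ k ∈ I, α k b * K (((i - k : ℤ) : ℝ) / (t.ℓ n : ℝ)) := by
    simp only [Finset.mul_sum]
    refine Finset.sum_congr rfl fun i _ => Finset.sum_congr rfl fun k _ => ?_
    ring
  rw [show (∑ i ∈ win n (t.m n) (t.h n), _ : ℝ) = _ from h1, h2, h3, ← two_mul, ← mul_assoc,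
    mul_one_div]
  congr 1
  rw [sum_loading_mul (t.d n) ha ha'
    fun i => ∑ k ∈ I, α k b * K (((i - k : ℤ) : ℝ) / (t.ℓ n : ℝ))]
  simp only [hα]
  simp only [I, fun i : ℤ => sum_loading_mul (M := M) (ψ := ψ) (t.d n) hb hb'
    fun k => K (((i - k : ℤ) : ℝ) / (t.ℓ n : ℝ))]
  rw [← sum_sum_eq_sum_delta (t.m n) (t.d n) fun s => ∑ u ∈ Finset.Icc (-(M : ℤ)) M, delta M ψ u *
          K (((a - b + u + s * t.h n : ℤ) : ℝ) / t.ℓ n)]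
  refine Finset.sum_congr rfl fun j _ => ?_
  simp only [Finset.mul_sum]
  rw [Finset.sum_comm]
  refine Finset.sum_congr rfl fun j' _ => ?_
  rw [← Finset.mul_sum, ← sum_sum_eq_sum_delta M ψ fun u =>
          K (((a - b + u + ((j : ℤ) - j') * t.h n : ℤ) : ℝ) / t.ℓ n), Finset.mul_sum]
  refine Finset.sum_congr rfl fun p _ => ?_
  rw [Finset.mul_sum]
  refine Finset.sum_congr rfl fun p' _ => ?_
  have e : (a + j * t.h n + p - (b + j' * t.h n + p') : ℤ) =
    a - b + ((p : ℤ) - p') + ((j : ℤ) - j') * t.h n := by ring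
  rw [e]
  ring

/-- Bessel over the RL orthonormal products at sites a and a + p. The coefficient depends on p only,
and `hroom` keeps both sites away from the ends of the window. -/
lemma variance_vHat_ge_of_le_abs {K : ℝ → ℝ} (hK : IsKernel K) (t : Tuning) (μ : ℕ → MeanFn)
    {n : ℕ} (hℓ : 1 ≤ t.ℓ n) {L R : ℕ} {w : ℝ} (hw0 : 0 ≤ w)
    (hw : ∀ p : ℕ, 1 ≤ p → p ≤ L → w ≤ |∑ s ∈ Finset.Icc (-(t.m n : ℤ)) (t.m n),
      delta (t.m n) (t.d n) s * ∑ u ∈ Finset.Icc (-(M : ℤ)) M, delta M ψ u *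
          K (((-p + u + s * t.h n : ℤ) : ℝ) / t.ℓ n)|)
    (hroom : 2 * (t.m n * t.h n) + M + L + R ≤ n) :
    R * L * (2 * w / n) ^ 2 ≤
      Var[fun ε => vHat K t n (DGM.X ⟨maNoise M ψ, μ⟩ n ε); (maNoise M ψ).P] := by
  set G : DGM := ⟨maNoise M ψ, μ⟩ with hG
  have hmem : MemLp (fun ε => vHat K t n (G.X n ε)) 2 (maNoise M ψ).P :=
    memLp_vHat (G := G) hK t weakDep_maNoise hℓ
  set e : ℝ := ∫ ε, vHat K t n (G.X n ε) ∂(maNoise M ψ).P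
  set S := Finset.Icc ((t.m n : ℤ) * t.h n + 1) ((t.m n : ℤ) * t.h n + R) ×ˢ Finset.Icc 1 L
  set φ : ℤ × ℕ → (ℤ → ℝ) → ℝ := fun x ε => sg x.1 ε * sg (x.1 + x.2) ε with hφ
  have hφm : ∀ x, MemLp (φ x) 2 (maNoise M ψ).P := fun x =>
    memLp_mul_two (memLp_sg _ 4) (memLp_sg _ 4)
  have hB := sum_sq_integral_le (μ := (maNoise M ψ).P) S hφm (by
    rintro ⟨a, p⟩ hx ⟨b, r⟩ hy
    simp only [S, Finset.mem_product, Finset.mem_Icc] at hx hy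
    simp only [hφ]
    rw [integral_sg_mul_four _ _ (show b ≠ b + r by omega)]
    by_cases h : a = b
    · subst h
      by_cases h' : p = r
      · subst h'; simp; omega
      · have h1 : ¬ (a + (p : ℤ) = a + r) := by omega
        have h2 : ¬ (a + (p : ℤ) = a) := by omega
        have h3 : ¬ ((a, p) = (a, r)) := fun hc => h' (Prod.ext_iff.1 hc).2
        simp [h', h2]
    · have h3 : ¬ ((a, p) = (b, r)) := fun hc => h (Prod.ext_iff.1 hc).1
      rw [if_neg h, if_neg h3]
      split_ifs
      · omega
      · simp
      · simp) (f := fun ε => vHat K t n (G.X n ε) - e)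
    (hmem.sub (memLp_const e))
  have hvar : Var[fun ε => vHat K t n (G.X n ε); (maNoise M ψ).P] =
      ∫ ε, (vHat K t n (G.X n ε) - e) ^ 2 ∂(maNoise M ψ).P :=
    variance_eq_integral hmem.aestronglyMeasurable.aemeasurable
  rw [hvar]
  refine le_trans ?_ hB
  have hterm : ∀ x ∈ S, (2 * w / n) ^ 2 ≤
      (∫ ε, (vHat K t n (G.X n ε) - e) * φ x ε ∂(maNoise M ψ).P) ^ 2 := by
    rintro ⟨a, p⟩ hx
    simp only [S, Finset.mem_product, Finset.mem_Icc] at hx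
    have hne : a ≠ a + p := by omega
    have h1 : ∫ ε, (vHat K t n (G.X n ε) - e) * φ (a, p) ε ∂(maNoise M ψ).P =
        ∫ ε, vHat K t n (G.X n ε) * (sg a ε * sg (a + p) ε) ∂(maNoise M ψ).P := by
      simp only [sub_mul, hφ]
      rw [integral_sub, integral_const_mul, integral_sg_mul, if_neg hne, mul_zero, sub_zero]
      · exact hmem.integrable_mul (hφm (a, p))
      · exact ((hφm (a, p)).integrable (by norm_num)).const_mul _
    rw [h1, integral_vHat_mul_sg hK t μ hℓ hne (by omega) (by zify at hroom; omega)
      (by omega) (by zify at hroom; omega), sub_add_cancel_left, ← sq_abs (2 / (n : ℝ) * _), abs_mul,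
      abs_of_nonneg (by positivity : (0 : ℝ) ≤ 2 / n), mul_div_right_comm]
    have := hw p hx.2.1 hx.2.2
    gcongr
  calc (R : ℝ) * L * (2 * w / n) ^ 2 = ∑ x ∈ S, (2 * w / n) ^ 2 := by
        rw [Finset.sum_const, nsmul_eq_mul]
        simp only [S, Finset.card_product, Int.card_Icc, Nat.card_Icc]
        push_cast
        rw [show ((t.m n : ℤ) * t.h n + R + 1 - (t.m n * t.h n + 1)) = R by ring]
        simp
    _ ≤ _ := Finset.sum_le_sum hterm

/-- With s = 0 and the kernel replaced by 1, the sum is ∑ γ_u = (∑ψ)². The two replacement errors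
are those collected in η. -/
lemma le_abs_sum_delta_mul_kernel {K : ℝ → ℝ} {m ℓ h : ℕ} {d : ℕ → ℝ}
    (hd : ∑ j ∈ Finset.range (m + 1), d j ^ 2 = 1) (x : ℤ) {η : ℝ}
    (hη : ∀ u ∈ Finset.Icc (-(M : ℤ)) M, |K (((x + u : ℤ) : ℝ) / ℓ) - 1| +
      offDiag K m ℓ h d (x + u) ≤ η) :
    (∑ p ∈ Finset.range (M + 1), ψ p) ^ 2 - (∑ u ∈ Finset.Icc (-(M : ℤ)) M, |delta M ψ u|) * η ≤
      |∑ s ∈ Finset.Icc (-(m : ℤ)) m, delta m d s * ∑ u ∈ Finset.Icc (-(M : ℤ)) M,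
        delta M ψ u * K (((x + u + s * h : ℤ) : ℝ) / ℓ)| := by
  rw [← Finset.add_sum_erase _ _ (show (0 : ℤ) ∈ Finset.Icc (-(m : ℤ)) m by simp),
    delta_zero, hd, one_mul, ← sum_delta]
  have hmain : |∑ u ∈ Finset.Icc (-(M : ℤ)) M, delta M ψ u *
      K (((x + u + 0 * h : ℤ) : ℝ) / ℓ) - ∑ u ∈ Finset.Icc (-(M : ℤ)) M, delta M ψ u| ≤
      ∑ u ∈ Finset.Icc (-(M : ℤ)) M, |delta M ψ u| * |K (((x + u : ℤ) : ℝ) / ℓ) - 1| := by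
    rw [← Finset.sum_sub_distrib]
    refine (Finset.abs_sum_le_sum_abs _ _).trans (Finset.sum_le_sum fun u _ => ?_)
    rw [zero_mul, add_zero, ← mul_sub_one, abs_mul]
  have hrest : |∑ s ∈ (Finset.Icc (-(m : ℤ)) m).erase 0, delta m d s *
      ∑ u ∈ Finset.Icc (-(M : ℤ)) M, delta M ψ u * K (((x + u + s * h : ℤ) : ℝ) / ℓ)| ≤
      ∑ u ∈ Finset.Icc (-(M : ℤ)) M, |delta M ψ u| * offDiag K m ℓ h d (x + u) := by
    calc _ ≤ ∑ s ∈ (Finset.Icc (-(m : ℤ)) m).erase 0, ∑ u ∈ Finset.Icc (-(M : ℤ)) M,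
          |delta M ψ u| * (|delta m d s| * |K (((x + u + s * h : ℤ) : ℝ) / ℓ)|) := by
          refine (Finset.abs_sum_le_sum_abs _ _).trans (Finset.sum_le_sum fun s _ => ?_)
          rw [Finset.mul_sum]
          refine (Finset.abs_sum_le_sum_abs _ _).trans (Finset.sum_le_sum fun u _ => ?_)
          rw [abs_mul, abs_mul]
          exact le_of_eq (by ring)
      _ = _ := by
          rw [Finset.sum_comm]
          simp only [offDiag, Finset.mul_sum]
  have hsum : ∑ u ∈ Finset.Icc (-(M : ℤ)) M, |delta M ψ u| * |K (((x + u : ℤ) : ℝ) / ℓ) - 1| +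
      ∑ u ∈ Finset.Icc (-(M : ℤ)) M, |delta M ψ u| * offDiag K m ℓ h d (x + u) ≤
      (∑ u ∈ Finset.Icc (-(M : ℤ)) M, |delta M ψ u|) * η := by
    rw [← Finset.sum_add_distrib, Finset.sum_mul]
    refine Finset.sum_le_sum fun u hu => ?_
    rw [← mul_add]
    gcongr
    exact hη u hu
  have a1 := (abs_le.1 hmain).1
  have a2 := (abs_le.1 hrest).1
  refine le_trans ?_ (le_abs_self _)
  linarith

/-- The variance is at least of the order `ℓ / n` when the off-diagonal weights are negligible. -/
theorem variance_vHat_ge {K : ℝ → ℝ} (hK : IsKernel K) {q : ℕ} (hq : NearOrigin K q) {t : Tuning}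
    (ht : t.Admissible) (μ : ℕ → MeanFn) (hψ : ∑ p ∈ Finset.range (M + 1), ψ p ≠ 0)
    (hoff : ∃ C : ℝ, ∀ᶠ n in atTop, ∀ u : ℤ, offDiag K (t.m n) (t.ℓ n) (t.h n) (t.d n) u ≤
      C / t.ℓ n * (1 + |(u : ℝ)|)) :
    ∃ c : ℝ, 0 < c ∧ ∀ᶠ n in atTop, c * (t.ℓ n / n) ≤
      Var[fun ε => vHat K t n (DGM.X ⟨maNoise M ψ, μ⟩ n ε); (maNoise M ψ).P] := by
  obtain ⟨C₁, hC₁0, hC₁⟩ := hK.abs_sub_one_le hq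
  obtain ⟨C₂, hC₂⟩ := hoff
  set v : ℝ := (∑ p ∈ Finset.range (M + 1), ψ p) ^ 2 with hv
  have hv0 : 0 < v := by positivity
  have hvsum : ∑ u ∈ Finset.Icc (-(M : ℤ)) M, delta M ψ u = v := sum_delta M ψ
  set Γ : ℝ := ∑ u ∈ Finset.Icc (-(M : ℤ)) M, |delta M ψ u| with hΓ
  have hΓv : v ≤ Γ := by
    rw [← hvsum]; exact Finset.sum_le_sum fun _ _ => le_abs_self _
  have hΓ0 : 0 < Γ := hv0.trans_le hΓv
  set C : ℝ := C₁ + |C₂| + 1 with hC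
  have hC0 : 1 ≤ C := by have := abs_nonneg C₂; linarith
  -- Chosen so that the lower bound v - Γη equals v/2. The fraction e below limits the lags p to eℓ,
  -- where the kernel is still close to 1 and the off-diagonal weights are small.
  set η : ℝ := v / (2 * Γ) with hη
  have hη0 : 0 < η := by positivity
  have hη1 : η ≤ 1 / 2 := by rw [hη, div_le_iff₀ (by positivity)]; linarith
  set e : ℝ := η / (2 * C) with he
  have he0 : 0 < e := by positivity
  have he1 : e ≤ 1 / 4 := by rw [he, div_le_iff₀ (by positivity)]; nlinarith
  refine ⟨e * v ^ 2 / 8, by positivity, ?_⟩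
  have hℓr : Tendsto (fun n => (t.ℓ n : ℝ)) atTop atTop :=
    tendsto_natCast_atTop_atTop.comp ht.bandwidth_tendsto
  filter_upwards [ht.eventually_basic, hC₂, ht.normalized,
    hℓr.eventually_ge_atTop (2 * C * (1 + M) / η), hℓr.eventually_ge_atTop (2 / e),
    hℓr.eventually_ge_atTop (2 * ((M : ℝ) + 1)), tendsto_natCast_atTop_atTop.eventually_ge_atTop (4 * (M : ℝ)),
    ht.negligible.eventually (gt_mem_nhds (show (0 : ℝ) < 1 / 8 by norm_num))] with
    n hb hoffn hd h1 h2 h3 h4 h5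
  obtain ⟨hn1, hℓ1, -, -, -⟩ := hb
  have hn0 : (0 : ℝ) < n := by exact_mod_cast hn1
  have hℓ0 : (0 : ℝ) < t.ℓ n := by exact_mod_cast hℓ1
  set L : ℕ := ⌊e * t.ℓ n⌋₊ with hL
  have hLle : (L : ℝ) ≤ e * t.ℓ n := Nat.floor_le (by positivity)
  have hLge : e * t.ℓ n / 2 ≤ L := by
    have := Nat.lt_floor_add_one (e * t.ℓ n)
    rw [div_le_iff₀ he0] at h2
    rw [← hL] at this
    linarith
  rw [div_lt_iff₀ hn0] at h5
  -- R ≥ n/4 base points and L ≥ eℓ/2 lags, each with squared coefficient (v/n)², add up to the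
  -- order ℓ/n.
  set R : ℕ := n - (2 * (t.m n * t.h n) + M + L) with hR
  have hmh : (0 : ℝ) ≤ (t.m n : ℝ) * t.h n := by positivity
  have hsmall : (2 * ((t.m n : ℝ) * t.h n) + M + L) ≤ n / 2 + n / 8 := by
    have : e * t.ℓ n ≤ 1 / 4 * t.ℓ n := by gcongr
    linarith
  have hle : 2 * (t.m n * t.h n) + M + L ≤ n := by
    have : (2 * ((t.m n : ℝ) * t.h n) + M + L) ≤ n := by linarith
    exact_mod_cast this
  have hRr : (n : ℝ) / 4 ≤ R := by
    rw [hR, Nat.cast_sub hle]; push_cast; linarith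
  have hkey := variance_vHat_ge_of_le_abs (M := M) (ψ := ψ) (w := v / 2) hK t μ hℓ1 (L := L) (R := R)
    (by positivity) ?_ (by omega)
  · refine le_trans ?_ hkey
    calc e * v ^ 2 / 8 * (t.ℓ n / n) = (n / 4) * (e * t.ℓ n / 2) * (2 * (v / 2) / n) ^ 2 := by
          field_simp; norm_num
      _ ≤ _ := by gcongr
  · intro p hp1 hpL
    have hpr : (p : ℝ) ≤ e * t.ℓ n := le_trans (by exact_mod_cast hpL) hLle
    have hbd : ∀ u ∈ Finset.Icc (-(M : ℤ)) M, C * ((1 + |((-p + u : ℤ) : ℝ)|) / t.ℓ n) ≤ η := by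
      intro u hu
      rw [Finset.mem_Icc] at hu
      have hu' : |(u : ℝ)| ≤ M := by
        rw [abs_le]; exact ⟨by exact_mod_cast hu.1, by exact_mod_cast hu.2⟩
      have : |((-p + u : ℤ) : ℝ)| ≤ p + M := by
        push_cast
        refine (abs_add_le _ _).trans ?_
        rw [abs_neg, Nat.abs_cast]; linarith
      rw [div_le_iff₀ hη0] at h1
      have hCe : C * e = η / 2 := by rw [he]; field_simp
      rw [← mul_div_assoc, div_le_iff₀ hℓ0]
      calc C * (1 + |((-p + u : ℤ) : ℝ)|) ≤ C * (1 + (e * t.ℓ n + M)) := by gcongr; linarith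
        _ = C * (1 + M) + (C * e) * t.ℓ n := by ring
        _ ≤ _ := by rw [hCe]; linarith
    have hbd' : ∀ u ∈ Finset.Icc (-(M : ℤ)) M, |K (((-p + u : ℤ) : ℝ) / t.ℓ n) - 1| +
        offDiag K (t.m n) (t.ℓ n) (t.h n) (t.d n) (-p + u) ≤ η := by
      intro u hu
      set y : ℝ := (1 + |((-p + u : ℤ) : ℝ)|) / t.ℓ n with hy
      have hy0 : 0 ≤ y := by positivity
      have hyη : C * y ≤ η := hbd u hu
      have hy1 : y ≤ 1 := by nlinarith
      have hxy : |((-p + u : ℤ) : ℝ) / t.ℓ n| ≤ y := by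
        rw [abs_div, Nat.abs_cast, hy]
        gcongr
        linarith
      have b1 : |K (((-p + u : ℤ) : ℝ) / t.ℓ n) - 1| ≤ C₁ * y := by
        refine (hC₁ _).trans ?_
        gcongr
        exact (pow_le_of_le_one (abs_nonneg _) (hxy.trans hy1) (by have := hq.1; omega)).trans hxy
      have b2 : offDiag K (t.m n) (t.ℓ n) (t.h n) (t.d n) (-p + u) ≤ |C₂| * y := by
        refine (hoffn _).trans ?_
        rw [div_mul_eq_mul_div, mul_div_assoc]
        gcongr
        exact le_abs_self _
      calc _ ≤ C₁ * y + |C₂| * y := add_le_add b1 b2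
        _ ≤ C * y := by rw [hC]; linarith
        _ ≤ η := hyη
    refine le_trans (le_of_eq ?_) (le_abs_sum_delta_mul_kernel hd (-p) hbd')
    rw [← hv, ← hΓ, hη]
    field_simp
    ring

end

end
end DiffLRV

namespace DiffLRV

noncomputable section

/-! ### Step means -/

/-- A mean with a single unit step at `T`, and a continuous part that is constant on the design. -/
def stepMean (T : ℕ → ℕ) (n : ℕ) : MeanFn :=
  if 2 ≤ T n ∧ T n ≤ n then
    { c := fun x => min x (1 / n)
      J := 1
      T := fun j => if j = 0 then 1 else if j = 1 then T n else n + 1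
      ξ := fun j => j }
  else
    { c := fun _ => 0
      J := 0
      T := fun j => if j = 0 then 1 else n + 1
      ξ := fun _ => 0 }

lemma stepMean_valid (T : ℕ → ℕ) {n : ℕ} (hn : 1 ≤ n) : (stepMean T n).Valid n := by
  unfold stepMean
  split_ifs with h
  · refine ⟨by fun_prop, by simp, by simp, ?_, ?_⟩
    · intro j hj
      have : j = 0 ∨ j = 1 := by simp only at hj; omega
      rcases this with rfl | rfl
      · simp; omega
      · simp; omega
    · intro j hj
      push_cast
      simp
  · refine ⟨by fun_prop, by simp, by simp, ?_, ?_⟩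
    · intro j hj
      have : j = 0 := by simp only at hj; omega
      subst this
      simp; omega
    · intro j hj
      simp at hj

/-- The class demands a continuous part whose slopes are bounded away from zero. The ramp min(x,
1/n) supplies slope 1 before the first design point, where it is never observed. -/
lemma mildMean_stepMean {T : ℕ → ℕ} (hT : ∀ᶠ n in atTop, 2 ≤ T n ∧ T n ≤ n) :
    MildMean (stepMean T) := by
  refine ⟨fun n hn => stepMean_valid T hn, 1, one_pos, ?_⟩
  filter_upwards [hT, eventually_ge_atTop 1] with n hTn hn
  have hn0 : (0 : ℝ) < n := by exact_mod_cast hn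
  have hn1 : (1 : ℝ) ≤ n := by exact_mod_cast hn
  have hs : (stepMean T n).maxStep = 1 := by
    unfold MeanFn.maxStep stepMean
    rw [if_pos hTn]
    simp
  have hc : IsLUB (stepMean T n).slopes 1 := by
    have hsl : (stepMean T n).slopes = {r | ∃ x' x : ℝ, 0 ≤ x' ∧ x' < x ∧ x ≤ 1 ∧
        r = |(min x (1 / (n : ℝ)) - min x' (1 / (n : ℝ))) / (x - x')|} := by
      unfold MeanFn.slopes stepMean
      rw [if_pos hTn]
    rw [hsl]
    refine IsGreatest.isLUB ⟨⟨0, 1 / n, le_rfl, by positivity, ?_, ?_⟩, ?_⟩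
    · rw [div_le_one hn0]; exact hn1
    · rw [min_self, min_eq_left (by positivity), sub_zero, div_self (by positivity), abs_one]
    · rintro r ⟨x', x, -, hlt, -, rfl⟩
      rw [abs_div, div_le_one (abs_pos.2 (by linarith))]
      have := abs_min_sub_min_le_max x (1 / (n : ℝ)) x' (1 / (n : ℝ))
      simpa using this
  refine ⟨?_, ?_, 1, hc, by norm_num, le_rfl⟩
  · unfold stepMean; rw [if_pos hTn]; simp
  · rw [hs]; simp

lemma eval_stepMean {T : ℕ → ℕ} {n : ℕ} (hT : 2 ≤ T n ∧ T n ≤ n) {k : ℤ} (hk1 : 1 ≤ k)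
    (hkn : k ≤ n) : (stepMean T n).eval n ((k : ℝ) / n) = 1 / n + stepFn (T n) k := by
  have hn : 1 ≤ n := by omega
  have hn0 : (0 : ℝ) < n := by exact_mod_cast hn
  rw [(stepMean_valid T hn).eval_eq hk1 hkn]
  unfold stepMean
  rw [if_pos hT]
  have : min ((k : ℝ) / n) (1 / n) = 1 / n := by
    apply min_eq_right
    gcongr
    exact_mod_cast hk1
  simp only [this]
  simp

lemma meanBias_stepMean (K : ℝ → ℝ) (t : Tuning) (N : Noise) {T : ℕ → ℕ} {n : ℕ}
    (hT : 2 ≤ T n ∧ T n ≤ n) (hd : ∑ j ∈ Finset.range (t.m n + 1), t.d n j = 0) :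
    meanBias K t n (DGM.mu ⟨N, stepMean T⟩ n) = meanBias K t n (stepFn (T n)) := by
  have h : ∀ i ∈ win n (t.m n) (t.h n), diffStat (t.m n) (t.h n) (t.d n)
      (DGM.mu ⟨N, stepMean T⟩ n) i = diffStat (t.m n) (t.h n) (t.d n) (stepFn (T n)) i := by
    intro i hi
    rw [diffStat_congr (t.d n) (X := DGM.mu ⟨N, stepMean T⟩ n)
      (Y := fun k => 1 / (n : ℝ) + stepFn (T n) k) (fun k hk1 hkn => eval_stepMean hT hk1 hkn) hi,
      diffStat_add _ _ _ (fun _ => 1 / (n : ℝ)) (stepFn (T n)), diffStat_const _ hd, zero_add]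
  unfold meanBias
  congr 1
  refine Finset.sum_congr rfl fun i hi => Finset.sum_congr rfl fun k hk => ?_
  rw [h i hi, h k hk]

/-- A step at the last observation is invisible up to `1 / n`. -/
lemma meanBias_stepFn_last {K : ℝ → ℝ} (hK : IsKernel K) (t : Tuning) {n : ℕ}
    (hh : 1 ≤ t.h n) (hmh : t.m n * t.h n + 1 ≤ n)
    (hd : ∑ j ∈ Finset.range (t.m n + 1), t.d n j ^ 2 = 1) :
    0 ≤ meanBias K t n (stepFn n) ∧ meanBias K t n (stepFn n) ≤ 1 / n := by
  have hn0 : (0 : ℝ) < n := by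
    have : 0 < n := by omega
    exact_mod_cast this
  set D := diffStat (t.m n) (t.h n) (t.d n) (stepFn n) with hD
  have hz : ∀ i ∈ win n (t.m n) (t.h n), i ≠ n → D i = 0 := by
    intro i hi hne
    rw [Finset.mem_Icc] at hi
    exact diffStat_stepFn_of_lt _ (lt_of_le_of_ne hi.2 hne)
  have hDn : D n = t.d n 0 := by
    rw [hD, diffStat, Finset.sum_eq_single 0]
    · simp [stepFn]
    · intro j _ hj
      have : ¬ ((n : ℤ) ≤ n - j * t.h n) := by
        have : 0 < j * t.h n := Nat.mul_pos (by omega) (by omega)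
        have : (0 : ℤ) < j * t.h n := by exact_mod_cast this
        omega
      rw [stepFn, if_neg this, mul_zero]
    · simp
  have hnmem : (n : ℤ) ∈ win n (t.m n) (t.h n) := by
    rw [Finset.mem_Icc]; constructor
    · exact_mod_cast hmh
    · exact le_rfl
  have hval : meanBias K t n (stepFn n) = 1 / n * t.d n 0 ^ 2 := by
    rw [meanBias, Finset.sum_eq_single (n : ℤ), Finset.sum_eq_single (n : ℤ)]
    · rw [← hD, hDn, sub_self]; simp [hK.zero, sq]
    · intro k hk hkn; rw [← hD, hz k hk hkn, mul_zero, mul_zero]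
    · exact fun h => absurd hnmem h
    · intro i hi hin
      refine Finset.sum_eq_zero fun k _ => ?_
      rw [← hD, hz i hi hin, zero_mul, mul_zero]
    · exact fun h => absurd hnmem h
  have h1 : t.d n 0 ^ 2 ≤ 1 := by
    rw [← hd]
    exact Finset.single_le_sum (f := fun j => t.d n j ^ 2) (fun j _ => sq_nonneg _) (by simp)
  rw [hval]
  refine ⟨by positivity, ?_⟩
  exact mul_le_of_le_one_right (by positivity) h1

/-! ### Increments of a differenced step -/

/-- The overlap sum `∑_s δ_s (k - |s| h)₊`. -/
def overlap (m h : ℕ) (d : ℕ → ℝ) (k : ℕ) : ℝ :=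
  ∑ s ∈ Finset.Icc (-(m : ℤ)) m, delta m d s * max ((k : ℝ) - |(s : ℝ)| * h) 0

/-- The increment is the combination with weights d_j of the indicators of [T + jh, T + jh + k), and
two such intervals share (k - |j - j'|h)₊ points. -/
lemma sum_sq_increment_eq (m h : ℕ) (d : ℕ → ℝ) (T : ℤ) (k : ℕ) :
    ∑ i ∈ Finset.Ico T (T + m * h + k),
      (diffStat m h d (stepFn T) i - diffStat m h d (stepFn T) (i - k)) ^ 2 = overlap m h d k := by
  set e : ℕ → ℤ → ℝ := fun j i => if T + j * h ≤ i ∧ i < T + j * h + k then 1 else 0 with he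
  have h1 : ∀ i, diffStat m h d (stepFn T) i - diffStat m h d (stepFn T) (i - k) =
      ∑ j ∈ Finset.range (m + 1), d j * e j i := by
    intro i
    rw [diffStat, diffStat, ← Finset.sum_sub_distrib]
    refine Finset.sum_congr rfl fun j _ => ?_
    rw [← mul_sub]
    congr 1
    simp only [stepFn, he]
    by_cases ha : T ≤ i - j * h <;> by_cases hb : T ≤ i - k - j * h
    · rw [if_pos ha, if_pos hb, if_neg (by omega)]; ring
    · rw [if_pos ha, if_neg hb, if_pos (by omega)]; ring
    · omega
    · rw [if_neg ha, if_neg hb, if_neg (by omega)]; ring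
  have h2 : ∀ j ∈ Finset.range (m + 1), ∀ j' ∈ Finset.range (m + 1),
      ∑ i ∈ Finset.Ico T (T + m * h + k), e j i * e j' i =
        max ((k : ℝ) - |(((j : ℤ) - j' : ℤ) : ℝ)| * h) 0 := by
    intro j hj j' hj'
    have hjm : (j : ℤ) * h ≤ m * h := by
      have : j * h ≤ m * h := Nat.mul_le_mul_right _ (by rw [Finset.mem_range] at hj; omega)
      exact_mod_cast this
    have hjm' : (j' : ℤ) * h ≤ m * h := by
      have : j' * h ≤ m * h := Nat.mul_le_mul_right _ (by rw [Finset.mem_range] at hj'; omega)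
      exact_mod_cast this
    have hj0 : (0 : ℤ) ≤ (j : ℤ) * h := by positivity
    have hj0' : (0 : ℤ) ≤ (j' : ℤ) * h := by positivity
    have hprod : ∀ i, e j i * e j' i = if i ∈ Finset.Ico (T + max ((j : ℤ) * h) (j' * h))
        (T + min ((j : ℤ) * h) (j' * h) + k) then 1 else 0 := by
      intro i
      simp only [he, Finset.mem_Ico]
      by_cases ha : T + j * h ≤ i ∧ i < T + j * h + k <;>
        by_cases hb : T + j' * h ≤ i ∧ i < T + j' * h + k
      · rw [if_pos ha, if_pos hb, if_pos (by omega), mul_one]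
      · rw [if_neg hb, mul_zero, if_neg (by omega)]
      · rw [if_neg ha, zero_mul, if_neg (by omega)]
      · rw [if_neg ha, zero_mul, if_neg (by omega)]
    simp only [hprod]
    rw [← Finset.sum_filter, Finset.sum_const, nsmul_eq_mul, mul_one]
    have hfil : (Finset.Ico T (T + m * h + k)).filter (fun i => i ∈ Finset.Ico
        (T + max ((j : ℤ) * h) (j' * h)) (T + min ((j : ℤ) * h) (j' * h) + k)) =
        Finset.Ico (T + max ((j : ℤ) * h) (j' * h)) (T + min ((j : ℤ) * h) (j' * h) + k) := by
      ext i
      simp only [Finset.mem_filter, Finset.mem_Ico]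
      omega
    rw [hfil, Int.card_Ico]
    have habs : |(((j : ℤ) - j' : ℤ) : ℝ)| * h =
        ((max ((j : ℤ) * h) (j' * h) - min ((j : ℤ) * h) (j' * h) : ℤ) : ℝ) := by
      rw [max_sub_min_eq_abs', ← sub_mul]
      push_cast
      rw [abs_mul, Nat.abs_cast]
    rw [habs]
    have hc : (((T + min ((j : ℤ) * h) (j' * h) + k - (T + max ((j : ℤ) * h) (j' * h))).toNat : ℤ) : ℝ) =
        ((max ((k : ℤ) - (max ((j : ℤ) * h) (j' * h) - min ((j : ℤ) * h) (j' * h))) 0 : ℤ) : ℝ) := by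
      rw [Int.toNat_eq_max]
      congr 2
      ring
    rw [Int.cast_natCast] at hc
    rw [hc]
    push_cast
    rfl
  simp only [h1, sq, Finset.sum_mul_sum]
  rw [Finset.sum_comm, overlap, ← sum_sum_eq_sum_delta m d fun s =>
    max ((k : ℝ) - |(s : ℝ)| * h) 0]
  refine Finset.sum_congr rfl fun j hj => ?_
  rw [Finset.sum_comm]
  refine Finset.sum_congr rfl fun j' hj' => ?_
  rw [← h2 j hj j' hj', Finset.mul_sum]
  exact Finset.sum_congr rfl fun i _ => by ring

lemma sum_sq_increment_le {m h : ℕ} {d : ℕ → ℝ} (hd : ∑ j ∈ Finset.range (m + 1), d j = 0) (T : ℤ)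
    (k : ℕ) (I : Finset ℤ) :
    ∑ i ∈ I, (diffStat m h d (stepFn T) i - diffStat m h d (stepFn T) (i - k)) ^ 2 ≤
      overlap m h d k := by
  rw [← sum_sq_increment_eq m h d T k]
  have hz : ∀ i ∉ Finset.Ico T (T + m * h + k),
      (diffStat m h d (stepFn T) i - diffStat m h d (stepFn T) (i - k)) ^ 2 = 0 := by
    intro i hi
    rw [Finset.mem_Ico, not_and_or, not_le, not_lt] at hi
    rcases hi with hi | hi
    · rw [diffStat_stepFn_of_lt d hi, diffStat_stepFn_of_lt d (by omega)]; norm_num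
    · rw [diffStat_stepFn_of_ge hd (by omega), diffStat_stepFn_of_ge hd (by omega)]; norm_num
  calc _ ≤ ∑ i ∈ I ∪ Finset.Ico T (T + m * h + k),
        (diffStat m h d (stepFn T) i - diffStat m h d (stepFn T) (i - k)) ^ 2 :=
        Finset.sum_le_sum_of_subset_of_nonneg Finset.subset_union_left fun _ _ _ => sq_nonneg _
    _ = _ := (Finset.sum_subset Finset.subset_union_right fun i _ hi => hz i hi).symm

lemma sum_sq_diffStat_le {n m h : ℕ} {d : ℕ → ℝ} (hd : ∑ j ∈ Finset.range (m + 1), d j = 0) {T : ℤ}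
    (hT : (m : ℤ) * h + 1 ≤ T) (hT' : T + m * h ≤ n) (I : Finset ℤ) :
    ∑ i ∈ I, diffStat m h d (stepFn T) i ^ 2 ≤
      ∑ i ∈ win n m h, diffStat m h d (stepFn T) i ^ 2 := by
  calc _ ≤ ∑ i ∈ I ∪ win n m h, diffStat m h d (stepFn T) i ^ 2 :=
        Finset.sum_le_sum_of_subset_of_nonneg Finset.subset_union_left fun _ _ _ => sq_nonneg _
    _ = _ := by
        refine (Finset.sum_subset Finset.subset_union_right fun i _ hi => ?_).symm
        rw [Finset.mem_Icc, not_and_or, not_le, not_le] at hi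
        rcases hi with hi | hi
        · rw [diffStat_stepFn_of_lt d (by omega)]; norm_num
        · rw [diffStat_stepFn_of_ge hd (by omega)]; norm_num

/-- The energy of a differenced step dominates its overlap sums. -/
lemma overlap_le_energy {n m h : ℕ} {d : ℕ → ℝ} (hd : ∑ j ∈ Finset.range (m + 1), d j = 0) {T : ℤ}
    (hT : (m : ℤ) * h + 1 ≤ T) (hT' : T + m * h ≤ n) (k : ℕ) :
    overlap m h d k ≤ 4 * ∑ i ∈ win n m h, diffStat m h d (stepFn T) i ^ 2 := by
  rw [← sum_sq_increment_eq m h d T k]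
  set D := diffStat m h d (stepFn T)
  set I := Finset.Ico T (T + m * h + k)
  have h1 : ∑ i ∈ I, D (i - k) ^ 2 ≤ ∑ i ∈ win n m h, D i ^ 2 := by
    have := sum_sq_diffStat_le hd hT hT' (I.map ⟨fun i => i - (k : ℤ), sub_left_injective⟩)
    rwa [Finset.sum_map] at this
  have h2 := sum_sq_diffStat_le hd hT hT' I
  calc _ ≤ ∑ i ∈ I, (2 * D i ^ 2 + 2 * D (i - k) ^ 2) := Finset.sum_le_sum fun i _ => by
        nlinarith [sq_nonneg (D i + D (i - k))]
    _ = 2 * ∑ i ∈ I, D i ^ 2 + 2 * ∑ i ∈ I, D (i - k) ^ 2 := by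
        rw [Finset.sum_add_distrib, Finset.mul_sum, Finset.mul_sum]
    _ ≤ _ := by linarith

lemma sum_kernel_window {K : ℝ → ℝ} (hK : IsKernel K) {n m h ℓ : ℕ} (hℓ : 1 ≤ ℓ) {i : ℤ}
    (hi : (m : ℤ) * h + ℓ ≤ i) (hi' : i + ℓ ≤ n) :
    ∑ k ∈ win n m h, K (((i - k : ℤ) : ℝ) / ℓ) = ∑ k ∈ Finset.Ioo (-(ℓ : ℤ)) ℓ, K ((k : ℝ) / ℓ) := by
  symm
  have : ∑ k ∈ Finset.Ioo (-(ℓ : ℤ)) ℓ, K ((k : ℝ) / ℓ) =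
      ∑ k ∈ Finset.Ioo (i - ℓ) (i + ℓ), K (((i - k : ℤ) : ℝ) / ℓ) := by
    refine Finset.sum_bij' (fun k _ => i - k) (fun k _ => i - k) ?_ ?_ ?_ ?_ ?_
    · intro k hk; rw [Finset.mem_Ioo] at *; omega
    · intro k hk; rw [Finset.mem_Ioo] at *; omega
    · intro k _; ring
    · intro k _; ring
    · intro k _; rw [sub_sub_cancel]
  rw [this]
  refine Finset.sum_subset ?_ ?_
  · intro k hk; rw [Finset.mem_Ioo] at hk; rw [Finset.mem_Icc]; omega
  · intro k _ hk
    rw [Finset.mem_Ioo] at hk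
    exact kernel_eq_zero hK hℓ (by rw [le_abs]; omega)

/-- Polarisation, 2 D_i D_k = D_i² + D_k² - (D_i - D_k)². The squares give the kernel sum times the
energy; the increments occur only at lags below ℓ, where the overlap sums bound them. -/
lemma abs_meanBias_stepFn_sub_le {K : ℝ → ℝ} (hK : IsKernel K) {A : ℝ} (hA : ∀ x, |K x| ≤ A)
    (t : Tuning) {n : ℕ} (hn : 1 ≤ n) (hℓ : 1 ≤ t.ℓ n)
    (hd : ∑ j ∈ Finset.range (t.m n + 1), t.d n j = 0) {T : ℤ}
    (hT : (t.m n : ℤ) * t.h n + t.ℓ n ≤ T) (hT' : T + t.m n * t.h n + t.ℓ n ≤ n) {b : ℝ}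
    (hover : ∀ k : ℕ, k < t.ℓ n → overlap (t.m n) (t.h n) (t.d n) k ≤ b) :
    |n * meanBias K t n (stepFn T) - (∑ k ∈ Finset.Ioo (-(t.ℓ n : ℤ)) (t.ℓ n), K ((k : ℝ) / t.ℓ n)) *
      meanEnergy t n (stepFn T)| ≤ A * t.ℓ n * b := by
  have hn0 : (0 : ℝ) < n := by exact_mod_cast hn
  set I := win n (t.m n) (t.h n) with hI
  set D := diffStat (t.m n) (t.h n) (t.d n) (stepFn T) with hD
  set ℓ := t.ℓ n with hℓd
  set κ := ∑ k ∈ Finset.Ioo (-(ℓ : ℤ)) ℓ, K ((k : ℝ) / ℓ) with hκ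
  -- Where D_i does not vanish, i is far enough from both ends of the window to see the whole
  -- kernel.
  have hrow : ∀ i ∈ I, D i ^ 2 * ∑ k ∈ I, K (((i - k : ℤ) : ℝ) / ℓ) = D i ^ 2 * κ := by
    intro i _
    by_cases h : T ≤ i ∧ i < T + t.m n * t.h n
    · rw [sum_kernel_window hK hℓ (by omega) (by omega)]
    · rw [not_and_or, not_le, not_lt] at h
      rcases h with h | h
      · rw [hD, diffStat_stepFn_of_lt _ h]; norm_num
      · rw [hD, diffStat_stepFn_of_ge hd h]; norm_num
  have hsym : ∑ i ∈ I, ∑ k ∈ I, K (((i - k : ℤ) : ℝ) / ℓ) * D k ^ 2 =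
      ∑ i ∈ I, ∑ k ∈ I, K (((i - k : ℤ) : ℝ) / ℓ) * D i ^ 2 := by
    rw [Finset.sum_comm]
    refine Finset.sum_congr rfl fun i _ => Finset.sum_congr rfl fun k _ => ?_
    rw [kernel_swap hK]
  have hdiag : ∑ i ∈ I, ∑ k ∈ I, K (((i - k : ℤ) : ℝ) / ℓ) * D i ^ 2 = κ * ∑ i ∈ I, D i ^ 2 := by
    rw [Finset.mul_sum]
    refine Finset.sum_congr rfl fun i hi => ?_
    rw [← Finset.sum_mul, mul_comm, hrow i hi, mul_comm]
  have hsq : ∑ i ∈ I, ∑ k ∈ I, K (((i - k : ℤ) : ℝ) / ℓ) * (D i - D k) ^ 2 =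
      2 * (κ * ∑ i ∈ I, D i ^ 2) - 2 * ∑ i ∈ I, ∑ k ∈ I, K (((i - k : ℤ) : ℝ) / ℓ) * (D i * D k) := by
    calc _ = ∑ i ∈ I, ∑ k ∈ I, K (((i - k : ℤ) : ℝ) / ℓ) * D i ^ 2 +
          ∑ i ∈ I, ∑ k ∈ I, K (((i - k : ℤ) : ℝ) / ℓ) * D k ^ 2 -
          2 * ∑ i ∈ I, ∑ k ∈ I, K (((i - k : ℤ) : ℝ) / ℓ) * (D i * D k) := by
          simp only [Finset.mul_sum]
          rw [← Finset.sum_add_distrib, ← Finset.sum_sub_distrib]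
          refine Finset.sum_congr rfl fun i _ => ?_
          rw [← Finset.sum_add_distrib, ← Finset.sum_sub_distrib]
          exact Finset.sum_congr rfl fun k _ => by ring
      _ = _ := by rw [hsym, hdiag]; ring
  have hA0 : 0 ≤ A := (abs_nonneg _).trans (hA 0)
  have hlag : ∀ r ∈ Finset.Ioo (-(ℓ : ℤ)) ℓ, ∑ i ∈ I, (D i - D (i - r)) ^ 2 ≤ b := by
    intro r hr
    rw [Finset.mem_Ioo] at hr
    rcases le_total 0 r with h0 | h0
    · lift r to ℕ using h0
      exact (sum_sq_increment_le hd T r I).trans (hover r (by omega))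
    · obtain ⟨k, hk⟩ := Int.exists_eq_neg_ofNat h0
      have := (sum_sq_increment_le (h := t.h n) hd T k
        (I.map ⟨fun i => i + (k : ℤ), add_left_injective _⟩)).trans (hover k (by omega))
      rw [Finset.sum_map] at this
      refine le_trans (le_of_eq ?_) this
      refine Finset.sum_congr rfl fun i _ => ?_
      simp only [Function.Embedding.coeFn_mk, add_sub_cancel_right, hk, sub_neg_eq_add]
      ring
  have hb0 : 0 ≤ b := le_trans (Finset.sum_nonneg fun _ _ => sq_nonneg _)
    (hlag 0 (by rw [Finset.mem_Ioo]; omega))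
  have hbound : |∑ i ∈ I, ∑ k ∈ I, K (((i - k : ℤ) : ℝ) / ℓ) * (D i - D k) ^ 2| ≤ A * (2 * ℓ * b) := by
    calc _ ≤ ∑ i ∈ I, ∑ k ∈ I, |K (((i - k : ℤ) : ℝ) / ℓ)| * (D i - D k) ^ 2 := by
          refine (Finset.abs_sum_le_sum_abs _ _).trans (Finset.sum_le_sum fun i _ => ?_)
          refine (Finset.abs_sum_le_sum_abs _ _).trans (Finset.sum_le_sum fun k _ => ?_)
          rw [abs_mul, abs_of_nonneg (sq_nonneg (D i - D k))]
      _ ≤ ∑ i ∈ I, ∑ r ∈ Finset.Ioo (-(ℓ : ℤ)) ℓ, A * (D i - D (i - r)) ^ 2 := by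
          refine Finset.sum_le_sum fun i _ => ?_
          calc _ ≤ ∑ k ∈ I ∪ Finset.Ioo (i - ℓ) (i + ℓ), |K (((i - k : ℤ) : ℝ) / ℓ)| * (D i - D k) ^ 2 :=
                Finset.sum_le_sum_of_subset_of_nonneg Finset.subset_union_left
                  fun _ _ _ => by positivity
            _ = ∑ k ∈ Finset.Ioo (i - ℓ) (i + ℓ), |K (((i - k : ℤ) : ℝ) / ℓ)| * (D i - D k) ^ 2 := by
                refine (Finset.sum_subset Finset.subset_union_right fun k _ hk => ?_).symm
                rw [Finset.mem_Ioo] at hk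
                rw [kernel_eq_zero hK hℓ (by rw [le_abs]; omega), abs_zero, zero_mul]
            _ = ∑ r ∈ Finset.Ioo (-(ℓ : ℤ)) ℓ, |K ((r : ℝ) / ℓ)| * (D i - D (i - r)) ^ 2 := by
                refine Finset.sum_bij' (fun k _ => i - k) (fun k _ => i - k) ?_ ?_ ?_ ?_ ?_
                · intro k hk; rw [Finset.mem_Ioo] at *; omega
                · intro k hk; rw [Finset.mem_Ioo] at *; omega
                · intro k _; ring
                · intro k _; ring
                · intro k _; rw [sub_sub_cancel]
            _ ≤ _ := Finset.sum_le_sum fun r _ => by gcongr; exact hA _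
      _ = A * ∑ r ∈ Finset.Ioo (-(ℓ : ℤ)) ℓ, ∑ i ∈ I, (D i - D (i - r)) ^ 2 := by
          rw [Finset.sum_comm]
          simp only [Finset.mul_sum]
      _ ≤ A * (2 * ℓ * b) := by
          gcongr
          refine (Finset.sum_le_sum hlag).trans ?_
          rw [Finset.sum_const, nsmul_eq_mul]
          gcongr
          rw [Int.card_Ioo]
          have : ((ℓ : ℤ) - -ℓ - 1).toNat ≤ 2 * ℓ := by omega
          exact_mod_cast this
  rw [hsq] at hbound
  rw [meanBias, meanEnergy, ← mul_assoc, mul_one_div_cancel hn0.ne', one_mul]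
  rw [← mul_sub, abs_mul, abs_of_pos (by norm_num : (0 : ℝ) < 2), abs_sub_comm] at hbound
  linarith

end
end DiffLRV

namespace DiffLRV

noncomputable section

/-! ### Kernel asymptotics -/

/-- The sum is the integral of a step function. Rounding down adds only the lag -ℓ, where the kernel
vanishes, and makes the integrand measurable without any regularity of `K`. -/
lemma sum_kernel_eq_integral {K : ℝ → ℝ} (hK : IsKernel K) {ℓ : ℕ} (hℓ : 1 ≤ ℓ) :
    (∑ k ∈ Finset.Ioo (-(ℓ : ℤ)) ℓ, K ((k : ℝ) / ℓ)) / ℓ =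
      ∫ x in (-1 : ℝ)..1, K ((⌊x * ℓ⌋ : ℝ) / ℓ) := by
  have hℓ0 : (0 : ℝ) < ℓ := by exact_mod_cast hℓ
  obtain ⟨A, hA⟩ := hK.bounded
  have hmeas : Measurable fun x : ℝ => K ((⌊x * ℓ⌋ : ℝ) / ℓ) :=
    (measurable_of_countable fun z : ℤ => K ((z : ℝ) / ℓ)).comp
      (Int.measurable_floor.comp (measurable_id.mul_const (ℓ : ℝ)))
  have hintg : ∀ a b : ℝ, IntervalIntegrable (fun x : ℝ => K ((⌊x * ℓ⌋ : ℝ) / ℓ)) volume a b :=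
    fun a b => (intervalIntegrable_const (c := A)).mono_fun hmeas.aestronglyMeasurable
      (ae_of_all _ fun x => by
        simp only [Real.norm_eq_abs]
        exact (hA _).trans (le_abs_self A))
  have h1 := intervalIntegral.sum_integral_adjacent_intervals
    (a := fun j : ℕ => -1 + (j : ℝ) / ℓ) (n := 2 * ℓ) fun k _ => hintg (-1 + (k : ℝ) / ℓ) _
  have e0 : (-1 : ℝ) + ((0 : ℕ) : ℝ) / ℓ = -1 := by simp
  have e1 : (-1 : ℝ) + ((2 * ℓ : ℕ) : ℝ) / ℓ = 1 := by push_cast; field_simp; norm_num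
  rw [e0, e1] at h1
  rw [← h1]
  have h2 : ∀ j : ℕ, ∫ x in (-1 + (j : ℝ) / ℓ)..(-1 + ((j + 1 : ℕ) : ℝ) / ℓ),
      K ((⌊x * ℓ⌋ : ℝ) / ℓ) = K (((j - ℓ : ℤ) : ℝ) / ℓ) / ℓ := by
    intro j
    rw [intervalIntegral.integral_congr_Ioo_of_le (g := fun _ => K (((j - ℓ : ℤ) : ℝ) / ℓ))]
    · rw [intervalIntegral.integral_const, smul_eq_mul]
      push_cast
      field_simp
      ring
    · gcongr; simp
    · intro x hx
      have hx1 : (j : ℝ) - ℓ < x * ℓ := by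
        have := mul_lt_mul_of_pos_right hx.1 hℓ0
        rw [add_mul, div_mul_cancel₀ _ hℓ0.ne'] at this
        linarith
      have hx2 : x * ℓ < (j : ℝ) - ℓ + 1 := by
        have := mul_lt_mul_of_pos_right hx.2 hℓ0
        rw [add_mul, div_mul_cancel₀ _ hℓ0.ne'] at this
        push_cast at this
        linarith
      have : ⌊x * ℓ⌋ = (j - ℓ : ℤ) := by
        rw [Int.floor_eq_iff]
        push_cast
        exact ⟨hx1.le, hx2⟩
      simp only [this]
  simp only [h2]
  rw [← Finset.sum_div]
  congr 1
  have h3 : ∑ k ∈ Finset.Ioo (-(ℓ : ℤ)) ℓ, K ((k : ℝ) / ℓ) =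
      ∑ k ∈ Finset.Ico (-(ℓ : ℤ)) ℓ, K ((k : ℝ) / ℓ) := by
    refine Finset.sum_subset Finset.Ioo_subset_Ico_self fun k hk hk' => ?_
    rw [Finset.mem_Ico] at hk
    rw [Finset.mem_Ioo] at hk'
    exact kernel_eq_zero hK hℓ (by rw [le_abs]; omega)
  rw [h3]
  refine Finset.sum_bij' (fun k _ => (k + ℓ).toNat) (fun j _ => (j : ℤ) - ℓ) ?_ ?_ ?_ ?_ ?_
  · intro k hk; rw [Finset.mem_Ico] at hk; rw [Finset.mem_range]; omega
  · intro j hj; rw [Finset.mem_range] at hj; rw [Finset.mem_Ico]; omega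
  · intro k hk; rw [Finset.mem_Ico] at hk; omega
  · intro j _; simp
  · intro k hk
    rw [Finset.mem_Ico] at hk
    have : (((k + ℓ).toNat : ℤ) - ℓ) = k := by omega
    rw [this]

/-- The Riemann sums of the kernel converge to `κ`. -/
lemma tendsto_sum_kernel {K : ℝ → ℝ} (hK : IsKernel K) :
    Tendsto (fun ℓ : ℕ => (∑ k ∈ Finset.Ioo (-(ℓ : ℤ)) ℓ, K ((k : ℝ) / ℓ)) / ℓ) atTop
      (𝓝 (kappa K)) := by
  obtain ⟨A, hA⟩ := hK.bounded
  have h : Tendsto (fun ℓ : ℕ => ∫ x in (-1 : ℝ)..1, K ((⌊x * ℓ⌋ : ℝ) / ℓ)) atTop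
      (𝓝 (∫ x in (-1 : ℝ)..1, K x)) := by
    refine intervalIntegral.tendsto_integral_filter_of_dominated_convergence (fun _ => A) ?_ ?_ ?_ ?_
    · refine Eventually.of_forall fun ℓ => Measurable.aestronglyMeasurable ?_
      exact (measurable_of_countable fun z : ℤ => K ((z : ℝ) / ℓ)).comp
        (Int.measurable_floor.comp (measurable_id.mul_const (ℓ : ℝ)))
    · exact Eventually.of_forall fun ℓ => ae_of_all _ fun x _ => hA _
    · exact intervalIntegrable_const
    · have hne : ∀ᵐ x : ℝ, x ≠ 1 := by
        rw [ae_iff]; simp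
      filter_upwards [hne] with x hx1 hx
      rw [Set.uIoc_of_le (by norm_num)] at hx
      have hmem : x ∈ Set.Ioo (-1 : ℝ) 1 := ⟨hx.1, lt_of_le_of_ne hx.2 hx1⟩
      have hc : ContinuousAt K x := hK.continuousOn.continuousAt (isOpen_Ioo.mem_nhds hmem)
      refine hc.tendsto.comp ?_
      have hinv : Tendsto (fun ℓ : ℕ => x - 1 / (ℓ : ℝ)) atTop (𝓝 x) := by
        simpa using tendsto_const_nhds.sub (tendsto_one_div_atTop_nhds_zero_nat (𝕜 := ℝ))
      refine tendsto_of_tendsto_of_tendsto_of_le_of_le' hinv tendsto_const_nhds ?_ ?_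
      · filter_upwards [eventually_ge_atTop 1] with ℓ hℓ
        have hℓ0 : (0 : ℝ) < ℓ := by exact_mod_cast hℓ
        rw [le_div_iff₀ hℓ0, sub_mul, one_div, inv_mul_cancel₀ hℓ0.ne']
        exact (Int.sub_one_lt_floor _).le
      · filter_upwards [eventually_ge_atTop 1] with ℓ hℓ
        have hℓ0 : (0 : ℝ) < ℓ := by exact_mod_cast hℓ
        rw [div_le_iff₀ hℓ0]
        exact Int.floor_le _
  refine h.congr' ?_
  filter_upwards [eventually_ge_atTop 1] with ℓ hℓ
  exact (sum_kernel_eq_integral hK hℓ).symm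

lemma IsKernel.apply_abs {K : ℝ → ℝ} (hK : IsKernel K) (x : ℝ) : K |x| = K x := by
  rcases abs_choice x with h | h <;> rw [h]
  exact hK.even x

/-- Near the origin, `ℓ ^ q (K (u / ℓ) - 1) → B |u| ^ q`. -/
lemma tendsto_kernel_origin {K : ℝ → ℝ} (hK : IsKernel K) {q : ℕ} (hq1 : 1 ≤ q) {B : ℝ}
    (hB : Tendsto (fun t : ℝ => (K t - K 0) / |t| ^ q) (𝓝[>] 0) (𝓝 B)) (u : ℤ) :
    Tendsto (fun ℓ : ℕ => (ℓ : ℝ) ^ q * (K ((u : ℝ) / ℓ) - 1)) atTop (𝓝 (B * |(u : ℝ)| ^ q)) := by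
  rcases eq_or_ne u 0 with rfl | hu
  · simp [hK.zero, show q ≠ 0 by omega]
  have hu0 : 0 < |(u : ℝ)| := abs_pos.2 (by exact_mod_cast hu)
  have h1 : Tendsto (fun ℓ : ℕ => |(u : ℝ)| / ℓ) atTop (𝓝[>] 0) := by
    refine tendsto_nhdsWithin_iff.2 ⟨tendsto_const_div_atTop_nhds_zero_nat _, ?_⟩
    filter_upwards [eventually_ge_atTop 1] with ℓ hℓ
    have hℓ0 : (0 : ℝ) < ℓ := by exact_mod_cast hℓ
    exact Set.mem_Ioi.2 (by positivity)
  refine ((hB.comp h1).mul_const (|(u : ℝ)| ^ q)).congr' ?_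
  filter_upwards [eventually_ge_atTop 1] with ℓ hℓ
  have hℓ0 : (0 : ℝ) < ℓ := by exact_mod_cast hℓ
  have : K (|(u : ℝ)| / ℓ) = K ((u : ℝ) / ℓ) := by
    rw [← hK.apply_abs ((u : ℝ) / ℓ), abs_div, Nat.abs_cast]
  simp only [Function.comp_apply]
  rw [this, hK.zero, abs_of_pos (by positivity : (0 : ℝ) < |(u : ℝ)| / ℓ), div_pow]
  field_simp

/-- Near the boundary, `ℓ ^ q' K ((ℓ - y) / ℓ) → -B' y₊ ^ q'`. -/
lemma tendsto_kernel_boundary {K : ℝ → ℝ} (hK : IsKernel K) {q' : ℕ} (hq1 : 1 ≤ q') {B' : ℝ}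
    (hB : Tendsto (fun t : ℝ => (K 1 - K (1 - t)) / |t| ^ q') (𝓝[>] 0) (𝓝 B')) (y : ℤ) :
    Tendsto (fun ℓ : ℕ => (ℓ : ℝ) ^ q' * K (((ℓ - y : ℤ) : ℝ) / ℓ)) atTop
      (𝓝 (-B' * (max (y : ℝ) 0) ^ q')) := by
  rcases le_or_gt y 0 with hy | hy
  · have : max (y : ℝ) 0 = 0 := max_eq_right (by exact_mod_cast hy)
    rw [this, zero_pow (by omega), mul_zero]
    refine tendsto_const_nhds.congr' ?_
    filter_upwards [eventually_ge_atTop 1] with ℓ hℓ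
    rw [kernel_eq_zero hK hℓ (by rw [le_abs]; omega), mul_zero]
  have hy0 : (0 : ℝ) < y := by exact_mod_cast hy
  have h1 : Tendsto (fun ℓ : ℕ => (y : ℝ) / ℓ) atTop (𝓝[>] 0) := by
    refine tendsto_nhdsWithin_iff.2 ⟨tendsto_const_div_atTop_nhds_zero_nat _, ?_⟩
    filter_upwards [eventually_ge_atTop 1] with ℓ hℓ
    have hℓ0 : (0 : ℝ) < ℓ := by exact_mod_cast hℓ
    exact Set.mem_Ioi.2 (by positivity)
  rw [max_eq_left hy0.le, neg_mul]
  refine ((hB.comp h1).mul_const ((y : ℝ) ^ q')).neg.congr' ?_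
  filter_upwards [eventually_ge_atTop 1] with ℓ hℓ
  have hℓ0 : (0 : ℝ) < ℓ := by exact_mod_cast hℓ
  have : 1 - (y : ℝ) / ℓ = ((ℓ - y : ℤ) : ℝ) / ℓ := by push_cast; field_simp
  simp only [Function.comp_apply]
  rw [this, hK.support 1 (by simp), abs_of_pos (by positivity : (0 : ℝ) < (y : ℝ) / ℓ), div_pow]
  field_simp
  ring

/-! ### The bias caused by a step in the middle of the sample -/

/-- The change point in the middle of the sample. -/
def midPoint (n : ℕ) : ℕ := n / 2 + 1

lemma midPoint_mem : ∀ᶠ n in atTop, 2 ≤ midPoint n ∧ midPoint n ≤ n := by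
  filter_upwards [eventually_ge_atTop 2] with n hn
  unfold midPoint
  omega

/-- If the differenced step has energy of order at least `ρ ≫ ℓ` and small increments over lags
below `ℓ`, then it causes a bias of order at least `ℓ ρ / n`. -/
theorem meanBias_mid_ge {K : ℝ → ℝ} (hK : IsKernel K) (hκ : kappa K ≠ 0) {t : Tuning}
    (ht : t.Admissible) (N : Noise) {ρ : ℕ → ℝ} {c : ℝ} (hc : 0 < c)
    (hρ : ∀ᶠ n in atTop, ∃ k, c * ρ n ≤ overlap (t.m n) (t.h n) (t.d n) k)
    (hℓρ : ∀ e : ℝ, 0 < e → ∀ᶠ n in atTop, (t.ℓ n : ℝ) ≤ e * ρ n)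
    (hover : ∀ᶠ n in atTop, ∀ k : ℕ, k < t.ℓ n →
      overlap (t.m n) (t.h n) (t.d n) k ≤ t.ℓ n) :
    ∃ c' : ℝ, 0 < c' ∧ ∀ᶠ n in atTop, c' * (t.ℓ n * ρ n / n) ≤
      |meanBias K t n (DGM.mu ⟨N, stepMean midPoint⟩ n)| := by
  obtain ⟨A, hA⟩ := hK.bounded
  have hA1 : 1 ≤ A := by
    have := hA 0
    rwa [hK.zero, abs_one] at this
  have hκ0 : 0 < |kappa K| := abs_pos.2 hκ
  refine ⟨|kappa K| * c / 16, by positivity, ?_⟩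
  have hRie := ((tendsto_sum_kernel hK).comp ht.bandwidth_tendsto).abs.eventually
    (lt_mem_nhds (show |kappa K| / 2 < |kappa K| by linarith))
  filter_upwards [ht.eventually_basic, ht.sum_zero, hρ, hover, hRie, midPoint_mem,
    hℓρ (|kappa K| * c / (16 * A)) (by positivity),
    ht.negligible.eventually (gt_mem_nhds (show (0 : ℝ) < 1 / 4 by norm_num)),
    eventually_ge_atTop 8] with n hb hd hρn hovern hR hmid hℓn hneg hn8
  obtain ⟨hn1, hℓ1, -, -, -⟩ := hb
  obtain ⟨k, hk⟩ := hρn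
  have hn0 : (0 : ℝ) < n := by exact_mod_cast hn1
  have hℓ0 : (0 : ℝ) < t.ℓ n := by exact_mod_cast hℓ1
  rw [meanBias_stepMean K t N hmid hd]
  have hsm : 4 * (t.ℓ n + t.m n * t.h n) < n := by
    rw [div_lt_iff₀ hn0] at hneg
    have : 4 * ((t.ℓ n : ℝ) + t.m n * t.h n) < n := by linarith
    exact_mod_cast this
  have hcast : ((t.m n * t.h n : ℕ) : ℤ) = (t.m n : ℤ) * t.h n := by push_cast; rfl
  have hT1 : (t.m n : ℤ) * t.h n + t.ℓ n ≤ (midPoint n : ℕ) := by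
    rw [← hcast]; unfold midPoint; omega
  have hT2 : ((midPoint n : ℕ) : ℤ) + t.m n * t.h n + t.ℓ n ≤ n := by
    rw [← hcast]; unfold midPoint; omega
  have hmain := abs_meanBias_stepFn_sub_le hK hA t hn1 hℓ1 hd hT1 hT2 hovern
  have hen : c * ρ n ≤ 4 * meanEnergy t n (stepFn (midPoint n)) :=
    hk.trans (overlap_le_energy hd (by omega) (by omega) k)
  set S := ∑ k ∈ Finset.Ioo (-(t.ℓ n : ℤ)) (t.ℓ n), K ((k : ℝ) / t.ℓ n)
  set E := meanEnergy t n (stepFn (midPoint n))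
  set b := meanBias K t n (stepFn (midPoint n))
  have hS : |kappa K| / 2 * t.ℓ n ≤ |S| := by
    simp only [Function.comp_apply] at hR
    rw [abs_div, Nat.abs_cast, lt_div_iff₀ hℓ0] at hR
    exact hR.le
  have hρ0 : 0 < ρ n := by
    by_contra hcon
    have : |kappa K| * c / (16 * A) * ρ n ≤ 0 :=
      mul_nonpos_of_nonneg_of_nonpos (by positivity) (not_lt.1 hcon)
    linarith
  have hE : c * ρ n / 4 ≤ E := by linarith
  have hE0 : 0 ≤ E := le_trans (by positivity) hE
  have h1 : |kappa K| / 2 * t.ℓ n * (c * ρ n / 4) ≤ |S * E| := by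
    rw [abs_mul, abs_of_nonneg hE0]; gcongr
  -- The increment error is at most half of the main term |κ|cℓρ/8; this is why ℓ ≤ eρ was taken
  -- with e = |κ|c/(16A).
  have h2 : A * t.ℓ n * t.ℓ n ≤ |kappa K| * c / 16 * (t.ℓ n * ρ n) := by
    calc A * t.ℓ n * t.ℓ n ≤ A * t.ℓ n * (|kappa K| * c / (16 * A) * ρ n) := by gcongr
      _ = _ := by field_simp
  have h3 : |S * E| ≤ |n * b| + A * t.ℓ n * t.ℓ n := by
    have : |S * E| - |n * b| ≤ |S * E - n * b| := abs_sub_abs_le_abs_sub _ _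
    rw [abs_sub_comm] at this
    linarith
  rw [← mul_div_assoc, div_le_iff₀ hn0]
  have h4 : |(n : ℝ) * b| = |b| * n := by rw [abs_mul, Nat.abs_cast, mul_comm]
  linarith

end
end DiffLRV

/-! ### Overlap sums and the mean bias they produce. -/

namespace DiffLRV

noncomputable section

lemma overlap_le_of_nonpos {m h : ℕ} {d : ℕ → ℝ} (hd : ∑ j ∈ Finset.range (m + 1), d j ^ 2 = 1)
    (hδ : ∀ s : ℤ, 1 ≤ |s| → |s| ≤ m → delta m d s ≤ 0) (k : ℕ) : overlap m h d k ≤ k := by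
  rw [overlap, ← Finset.add_sum_erase _ _ (show (0 : ℤ) ∈ Finset.Icc (-(m : ℤ)) m by simp),
    delta_zero, hd]
  have : ∑ s ∈ (Finset.Icc (-(m : ℤ)) m).erase 0, delta m d s * max ((k : ℝ) - |(s : ℝ)| * h) 0 ≤ 0 := by
    refine Finset.sum_nonpos fun s hs => mul_nonpos_of_nonpos_of_nonneg ?_ (le_max_right _ _)
    rw [Finset.mem_erase, Finset.mem_Icc, ← abs_le] at hs
    exact hδ s (Int.one_le_abs hs.1) hs.2
  simp only [Int.cast_zero, abs_zero, zero_mul, sub_zero, one_mul, Nat.cast_nonneg, max_eq_left]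
  linarith

lemma overlap_eq_of_le {m h : ℕ} {d : ℕ → ℝ} (hd : ∑ j ∈ Finset.range (m + 1), d j ^ 2 = 1)
    {k : ℕ} (hk : k ≤ h) : overlap m h d k = k := by
  rw [overlap, ← Finset.add_sum_erase _ _ (show (0 : ℤ) ∈ Finset.Icc (-(m : ℤ)) m by simp),
    delta_zero, hd, Finset.sum_eq_zero]
  · simp
  · intro s hs
    have hs0 : s ≠ 0 := (Finset.mem_erase.1 hs).1
    have h1 : (1 : ℝ) ≤ |(s : ℝ)| := by
      rw [← Int.cast_abs]; exact_mod_cast Int.one_le_abs hs0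
    have h2 : (k : ℝ) ≤ h := by exact_mod_cast hk
    have h0 : (0 : ℝ) ≤ h := by positivity
    rw [max_eq_right (by nlinarith), mul_zero]

/-- At lag (m + 1)h no positive part is truncated, so the constant in s cancels by ∑ δ_s = 0. What
is left is -h ∑ δ_s |s|, a sum of non-negative terms, at least hc|s|/m each. -/
lemma overlap_ge {m h : ℕ} (hm : 1 ≤ m) {d : ℕ → ℝ} (hd : ∑ j ∈ Finset.range (m + 1), d j = 0)
    {c : ℝ} (hc : 0 ≤ c) (hδ : ∀ s : ℤ, 1 ≤ |s| → |s| ≤ m → delta m d s ≤ -c / m) :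
    c / 2 * (m * h) ≤ overlap m h d ((m + 1) * h) := by
  have hm0 : (0 : ℝ) < m := by exact_mod_cast hm
  have h1 : overlap m h d ((m + 1) * h) =
      ∑ s ∈ Finset.Icc (-(m : ℤ)) m, -(delta m d s * |(s : ℝ)|) * h := by
    have hs0 := sum_delta m d
    rw [hd] at hs0
    calc overlap m h d ((m + 1) * h) = ∑ s ∈ Finset.Icc (-(m : ℤ)) m,
          (delta m d s * ((m + 1) * h) + -(delta m d s * |(s : ℝ)|) * h) := by
          refine Finset.sum_congr rfl fun s hs => ?_
          rw [Finset.mem_Icc, ← abs_le] at hs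
          have hs' : |(s : ℝ)| ≤ m := by rw [← Int.cast_abs]; exact_mod_cast hs
          have h0 : (0 : ℝ) ≤ h := by positivity
          rw [max_eq_left (by push_cast; nlinarith)]
          push_cast
          ring
      _ = _ := by
          rw [Finset.sum_add_distrib, ← Finset.sum_mul, hs0]
          ring
  rw [h1, ← Finset.sum_mul]
  have h2 : c / 2 * m ≤ ∑ s ∈ Finset.Icc (-(m : ℤ)) m, -(delta m d s * |(s : ℝ)|) := by
    have hterm : ∀ s ∈ Finset.Icc (-(m : ℤ)) m, c / m * |(s : ℝ)| ≤ -(delta m d s * |(s : ℝ)|) := by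
      intro s hs
      rw [Finset.mem_Icc, ← abs_le] at hs
      rcases eq_or_ne s 0 with rfl | h0
      · simp
      · have := hδ s (Int.one_le_abs h0) hs
        rw [neg_div] at this
        have ha := abs_nonneg (s : ℝ)
        nlinarith
    refine le_trans ?_ (Finset.sum_le_sum hterm)
    rw [← Finset.mul_sum]
    have h3 : ((m : ℝ) * (m + 1)) / 2 ≤ ∑ s ∈ Finset.Icc (-(m : ℤ)) m, |(s : ℝ)| := by
      have hinj : ∑ j ∈ Finset.range (m + 1), (j : ℝ) ≤ ∑ s ∈ Finset.Icc (-(m : ℤ)) m, |(s : ℝ)| := by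
        calc ∑ j ∈ Finset.range (m + 1), (j : ℝ) =
            ∑ s ∈ (Finset.range (m + 1)).map Nat.castEmbedding, |((s : ℤ) : ℝ)| := by
              rw [Finset.sum_map]; simp
          _ ≤ _ := by
              refine Finset.sum_le_sum_of_subset_of_nonneg ?_ fun _ _ _ => abs_nonneg _
              intro s hs
              rw [Finset.mem_map] at hs
              obtain ⟨j, hj, rfl⟩ := hs
              rw [Finset.mem_range] at hj
              simp only [Nat.castEmbedding_apply, Finset.mem_Icc]
              omega
      refine le_trans (le_of_eq ?_) hinj
      have := Finset.sum_range_id_mul_two (m + 1)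
      have h4 : (∑ i ∈ Finset.range (m + 1), (i : ℝ)) * 2 = (m + 1) * m := by
        have h5 : (m + 1 - 1 : ℕ) = m := rfl
        rw [h5] at this
        have h6 := congrArg (Nat.cast (R := ℝ)) this
        push_cast at h6
        exact h6
      linarith
    calc c / 2 * m ≤ c / m * (((m : ℝ) * (m + 1)) / 2) := by
          field_simp
          nlinarith
      _ ≤ _ := by gcongr
  calc c / 2 * (m * h) = c / 2 * m * h := by ring
    _ ≤ _ := by gcongr

/-- Under approximately uncorrelated differencing, a step in the middle of the sample causes a bias
of order `ℓ m h / n`. -/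
theorem meanBias_mid_ge_of_approxUncorrelated {K : ℝ → ℝ} (hK : IsKernel K) (hκ : kappa K ≠ 0)
    {t : Tuning} (ht : t.Admissible) (hA : t.ApproxUncorrelated) (N : Noise)
    (hℓ : ∀ e : ℝ, 0 < e → ∀ᶠ n in atTop, (t.ℓ n : ℝ) ≤ e * (t.m n * t.h n)) :
    ∃ c : ℝ, 0 < c ∧ ∀ᶠ n in atTop, c * (t.ℓ n * (t.m n * t.h n) / n) ≤
      |meanBias K t n (DGM.mu ⟨N, stepMean midPoint⟩ n)| := by
  obtain ⟨c', c'', hc', hc'', hδ⟩ := hA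
  refine meanBias_mid_ge hK hκ ht N (ρ := fun n => (t.m n : ℝ) * t.h n) (c := c' / 2)
    (by positivity) ?_ hℓ ?_
  · filter_upwards [hδ, ht.eventually_basic, ht.sum_zero] with n hn hb hd
    exact ⟨(t.m n + 1) * t.h n, overlap_ge hb.2.2.2.1 hd hc'.le fun s h1 h2 => (hn s h1 h2).2⟩
  · filter_upwards [hδ, ht.eventually_basic, ht.normalized] with n hn hb hd k hk
    refine (overlap_le_of_nonpos hd (fun s h1 h2 => (hn s h1 h2).2.trans ?_) k).trans ?_
    · rw [neg_div]
      exact neg_nonpos.2 (by positivity)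
    · exact_mod_cast hk.le

/-- If `h ≫ ℓ`, a step in the middle of the sample causes a bias of order `ℓ h / n`. -/
theorem meanBias_mid_ge_of_ratio {K : ℝ → ℝ} (hK : IsKernel K) (hκ : kappa K ≠ 0)
    {t : Tuning} (ht : t.Admissible) (N : Noise) (hr : Tendsto t.ratio atTop atTop) :
    ∃ c : ℝ, 0 < c ∧ ∀ᶠ n in atTop, c * (t.ℓ n * t.h n / n) ≤
      |meanBias K t n (DGM.mu ⟨N, stepMean midPoint⟩ n)| := by
  refine meanBias_mid_ge hK hκ ht N (ρ := fun n => (t.h n : ℝ)) (c := 1) one_pos ?_ ?_ ?_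
  · filter_upwards [ht.normalized] with n hd
    exact ⟨t.h n, by rw [overlap_eq_of_le hd le_rfl, one_mul]⟩
  · intro e he
    filter_upwards [hr.eventually_ge_atTop (1 / e), ht.eventually_basic] with n hn hb
    have hℓ0 : (0 : ℝ) < t.ℓ n := by exact_mod_cast hb.2.1
    rw [Tuning.ratio, div_le_div_iff₀ he hℓ0] at hn
    linarith
  · filter_upwards [ht.normalized, hr.eventually_ge_atTop 1, ht.eventually_basic] with n hd hn hb k hk
    have hℓ0 : (0 : ℝ) < t.ℓ n := by exact_mod_cast hb.2.1
    rw [Tuning.ratio, le_div_iff₀ hℓ0, one_mul] at hn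
    have hn' : t.ℓ n ≤ t.h n := by exact_mod_cast hn
    rw [overlap_eq_of_le hd (by omega)]
    exact_mod_cast hk.le

/-! ### Consequences of rate optimality -/

lemma le_of_mse_isBigO {K : ℝ → ℝ} {q : ℕ} {t : Tuning} {G : DGM}
    (h : mse K t G =O[atTop] optRate q) :
    ∃ C : ℝ, 0 < C ∧ ∀ᶠ n in atTop, mse K t G n ≤ C / scale q n ^ (2 * q) := by
  obtain ⟨C, hC0, hC⟩ := h.exists_pos
  refine ⟨C, hC0, ?_⟩
  filter_upwards [hC.bound, eventually_ge_atTop 1] with n hn hn1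
  have hs := scale_pos q hn1
  rw [optRate_eq q hn1, Real.norm_eq_abs, Real.norm_eq_abs,
    abs_of_pos (by positivity : (0 : ℝ) < 1 / scale q n ^ (2 * q)), mul_one_div] at hn
  exact (le_abs_self _).trans hn

lemma abs_bias_le_of_rateOptimal {K : ℝ → ℝ} (hK : IsKernel K) {q : ℕ} {t : Tuning}
    (ht : t.Admissible) (hopt : RateOptimal K q t) {G : DGM} (hG : G.InClass q) :
    ∃ C : ℝ, 0 < C ∧ ∀ᶠ n in atTop,
      |noiseBias K t n G.noise + meanBias K t n (G.mu n)| ≤ C / scale q n ^ q := by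
  obtain ⟨C, hC0, hC⟩ := le_of_mse_isBigO (hopt G hG)
  refine ⟨C + 1, by linarith, ?_⟩
  filter_upwards [hC, ht.eventually_basic] with n hn hb
  have hs := scale_pos q hb.1
  rw [mse_eq hK t hG.weakDep hG.finiteU hb.2.1 hb.2.2.2.2] at hn
  have hv := variance_nonneg (fun ε => vHat K t n (G.X n ε)) G.noise.P
  refine abs_le_of_sq_le_sq ?_ (by positivity)
  calc _ ≤ C / scale q n ^ (2 * q) := by linarith
    _ ≤ (C + 1) ^ 2 / scale q n ^ (2 * q) := by gcongr; nlinarith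
    _ = _ := by rw [div_pow, ← pow_mul, mul_comm q 2]

lemma one_div_natCast_le (q : ℕ) {n : ℕ} (hn : 1 ≤ n) : 1 / (n : ℝ) ≤ 1 / scale q n ^ q := by
  have hs := scale_pos q hn
  have h1 : 1 ≤ scale q n := by
    by_contra hcon
    have := pow_lt_one₀ hs.le (not_le.1 hcon) (show 1 + 2 * q ≠ 0 by omega)
    rw [scale_pow_eq] at this
    have : (1 : ℝ) ≤ n := by exact_mod_cast hn
    linarith
  gcongr
  rw [← scale_pow_eq q n]
  exact pow_le_pow_right₀ h1 (by omega)

/-- A mean that leaves no trace in the differenced data. -/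
def lastMean : ℕ → MeanFn := stepMean id

lemma mildMean_lastMean : MildMean lastMean := by
  refine mildMean_stepMean ?_
  filter_upwards [eventually_ge_atTop 2] with n hn
  exact ⟨hn, le_rfl⟩

lemma meanBias_lastMean {K : ℝ → ℝ} (hK : IsKernel K) {t : Tuning} (ht : t.Admissible)
    (N : Noise) : ∀ᶠ n in atTop, 0 ≤ meanBias K t n (DGM.mu ⟨N, lastMean⟩ n) ∧
      meanBias K t n (DGM.mu ⟨N, lastMean⟩ n) ≤ 1 / n := by
  filter_upwards [ht.eventually_basic, ht.sum_zero, ht.normalized, eventually_ge_atTop 2] with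
    n hb hd hd2 hn2
  rw [lastMean, meanBias_stepMean K t N (T := id) ⟨hn2, le_rfl⟩ hd]
  exact meanBias_stepFn_last hK t hb.2.2.1 (by omega) hd2

lemma inClass_maNoise {M : ℕ} {ψ : ℕ → ℝ} {μ : ℕ → MeanFn} (hμ : MildMean μ) (q : ℕ) :
    DGM.InClass ⟨maNoise M ψ, μ⟩ q :=
  ⟨weakDep_maNoise, finiteU_maNoise q, hμ⟩

/-- With the step at the last observation the mean bias lies in [0, 1/n], so the bound on the total
bias is one on the noise bias. -/
lemma abs_noiseBias_le_of_rateOptimal {K : ℝ → ℝ} (hK : IsKernel K) {q : ℕ} {t : Tuning}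
    (ht : t.Admissible) (hopt : RateOptimal K q t) (M : ℕ) (ψ : ℕ → ℝ) :
    ∃ C : ℝ, 0 < C ∧ ∀ᶠ n in atTop, |noiseBias K t n (maNoise M ψ)| ≤ C / scale q n ^ q := by
  obtain ⟨C, hC0, hC⟩ := abs_bias_le_of_rateOptimal hK ht hopt
    (inClass_maNoise (M := M) (ψ := ψ) mildMean_lastMean q)
  refine ⟨C + 1, by linarith, ?_⟩
  filter_upwards [hC, meanBias_lastMean hK ht (maNoise M ψ), eventually_ge_atTop 1] with n h1 h2 hn1
  have h3 := one_div_natCast_le q hn1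
  have h4 := abs_le.1 h1
  rw [add_div]
  rw [abs_le]
  constructor <;> linarith [h4.1, h4.2, h2.1, h2.2]

/-- The same noise with another mean: the noise bias is already controlled and can be subtracted, so
noise and mean cannot conspire to cancel. -/
lemma abs_meanBias_le_of_rateOptimal {K : ℝ → ℝ} (hK : IsKernel K) {q : ℕ} {t : Tuning}
    (ht : t.Admissible) (hopt : RateOptimal K q t) (M : ℕ) (ψ : ℕ → ℝ) :
    ∃ C : ℝ, 0 < C ∧ ∀ᶠ n in atTop,
      |meanBias K t n (DGM.mu ⟨maNoise M ψ, stepMean midPoint⟩ n)| ≤ C / scale q n ^ q := by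
  obtain ⟨C₁, hC₁0, hC₁⟩ := abs_noiseBias_le_of_rateOptimal hK ht hopt M ψ
  obtain ⟨C₂, hC₂0, hC₂⟩ := abs_bias_le_of_rateOptimal hK ht hopt
    (inClass_maNoise (M := M) (ψ := ψ) (mildMean_stepMean midPoint_mem) q)
  refine ⟨C₁ + C₂, by linarith, ?_⟩
  filter_upwards [hC₁, hC₂] with n h1 h2
  have h3 := abs_le.1 h1
  have h4 := abs_le.1 h2
  rw [add_div]
  rw [abs_le]
  constructor <;> linarith [h3.1, h3.2, h4.1, h4.2]

/-- With x = `scale q n` one has n x^{-q} = x^{1+q}. -/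
lemma mean_effect_le_of_meanBias_ge {K : ℝ → ℝ} (hK : IsKernel K) {q : ℕ} {t : Tuning}
    (ht : t.Admissible) (hopt : RateOptimal K q t) {ρ : ℕ → ℝ} {c : ℝ} (hc0 : 0 < c)
    (hc : ∀ᶠ n in atTop, c * (ρ n / n) ≤
      |meanBias K t n (DGM.mu ⟨maNoise 0 1, stepMean midPoint⟩ n)|) :
    ∃ C : ℝ, 0 < C ∧ ∀ᶠ n in atTop, ρ n ≤ C * scale q n ^ (1 + q) := by
  obtain ⟨C, hC0, hC⟩ := abs_meanBias_le_of_rateOptimal hK ht hopt 0 1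
  refine ⟨C / c, by positivity, ?_⟩
  filter_upwards [hc, hC, eventually_ge_atTop 1] with n h1 h2 hn1
  have hs := scale_pos q hn1
  have hn0 : (0 : ℝ) < n := by exact_mod_cast hn1
  have h3 := h1.trans h2
  have hn : (n : ℝ) = scale q n ^ (1 + q) * scale q n ^ q := by
    rw [← pow_add, show 1 + q + q = 1 + 2 * q by ring, scale_pow_eq]
  rw [← mul_div_assoc, div_le_div_iff₀ hn0 (by positivity), hn] at h3
  rw [div_mul_eq_mul_div, le_div_iff₀ hc0]
  have h4 : (c * ρ n) * scale q n ^ q ≤ (C * scale q n ^ (1 + q)) * scale q n ^ q := by linarith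
  have := le_of_mul_le_mul_right h4 (by positivity)
  linarith

/-- Rate optimality bounds the mean effect. -/
theorem mean_effect_le_of_rateOptimal {K : ℝ → ℝ} (hK : IsKernel K) (hκ : kappa K ≠ 0) {q : ℕ}
    {t : Tuning} (ht : t.Admissible) (hA : t.ApproxUncorrelated)
    (hℓ : ∀ e : ℝ, 0 < e → ∀ᶠ n in atTop, (t.ℓ n : ℝ) ≤ e * (t.m n * t.h n))
    (hopt : RateOptimal K q t) :
    ∃ C : ℝ, 0 < C ∧ ∀ᶠ n in atTop, (t.ℓ n : ℝ) * (t.m n * t.h n) ≤ C * scale q n ^ (1 + q) := by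
  obtain ⟨c, hc0, hc⟩ := meanBias_mid_ge_of_approxUncorrelated hK hκ ht hA (maNoise 0 1) hℓ
  exact mean_effect_le_of_meanBias_ge hK ht hopt hc0 hc

/-- Rate optimality bounds the mean effect when `h ≫ ℓ`. -/
theorem mean_effect_le_of_rateOptimal_of_ratio {K : ℝ → ℝ} (hK : IsKernel K) (hκ : kappa K ≠ 0)
    {q : ℕ} {t : Tuning} (ht : t.Admissible) (hr : Tendsto t.ratio atTop atTop)
    (hopt : RateOptimal K q t) :
    ∃ C : ℝ, 0 < C ∧ ∀ᶠ n in atTop, (t.ℓ n : ℝ) * t.h n ≤ C * scale q n ^ (1 + q) := by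
  obtain ⟨c, hc0, hc⟩ := meanBias_mid_ge_of_ratio hK hκ ht (maNoise 0 1) hr
  exact mean_effect_le_of_meanBias_ge hK ht hopt hc0 hc

end
end DiffLRV

namespace DiffLRV

noncomputable section

/-! ### Expansion of the bias for moving averages -/

/-- The part of the weight that is due to the correlation of the differencing sequence. -/
def offWt (K : ℝ → ℝ) (n m ℓ h : ℕ) (d : ℕ → ℝ) (u : ℤ) : ℝ :=
  wt K n m ℓ h d u - K ((u : ℝ) / ℓ) * (((n : ℝ) - m * h - |(u : ℝ)|) / n)

lemma Tuning.Admissible.tendsto_edge {t : Tuning} (ht : t.Admissible) :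
    Tendsto (fun n => (t.m n : ℝ) * t.h n / n) atTop (𝓝 0) := by
  refine squeeze_zero (fun n => by positivity) (fun n => ?_) ht.negligible
  gcongr
  have : (0 : ℝ) ≤ t.ℓ n := by positivity
  linarith

lemma Tuning.Admissible.tendsto_factor {t : Tuning} (ht : t.Admissible) (x : ℝ) :
    Tendsto (fun n : ℕ => ((n : ℝ) - t.m n * t.h n - x) / n) atTop (𝓝 1) := by
  have h1 : Tendsto (fun n : ℕ => x / (n : ℝ)) atTop (𝓝 0) := tendsto_const_div_atTop_nhds_zero_nat x
  have h2 := (tendsto_const_nhds (x := (1 : ℝ))).sub (ht.tendsto_edge.add h1)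
  rw [add_zero, sub_zero] at h2
  refine h2.congr' ?_
  filter_upwards [eventually_ge_atTop 1] with n hn
  have hn0 : (0 : ℝ) < n := by exact_mod_cast hn
  field_simp
  ring

lemma Tuning.Admissible.tendsto_mul_lag {t : Tuning} (ht : t.Admissible) :
    Tendsto (fun n => (t.m n : ℝ) * t.h n) atTop atTop := by
  refine tendsto_atTop_mono' atTop ?_ (tendsto_natCast_atTop_atTop.comp ht.order_tendsto)
  filter_upwards [ht.lag_mem] with n hn
  have : (1 : ℝ) ≤ t.h n := by exact_mod_cast hn.1
  exact le_mul_of_one_le_right (Nat.cast_nonneg _) this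

section

variable {M : ℕ} {ψ : ℕ → ℝ}

/-- The four terms are smoothing, the edge loss of order mh/n, an edge correction O(1/n), and the
correlation of the differences. The edge loss always has a negative sign, which dictates the sign
aimed at for the others. -/
lemma noiseBias_maNoise_eq (K : ℝ → ℝ) (t : Tuning) {n : ℕ} (hn : 1 ≤ n) :
    noiseBias K t n (maNoise M ψ) =
      ∑ u ∈ Finset.Icc (-(M : ℤ)) M, delta M ψ u * ((K ((u : ℝ) / t.ℓ n) - 1) *
        (((n : ℝ) - t.m n * t.h n - |(u : ℝ)|) / n)) -
      (∑ p ∈ Finset.range (M + 1), ψ p) ^ 2 * ((t.m n : ℝ) * t.h n / n) -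
      (∑ u ∈ Finset.Icc (-(M : ℤ)) M, delta M ψ u * |(u : ℝ)|) / n +
      ∑ u ∈ Finset.Icc (-(M : ℤ)) M, delta M ψ u *
        offWt K n (t.m n) (t.ℓ n) (t.h n) (t.d n) u := by
  have hn0 : (0 : ℝ) < n := by exact_mod_cast hn
  rw [noiseBias_maNoise, ← sum_delta, Finset.sum_mul, Finset.sum_div, ← Finset.sum_sub_distrib,
    ← Finset.sum_sub_distrib, ← Finset.sum_add_distrib]
  refine Finset.sum_congr rfl fun u _ => ?_
  rw [offWt]
  field_simp
  ring

lemma noiseBias_maNoise_le {K : ℝ → ℝ} (hK : IsKernel K) {q : ℕ} (hq1 : 1 ≤ q) {B : ℝ}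
    (hB : Tendsto (fun t : ℝ => (K t - K 0) / |t| ^ q) (𝓝[>] 0) (𝓝 B)) {t : Tuning}
    (ht : t.Admissible) (hψ : ∑ p ∈ Finset.range (M + 1), ψ p ≠ 0) {e : ℝ} (he : 0 < e) :
    ∀ᶠ n in atTop, noiseBias K t n (maNoise M ψ) ≤
      (B * (∑ u ∈ Finset.Icc (-(M : ℤ)) M, delta M ψ u * |(u : ℝ)| ^ q) + e) / (t.ℓ n : ℝ) ^ q -
      (∑ p ∈ Finset.range (M + 1), ψ p) ^ 2 / 2 * ((t.m n : ℝ) * t.h n / n) +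
      ∑ u ∈ Finset.Icc (-(M : ℤ)) M, delta M ψ u *
        offWt K n (t.m n) (t.ℓ n) (t.h n) (t.d n) u := by
  set v := (∑ p ∈ Finset.range (M + 1), ψ p) ^ 2 with hv
  have hv0 : 0 < v := by positivity
  have hlim : Tendsto (fun n : ℕ => ∑ u ∈ Finset.Icc (-(M : ℤ)) M, delta M ψ u *
      ((t.ℓ n : ℝ) ^ q * (K ((u : ℝ) / t.ℓ n) - 1) *
        (((n : ℝ) - t.m n * t.h n - |(u : ℝ)|) / n))) atTop
      (𝓝 (∑ u ∈ Finset.Icc (-(M : ℤ)) M, delta M ψ u * (B * |(u : ℝ)| ^ q * 1))) :=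
    tendsto_finsetSum _ fun u _ =>
      (((tendsto_kernel_origin hK hq1 hB u).comp ht.bandwidth_tendsto).mul
        (ht.tendsto_factor |(u : ℝ)|)).const_mul _
  have hS : ∑ u ∈ Finset.Icc (-(M : ℤ)) M, delta M ψ u * (B * |(u : ℝ)| ^ q * 1) =
      B * (∑ u ∈ Finset.Icc (-(M : ℤ)) M, delta M ψ u * |(u : ℝ)| ^ q) := by
    rw [Finset.mul_sum]; exact Finset.sum_congr rfl fun u _ => by ring
  rw [hS] at hlim
  set S := B * (∑ u ∈ Finset.Icc (-(M : ℤ)) M, delta M ψ u * |(u : ℝ)| ^ q)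
  set Γ := ∑ u ∈ Finset.Icc (-(M : ℤ)) M, delta M ψ u * |(u : ℝ)|
  filter_upwards [hlim.eventually (gt_mem_nhds (show S < S + e by linarith)), ht.eventually_basic,
    ht.tendsto_mul_lag.eventually_ge_atTop (2 * |Γ| / v)] with n h1 hb h2
  have hn0 : (0 : ℝ) < n := by exact_mod_cast hb.1
  have hℓ0 : (0 : ℝ) < t.ℓ n := by exact_mod_cast hb.2.1
  rw [noiseBias_maNoise_eq K t hb.1, ← hv]
  have e1 : ∑ u ∈ Finset.Icc (-(M : ℤ)) M, delta M ψ u * ((K ((u : ℝ) / t.ℓ n) - 1) *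
        (((n : ℝ) - t.m n * t.h n - |(u : ℝ)|) / n)) ≤ (S + e) / (t.ℓ n : ℝ) ^ q := by
    rw [le_div_iff₀ (by positivity), Finset.sum_mul]
    refine le_trans (le_of_eq ?_) h1.le
    exact Finset.sum_congr rfl fun u _ => by ring
  -- As mh → ∞, half of the edge loss absorbs the correction of order 1/n.
  have e2 : -(Γ / n) ≤ v / 2 * ((t.m n : ℝ) * t.h n / n) := by
    rw [← neg_div, ← mul_div_assoc]
    gcongr
    rw [div_le_iff₀ hv0] at h2
    have := neg_abs_le Γ
    linarith
  linarith

lemma sum_delta_mul_neg (F : ℤ → ℝ) :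
    ∑ u ∈ Finset.Icc (-(M : ℤ)) M, delta M ψ u * F (-u) =
      ∑ u ∈ Finset.Icc (-(M : ℤ)) M, delta M ψ u * F u := by
  refine Finset.sum_bij' (fun u _ => -u) (fun u _ => -u) ?_ ?_ ?_ ?_ ?_
  · intro u hu; rw [Finset.mem_Icc] at *; omega
  · intro u hu; rw [Finset.mem_Icc] at *; omega
  · intro u _; ring
  · intro u _; ring
  · intro u _; rw [delta_neg]

/-- The kernel near the boundary, including the edge effect. -/
def edgeKernel (K : ℝ → ℝ) (t : Tuning) (n : ℕ) (y : ℤ) : ℝ :=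
  K (((t.ℓ n - y : ℤ) : ℝ) / t.ℓ n) *
    (((n : ℝ) - t.m n * t.h n - |((t.ℓ n - y : ℤ) : ℝ)|) / n)

lemma edgeKernel_eq {K : ℝ → ℝ} (hK : IsKernel K) (t : Tuning) (n : ℕ) {y z : ℤ}
    (hz : z = t.ℓ n - y ∨ z = -(t.ℓ n - y)) :
    K ((z : ℝ) / t.ℓ n) * (((n : ℝ) - t.m n * t.h n - |(z : ℝ)|) / n) = edgeKernel K t n y := by
  rcases hz with rfl | rfl
  · rfl
  · rw [edgeKernel, Int.cast_neg, abs_neg, neg_div, hK.even]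

lemma tendsto_edgeKernel {K : ℝ → ℝ} (hK : IsKernel K) {q' : ℕ} (hq1 : 1 ≤ q') {B' : ℝ}
    (hB : Tendsto (fun t : ℝ => (K 1 - K (1 - t)) / |t| ^ q') (𝓝[>] 0) (𝓝 B')) {t : Tuning}
    (ht : t.Admissible) (y : ℤ) :
    Tendsto (fun n => (t.ℓ n : ℝ) ^ q' * edgeKernel K t n y) atTop
      (𝓝 (-B' * (max (y : ℝ) 0) ^ q')) := by
  have hf : Tendsto (fun n : ℕ => ((n : ℝ) - t.m n * t.h n - |((t.ℓ n - y : ℤ) : ℝ)|) / n) atTop (𝓝 1) := by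
    have h1 : Tendsto (fun n : ℕ => |(y : ℝ)| / (n : ℝ)) atTop (𝓝 0) :=
      tendsto_const_div_atTop_nhds_zero_nat _
    have h2 := (tendsto_const_nhds (x := (1 : ℝ))).sub (ht.negligible.add h1)
    rw [add_zero, sub_zero] at h2
    refine tendsto_of_tendsto_of_tendsto_of_le_of_le' h2 tendsto_const_nhds ?_ ?_
    · filter_upwards [eventually_ge_atTop 1] with n hn
      have hn0 : (0 : ℝ) < n := by exact_mod_cast hn
      have h3 : |((t.ℓ n - y : ℤ) : ℝ)| ≤ t.ℓ n + |(y : ℝ)| := by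
        push_cast
        refine (abs_sub _ _).trans ?_
        rw [Nat.abs_cast]
      rw [le_div_iff₀ hn0, sub_mul, add_mul, div_mul_cancel₀ _ hn0.ne', div_mul_cancel₀ _ hn0.ne']
      linarith
    · filter_upwards [eventually_ge_atTop 1] with n hn
      have hn0 : (0 : ℝ) < n := by exact_mod_cast hn
      rw [div_le_one hn0]
      have h3 := abs_nonneg ((t.ℓ n - y : ℤ) : ℝ)
      have h4 : (0 : ℝ) ≤ (t.m n : ℝ) * t.h n := by positivity
      linarith
  have := ((tendsto_kernel_boundary hK hq1 hB y).comp ht.bandwidth_tendsto).mul hf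
  rw [mul_one] at this
  refine this.congr fun n => ?_
  simp only [Function.comp_apply, edgeKernel]
  ring

/-- For |s| ≥ 2 the shifted lag leaves the support. The lags u ± h of s = ±1 equal ±(ℓ - y) with y =
ℓ - h ∓ u, and evenness moves both to the right boundary. -/
lemma offWt_eq_of_near {K : ℝ → ℝ} (hK : IsKernel K) (t : Tuning) {n : ℕ} (hℓ : 1 ≤ t.ℓ n)
    (hm : 1 ≤ t.m n) (hd : ∑ j ∈ Finset.range (t.m n + 1), t.d n j ^ 2 = 1) {u : ℤ}
    (hu : (t.ℓ n : ℤ) + |u| ≤ 2 * t.h n) :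
    offWt K n (t.m n) (t.ℓ n) (t.h n) (t.d n) u = delta (t.m n) (t.d n) 1 *
      (edgeKernel K t n (t.ℓ n - t.h n - u) + edgeKernel K t n (t.ℓ n - t.h n + u)) := by
  rw [offWt, wt_eq u hd, add_sub_cancel_left]
  have hsub : ({1, -1} : Finset ℤ) ⊆ (Finset.Icc (-(t.m n : ℤ)) (t.m n)).erase 0 := by
    intro s hs
    rw [Finset.mem_insert, Finset.mem_singleton] at hs
    rw [Finset.mem_erase, Finset.mem_Icc]
    omega
  rw [← Finset.sum_subset hsub, Finset.sum_pair (by norm_num), delta_neg,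
    edgeKernel_eq hK t n (y := t.ℓ n - t.h n - u) (by left; ring),
    edgeKernel_eq hK t n (y := t.ℓ n - t.h n + u) (by right; ring), mul_add]
  intro s hs hs'
  rw [kernel_eq_zero hK hℓ, zero_mul, mul_zero]
  rw [Finset.mem_erase, Finset.mem_Icc] at hs
  rw [Finset.mem_insert, Finset.mem_singleton, not_or] at hs'
  have h2 : 2 ≤ |s| := by
    rw [le_abs]; omega
  have h3 : (2 : ℤ) * t.h n ≤ |s * t.h n| := by
    rw [abs_mul, Nat.abs_cast]; gcongr
  have h4 : |s * t.h n| ≤ |u + s * t.h n| + |u| := by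
    have := abs_sub (u + s * (t.h n : ℤ)) u
    rwa [add_sub_cancel_left] at this
  omega

/-- The boundary functional `∑_u γ_u (x + u)₊ ^ q'` of a moving average. -/
def boundaryMoment (M : ℕ) (ψ : ℕ → ℝ) (q' : ℕ) (x : ℤ) : ℝ :=
  ∑ u ∈ Finset.Icc (-(M : ℤ)) M, delta M ψ u * (max ((x + u : ℤ) : ℝ) 0) ^ q'

lemma sum_offWt_le {K : ℝ → ℝ} (hK : IsKernel K) {q' : ℕ} (hq1 : 1 ≤ q') {B' : ℝ}
    (hB : Tendsto (fun t : ℝ => (K 1 - K (1 - t)) / |t| ^ q') (𝓝[>] 0) (𝓝 B')) {t : Tuning}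
    (ht : t.Admissible) {C : ℕ} (hC : ∀ᶠ n in atTop, |(t.ℓ n : ℤ) - t.h n| ≤ C)
    (hδ : ∀ᶠ n in atTop, delta (t.m n) (t.d n) 1 ≤ 0) {e : ℝ} (he : 0 < e) :
    ∀ᶠ n in atTop, ∑ u ∈ Finset.Icc (-(M : ℤ)) M, delta M ψ u *
        offWt K n (t.m n) (t.ℓ n) (t.h n) (t.d n) u ≤
      2 * -delta (t.m n) (t.d n) 1 * (B' * boundaryMoment M ψ q' (t.ℓ n - t.h n) + e) /
        (t.ℓ n : ℝ) ^ q' := by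
  set Γ : ℝ := ∑ u ∈ Finset.Icc (-(M : ℤ)) M, |delta M ψ u| with hΓ
  have hΓ0 : 0 ≤ Γ := Finset.sum_nonneg fun _ _ => abs_nonneg _
  set e' : ℝ := e / (Γ + 1)
  have he' : 0 < e' := by positivity
  -- The offset ℓ - h need not converge, but with |u| ≤ M the argument ℓ - h + u takes finitely many
  -- integer values, so the pointwise limits hold uniformly.
  have hunif : ∀ᶠ n in atTop, ∀ y ∈ Finset.Icc (-((C : ℤ) + M)) (C + M),
      |(t.ℓ n : ℝ) ^ q' * edgeKernel K t n y - -B' * (max (y : ℝ) 0) ^ q'| < e' := by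
    rw [Finset.eventually_all]
    intro y _
    have := (tendsto_edgeKernel hK hq1 hB ht y).eventually (Metric.ball_mem_nhds _ he')
    exact this
  filter_upwards [hunif, hC, hδ, ht.eventually_basic, ht.normalized,
    ht.bandwidth_tendsto.eventually_ge_atTop (2 * C + M)] with n hy hCn hδn hb hd hℓn
  have hℓ0 : (0 : ℝ) < t.ℓ n := by exact_mod_cast hb.2.1
  rw [abs_le] at hCn
  set x : ℤ := (t.ℓ n : ℤ) - t.h n with hx
  have h1 : ∑ u ∈ Finset.Icc (-(M : ℤ)) M, delta M ψ u *
        offWt K n (t.m n) (t.ℓ n) (t.h n) (t.d n) u =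
      2 * delta (t.m n) (t.d n) 1 *
        ∑ u ∈ Finset.Icc (-(M : ℤ)) M, delta M ψ u * edgeKernel K t n (x + u) := by
    calc _ = ∑ u ∈ Finset.Icc (-(M : ℤ)) M, (delta (t.m n) (t.d n) 1 *
          (delta M ψ u * edgeKernel K t n (x + -u)) + delta (t.m n) (t.d n) 1 *
          (delta M ψ u * edgeKernel K t n (x + u))) := by
          refine Finset.sum_congr rfl fun u hu => ?_
          rw [Finset.mem_Icc, ← abs_le] at hu
          rw [offWt_eq_of_near hK t hb.2.1 hb.2.2.2.1 hd (by omega), ← hx, sub_eq_add_neg x u]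
          ring
      _ = _ := by
          rw [Finset.sum_add_distrib, ← Finset.mul_sum, ← Finset.mul_sum,
            sum_delta_mul_neg fun u => edgeKernel K t n (x + u)]
          ring
  have h2 : -(B' * boundaryMoment M ψ q' x + e) ≤
      (∑ u ∈ Finset.Icc (-(M : ℤ)) M, delta M ψ u * edgeKernel K t n (x + u)) *
        (t.ℓ n : ℝ) ^ q' := by
    have h3 : |(∑ u ∈ Finset.Icc (-(M : ℤ)) M, delta M ψ u * edgeKernel K t n (x + u)) *
        (t.ℓ n : ℝ) ^ q' + B' * boundaryMoment M ψ q' x| ≤ Γ * e' := by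
      rw [boundaryMoment, Finset.mul_sum, Finset.sum_mul, ← Finset.sum_add_distrib, hΓ, Finset.sum_mul]
      refine (Finset.abs_sum_le_sum_abs _ _).trans (Finset.sum_le_sum fun u hu => ?_)
      rw [Finset.mem_Icc] at hu
      have := (hy (x + u) (by rw [Finset.mem_Icc]; omega)).le
      calc _ = |delta M ψ u * ((t.ℓ n : ℝ) ^ q' * edgeKernel K t n (x + u) -
            -B' * (max ((x + u : ℤ) : ℝ) 0) ^ q')| := by congr 1; ring
        _ ≤ _ := by rw [abs_mul]; gcongr
    have h4 : Γ * e' ≤ e := by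
      rw [← mul_div_assoc, div_le_iff₀ (by positivity)]
      nlinarith
    have := (abs_le.1 h3).1
    linarith
  rw [h1, le_div_iff₀ (by positivity)]
  have h5 := mul_le_mul_of_nonneg_left h2 (show 0 ≤ 2 * -delta (t.m n) (t.d n) 1 by linarith)
  linarith

end

end
end DiffLRV

namespace DiffLRV

noncomputable section

/-! ### Moving averages with three terms -/

/-- The coefficients of `1 + a L ^ p + b L ^ r`. -/
def threeTerm (p r : ℕ) (a b : ℝ) (i : ℕ) : ℝ :=
  (if i = 0 then 1 else 0) + (if i = p then a else 0) + (if i = r then b else 0)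

lemma sum_threeTerm_mul {p r : ℕ} (hpr : p ≤ r) (a b : ℝ) (f : ℕ → ℝ) :
    ∑ i ∈ Finset.range (r + 1), threeTerm p r a b i * f i = f 0 + a * f p + b * f r := by
  simp only [threeTerm, add_mul, ite_mul, one_mul, zero_mul]
  rw [Finset.sum_add_distrib, Finset.sum_add_distrib, Finset.sum_ite_eq', Finset.sum_ite_eq',
    Finset.sum_ite_eq', if_pos (by simp), if_pos (by rw [Finset.mem_range]; omega), if_pos (by simp)]

lemma sum_threeTerm {p r : ℕ} (hpr : p ≤ r) (a b : ℝ) :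
    ∑ i ∈ Finset.range (r + 1), threeTerm p r a b i = 1 + a + b := by
  have := sum_threeTerm_mul hpr a b fun _ => 1
  simpa using this

lemma sum_delta_threeTerm {p r : ℕ} (hpr : p ≤ r) (a b : ℝ) (F : ℤ → ℝ) :
    ∑ u ∈ Finset.Icc (-(r : ℤ)) r, delta r (threeTerm p r a b) u * F u =
      (1 + a ^ 2 + b ^ 2) * F 0 + a * (F p + F (-p)) + b * (F r + F (-r)) +
        a * b * (F (r - p) + F (p - r)) := by
  rw [← sum_sum_eq_sum_delta]
  simp only [mul_assoc, ← Finset.mul_sum]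
  rw [sum_threeTerm_mul hpr a b fun i => ∑ j ∈ Finset.range (r + 1),
    threeTerm p r a b j * F ((i : ℤ) - j)]
  simp only [sum_threeTerm_mul hpr a b fun j => F ((_ : ℤ) - (j : ℤ))]
  simp only [Nat.cast_zero, sub_self, zero_sub, sub_zero]
  ring

lemma moment_threeTerm {p r : ℕ} (hpr : p ≤ r) (a b : ℝ) {q : ℕ} (hq : 1 ≤ q) :
    ∑ u ∈ Finset.Icc (-(r : ℤ)) r, delta r (threeTerm p r a b) u * |(u : ℝ)| ^ q =
      2 * (a * (p : ℝ) ^ q + b * (r : ℝ) ^ q + a * b * ((r : ℝ) - p) ^ q) := by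
  have hpr' : (p : ℝ) ≤ r := by exact_mod_cast hpr
  rw [sum_delta_threeTerm hpr a b fun u => |(u : ℝ)| ^ q]
  push_cast
  rw [abs_sub_comm (p : ℝ) r, abs_of_nonneg (sub_nonneg.2 hpr'), abs_neg, abs_neg, Nat.abs_cast,
    Nat.abs_cast, abs_zero, zero_pow (by omega)]
  ring

lemma boundaryMoment_threeTerm {p r : ℕ} (hpr : 2 * p ≤ r) (a b : ℝ) {q' : ℕ} (hq : 1 ≤ q') {x : ℤ}
    (hx : |x| ≤ p) :
    boundaryMoment r (threeTerm p r a b) q' x = (1 + a ^ 2 + b ^ 2) * (max (x : ℝ) 0) ^ q' +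
      a * ((x : ℝ) + p) ^ q' + b * ((x : ℝ) + r) ^ q' + a * b * ((x : ℝ) + r - p) ^ q' := by
  rw [abs_le] at hx
  rw [boundaryMoment, sum_delta_threeTerm (by omega) a b fun u => (max ((x + u : ℤ) : ℝ) 0) ^ q']
  have hneg : ∀ z : ℤ, z ≤ 0 → (max (z : ℝ) 0) ^ q' = 0 := by
    intro z hz
    rw [max_eq_right (by exact_mod_cast hz), zero_pow (by omega)]
  have hpos : ∀ z : ℤ, 0 ≤ z → (max (z : ℝ) 0) = z := fun z hz =>
    max_eq_left (by exact_mod_cast hz)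
  simp only [add_zero]
  rw [hneg (x + -p) (by omega), hneg (x + -r) (by omega), hneg (x + (p - r)) (by omega),
    hpos (x + p) (by omega), hpos (x + r) (by omega), hpos (x + (r - p)) (by omega)]
  push_cast
  ring

/-- The lag p exceeds eight times every admissible |x|, so (x + p)^{q'} dominates x₊^{q'} uniformly
in the uncontrolled offset x = ℓ - h. -/
lemma pow_bounds {q' : ℕ} (hq : 1 ≤ q') {C p : ℕ} (hp : p = 8 * C + 8) {x : ℤ} (hx : |x| ≤ C) :
    1 ≤ ((x : ℝ) + p) ^ q' ∧ 9 * (max (x : ℝ) 0) ^ q' ≤ ((x : ℝ) + p) ^ q' ∧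
      ∀ R : ℕ, 1 ≤ R → ((x : ℝ) + (R * p : ℕ)) ^ q' ≤ (2 * R + 1) ^ q' * ((x : ℝ) + p) ^ q' := by
  have hx' := abs_le.1 hx
  have h1 : -(C : ℝ) ≤ x := by exact_mod_cast hx'.1
  have h2 : (x : ℝ) ≤ C := by exact_mod_cast hx'.2
  have hpr : (p : ℝ) = 8 * C + 8 := by rw [hp]; push_cast; ring
  have hC0 : (0 : ℝ) ≤ C := by positivity
  refine ⟨one_le_pow₀ (by linarith), ?_, fun R hR => ?_⟩
  · have h3 : 9 * max (x : ℝ) 0 ≤ x + p := by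
      rcases le_total (x : ℝ) 0 with h | h
      · rw [max_eq_right h]; linarith
      · rw [max_eq_left h]; linarith
    calc 9 * (max (x : ℝ) 0) ^ q' ≤ 9 ^ q' * (max (x : ℝ) 0) ^ q' := by
          gcongr
          exact le_self_pow₀ (by norm_num) (by omega)
      _ = (9 * max (x : ℝ) 0) ^ q' := (mul_pow _ _ _).symm
      _ ≤ _ := by gcongr
  · have hR' : (1 : ℝ) ≤ R := by exact_mod_cast hR
    rw [← mul_pow]
    push_cast
    have h0 : 0 ≤ (x : ℝ) + R * p := by nlinarith
    gcongr
    nlinarith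

/-- A moving average whose boundary functional has a prescribed sign. -/
lemma exists_boundaryMoment {B' : ℝ} (hB : B' ≠ 0) {q' : ℕ} (hq : 1 ≤ q') (C : ℕ) :
    ∃ (M : ℕ) (ψ : ℕ → ℝ) (c : ℝ), 0 < c ∧ ∑ p ∈ Finset.range (M + 1), ψ p ≠ 0 ∧
      ∀ x : ℤ, |x| ≤ C → B' * boundaryMoment M ψ q' x ≤ -c := by
  set p := 8 * C + 8 with hp
  rcases hB.lt_or_gt with h | h
  · refine ⟨2 * p, threeTerm p (2 * p) 1 0, -B', by linarith, ?_, fun x hx => ?_⟩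
    · rw [sum_threeTerm (by omega)]; norm_num
    · obtain ⟨b1, b2, -⟩ := pow_bounds hq hp hx
      rw [boundaryMoment_threeTerm le_rfl 1 0 hq (by omega)]
      have h0 : 0 ≤ (max (x : ℝ) 0) ^ q' := by positivity
      nlinarith
  -- The term (5/4) x₊^{q'} is at most (5/36)(x + p)^{q'}, so the coefficient -1/2 leaves a margin
  -- above 1/4. The value -1 is avoided because ∑ψ must not vanish.
  · refine ⟨2 * p, threeTerm p (2 * p) (-1 / 2) 0, B' / 4, by linarith, ?_, fun x hx => ?_⟩
    · rw [sum_threeTerm (by omega)]; norm_num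
    · obtain ⟨b1, b2, -⟩ := pow_bounds hq hp hx
      rw [boundaryMoment_threeTerm le_rfl _ 0 hq (by omega)]
      have h0 : 0 ≤ (max (x : ℝ) 0) ^ q' := by positivity
      nlinarith

/-- A moving average whose moment `∑_u γ_u |u| ^ q` has a prescribed sign. -/
lemma exists_moment {B : ℝ} (hB : B ≠ 0) {q : ℕ} (hq : 1 ≤ q) :
    ∃ (M : ℕ) (ψ : ℕ → ℝ), ∑ p ∈ Finset.range (M + 1), ψ p ≠ 0 ∧
      B * (∑ u ∈ Finset.Icc (-(M : ℤ)) M, delta M ψ u * |(u : ℝ)| ^ q) < 0 := by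
  rcases hB.lt_or_gt with h | h
  · refine ⟨2, threeTerm 1 2 1 0, ?_, ?_⟩
    · rw [sum_threeTerm (by norm_num)]; norm_num
    · rw [moment_threeTerm (by norm_num) 1 0 hq]
      simp
      linarith
  · refine ⟨2, threeTerm 1 2 (-1 / 2) 0, ?_, ?_⟩
    · rw [sum_threeTerm (by norm_num)]; norm_num
    · rw [moment_threeTerm (by norm_num) _ 0 hq]
      simp
      linarith

/-- A moving average for which the two leading terms of the bias have prescribed signs. -/
lemma exists_moment_boundaryMoment {B B' : ℝ} (hB : B ≠ 0) (hB' : B' ≠ 0) {q q' : ℕ} (hq' : 1 ≤ q')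
    (hqq : q' < q) (C : ℕ) :
    ∃ (M : ℕ) (ψ : ℕ → ℝ), ∑ p ∈ Finset.range (M + 1), ψ p ≠ 0 ∧
      B * (∑ u ∈ Finset.Icc (-(M : ℤ)) M, delta M ψ u * |(u : ℝ)| ^ q) < 0 ∧
      ∀ x : ℤ, |x| ≤ C → B' * boundaryMoment M ψ q' x ≤ 0 := by
  set p := 8 * C + 8 with hp
  have hp0 : (0 : ℝ) < p := by rw [hp]; positivity
  -- A small coefficient β at the distant lag Rp. Since (2R + 1)^{q'} ≤ (3R)^{q'} and q > q', βR^q >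
  -- 1, so it outweighs lag p in the moment of order q; in the boundary functional of order q' its
  -- share is at most a quarter.
  set R : ℕ := 4 * 3 ^ q' + 1 with hR
  have hR1 : 1 ≤ R := by omega
  have hR2 : 2 ≤ R := by have : 1 ≤ 3 ^ q' := Nat.one_le_pow _ _ (by norm_num); omega
  have hR1r : (1 : ℝ) ≤ R := by exact_mod_cast hR1
  set β : ℝ := 1 / (4 * (2 * R + 1) ^ q') with hβ
  have hβ0 : 0 < β := by positivity
  have hden : (1 : ℝ) ≤ (2 * R + 1) ^ q' := one_le_pow₀ (by linarith)
  have hβ1 : β ≤ 1 / 4 := by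
    rw [hβ]
    apply one_div_le_one_div_of_le (by norm_num)
    linarith
  have hβR : 1 < β * (R : ℝ) ^ q := by
    rw [hβ, one_div, inv_mul_eq_div, lt_div_iff₀ (by positivity), one_mul]
    have h1 : (2 * (R : ℝ) + 1) ^ q' ≤ 3 ^ q' * (R : ℝ) ^ q' := by
      rw [← mul_pow]; gcongr; linarith
    have h2 : (4 : ℝ) * 3 ^ q' < R := by rw [hR]; push_cast; linarith
    calc 4 * (2 * (R : ℝ) + 1) ^ q' ≤ 4 * 3 ^ q' * (R : ℝ) ^ q' := by linarith
      _ < R * (R : ℝ) ^ q' := by gcongr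
      _ = (R : ℝ) ^ (q' + 1) := by ring
      _ ≤ (R : ℝ) ^ q := pow_le_pow_right₀ hR1r (by omega)
  have hpq : (0 : ℝ) < (p : ℝ) ^ q := by positivity
  have hrq : ((R * p : ℕ) : ℝ) ^ q = (R : ℝ) ^ q * (p : ℝ) ^ q := by push_cast; rw [mul_pow]
  have hrp : ((R * p : ℕ) : ℝ) - p = ((R : ℝ) - 1) * p := by push_cast; ring
  have h2pr : 2 * p ≤ R * p := Nat.mul_le_mul_right _ hR2
  have hle : (((R * p : ℕ) : ℝ) - p) ^ q ≤ (R : ℝ) ^ q * (p : ℝ) ^ q := by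
    rw [hrp, ← mul_pow]
    have : 0 ≤ ((R : ℝ) - 1) * p := mul_nonneg (by linarith) hp0.le
    gcongr
    linarith
  have hnn : 0 ≤ (((R * p : ℕ) : ℝ) - p) ^ q := by
    rw [hrp]
    have : 0 ≤ ((R : ℝ) - 1) * p := mul_nonneg (by linarith) hp0.le
    positivity
  have hbig : (p : ℝ) ^ q < β * ((R : ℝ) ^ q * (p : ℝ) ^ q) := by nlinarith
  have hphi : ∀ x : ℤ, |x| ≤ C → 0 ≤ (max (x : ℝ) 0) ^ q' ∧
      9 * (max (x : ℝ) 0) ^ q' ≤ ((x : ℝ) + p) ^ q' ∧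
      β * ((x : ℝ) + (R * p : ℕ)) ^ q' ≤ ((x : ℝ) + p) ^ q' / 4 ∧
      0 ≤ β * ((x : ℝ) + (R * p : ℕ) - p) ^ q' ∧
      β * ((x : ℝ) + (R * p : ℕ) - p) ^ q' ≤ β * ((x : ℝ) + (R * p : ℕ)) ^ q' ∧
      0 ≤ β * ((x : ℝ) + (R * p : ℕ)) ^ q' := by
    intro x hx
    obtain ⟨b1, b2, b3⟩ := pow_bounds hq' hp hx
    have hxC : -(C : ℝ) ≤ x := by exact_mod_cast (abs_le.1 hx).1
    have hpr : (p : ℝ) = 8 * C + 8 := by rw [hp]; push_cast; ring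
    have h2pr' : 2 * (p : ℝ) ≤ (R * p : ℕ) := by exact_mod_cast h2pr
    have h3 : 0 ≤ (x : ℝ) + (R * p : ℕ) - p := by
      have : (0 : ℝ) ≤ C := by positivity
      linarith
    refine ⟨by positivity, b2, ?_, by positivity, ?_, ?_⟩
    · calc β * ((x : ℝ) + (R * p : ℕ)) ^ q' ≤ β * ((2 * R + 1) ^ q' * ((x : ℝ) + p) ^ q') := by
            gcongr; exact b3 R hR1
        _ = _ := by rw [hβ]; field_simp
    · gcongr; linarith
    · have : 0 ≤ (x : ℝ) + (R * p : ℕ) := by linarith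
      positivity
  have hp2 : ∀ x : ℤ, |x| ≤ C → |x| ≤ (p : ℤ) := fun x hx => by omega
  -- If B and B' have the same sign, one coefficient at lag p serves both requirements. If not, ±β
  -- at the distant lag reverses the moment without changing the sign of the boundary functional.
  rcases hB.lt_or_gt with h | h <;> rcases hB'.lt_or_gt with h' | h'
  · refine ⟨R * p, threeTerm p (R * p) 1 0, ?_, ?_, fun x hx => ?_⟩
    · rw [sum_threeTerm (by omega)]; norm_num
    · rw [moment_threeTerm (by omega) 1 0 (by omega)]
      nlinarith
    · rw [boundaryMoment_threeTerm h2pr 1 0 hq' (hp2 x hx)]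
      obtain ⟨b0, b1, -⟩ := hphi x hx
      nlinarith
  · refine ⟨R * p, threeTerm p (R * p) (-1 / 2) β, ?_, ?_, fun x hx => ?_⟩
    · rw [sum_threeTerm (by omega)]
      have : 0 < 1 + -1 / 2 + β := by linarith
      exact this.ne'
    · rw [moment_threeTerm (by omega) _ _ (by omega), hrq]
      have : 0 < -1 / 2 * (p : ℝ) ^ q + β * ((R : ℝ) ^ q * (p : ℝ) ^ q) +
        -1 / 2 * β * (((R * p : ℕ) : ℝ) - p) ^ q := by nlinarith
      nlinarith
    · rw [boundaryMoment_threeTerm h2pr _ _ hq' (hp2 x hx)]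
      obtain ⟨b0, b1, b2, b3, b4, b5⟩ := hphi x hx
      have hβ2 : β ^ 2 ≤ 1 / 16 := by nlinarith
      have h6 : (1 + (-1 / 2) ^ 2 + β ^ 2) * (max (x : ℝ) 0) ^ q' ≤ 3 / 2 * (max (x : ℝ) 0) ^ q' := by
        gcongr; linarith
      refine mul_nonpos_of_nonneg_of_nonpos h'.le ?_
      linarith
  · refine ⟨R * p, threeTerm p (R * p) 1 (-β), ?_, ?_, fun x hx => ?_⟩
    · rw [sum_threeTerm (by omega)]
      have : 0 < 1 + 1 + -β := by linarith
      exact this.ne'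
    · rw [moment_threeTerm (by omega) _ _ (by omega), hrq]
      have : 1 * (p : ℝ) ^ q + -β * ((R : ℝ) ^ q * (p : ℝ) ^ q) +
        1 * -β * (((R * p : ℕ) : ℝ) - p) ^ q < 0 := by nlinarith
      nlinarith
    · rw [boundaryMoment_threeTerm h2pr _ _ hq' (hp2 x hx)]
      obtain ⟨b0, b1, b2, b3, b4, b5⟩ := hphi x hx
      have h6 : 0 ≤ (1 + 1 ^ 2 + (-β) ^ 2) * (max (x : ℝ) 0) ^ q' := by positivity
      refine mul_nonpos_of_nonpos_of_nonneg h'.le ?_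
      linarith
  · refine ⟨R * p, threeTerm p (R * p) (-1 / 2) 0, ?_, ?_, fun x hx => ?_⟩
    · rw [sum_threeTerm (by omega)]; norm_num
    · rw [moment_threeTerm (by omega) _ 0 (by omega)]
      nlinarith
    · rw [boundaryMoment_threeTerm h2pr _ 0 hq' (hp2 x hx)]
      obtain ⟨b0, b1, -⟩ := hphi x hx
      nlinarith

end
end DiffLRV

namespace DiffLRV

noncomputable section

/-! ### Lower bounds for the risk -/

/-- Under some mechanism the risk is at least of the order `ℓ / n + ρ ^ 2`. -/
def RiskLowerBound (K : ℝ → ℝ) (q : ℕ) (t : Tuning) (ρ : ℕ → ℝ) : Prop :=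
  ∃ G : DGM, G.InClass q ∧ ∃ c : ℝ, 0 < c ∧
    ∀ᶠ n in atTop, c * ((t.ℓ n : ℝ) / n + ρ n ^ 2) ≤ mse K t G n

/-- The edge term in `hbias` absorbs the mean bias, which is at most 1/n while mh → ∞. The total
bias thus stays below -cρ, and the same mechanism carries the variance ℓ/n. -/
lemma riskLowerBound_of_noiseBias_le {K : ℝ → ℝ} (hK : IsKernel K) {q : ℕ} (hq : NearOrigin K q)
    {t : Tuning} (ht : t.Admissible) {M : ℕ} {ψ : ℕ → ℝ}
    (hψ : ∑ p ∈ Finset.range (M + 1), ψ p ≠ 0)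
    (hoff : ∃ C : ℝ, ∀ᶠ n in atTop, ∀ u : ℤ, offDiag K (t.m n) (t.ℓ n) (t.h n) (t.d n) u ≤
      C / t.ℓ n * (1 + |(u : ℝ)|)) {ρ : ℕ → ℝ} (hρ : ∀ n, 0 ≤ ρ n) {c : ℝ} (hc : 0 < c)
    (hbias : ∀ᶠ n in atTop, noiseBias K t n (maNoise M ψ) ≤
      -(c * ρ n) - c * ((t.m n : ℝ) * t.h n / n)) : RiskLowerBound K q t ρ := by
  obtain ⟨c₁, hc₁, hvar⟩ := variance_vHat_ge (M := M) (ψ := ψ) hK hq ht lastMean hψ hoff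
  have hG : DGM.InClass ⟨maNoise M ψ, lastMean⟩ q := inClass_maNoise mildMean_lastMean q
  refine ⟨⟨maNoise M ψ, lastMean⟩, hG, min c₁ (c ^ 2), by positivity, ?_⟩
  filter_upwards [hvar, hbias, meanBias_lastMean hK ht (maNoise M ψ), ht.eventually_basic,
    ht.tendsto_mul_lag.eventually_ge_atTop (1 / c)] with n h1 h2 h3 hb h4
  have hn0 : (0 : ℝ) < n := by exact_mod_cast hb.1
  rw [mse_eq hK t hG.weakDep hG.finiteU hb.2.1 hb.2.2.2.2]
  have h5 : 1 / (n : ℝ) ≤ c * ((t.m n : ℝ) * t.h n / n) := by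
    rw [div_le_iff₀ hc] at h4
    rw [← mul_div_assoc]
    gcongr
    linarith
  set b := noiseBias K t n (maNoise M ψ) + meanBias K t n (DGM.mu ⟨maNoise M ψ, lastMean⟩ n)
  have h6 : b ≤ -(c * ρ n) := by simp only [b]; linarith [h3.2]
  have h7 : 0 ≤ c * ρ n := mul_nonneg hc.le (hρ n)
  have h8 : c ^ 2 * ρ n ^ 2 ≤ b ^ 2 := by nlinarith
  have h9 : min c₁ (c ^ 2) * ((t.ℓ n : ℝ) / n) ≤ c₁ * ((t.ℓ n : ℝ) / n) := by
    gcongr; exact min_le_left _ _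
  have h10 : min c₁ (c ^ 2) * ρ n ^ 2 ≤ c ^ 2 * ρ n ^ 2 := by
    gcongr; exact min_le_right _ _
  rw [mul_add]
  linarith

lemma natCast_eq_scale (q n : ℕ) : (n : ℝ) = scale q n * scale q n ^ (2 * q) := by
  rw [← pow_succ', add_comm, scale_pow_eq]

lemma noBetterThanOpt_of_riskLowerBound {K : ℝ → ℝ} {q : ℕ} {t : Tuning} (ht : t.Admissible)
    (h : RiskLowerBound K q t fun n => 1 / (t.ℓ n : ℝ) ^ q) : NoBetterThanOpt K q t := by
  obtain ⟨G, hG, c, hc, hmse⟩ := h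
  refine ⟨G, hG, IsBigO.of_bound (1 / c) ?_⟩
  filter_upwards [hmse, ht.eventually_basic] with n h1 hb
  have hs := scale_pos q hb.1
  have hℓ0 : (0 : ℝ) < t.ℓ n := by exact_mod_cast hb.2.1
  have hn0 : (0 : ℝ) < n := by exact_mod_cast hb.1
  -- The trade-off: for ℓ ≥ x the variance term, for ℓ ≤ x the squared bias is at least x^{-2q}.
  have h2 : 1 / scale q n ^ (2 * q) ≤ (t.ℓ n : ℝ) / n + (1 / (t.ℓ n : ℝ) ^ q) ^ 2 := by
    rcases le_total (scale q n) (t.ℓ n) with h | h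
    · have h3 : 1 / scale q n ^ (2 * q) ≤ (t.ℓ n : ℝ) / n := by
        rw [div_le_div_iff₀ (by positivity) hn0, one_mul]
        conv_lhs => rw [natCast_eq_scale q n]
        gcongr
      have : 0 ≤ (1 / (t.ℓ n : ℝ) ^ q) ^ 2 := by positivity
      linarith
    · have h3 : 1 / scale q n ^ (2 * q) ≤ (1 / (t.ℓ n : ℝ) ^ q) ^ 2 := by
        rw [div_pow, one_pow, ← pow_mul, mul_comm q 2]
        gcongr
      have : 0 ≤ (t.ℓ n : ℝ) / n := by positivity
      linarith
  have h4 : 0 ≤ mse K t G n := le_trans (by positivity) h1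
  rw [optRate_eq q hb.1, Real.norm_eq_abs, Real.norm_eq_abs, abs_of_nonneg h4,
    abs_of_nonneg (by positivity), one_div_mul_eq_div, le_div_iff₀ hc, mul_comm]
  exact (mul_le_mul_of_nonneg_left h2 hc.le).trans h1

/-- Rate optimality bounds the bandwidth from above and the bias scale `ρ`. -/
lemma le_of_rateOptimal_of_riskLowerBound {K : ℝ → ℝ} {q : ℕ} {t : Tuning}
    {ρ : ℕ → ℝ} (h : RiskLowerBound K q t ρ) (hopt : RateOptimal K q t) :
    ∃ C : ℝ, 0 < C ∧ ∀ᶠ n in atTop, (t.ℓ n : ℝ) ≤ C * scale q n ∧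
      ρ n * scale q n ^ q ≤ C := by
  obtain ⟨G, hG, c, hc, hmse⟩ := h
  obtain ⟨C, hC0, hC⟩ := le_of_mse_isBigO (hopt G hG)
  refine ⟨C / c + 1, by positivity, ?_⟩
  filter_upwards [hmse, hC, eventually_ge_atTop 1] with n h1 h2 hn1
  have hs := scale_pos q hn1
  have hn0 : (0 : ℝ) < n := by exact_mod_cast hn1
  have h3 := h1.trans h2
  have h4 : 0 ≤ (t.ℓ n : ℝ) / n := by positivity
  have h5 : 0 ≤ ρ n ^ 2 := sq_nonneg _
  rw [le_div_iff₀ (by positivity)] at h3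
  constructor
  · have h6 : c * ((t.ℓ n : ℝ) / n) * scale q n ^ (2 * q) ≤ C := by
      refine le_trans ?_ h3
      gcongr
      linarith
    have h7 : (t.ℓ n : ℝ) / n * scale q n ^ (2 * q) = t.ℓ n / scale q n := by
      conv_lhs => rw [natCast_eq_scale q n]
      field_simp
    rw [mul_assoc, h7, ← mul_div_assoc, div_le_iff₀ hs] at h6
    rw [add_mul, div_mul_eq_mul_div, one_mul]
    have : (t.ℓ n : ℝ) ≤ C * scale q n / c := by rw [le_div_iff₀ hc]; linarith
    linarith
  · have h6 : c * (ρ n ^ 2 * scale q n ^ (2 * q)) ≤ C := by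
      rw [← mul_assoc]
      refine le_trans ?_ h3
      gcongr
      linarith
    have h7 : ρ n ^ 2 * scale q n ^ (2 * q) = (ρ n * scale q n ^ q) ^ 2 := by
      rw [mul_pow, ← pow_mul, mul_comm q 2]
    rw [h7] at h6
    have h8 : (ρ n * scale q n ^ q) ^ 2 ≤ C / c := by rw [le_div_iff₀ hc]; linarith
    have h9 : 0 ≤ C / c := by positivity
    nlinarith

/-- Rate optimality forces the bandwidth to be of the optimal order. -/
lemma bandwidth_of_rateOptimal {K : ℝ → ℝ} {q : ℕ} (hq : 1 ≤ q) {t : Tuning} (ht : t.Admissible)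
    (h : RiskLowerBound K q t fun n => 1 / (t.ℓ n : ℝ) ^ q) (hopt : RateOptimal K q t) :
    ∃ C : ℝ, 1 ≤ C ∧ ∀ᶠ n in atTop, (t.ℓ n : ℝ) ≤ C * scale q n ∧ scale q n ≤ C * t.ℓ n := by
  obtain ⟨C, hC0, hC⟩ := le_of_rateOptimal_of_riskLowerBound h hopt
  refine ⟨C + 1, by linarith, ?_⟩
  filter_upwards [hC, ht.eventually_basic] with n h1 hb
  have hs := scale_pos q hb.1
  have hℓ0 : (0 : ℝ) < t.ℓ n := by exact_mod_cast hb.2.1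
  refine ⟨h1.1.trans (by nlinarith), ?_⟩
  have h2 := h1.2
  rw [one_div_mul_eq_div, div_le_iff₀ (by positivity)] at h2
  refine le_of_pow_le_pow_left₀ (n := q) (by omega) (by positivity) ?_
  rw [mul_pow]
  refine h2.trans ?_
  gcongr
  exact (by linarith : C ≤ C + 1).trans (le_self_pow₀ (by linarith) (by omega))

lemma isTheta_scale_of_bounds {q : ℕ} {t : Tuning} {C : ℝ} (hC : 1 ≤ C)
    (h : ∀ᶠ n in atTop, (t.ℓ n : ℝ) ≤ C * scale q n ∧ scale q n ≤ C * t.ℓ n) :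
    (fun n => (t.ℓ n : ℝ)) =Θ[atTop] nPow q 1 := by
  constructor
  · refine IsBigO.of_bound C ?_
    filter_upwards [h, eventually_ge_atTop 1] with n hn hn1
    have hs := scale_pos q hn1
    rw [Real.norm_eq_abs, Real.norm_eq_abs, Nat.abs_cast]
    exact hn.1.trans (mul_le_mul_of_nonneg_left (le_abs_self (scale q n)) (by linarith))
  · refine IsBigO.of_bound C ?_
    filter_upwards [h, eventually_ge_atTop 1] with n hn hn1
    have hs := scale_pos q hn1
    rw [Real.norm_eq_abs, Real.norm_eq_abs, Nat.abs_cast, show nPow q 1 n = scale q n from rfl,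
      abs_of_pos hs]
    exact hn.2

lemma bounds_of_isTheta_scale {q : ℕ} {t : Tuning}
    (h : (fun n => (t.ℓ n : ℝ)) =Θ[atTop] nPow q 1) :
    ∃ C : ℝ, 1 ≤ C ∧ ∀ᶠ n in atTop, (t.ℓ n : ℝ) ≤ C * scale q n ∧ scale q n ≤ C * t.ℓ n := by
  obtain ⟨C₁, hC₁, h₁⟩ := h.1.exists_pos
  obtain ⟨C₂, hC₂, h₂⟩ := h.2.exists_pos
  refine ⟨C₁ + C₂ + 1, by linarith, ?_⟩
  filter_upwards [h₁.bound, h₂.bound, eventually_ge_atTop 1] with n h1 h2 hn1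
  have hs := scale_pos q hn1
  rw [Real.norm_eq_abs, Real.norm_eq_abs, Nat.abs_cast, show nPow q 1 n = scale q n from rfl,
    abs_of_pos hs] at h1 h2
  have : (0 : ℝ) ≤ t.ℓ n := by positivity
  exact ⟨by nlinarith, by nlinarith⟩

lemma attainsOpt_of {K : ℝ → ℝ} {q : ℕ} {t : Tuning} (hopt : RateOptimal K q t)
    (hnb : NoBetterThanOpt K q t) : AttainsOpt K q t := by
  obtain ⟨G, hG, h⟩ := hnb
  exact ⟨hopt, G, hG, hopt G hG, h⟩

/-- The risk when the off-diagonal weights are negligible. -/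
theorem riskLowerBound_of_offDiag {K : ℝ → ℝ} (hK : IsKernel K) {q : ℕ} (hq : NearOrigin K q)
    {t : Tuning} (ht : t.Admissible)
    (hoff : ∃ C : ℝ, ∀ᶠ n in atTop, ∀ u : ℤ, offDiag K (t.m n) (t.ℓ n) (t.h n) (t.d n) u ≤
      C / t.ℓ n * (1 + |(u : ℝ)|))
    (hoffq : ∀ u : ℤ, ∀ e : ℝ, 0 < e → ∀ᶠ n in atTop,
      offDiag K (t.m n) (t.ℓ n) (t.h n) (t.d n) u ≤ e / (t.ℓ n : ℝ) ^ q) :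
    RiskLowerBound K q t fun n => 1 / (t.ℓ n : ℝ) ^ q := by
  obtain ⟨hq1, B, hB0, hB⟩ := id hq
  -- The smoothing bias gets the sign of the edge loss. Of its size |S|, a quarter is spent on the
  -- limit and a quarter on the off-diagonal weights.
  obtain ⟨M, ψ, hψ, hneg⟩ := exists_moment hB0 hq1
  set S := B * (∑ u ∈ Finset.Icc (-(M : ℤ)) M, delta M ψ u * |(u : ℝ)| ^ q)
  set Γ : ℝ := ∑ u ∈ Finset.Icc (-(M : ℤ)) M, |delta M ψ u| with hΓ
  have hΓ0 : 0 ≤ Γ := Finset.sum_nonneg fun _ _ => abs_nonneg _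
  set v := (∑ p ∈ Finset.range (M + 1), ψ p) ^ 2 with hv
  have hv0 : 0 < v := by positivity
  have he : 0 < -S / 4 := by linarith
  have he' : 0 < -S / 4 / (Γ + 1) := by positivity
  refine riskLowerBound_of_noiseBias_le hK hq ht hψ hoff (fun n => by positivity)
    (c := min (-S / 2) (v / 2)) (lt_min (by linarith) (by linarith)) ?_
  have hall : ∀ᶠ n in atTop, ∀ u ∈ Finset.Icc (-(M : ℤ)) M,
      offDiag K (t.m n) (t.ℓ n) (t.h n) (t.d n) u ≤ -S / 4 / (Γ + 1) / (t.ℓ n : ℝ) ^ q := by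
    rw [Finset.eventually_all]
    exact fun u _ => hoffq u _ he'
  filter_upwards [noiseBias_maNoise_le hK hq1 hB ht hψ he, hall, ht.eventually_basic,
    ht.normalized] with n h1 h2 hb hd
  have hn0 : (0 : ℝ) < n := by exact_mod_cast hb.1
  have hℓ0 : (0 : ℝ) < t.ℓ n := by exact_mod_cast hb.2.1
  have h3 : ∑ u ∈ Finset.Icc (-(M : ℤ)) M, delta M ψ u *
      offWt K n (t.m n) (t.ℓ n) (t.h n) (t.d n) u ≤ -S / 4 / (t.ℓ n : ℝ) ^ q := by
    calc _ ≤ ∑ u ∈ Finset.Icc (-(M : ℤ)) M, |delta M ψ u| *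
          (-S / 4 / (Γ + 1) / (t.ℓ n : ℝ) ^ q) := by
          refine Finset.sum_le_sum fun u hu => (le_abs_self _).trans ?_
          rw [abs_mul]
          gcongr
          exact (abs_wt_sub_le hK hb.2.1 hb.2.2.2.2 hd u).trans (h2 u hu)
      _ = Γ * (-S / 4 / (Γ + 1)) / (t.ℓ n : ℝ) ^ q := by
          rw [← Finset.sum_mul, ← hΓ, mul_div_assoc]
      _ ≤ _ := by
          gcongr
          rw [← mul_div_assoc, div_le_iff₀ (by positivity)]
          nlinarith
  have h4 : (S + -S / 4) / (t.ℓ n : ℝ) ^ q + -S / 4 / (t.ℓ n : ℝ) ^ q =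
      -(-S / 2 * (1 / (t.ℓ n : ℝ) ^ q)) := by ring
  have h5 : min (-S / 2) (v / 2) * (1 / (t.ℓ n : ℝ) ^ q) ≤ -S / 2 * (1 / (t.ℓ n : ℝ) ^ q) := by
    gcongr; exact min_le_left _ _
  have h6 : min (-S / 2) (v / 2) * ((t.m n : ℝ) * t.h n / n) ≤ v / 2 * ((t.m n : ℝ) * t.h n / n) := by
    gcongr; exact min_le_right _ _
  linarith

/-- The risk when `h` exceeds `ℓ` by a factor. -/
theorem riskLowerBound_of_gap {K : ℝ → ℝ} (hK : IsKernel K) {q : ℕ} (hq : NearOrigin K q)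
    {t : Tuning} (ht : t.Admissible) {e : ℝ} (he : 0 < e)
    (hgap : ∀ᶠ n in atTop, (1 + e) * t.ℓ n ≤ t.h n) :
    RiskLowerBound K q t fun n => 1 / (t.ℓ n : ℝ) ^ q := by
  obtain ⟨A, hA⟩ := hK.bounded
  have hA0 : 0 ≤ A := (abs_nonneg _).trans (hA 0)
  obtain ⟨D, hD⟩ := ht.summable_delta
  refine riskLowerBound_of_offDiag hK hq ht ⟨A * D * (1 / e), ?_⟩ fun u e' he' => ?_
  · filter_upwards [hgap, hD, ht.eventually_basic] with n h1 h2 hb u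
    have hℓ0 : (0 : ℝ) < t.ℓ n := by exact_mod_cast hb.2.1
    have hD0 : 0 ≤ D := (Finset.sum_nonneg fun _ _ => abs_nonneg _).trans h2
    refine (offDiag_le_of_gap (q := 1) hK hA hb.2.1 he h1 u).trans ?_
    rw [pow_one, pow_one]
    calc _ ≤ A * D * (1 / (e * t.ℓ n)) * (1 + |(u : ℝ)|) := by
          gcongr
          linarith
      _ = _ := by field_simp
  · have hℓr : Tendsto (fun n => (t.ℓ n : ℝ)) atTop atTop :=
      tendsto_natCast_atTop_atTop.comp ht.bandwidth_tendsto
    filter_upwards [hgap, ht.eventually_basic, hℓr.eventually_gt_atTop (|(u : ℝ)| / e)] with n h1 hb h2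
    have hℓ0 : (0 : ℝ) < t.ℓ n := by exact_mod_cast hb.2.1
    have : offDiag K (t.m n) (t.ℓ n) (t.h n) (t.d n) u = 0 := by
      refine Finset.sum_eq_zero fun s hs => ?_
      have hs0 : s ≠ 0 := (Finset.mem_erase.1 hs).1
      rw [hK.support, abs_zero, mul_zero]
      rw [abs_div, Nat.abs_cast, le_div_iff₀ hℓ0, one_mul]
      have h3 : (1 : ℝ) ≤ |(s : ℝ)| := by
        rw [← Int.cast_abs]; exact_mod_cast Int.one_le_abs hs0
      have h4 : (t.h n : ℝ) ≤ |(s : ℝ) * t.h n| := by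
        rw [abs_mul, Nat.abs_cast]
        exact le_mul_of_one_le_left (by positivity) h3
      have h5 : |(s : ℝ) * t.h n| ≤ |((u + s * t.h n : ℤ) : ℝ)| + |(u : ℝ)| := by
        have := abs_sub ((u : ℝ) + s * t.h n) u
        rw [add_sub_cancel_left] at this
        push_cast
        exact this
      rw [div_lt_iff₀ he] at h2
      nlinarith
    rw [this]
    positivity

end
end DiffLRV

namespace DiffLRV

noncomputable section

/-! ### Lag close to the bandwidth -/

lemma Tuning.Admissible.tendsto_bandwidth {t : Tuning} (ht : t.Admissible) :
    Tendsto (fun n => (t.ℓ n : ℝ)) atTop atTop :=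
  tendsto_natCast_atTop_atTop.comp ht.bandwidth_tendsto

lemma Tuning.Admissible.tendsto_order {t : Tuning} (ht : t.Admissible) :
    Tendsto (fun n => (t.m n : ℝ)) atTop atTop :=
  tendsto_natCast_atTop_atTop.comp ht.order_tendsto

/-- Off-diagonal weights when `|h - ℓ|` is bounded. -/
lemma exists_offDiag_near {K : ℝ → ℝ} (hK : IsKernel K) {q' : ℕ} (hq' : NearBoundary K q')
    {t : Tuning} (ht : t.Admissible) (hA : t.ApproxUncorrelated)
    (hC : ∃ C : ℝ, ∀ᶠ n in atTop, |(t.h n : ℝ) - (t.ℓ n : ℝ)| ≤ C) (r : ℕ) :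
    ∃ C : ℝ, 0 < C ∧ ∀ᶠ n in atTop, ∀ u : ℤ, offDiag K (t.m n) (t.ℓ n) (t.h n) (t.d n) u ≤
      C * (1 / (t.ℓ n : ℝ) ^ r + 1 / (t.m n * (t.ℓ n : ℝ) ^ min r q')) * (1 + |(u : ℝ)| ^ r) := by
  obtain ⟨A, hAb⟩ := hK.bounded
  have hA0 : 0 ≤ A := (abs_nonneg _).trans (hAb 0)
  obtain ⟨D, hD⟩ := ht.summable_delta
  obtain ⟨c', c'', hc', hc'', hδ⟩ := hA
  obtain ⟨C₁, hC₁0, hC₁⟩ := hK.abs_le_near_one hq'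
  obtain ⟨C₂, hC₂⟩ := hC
  refine ⟨A * |D| * 2 ^ r + 2 * (c'' * (C₁ * (|C₂| + 1) ^ min r q')) + 1, by positivity, ?_⟩
  filter_upwards [hD, hδ, hC₂, ht.eventually_basic,
    ht.tendsto_bandwidth.eventually_ge_atTop (4 * |C₂|)] with n hDn hδn hCn hb hℓn u
  have hℓ0 : (0 : ℝ) < t.ℓ n := by exact_mod_cast hb.2.1
  have hm0 : (0 : ℝ) < t.m n := by exact_mod_cast hb.2.2.2.1
  have hab := abs_le.1 (hCn.trans (le_abs_self C₂))
  have ha : ∀ s : ℤ, |s| = 1 → |delta (t.m n) (t.d n) s| ≤ c'' / t.m n := by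
    intro s hs
    obtain ⟨h1, h2⟩ := hδn s hs.ge (by rw [hs]; exact_mod_cast hb.2.2.2.1)
    rw [neg_div] at h1 h2
    have h3 : 0 ≤ c' / t.m n := by positivity
    have h4 : 0 ≤ c'' / t.m n := by positivity
    exact abs_le.2 ⟨h1, by linarith⟩
  refine (offDiag_le_of_near (q := r) hK hAb hC₁0 hC₁ hb.2.1 ha (abs_nonneg C₂)
    (by linarith [hab.1]) (by linarith [hab.1]) u).trans ?_
  gcongr
  have h5 : A * (∑ s ∈ Finset.Icc (-(t.m n : ℤ)) (t.m n), |delta (t.m n) (t.d n) s|) *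
      (2 / (t.ℓ n : ℝ)) ^ r ≤ A * |D| * 2 ^ r * (1 / (t.ℓ n : ℝ) ^ r) := by
    rw [div_pow, mul_one_div, ← mul_div_assoc]
    gcongr
    exact hDn.trans (le_abs_self D)
  have h6 : 2 * (c'' / t.m n * (C₁ * ((|C₂| + 1) ^ min r q' / (t.ℓ n : ℝ) ^ min r q'))) =
      2 * (c'' * (C₁ * (|C₂| + 1) ^ min r q')) * (1 / (t.m n * (t.ℓ n : ℝ) ^ min r q')) := by
    field_simp
  rw [h6]
  have h7 : 0 ≤ 1 / (t.ℓ n : ℝ) ^ r := by positivity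
  have h8 : 0 ≤ 1 / (t.m n * (t.ℓ n : ℝ) ^ min r q') := by positivity
  have h9 : 0 ≤ A * |D| * 2 ^ r := by positivity
  have h10 : 0 ≤ 2 * (c'' * (C₁ * (|C₂| + 1) ^ min r q')) := by positivity
  nlinarith [mul_nonneg h9 h8, mul_nonneg h10 h7]

lemma exists_offDiag_near_linear {K : ℝ → ℝ} (hK : IsKernel K) {q' : ℕ} (hq' : NearBoundary K q')
    {t : Tuning} (ht : t.Admissible) (hA : t.ApproxUncorrelated)
    (hC : ∃ C : ℝ, ∀ᶠ n in atTop, |(t.h n : ℝ) - (t.ℓ n : ℝ)| ≤ C) :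
    ∃ C : ℝ, ∀ᶠ n in atTop, ∀ u : ℤ, offDiag K (t.m n) (t.ℓ n) (t.h n) (t.d n) u ≤
      C / t.ℓ n * (1 + |(u : ℝ)|) := by
  obtain ⟨C, hC0, hC⟩ := exists_offDiag_near hK hq' ht hA hC 1
  refine ⟨2 * C, ?_⟩
  filter_upwards [hC, ht.eventually_basic] with n h1 hb u
  have hℓ0 : (0 : ℝ) < t.ℓ n := by exact_mod_cast hb.2.1
  have hm1 : (1 : ℝ) ≤ t.m n := by exact_mod_cast hb.2.2.2.1
  have h2 := h1 u
  rw [min_eq_left hq'.1, pow_one, pow_one] at h2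
  refine h2.trans ?_
  gcongr
  have h3 : 1 / (t.m n * (t.ℓ n : ℝ)) ≤ 1 / t.ℓ n := by
    gcongr
    exact le_mul_of_one_le_left hℓ0.le hm1
  calc C * (1 / (t.ℓ n : ℝ) + 1 / (t.m n * (t.ℓ n : ℝ))) ≤ C * (1 / t.ℓ n + 1 / t.ℓ n) := by gcongr
    _ = _ := by ring

lemma exists_nat_bound {t : Tuning}
    (hC : ∃ C : ℝ, ∀ᶠ n in atTop, |(t.h n : ℝ) - (t.ℓ n : ℝ)| ≤ C) :
    ∃ C : ℕ, ∀ᶠ n in atTop, |(t.ℓ n : ℤ) - t.h n| ≤ C := by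
  obtain ⟨C, hC⟩ := hC
  refine ⟨⌈C⌉₊, ?_⟩
  filter_upwards [hC] with n hn
  have h1 : |(t.ℓ n : ℝ) - t.h n| ≤ ⌈C⌉₊ := by
    rw [abs_sub_comm]; exact hn.trans (Nat.le_ceil C)
  exact_mod_cast h1

lemma delta_one_bounds {t : Tuning} (ht : t.Admissible) (hA : t.ApproxUncorrelated) :
    ∃ c' c'' : ℝ, 0 < c' ∧ 0 < c'' ∧ ∀ᶠ n in atTop,
      c' / t.m n ≤ -delta (t.m n) (t.d n) 1 ∧ -delta (t.m n) (t.d n) 1 ≤ c'' / t.m n := by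
  obtain ⟨c', c'', hc', hc'', hδ⟩ := hA
  refine ⟨c', c'', hc', hc'', ?_⟩
  filter_upwards [hδ, ht.eventually_basic] with n h hb
  obtain ⟨h1, h2⟩ := h 1 (by simp) (by rw [abs_one]; exact_mod_cast hb.2.2.2.1)
  rw [neg_div] at h1 h2
  constructor <;> linarith

lemma eventually_delta_one_nonpos {t : Tuning} (ht : t.Admissible) (hA : t.ApproxUncorrelated) :
    ∀ᶠ n in atTop, delta (t.m n) (t.d n) 1 ≤ 0 := by
  obtain ⟨c', c'', hc', -, h⟩ := delta_one_bounds ht hA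
  filter_upwards [h] with n hn
  have : 0 ≤ c' / t.m n := by positivity
  linarith [hn.1]

/-- The risk when `|h - ℓ|` is bounded and `ℓ ^ q ≲ m ℓ ^ q'`. -/
theorem riskLowerBound_of_near {K : ℝ → ℝ} (hK : IsKernel K) {q q' : ℕ} (hq : NearOrigin K q)
    (hq' : NearBoundary K q') {t : Tuning} (ht : t.Admissible) (hA : t.ApproxUncorrelated)
    (hC : ∃ C : ℝ, ∀ᶠ n in atTop, |(t.h n : ℝ) - (t.ℓ n : ℝ)| ≤ C)
    (hO : ∃ C : ℝ, 0 < C ∧ ∀ᶠ n in atTop, (t.ℓ n : ℝ) ^ q ≤ C * (t.m n * (t.ℓ n : ℝ) ^ q')) :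
    RiskLowerBound K q t fun n => 1 / (t.ℓ n : ℝ) ^ q := by
  have hlin := exists_offDiag_near_linear hK hq' ht hA hC
  rcases le_or_gt q q' with hqq | hqq
  -- If q ≤ q', the off-diagonal weights are o(ℓ^{-q}): the boundary part carries an extra 1/m, and
  -- the other part is taken with exponent q + 1, harmless as u is fixed.
  · refine riskLowerBound_of_offDiag hK hq ht hlin fun u e he => ?_
    obtain ⟨C, hC0, hC⟩ := exists_offDiag_near hK hq' ht hA hC (q + 1)
    set w : ℝ := C * (1 + |(u : ℝ)| ^ (q + 1)) with hw
    have hw0 : 0 < w := by positivity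
    filter_upwards [hC, ht.eventually_basic, ht.tendsto_bandwidth.eventually_ge_atTop (2 * w / e),
      ht.tendsto_order.eventually_ge_atTop (2 * w / e)] with n h1 hb h2 h3
    have hℓ0 : (0 : ℝ) < t.ℓ n := by exact_mod_cast hb.2.1
    have hℓ1 : (1 : ℝ) ≤ t.ℓ n := by exact_mod_cast hb.2.1
    have hm0 : (0 : ℝ) < t.m n := by exact_mod_cast hb.2.2.2.1
    refine (h1 u).trans ?_
    have h4 : 1 / (t.m n * (t.ℓ n : ℝ) ^ min (q + 1) q') ≤ 1 / (t.m n * (t.ℓ n : ℝ) ^ q) := by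
      gcongr
      exact le_min (by omega) hqq
    have h5 : w / t.ℓ n ≤ e / 2 := by
      rw [div_le_iff₀ he] at h2
      rw [div_le_iff₀ hℓ0]
      linarith
    have h6 : w / t.m n ≤ e / 2 := by
      rw [div_le_iff₀ he] at h3
      rw [div_le_iff₀ hm0]
      linarith
    calc _ ≤ C * (1 / (t.ℓ n : ℝ) ^ (q + 1) + 1 / (t.m n * (t.ℓ n : ℝ) ^ q)) *
          (1 + |(u : ℝ)| ^ (q + 1)) := by gcongr
      _ = (w / t.ℓ n + w / t.m n) / (t.ℓ n : ℝ) ^ q := by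
          rw [hw]; field_simp; ring
      _ ≤ _ := by gcongr; linarith
  -- If q' < q, the boundary term may be as large as the smoothing bias, so the noise is chosen to
  -- give both the same sign.
  · obtain ⟨hq1, B, hB0, hB⟩ := id hq
    obtain ⟨hq1', B', hB0', hB'⟩ := id hq'
    obtain ⟨Cn, hCn⟩ := exists_nat_bound hC
    obtain ⟨M, ψ, hψ, hneg, hbm⟩ := exists_moment_boundaryMoment hB0 hB0' hq1' hqq Cn
    obtain ⟨c', c'', hc', hc'', hδ⟩ := delta_one_bounds ht hA
    obtain ⟨C₀, hC₀, hO⟩ := hO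
    set S := B * (∑ u ∈ Finset.Icc (-(M : ℤ)) M, delta M ψ u * |(u : ℝ)| ^ q)
    set v := (∑ p ∈ Finset.range (M + 1), ψ p) ^ 2 with hv
    have hv0 : 0 < v := by positivity
    have he : 0 < -S / 4 := by linarith
    -- The divisor undoes the factor 2, |δ_1| ≤ c''/m and 1/(mℓ^{q'}) ≤ C₀/ℓ^q, so the error spends
    -- a quarter of |S|.
    have he' : 0 < -S / 4 / (2 * c'' * C₀) := by positivity
    refine riskLowerBound_of_noiseBias_le hK hq ht hψ hlin (fun n => by positivity)
      (c := min (-S / 2) (v / 2)) (lt_min (by linarith) (by linarith)) ?_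
    filter_upwards [noiseBias_maNoise_le hK hq1 hB ht hψ he, ht.eventually_basic, hδ, hO, hCn,
      sum_offWt_le (M := M) (ψ := ψ) hK hq1' hB' ht hCn (eventually_delta_one_nonpos ht hA) he'] with
      n h1 hb hδn hOn hCnn h2
    have hn0 : (0 : ℝ) < n := by exact_mod_cast hb.1
    have hℓ0 : (0 : ℝ) < t.ℓ n := by exact_mod_cast hb.2.1
    have hm0 : (0 : ℝ) < t.m n := by exact_mod_cast hb.2.2.2.1
    have hδ0 : 0 ≤ -delta (t.m n) (t.d n) 1 := le_trans (by positivity) hδn.1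
    have h3 : ∑ u ∈ Finset.Icc (-(M : ℤ)) M, delta M ψ u *
        offWt K n (t.m n) (t.ℓ n) (t.h n) (t.d n) u ≤ -S / 4 / (t.ℓ n : ℝ) ^ q := by
      refine h2.trans ?_
      have hx := hbm _ hCnn
      calc _ ≤ 2 * (c'' / t.m n) * (-S / 4 / (2 * c'' * C₀)) / (t.ℓ n : ℝ) ^ q' := by
            have h7 : B' * boundaryMoment M ψ q' (t.ℓ n - t.h n) + -S / 4 / (2 * c'' * C₀) ≤
              -S / 4 / (2 * c'' * C₀) := by linarith
            calc _ ≤ 2 * -delta (t.m n) (t.d n) 1 * (-S / 4 / (2 * c'' * C₀)) /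
                  (t.ℓ n : ℝ) ^ q' := by gcongr
              _ ≤ _ := by gcongr; exact hδn.2
        _ = -S / 4 * (1 / (C₀ * (t.m n * (t.ℓ n : ℝ) ^ q'))) := by field_simp
        _ ≤ -S / 4 * (1 / (t.ℓ n : ℝ) ^ q) := by gcongr
        _ = _ := by ring
    have h4 : (S + -S / 4) / (t.ℓ n : ℝ) ^ q + -S / 4 / (t.ℓ n : ℝ) ^ q =
        -(-S / 2 * (1 / (t.ℓ n : ℝ) ^ q)) := by ring
    have h5 : min (-S / 2) (v / 2) * (1 / (t.ℓ n : ℝ) ^ q) ≤ -S / 2 * (1 / (t.ℓ n : ℝ) ^ q) := by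
      gcongr; exact min_le_left _ _
    have h6 : min (-S / 2) (v / 2) * ((t.m n : ℝ) * t.h n / n) ≤
        v / 2 * ((t.m n : ℝ) * t.h n / n) := by
      gcongr; exact min_le_right _ _
    linarith

/-- The risk when `|h - ℓ|` is bounded and `m ℓ ^ q' ≪ ℓ ^ q`. -/
theorem riskLowerBound_boundary {K : ℝ → ℝ} (hK : IsKernel K) {q q' : ℕ} (hq : NearOrigin K q)
    (hq' : NearBoundary K q') {t : Tuning} (ht : t.Admissible) (hA : t.ApproxUncorrelated)
    (hC : ∃ C : ℝ, ∀ᶠ n in atTop, |(t.h n : ℝ) - (t.ℓ n : ℝ)| ≤ C)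
    (ho : ∀ e : ℝ, 0 < e → ∀ᶠ n in atTop, t.m n * (t.ℓ n : ℝ) ^ q' ≤ e * (t.ℓ n : ℝ) ^ q) :
    RiskLowerBound K q t fun n => 1 / (t.m n * (t.ℓ n : ℝ) ^ q') := by
  have hlin := exists_offDiag_near_linear hK hq' ht hA hC
  obtain ⟨hq1, B, hB0, hB⟩ := id hq
  obtain ⟨hq1', B', hB0', hB'⟩ := id hq'
  obtain ⟨Cn, hCn⟩ := exists_nat_bound hC
  -- The smoothing bias is now of smaller order than the boundary term, so only the sign of the
  -- latter needs to be prescribed.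
  obtain ⟨M, ψ, c, hc, hψ, hbm⟩ := exists_boundaryMoment hB0' hq1' Cn
  obtain ⟨c', c'', hc', hc'', hδ⟩ := delta_one_bounds ht hA
  set S := B * (∑ u ∈ Finset.Icc (-(M : ℤ)) M, delta M ψ u * |(u : ℝ)| ^ q)
  set v := (∑ p ∈ Finset.range (M + 1), ψ p) ^ 2 with hv
  have hv0 : 0 < v := by positivity
  have hS0 : 0 < |S| + 1 := by positivity
  refine riskLowerBound_of_noiseBias_le hK hq ht hψ hlin (fun n => by positivity)
    (c := min (c * c' / 2) (v / 2)) (lt_min (by positivity) (by positivity)) ?_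
  filter_upwards [noiseBias_maNoise_le hK hq1 hB ht hψ one_pos, ht.eventually_basic, hδ, hCn,
    ho (c * c' / 2 / (|S| + 1)) (by positivity),
    sum_offWt_le (M := M) (ψ := ψ) hK hq1' hB' ht hCn (eventually_delta_one_nonpos ht hA)
      (half_pos hc)] with n h1 hb hδn hCnn hon h2
  have hn0 : (0 : ℝ) < n := by exact_mod_cast hb.1
  have hℓ0 : (0 : ℝ) < t.ℓ n := by exact_mod_cast hb.2.1
  have hm0 : (0 : ℝ) < t.m n := by exact_mod_cast hb.2.2.2.1
  have hδ0 : 0 ≤ -delta (t.m n) (t.d n) 1 := le_trans (by positivity) hδn.1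
  have h3 : ∑ u ∈ Finset.Icc (-(M : ℤ)) M, delta M ψ u *
      offWt K n (t.m n) (t.ℓ n) (t.h n) (t.d n) u ≤ -(c * c' * (1 / (t.m n * (t.ℓ n : ℝ) ^ q'))) := by
    refine h2.trans ?_
    have hx := hbm _ hCnn
    rw [div_le_iff₀ (by positivity)]
    have h7 : -(c * c' * (1 / (t.m n * (t.ℓ n : ℝ) ^ q'))) * (t.ℓ n : ℝ) ^ q' = -(c * (c' / t.m n)) := by
      field_simp
    rw [h7]
    nlinarith [hδn.1]
  have h4 : (S + 1) / (t.ℓ n : ℝ) ^ q ≤ c * c' / 2 * (1 / (t.m n * (t.ℓ n : ℝ) ^ q')) := by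
    rw [mul_one_div, div_le_div_iff₀ (by positivity) (by positivity)]
    calc (S + 1) * (t.m n * (t.ℓ n : ℝ) ^ q') ≤ (|S| + 1) * (t.m n * (t.ℓ n : ℝ) ^ q') := by
          gcongr; exact le_abs_self S
      _ ≤ (|S| + 1) * (c * c' / 2 / (|S| + 1) * (t.ℓ n : ℝ) ^ q) := by gcongr
      _ = _ := by field_simp
  have h5 : min (c * c' / 2) (v / 2) * (1 / (t.m n * (t.ℓ n : ℝ) ^ q')) ≤
      c * c' / 2 * (1 / (t.m n * (t.ℓ n : ℝ) ^ q')) := by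
    gcongr; exact min_le_left _ _
  have h6 : min (c * c' / 2) (v / 2) * ((t.m n : ℝ) * t.h n / n) ≤
      v / 2 * ((t.m n : ℝ) * t.h n / n) := by
    gcongr; exact min_le_right _ _
  linarith

end
end DiffLRV

namespace DiffLRV

noncomputable section

/-! ### Rate optimality when `h ≳ ℓ` -/

lemma isBigO_iff_le {f g : ℕ → ℝ} (hf : ∀ᶠ n in atTop, 0 ≤ f n) (hg : ∀ᶠ n in atTop, 0 ≤ g n) :
    f =O[atTop] g ↔ ∃ C : ℝ, 0 < C ∧ ∀ᶠ n in atTop, f n ≤ C * g n := by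
  constructor
  · intro h
    obtain ⟨C, hC, hb⟩ := h.exists_pos
    refine ⟨C, hC, ?_⟩
    filter_upwards [hb.bound, hf, hg] with n h1 h2 h3
    rwa [Real.norm_eq_abs, Real.norm_eq_abs, abs_of_nonneg h2, abs_of_nonneg h3] at h1
  · rintro ⟨C, hC, h⟩
    refine IsBigO.of_bound C ?_
    filter_upwards [h, hf, hg] with n h1 h2 h3
    rwa [Real.norm_eq_abs, Real.norm_eq_abs, abs_of_nonneg h2, abs_of_nonneg h3]

lemma isLittleO_iff_le {f g : ℕ → ℝ} (hf : ∀ᶠ n in atTop, 0 ≤ f n) (hg : ∀ᶠ n in atTop, 0 ≤ g n) :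
    f =o[atTop] g ↔ ∀ e : ℝ, 0 < e → ∀ᶠ n in atTop, f n ≤ e * g n := by
  rw [isLittleO_iff]
  refine forall_congr' fun e => ⟨fun h he => ?_, fun h he => ?_⟩
  · filter_upwards [h he, hf, hg] with n h1 h2 h3
    rwa [Real.norm_eq_abs, Real.norm_eq_abs, abs_of_nonneg h2, abs_of_nonneg h3] at h1
  · filter_upwards [h he, hf, hg] with n h1 h2 h3
    rwa [Real.norm_eq_abs, Real.norm_eq_abs, abs_of_nonneg h2, abs_of_nonneg h3]

lemma nPow_nonneg (q : ℕ) (a : ℝ) : ∀ᶠ n in atTop, 0 ≤ nPow q a n :=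
  Eventually.of_forall fun n => Real.rpow_nonneg (Nat.cast_nonneg n) _

/-- `m = O(n ^ ((q - 1) / (1 + 2 * q)))` in terms of `scale`. -/
lemma order_isBigO_iff {q : ℕ} {t : Tuning} :
    ((fun n => (t.m n : ℝ)) =O[atTop] nPow q ((q : ℝ) - 1)) ↔
      ∃ C : ℝ, 0 < C ∧ ∀ᶠ n in atTop, (t.m n : ℝ) * scale q n ≤ C * scale q n ^ q := by
  rw [isBigO_iff_le (Eventually.of_forall fun n => Nat.cast_nonneg _) (nPow_nonneg q _)]
  refine exists_congr fun C => and_congr_right fun hC => ?_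
  refine ⟨fun h => ?_, fun h => ?_⟩ <;>
  · filter_upwards [h, eventually_ge_atTop 1] with n h1 hn1
    have hs := scale_pos q hn1
    have h2 := nPow_sub q q 1 hn1
    rw [Nat.cast_one, pow_one] at h2
    first
    | rw [h2, ← mul_div_assoc, le_div_iff₀ hs] at h1
      exact h1
    | rw [h2, ← mul_div_assoc, le_div_iff₀ hs]
      exact h1

lemma mean_effect_div_le {q : ℕ} {t : Tuning} {C : ℝ}
    (h : ∀ᶠ n in atTop, (t.ℓ n : ℝ) * (t.m n * t.h n) ≤ C * scale q n ^ (1 + q)) :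
    ∀ᶠ n in atTop, (t.ℓ n : ℝ) * (t.m n * t.h n) / n ≤ C / scale q n ^ q := by
  filter_upwards [h, eventually_ge_atTop 1] with n h1 hn1
  have hs := scale_pos q hn1
  have hn0 : (0 : ℝ) < n := by exact_mod_cast hn1
  have hn : (n : ℝ) = scale q n ^ (1 + q) * scale q n ^ q := by
    rw [← pow_add, show 1 + q + q = 1 + 2 * q by ring, scale_pow_eq]
  rw [div_le_div_iff₀ hn0 (by positivity)]
  conv_rhs => rw [hn]
  rw [← mul_assoc C]
  exact mul_le_mul_of_nonneg_right h1 (by positivity)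

lemma bandwidth_le_mul {t : Tuning} (ht : t.Admissible) {c : ℝ} (hc : 0 < c)
    (hh : ∀ᶠ n in atTop, c * t.ℓ n ≤ t.h n) (e : ℝ) (he : 0 < e) :
    ∀ᶠ n in atTop, (t.ℓ n : ℝ) ≤ e * (t.m n * t.h n) := by
  filter_upwards [hh, ht.tendsto_order.eventually_ge_atTop (1 / (e * c))] with n h1 h2
  rw [div_le_iff₀ (by positivity)] at h2
  have h3 : (0 : ℝ) ≤ t.ℓ n := by positivity
  calc (t.ℓ n : ℝ) ≤ (t.m n * (e * c)) * t.ℓ n := le_mul_of_one_le_left h3 h2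
    _ = e * (t.m n * (c * t.ℓ n)) := by ring
    _ ≤ _ := by gcongr

/-- What rate optimality implies if `h ≳ ℓ`. -/
theorem order_le_of_rateOptimal {K : ℝ → ℝ} (hK : IsKernel K) (hκ : kappa K ≠ 0) {q : ℕ}
    (hq : 1 ≤ q) {t : Tuning} (ht : t.Admissible) (hA : t.ApproxUncorrelated) {c : ℝ} (hc : 0 < c)
    (hh : ∀ᶠ n in atTop, c * t.ℓ n ≤ t.h n)
    (hrisk : RiskLowerBound K q t fun n => 1 / (t.ℓ n : ℝ) ^ q) (hopt : RateOptimal K q t) :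
    ∃ C : ℝ, 0 < C ∧ ∀ᶠ n in atTop, (t.m n : ℝ) * scale q n ≤ C * scale q n ^ q := by
  obtain ⟨C₁, hC₁, h₁⟩ := bandwidth_of_rateOptimal hq ht hrisk hopt
  obtain ⟨C₂, hC₂, h₂⟩ := mean_effect_le_of_rateOptimal hK hκ ht hA (bandwidth_le_mul ht hc hh) hopt
  refine ⟨C₁ ^ 2 * C₂ / c, by positivity, ?_⟩
  filter_upwards [h₁, h₂, hh, eventually_ge_atTop 1] with n h1 h2 h3 hn1
  have hs := scale_pos q hn1
  have h4 : scale q n ^ 2 ≤ C₁ ^ 2 * (t.ℓ n : ℝ) ^ 2 := by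
    rw [← mul_pow]; gcongr; exact h1.2
  -- With h ≥ cℓ the mean effect bounds mℓ², and x ≲ ℓ turns this into mx² ≲ x^{1+q}.
  have h5 : (t.ℓ n : ℝ) * (t.m n * (c * t.ℓ n)) ≤ C₂ * scale q n ^ (1 + q) :=
    le_trans (by gcongr) h2
  rw [div_mul_eq_mul_div, le_div_iff₀ hc]
  refine le_of_mul_le_mul_right ?_ hs
  calc (t.m n : ℝ) * scale q n * c * scale q n = t.m n * c * scale q n ^ 2 := by ring
    _ ≤ t.m n * c * (C₁ ^ 2 * (t.ℓ n : ℝ) ^ 2) := by gcongr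
    _ = C₁ ^ 2 * ((t.ℓ n : ℝ) * (t.m n * (c * t.ℓ n))) := by ring
    _ ≤ C₁ ^ 2 * (C₂ * scale q n ^ (1 + q)) := by gcongr
    _ = _ := by rw [pow_add]; ring

/-- For q = 1 the bound mx ≲ x^q says that m is bounded, against m → ∞. -/
theorem rateSuboptimal_of_one {K : ℝ → ℝ} (hK : IsKernel K) (hκ : kappa K ≠ 0)
    {t : Tuning} (ht : t.Admissible) (hA : t.ApproxUncorrelated) {c : ℝ} (hc : 0 < c)
    (hh : ∀ᶠ n in atTop, c * t.ℓ n ≤ t.h n)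
    (hrisk : RiskLowerBound K 1 t fun n => 1 / (t.ℓ n : ℝ) ^ 1) : RateSuboptimal K 1 t := by
  intro hopt
  obtain ⟨C, hC, h⟩ := order_le_of_rateOptimal hK hκ le_rfl ht hA hc hh hrisk hopt
  obtain ⟨n, h1, h2, hn1⟩ := (h.and ((ht.tendsto_order.eventually_gt_atTop C).and
    (eventually_ge_atTop 1))).exists
  have hs := scale_pos 1 hn1
  rw [pow_one] at h1
  have := le_of_mul_le_mul_right h1 hs
  linarith

/-- Rate optimality if `h ≍ ℓ`, the bandwidth and order are right, and off-diagonal weights are small. -/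
theorem rateOptimal_of_comparable {K : ℝ → ℝ} (hK : IsKernel K) {q : ℕ} (hq : NearOrigin K q)
    {t : Tuning} (ht : t.Admissible) {c : ℝ} (hh : ∀ᶠ n in atTop, (t.h n : ℝ) ≤ c * t.ℓ n)
    (hℓ : (fun n => (t.ℓ n : ℝ)) =Θ[atTop] nPow q 1)
    (hm : (fun n => (t.m n : ℝ)) =O[atTop] nPow q ((q : ℝ) - 1))
    (hoff : ∃ C : ℝ, ∀ᶠ n in atTop, ∀ u : ℤ, offDiag K (t.m n) (t.ℓ n) (t.h n) (t.d n) u ≤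
      C / (t.ℓ n : ℝ) ^ q * (1 + |(u : ℝ)| ^ q)) : RateOptimal K q t := by
  obtain ⟨C₁, hC₁, h₁⟩ := bounds_of_isTheta_scale hℓ
  obtain ⟨C₂, hC₂, h₂⟩ := order_isBigO_iff.1 hm
  obtain ⟨C₃, h₃⟩ := hoff
  refine rateOptimal_of_offDiag hK hq ht ⟨C₁, h₁.mono fun n h => h.1⟩
    ⟨C₁, by linarith, h₁.mono fun n h => h.2⟩ ⟨C₁ ^ 2 * |c| * C₂, mean_effect_div_le ?_⟩
    ⟨|C₃| * C₁ ^ q, ?_⟩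
  · filter_upwards [h₁, h₂, hh, eventually_ge_atTop 1] with n h1 h2 h3 hn1
    have hs := scale_pos q hn1
    have h4 : (t.h n : ℝ) ≤ |c| * (C₁ * scale q n) :=
      h3.trans (mul_le_mul (le_abs_self c) h1.1 (by positivity) (abs_nonneg c))
    calc (t.ℓ n : ℝ) * (t.m n * t.h n) ≤ C₁ * scale q n * (t.m n * (|c| * (C₁ * scale q n))) := by
          gcongr; exact h1.1
      _ = C₁ ^ 2 * |c| * (t.m n * scale q n) * scale q n := by ring
      _ ≤ C₁ ^ 2 * |c| * (C₂ * scale q n ^ q) * scale q n := by gcongr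
      _ = _ := by rw [pow_add]; ring
  · filter_upwards [h₁, h₃, ht.eventually_basic] with n h1 h3 hb u
    have hs := scale_pos q hb.1
    have hℓ0 : (0 : ℝ) < t.ℓ n := by exact_mod_cast hb.2.1
    refine (h3 u).trans ?_
    gcongr ?_ * _
    rw [div_le_div_iff₀ (by positivity) (by positivity)]
    calc C₃ * scale q n ^ q ≤ |C₃| * (C₁ * t.ℓ n) ^ q := by
          gcongr
          · exact le_abs_self C₃
          · exact h1.2
      _ = _ := by rw [mul_pow]; ring

lemma exists_offDiag_gap {K : ℝ → ℝ} (hK : IsKernel K) {t : Tuning} (ht : t.Admissible) {e : ℝ}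
    (he : 0 < e) (hgap : ∀ᶠ n in atTop, (1 + e) * t.ℓ n ≤ t.h n) (q : ℕ) :
    ∃ C : ℝ, ∀ᶠ n in atTop, ∀ u : ℤ, offDiag K (t.m n) (t.ℓ n) (t.h n) (t.d n) u ≤
      C / (t.ℓ n : ℝ) ^ q * (1 + |(u : ℝ)| ^ q) := by
  obtain ⟨A, hA⟩ := hK.bounded
  have hA0 : 0 ≤ A := (abs_nonneg _).trans (hA 0)
  obtain ⟨D, hD⟩ := ht.summable_delta
  refine ⟨A * D * (1 / e) ^ q, ?_⟩
  filter_upwards [hgap, hD, ht.eventually_basic] with n h1 h2 hb u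
  have hℓ0 : (0 : ℝ) < t.ℓ n := by exact_mod_cast hb.2.1
  have hD0 : 0 ≤ D := (Finset.sum_nonneg fun _ _ => abs_nonneg _).trans h2
  refine (offDiag_le_of_gap (q := q) hK hA hb.2.1 he h1 u).trans ?_
  calc _ ≤ A * D * (1 / (e * t.ℓ n)) ^ q * (1 + |(u : ℝ)| ^ q) := by
        gcongr
        linarith
    _ = _ := by rw [one_div, mul_inv, mul_pow, one_div, inv_pow (t.ℓ n : ℝ)]; ring

/-! ### `h / ℓ → 1` -/

lemma eventually_near_bounds {t : Tuning} (ht : t.Admissible)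
    (hC : ∃ C : ℝ, ∀ᶠ n in atTop, |(t.h n : ℝ) - (t.ℓ n : ℝ)| ≤ C) :
    ∀ᶠ n in atTop, 1 / 2 * (t.ℓ n : ℝ) ≤ t.h n ∧ (t.h n : ℝ) ≤ 2 * t.ℓ n := by
  obtain ⟨C, hC⟩ := hC
  filter_upwards [hC, ht.tendsto_bandwidth.eventually_ge_atTop (2 * C)] with n h1 h2
  have := abs_le.1 h1
  constructor <;> linarith [this.1, this.2]

lemma pow_isBigO_iff {q q' : ℕ} {t : Tuning} :
    ((fun n => (t.ℓ n : ℝ) ^ q) =O[atTop] fun n => (t.m n : ℝ) * (t.ℓ n : ℝ) ^ q') ↔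
      ∃ C : ℝ, 0 < C ∧ ∀ᶠ n in atTop, (t.ℓ n : ℝ) ^ q ≤ C * (t.m n * (t.ℓ n : ℝ) ^ q') :=
  isBigO_iff_le (Eventually.of_forall fun n => by positivity)
    (Eventually.of_forall fun n => by positivity)

/-- As q' ≥ 1 = q, the comparison ℓ^q ≲ mℓ^{q'} holds automatically. -/
theorem rateSuboptimal_near_one {K : ℝ → ℝ} (hK : IsKernel K) (hq : NearOrigin K 1) {q' : ℕ}
    (hq' : NearBoundary K q') (hκ : kappa K ≠ 0) {t : Tuning} (ht : t.Admissible)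
    (hA : t.ApproxUncorrelated)
    (hC : ∃ C : ℝ, ∀ᶠ n in atTop, |(t.h n : ℝ) - (t.ℓ n : ℝ)| ≤ C) : RateSuboptimal K 1 t := by
  refine rateSuboptimal_of_one hK hκ ht hA (c := 1 / 2) (by norm_num)
    ((eventually_near_bounds ht hC).mono fun n h => h.1)
    (riskLowerBound_of_near hK hq hq' ht hA hC ⟨1, one_pos, ?_⟩)
  filter_upwards [ht.eventually_basic] with n hb
  have hℓ1 : (1 : ℝ) ≤ t.ℓ n := by exact_mod_cast hb.2.1
  have hm1 : (1 : ℝ) ≤ t.m n := by exact_mod_cast hb.2.2.2.1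
  rw [one_mul]
  calc (t.ℓ n : ℝ) ^ 1 ≤ (t.ℓ n : ℝ) ^ q' := pow_le_pow_right₀ hℓ1 hq'.1
    _ ≤ _ := le_mul_of_one_le_left (by positivity) hm1

/-- Rate optimality would give the contradictory chain x^q ≲ mℓ^{q'} ≪ ℓ^q ≲ x^q, the first link
from the boundary bias and the last from the variance. -/
theorem rateSuboptimal_near_boundary {K : ℝ → ℝ} (hK : IsKernel K) {q q' : ℕ} (hq : NearOrigin K q)
    (hq' : NearBoundary K q') {t : Tuning} (ht : t.Admissible)
    (hA : t.ApproxUncorrelated)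
    (hC : ∃ C : ℝ, ∀ᶠ n in atTop, |(t.h n : ℝ) - (t.ℓ n : ℝ)| ≤ C)
    (ho : (fun n => (t.m n : ℝ) * (t.ℓ n : ℝ) ^ q') =o[atTop] fun n => (t.ℓ n : ℝ) ^ q) :
    RateSuboptimal K q t := by
  rw [isLittleO_iff_le (Eventually.of_forall fun n => by positivity)
    (Eventually.of_forall fun n => by positivity)] at ho
  intro hopt
  obtain ⟨C, hC0, h⟩ := le_of_rateOptimal_of_riskLowerBound
    (riskLowerBound_boundary hK hq hq' ht hA hC ho) hopt
  obtain ⟨n, h1, h2, hb⟩ := (h.and ((ho (1 / (2 * C * C ^ q)) (by positivity)).and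
    ht.eventually_basic)).exists
  have hs := scale_pos q hb.1
  have hℓ0 : (0 : ℝ) < t.ℓ n := by exact_mod_cast hb.2.1
  have hm0 : (0 : ℝ) < t.m n := by exact_mod_cast hb.2.2.2.1
  have h3 := h1.2
  rw [one_div_mul_eq_div, div_le_iff₀ (by positivity)] at h3
  have h4 : (t.ℓ n : ℝ) ^ q ≤ C ^ q * scale q n ^ q := by
    rw [← mul_pow]; gcongr; exact h1.1
  have h5 : scale q n ^ q ≤ scale q n ^ q / 2 := by
    calc scale q n ^ q ≤ C * (1 / (2 * C * C ^ q) * (C ^ q * scale q n ^ q)) := by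
          exact h3.trans (mul_le_mul_of_nonneg_left
            (h2.trans (mul_le_mul_of_nonneg_left h4 (by positivity))) hC0.le)
      _ = _ := by field_simp
  have h6 : 0 < scale q n ^ q := by positivity
  linarith

theorem attainsOpt_near {K : ℝ → ℝ} (hK : IsKernel K) {q q' : ℕ} (hq : NearOrigin K q)
    (hq' : NearBoundary K q') {t : Tuning} (ht : t.Admissible) (hA : t.ApproxUncorrelated)
    (hC : ∃ C : ℝ, ∀ᶠ n in atTop, |(t.h n : ℝ) - (t.ℓ n : ℝ)| ≤ C)
    (hO : (fun n => (t.ℓ n : ℝ) ^ q) =O[atTop] fun n => (t.m n : ℝ) * (t.ℓ n : ℝ) ^ q')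
    (hℓ : (fun n => (t.ℓ n : ℝ)) =Θ[atTop] nPow q 1)
    (hm : (fun n => (t.m n : ℝ)) =O[atTop] nPow q ((q : ℝ) - 1)) : AttainsOpt K q t := by
  have hO' := pow_isBigO_iff.1 hO
  refine attainsOpt_of ?_ (noBetterThanOpt_of_riskLowerBound ht
    (riskLowerBound_of_near hK hq hq' ht hA hC hO'))
  refine rateOptimal_of_comparable hK hq ht
    ((eventually_near_bounds ht hC).mono fun n h => h.2) hℓ hm ?_
  obtain ⟨C₁, hC₁, h₁⟩ := exists_offDiag_near hK hq' ht hA hC q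
  obtain ⟨C₂, hC₂, h₂⟩ := hO'
  refine ⟨C₁ * (1 + (C₂ + 1)), ?_⟩
  filter_upwards [h₁, h₂, ht.eventually_basic] with n h1 h2 hb u
  have hℓ0 : (0 : ℝ) < t.ℓ n := by exact_mod_cast hb.2.1
  have hm0 : (0 : ℝ) < t.m n := by exact_mod_cast hb.2.2.2.1
  have hm1 : (1 : ℝ) ≤ t.m n := by exact_mod_cast hb.2.2.2.1
  refine (h1 u).trans ?_
  gcongr ?_ * _
  -- If q ≤ q', m ≥ 1 suffices; only q' < q draws on the comparison of ℓ^q with mℓ^{q'}.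
  have h3 : (t.ℓ n : ℝ) ^ q ≤ (C₂ + 1) * (t.m n * (t.ℓ n : ℝ) ^ min q q') := by
    have h0 : 0 ≤ (t.m n : ℝ) * (t.ℓ n : ℝ) ^ min q q' := by positivity
    rcases le_total q q' with h | h
    · rw [min_eq_left h] at h0 ⊢
      have : (t.ℓ n : ℝ) ^ q ≤ t.m n * (t.ℓ n : ℝ) ^ q := le_mul_of_one_le_left (by positivity) hm1
      nlinarith
    · rw [min_eq_right h] at h0 ⊢
      linarith
  have h4 : 1 / (t.m n * (t.ℓ n : ℝ) ^ min q q') ≤ (C₂ + 1) / (t.ℓ n : ℝ) ^ q := by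
    rw [div_le_div_iff₀ (by positivity) (by positivity), one_mul]
    exact h3
  calc _ ≤ C₁ * (1 / (t.ℓ n : ℝ) ^ q + (C₂ + 1) / (t.ℓ n : ℝ) ^ q) := by gcongr
    _ = _ := by ring

theorem conditions_of_rateOptimal_near {K : ℝ → ℝ} (hK : IsKernel K) {q q' : ℕ}
    (hq : NearOrigin K q) (hq' : NearBoundary K q') (hκ : kappa K ≠ 0) {t : Tuning}
    (ht : t.Admissible) (hA : t.ApproxUncorrelated)
    (hC : ∃ C : ℝ, ∀ᶠ n in atTop, |(t.h n : ℝ) - (t.ℓ n : ℝ)| ≤ C)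
    (hO : (fun n => (t.ℓ n : ℝ) ^ q) =O[atTop] fun n => (t.m n : ℝ) * (t.ℓ n : ℝ) ^ q')
    (hopt : RateOptimal K q t) :
    ((fun n => (t.ℓ n : ℝ)) =Θ[atTop] nPow q 1) ∧
      (nPow q ((q : ℝ) - (q' : ℝ)) =O[atTop] fun n => (t.m n : ℝ)) ∧
      ((fun n => (t.m n : ℝ)) =O[atTop] nPow q ((q : ℝ) - 1)) := by
  obtain ⟨C₀, hC₀, hO'⟩ := pow_isBigO_iff.1 hO
  have hrisk := riskLowerBound_of_near hK hq hq' ht hA hC ⟨C₀, hC₀, hO'⟩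
  obtain ⟨C₁, hC₁, h₁⟩ := bandwidth_of_rateOptimal hq.1 ht hrisk hopt
  refine ⟨isTheta_scale_of_bounds hC₁ h₁, ?_, order_isBigO_iff.2 ?_⟩
  · rw [isBigO_iff_le (nPow_nonneg q _) (Eventually.of_forall fun n => Nat.cast_nonneg _)]
    refine ⟨C₁ ^ q * C₀ * C₁ ^ q', by positivity, ?_⟩
    filter_upwards [h₁, hO', eventually_ge_atTop 1] with n h1 h2 hn1
    have hs := scale_pos q hn1
    rw [nPow_sub q q q' hn1, div_le_iff₀ (by positivity)]
    calc scale q n ^ q ≤ (C₁ * t.ℓ n) ^ q := by gcongr; exact h1.2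
      _ = C₁ ^ q * (t.ℓ n : ℝ) ^ q := mul_pow _ _ _
      _ ≤ C₁ ^ q * (C₀ * (t.m n * (C₁ * scale q n) ^ q')) := by
          gcongr
          refine h2.trans ?_
          gcongr
          exact h1.1
      _ = _ := by rw [mul_pow]; ring
  · exact order_le_of_rateOptimal hK hκ hq.1 ht hA (c := 1 / 2) (by norm_num)
      ((eventually_near_bounds ht hC).mono fun n h => h.1) hrisk hopt

/-! ### `h / ℓ → λ > 1` -/

lemma eventually_gap {t : Tuning} (ht : t.Admissible) {lam : ℝ} (hlam : 1 < lam)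
    (hr : ∀ᶠ n in atTop, lam < t.ratio n) :
    ∃ e : ℝ, 0 < e ∧ ∀ᶠ n in atTop, (1 + e) * t.ℓ n ≤ t.h n := by
  refine ⟨lam - 1, by linarith, ?_⟩
  filter_upwards [hr, ht.eventually_basic] with n hn hb
  have hℓ0 : (0 : ℝ) < t.ℓ n := by exact_mod_cast hb.2.1
  rw [Tuning.ratio, lt_div_iff₀ hℓ0] at hn
  linarith

lemma eventually_gap_of_tendsto {t : Tuning} (ht : t.Admissible) {lam : ℝ} (hlam : 1 < lam)
    (hr : Tendsto t.ratio atTop (𝓝 lam)) :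
    ∃ e : ℝ, 0 < e ∧ ∀ᶠ n in atTop, (1 + e) * t.ℓ n ≤ t.h n :=
  eventually_gap ht (lam := (1 + lam) / 2) (by linarith) (hr.eventually (lt_mem_nhds (by linarith)))

lemma eventually_le_mul_of_tendsto {t : Tuning} (ht : t.Admissible) {lam : ℝ}
    (hr : Tendsto t.ratio atTop (𝓝 lam)) :
    ∀ᶠ n in atTop, (t.h n : ℝ) ≤ (lam + 1) * t.ℓ n := by
  filter_upwards [hr.eventually (gt_mem_nhds (show lam < lam + 1 by linarith)),
    ht.eventually_basic] with n hn hb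
  have hℓ0 : (0 : ℝ) < t.ℓ n := by exact_mod_cast hb.2.1
  rw [Tuning.ratio, div_lt_iff₀ hℓ0] at hn
  exact hn.le

/-! ### `h / ℓ → ∞` -/

/-- The overlap at the single lag h gives ℓh ≲ x² ≲ ℓ², against h ≫ ℓ. No control of the individual
δ_s is required. -/
theorem rateSuboptimal_far_one {K : ℝ → ℝ} (hK : IsKernel K) (hq : NearOrigin K 1)
    (hκ : kappa K ≠ 0) {t : Tuning} (ht : t.Admissible) (hr : Tendsto t.ratio atTop atTop) :
    RateSuboptimal K 1 t := by
  intro hopt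
  obtain ⟨e, he, hgap⟩ := eventually_gap ht (lam := 2) (by norm_num) (hr.eventually_gt_atTop 2)
  have hrisk := riskLowerBound_of_gap hK hq ht he hgap
  obtain ⟨C₁, hC₁, h₁⟩ := bandwidth_of_rateOptimal le_rfl ht hrisk hopt
  obtain ⟨C₂, hC₂, h₂⟩ := mean_effect_le_of_rateOptimal_of_ratio hK hκ ht hr hopt
  obtain ⟨n, h1, h2, h3, hb⟩ := (h₁.and (h₂.and ((hr.eventually_gt_atTop (C₂ * C₁ ^ 2)).and
    ht.eventually_basic))).exists
  have hs := scale_pos 1 hb.1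
  have hℓ0 : (0 : ℝ) < t.ℓ n := by exact_mod_cast hb.2.1
  rw [Tuning.ratio, lt_div_iff₀ hℓ0] at h3
  have h4 : (t.ℓ n : ℝ) * t.h n ≤ C₂ * C₁ ^ 2 * t.ℓ n * t.ℓ n := by
    calc (t.ℓ n : ℝ) * t.h n ≤ C₂ * scale 1 n ^ 2 := h2
      _ ≤ C₂ * (C₁ * t.ℓ n) ^ 2 := by gcongr; exact h1.2
      _ = _ := by ring
  nlinarith

theorem attainsOpt_far {K : ℝ → ℝ} (hK : IsKernel K) {q : ℕ} (hq : NearOrigin K q)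
    {t : Tuning} (ht : t.Admissible) (hr : Tendsto t.ratio atTop atTop)
    (hℓ : (fun n => (t.ℓ n : ℝ)) =Θ[atTop] nPow q 1)
    (hmh : (fun n => (t.m n : ℝ) * (t.h n : ℝ)) =O[atTop] nPow q (q : ℝ)) : AttainsOpt K q t := by
  obtain ⟨e, he, hgap⟩ := eventually_gap ht (lam := 2) (by norm_num) (hr.eventually_gt_atTop 2)
  refine attainsOpt_of ?_ (noBetterThanOpt_of_riskLowerBound ht
    (riskLowerBound_of_gap hK hq ht he hgap))
  obtain ⟨C₁, hC₁, h₁⟩ := bounds_of_isTheta_scale hℓ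
  rw [isBigO_iff_le (Eventually.of_forall fun n => by positivity) (nPow_nonneg q _)] at hmh
  obtain ⟨C₂, hC₂, h₂⟩ := hmh
  obtain ⟨C₃, h₃⟩ := exists_offDiag_gap hK ht he hgap q
  refine rateOptimal_of_offDiag hK hq ht ⟨C₁, h₁.mono fun n h => h.1⟩
    ⟨C₁, by linarith, h₁.mono fun n h => h.2⟩ ⟨C₁ * C₂, mean_effect_div_le ?_⟩
    ⟨|C₃| * C₁ ^ q, ?_⟩
  · filter_upwards [h₁, h₂, eventually_ge_atTop 1] with n h1 h2 hn1
    have hs := scale_pos q hn1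
    rw [nPow_natCast] at h2
    calc (t.ℓ n : ℝ) * (t.m n * t.h n) ≤ C₁ * scale q n * (C₂ * scale q n ^ q) := by
          gcongr; exact h1.1
      _ = _ := by rw [pow_add]; ring
  · filter_upwards [h₁, h₃, ht.eventually_basic] with n h1 h3 hb u
    have hs := scale_pos q hb.1
    have hℓ0 : (0 : ℝ) < t.ℓ n := by exact_mod_cast hb.2.1
    refine (h3 u).trans ?_
    gcongr ?_ * _
    rw [div_le_div_iff₀ (by positivity) (by positivity)]
    calc C₃ * scale q n ^ q ≤ |C₃| * (C₁ * t.ℓ n) ^ q := by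
          gcongr
          · exact le_abs_self C₃
          · exact h1.2
      _ = _ := by rw [mul_pow]; ring

theorem conditions_of_rateOptimal_far {K : ℝ → ℝ} (hK : IsKernel K) {q : ℕ} (hq : NearOrigin K q)
    (hκ : kappa K ≠ 0) {t : Tuning} (ht : t.Admissible) (hA : t.ApproxUncorrelated)
    (hr : Tendsto t.ratio atTop atTop) (hopt : RateOptimal K q t) :
    ((fun n => (t.ℓ n : ℝ)) =Θ[atTop] nPow q 1) ∧
      (nPow q 1 =o[atTop] fun n => (t.m n : ℝ) * (t.h n : ℝ)) ∧
      ((fun n => (t.m n : ℝ) * (t.h n : ℝ)) =O[atTop] nPow q (q : ℝ)) := by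
  obtain ⟨e, he, hgap⟩ := eventually_gap ht (lam := 2) (by norm_num) (hr.eventually_gt_atTop 2)
  have hrisk := riskLowerBound_of_gap hK hq ht he hgap
  obtain ⟨C₁, hC₁, h₁⟩ := bandwidth_of_rateOptimal hq.1 ht hrisk hopt
  have hℓmh := bandwidth_le_mul ht (c := 1 + e) (by linarith) hgap
  obtain ⟨C₂, hC₂, h₂⟩ := mean_effect_le_of_rateOptimal hK hκ ht hA hℓmh hopt
  refine ⟨isTheta_scale_of_bounds hC₁ h₁, ?_, ?_⟩
  · rw [isLittleO_iff_le (nPow_nonneg q _) (Eventually.of_forall fun n => by positivity)]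
    intro e' he'
    filter_upwards [h₁, hℓmh (e' / C₁) (by positivity)] with n h1 h2
    calc scale q n ≤ C₁ * t.ℓ n := h1.2
      _ ≤ C₁ * (e' / C₁ * (t.m n * t.h n)) := by gcongr
      _ = _ := by field_simp
  · rw [isBigO_iff_le (Eventually.of_forall fun n => by positivity) (nPow_nonneg q _)]
    refine ⟨C₁ * C₂, by positivity, ?_⟩
    filter_upwards [h₁, h₂, eventually_ge_atTop 1] with n h1 h2 hn1
    have hs := scale_pos q hn1
    rw [nPow_natCast]
    refine le_of_mul_le_mul_left ?_ hs
    calc scale q n * ((t.m n : ℝ) * t.h n) ≤ C₁ * t.ℓ n * ((t.m n : ℝ) * t.h n) := by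
          gcongr; exact h1.2
      _ = C₁ * ((t.ℓ n : ℝ) * (t.m n * t.h n)) := by ring
      _ ≤ C₁ * (C₂ * scale q n ^ (1 + q)) := by gcongr
      _ = _ := by rw [pow_add]; ring

end
end DiffLRV

namespace DiffLRV

noncomputable section

/-! ### Lags within the bandwidth -/

/-- A bias that stays away from zero makes the estimator inconsistent. -/
lemma inconsistent_of_noiseBias {K : ℝ → ℝ} (hK : IsKernel K) {t : Tuning} (ht : t.Admissible)
    {M : ℕ} {ψ : ℕ → ℝ} {c : ℝ} (hc : 0 < c)
    (h : ∀ᶠ n in atTop, c ≤ |noiseBias K t n (maNoise M ψ)|) (q : ℕ) : Inconsistent K q t := by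
  have hG := inClass_maNoise (M := M) (ψ := ψ) mildMean_lastMean q
  refine ⟨_, hG, fun hlim => ?_⟩
  obtain ⟨n, h1, h2, h3, hb, h4⟩ := (h.and ((hlim.eventually
    (gt_mem_nhds (show (0 : ℝ) < (c / 2) ^ 2 by positivity))).and
    ((meanBias_lastMean hK ht (maNoise M ψ)).and (ht.eventually_basic.and
      (tendsto_natCast_atTop_atTop.eventually_ge_atTop (2 / c)))))).exists
  have hn0 : (0 : ℝ) < n := by exact_mod_cast hb.1
  rw [mse_eq hK t hG.weakDep hG.finiteU hb.2.1 hb.2.2.2.2] at h2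
  have hv := variance_nonneg (fun ε => vHat K t n (DGM.X ⟨maNoise M ψ, lastMean⟩ n ε))
    (maNoise M ψ).P
  have h5 : 1 / (n : ℝ) ≤ c / 2 := by
    rw [div_le_iff₀ hc] at h4
    rw [div_le_iff₀ hn0]
    linarith
  set x := noiseBias K t n (maNoise M ψ)
  set y := meanBias K t n (DGM.mu ⟨maNoise M ψ, lastMean⟩ n)
  have h6 : |x + y| < c / 2 := abs_lt_of_sq_lt_sq (by linarith) (by positivity)
  have h7 : |x| ≤ |x + y| + |y| := by
    have := abs_sub (x + y) y
    rwa [add_sub_cancel_right] at this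
  rw [abs_of_nonneg h3.1] at h7
  linarith [h3.2]

/-- Independent signs have γ_0 = 1 and no other autocovariance, so they read off the weight at the
origin. -/
lemma noiseBias_maNoise_zero (K : ℝ → ℝ) (hK : IsKernel K) (t : Tuning) {n : ℕ} (hn : 1 ≤ n) :
    noiseBias K t n (maNoise 0 1) =
      -((t.m n : ℝ) * t.h n / n) + offWt K n (t.m n) (t.ℓ n) (t.h n) (t.d n) 0 := by
  have hn0 : (n : ℝ) ≠ 0 := by
    have : n ≠ 0 := by omega
    exact_mod_cast this
  rw [noiseBias_maNoise, offWt]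
  simp only [Nat.cast_zero, neg_zero, Finset.Icc_self, Finset.sum_singleton, delta_zero, zero_add,
    Finset.sum_range_one, Pi.one_apply, one_pow, mul_one, Int.cast_zero, zero_div, abs_zero,
    sub_zero, hK.zero, one_mul]
  field_simp
  ring

lemma sum_erase_zero_eq (m : ℕ) {F : ℤ → ℝ} (hF : ∀ s, F (-s) = F s) :
    ∑ s ∈ (Finset.Icc (-(m : ℤ)) m).erase 0, F s = 2 * ∑ s ∈ Finset.Icc 1 m, F (s : ℤ) := by
  have hu : (Finset.Icc (-(m : ℤ)) m).erase 0 =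
      (Finset.Icc 1 m).image (fun s : ℕ => (s : ℤ)) ∪
        (Finset.Icc 1 m).image (fun s : ℕ => -(s : ℤ)) := by
    ext s
    simp only [Finset.mem_erase, Finset.mem_Icc, Finset.mem_union, Finset.mem_image]
    constructor
    · rintro ⟨h0, h1, h2⟩
      rcases lt_or_gt_of_ne h0 with h | h
      · exact Or.inr ⟨s.natAbs, by omega, by omega⟩
      · exact Or.inl ⟨s.natAbs, by omega, by omega⟩
    · rintro (⟨a, ha, rfl⟩ | ⟨a, ha, rfl⟩) <;> omega
  rw [hu, Finset.sum_union, Finset.sum_image (by simp), Finset.sum_image (by simp), two_mul]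
  · simp only [hF]
  · rw [Finset.disjoint_left]
    simp only [Finset.mem_image, Finset.mem_Icc]
    rintro s ⟨a, ha, rfl⟩ ⟨b, hb, h⟩
    omega

lemma offWt_zero_eq {K : ℝ → ℝ} (hK : IsKernel K) {n m ℓ h : ℕ} {d : ℕ → ℝ}
    (hd : ∑ j ∈ Finset.range (m + 1), d j ^ 2 = 1) :
    offWt K n m ℓ h d 0 = 2 * ∑ s ∈ Finset.Icc 1 m, delta m d s *
      (K (((s * h : ℤ) : ℝ) / ℓ) * (((n : ℝ) - m * h - |((s * h : ℤ) : ℝ)|) / n)) := by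
  rw [offWt, wt_eq 0 hd, add_sub_cancel_left]
  simp only [zero_add]
  refine sum_erase_zero_eq m (F := fun s => delta m d s *
    (K (((s * h : ℤ) : ℝ) / ℓ) * (((n : ℝ) - m * h - |((s * h : ℤ) : ℝ)|) / n))) fun s => ?_
  rw [delta_neg, neg_mul, Int.cast_neg, neg_div, hK.even, abs_neg]

/-- Both sums extend to the larger range: past ⌊ℓ/h⌋ the kernel vanishes, past m the δ_s do. -/
lemma sum_unambiguous_eq {K : ℝ → ℝ} (hK : IsKernel K) (t : Tuning) {n : ℕ} (hℓ : 1 ≤ t.ℓ n)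
    (hh : 1 ≤ t.h n) :
    ∑ s ∈ Finset.Icc 1 ⌊1 / t.ratio n⌋₊, delta (t.m n) (t.d n) (s : ℤ) * K (t.ratio n * s) =
      ∑ s ∈ Finset.Icc 1 (t.m n), delta (t.m n) (t.d n) (s : ℤ) *
        K (((s * t.h n : ℤ) : ℝ) / t.ℓ n) := by
  have hℓ0 : (0 : ℝ) < t.ℓ n := by exact_mod_cast hℓ
  have hh0 : (0 : ℝ) < t.h n := by exact_mod_cast hh
  have hr : 0 < t.ratio n := div_pos hh0 hℓ0
  have e1 : ∀ s : ℕ, K (((s * t.h n : ℤ) : ℝ) / t.ℓ n) = K (t.ratio n * s) := by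
    intro s
    rw [Tuning.ratio]
    push_cast
    congr 1
    ring
  simp only [e1]
  set N := ⌊1 / t.ratio n⌋₊ with hN
  trans ∑ s ∈ Finset.Icc 1 (max N (t.m n)), delta (t.m n) (t.d n) (s : ℤ) * K (t.ratio n * s)
  · refine Finset.sum_subset (Finset.Icc_subset_Icc le_rfl (le_max_left _ _)) fun s hs hs' => ?_
    rw [Finset.mem_Icc] at hs hs'
    have h1 : N < s := by omega
    rw [hN, Nat.floor_lt (by positivity), div_lt_iff₀ hr] at h1
    rw [hK.support, mul_zero]
    rw [abs_of_nonneg (by positivity)]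
    linarith
  · symm
    refine Finset.sum_subset (Finset.Icc_subset_Icc le_rfl (le_max_right _ _)) fun s hs hs' => ?_
    rw [Finset.mem_Icc] at hs hs'
    rw [delta_eq_zero (by rw [Nat.abs_cast]; omega), zero_mul]

lemma factor_ge {K : ℝ → ℝ} (hK : IsKernel K) {n m ℓ h : ℕ} (hℓ : 1 ≤ ℓ) (hn : 1 ≤ n) {k : ℤ}
    (hk : K ((k : ℝ) / ℓ) ≠ 0) :
    1 - ((ℓ : ℝ) + m * h) / n ≤ ((n : ℝ) - m * h - |(k : ℝ)|) / n := by
  have hn0 : (0 : ℝ) < n := by exact_mod_cast hn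
  have hlt : |k| < (ℓ : ℤ) := by
    by_contra hcon
    exact hk (kernel_eq_zero hK hℓ (not_lt.1 hcon))
  have hltr : |(k : ℝ)| < ℓ := by rw [← Int.cast_abs]; exact_mod_cast hlt
  rw [one_sub_div hn0.ne']
  exact div_le_div_of_nonneg_right (by linarith) hn0.le

/-- On the support of the kernel the edge factor is within (ℓ + mh)/n of 1, and ∑|δ_s| is bounded,
so edge effects vanish in the limit. -/
theorem tendsto_noiseBias_of_unambiguous {K : ℝ → ℝ} (hK : IsKernel K) {t : Tuning}
    (ht : t.Admissible) {Ω : ℝ}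
    (hΩ : Tendsto (fun n => 2 * ∑ s ∈ Finset.Icc 1 ⌊1 / t.ratio n⌋₊,
      delta (t.m n) (t.d n) (s : ℤ) * K (t.ratio n * s)) atTop (𝓝 Ω)) :
    Tendsto (fun n => noiseBias K t n (maNoise 0 1)) atTop (𝓝 Ω) := by
  obtain ⟨A, hA⟩ := hK.bounded
  have hA0 : 0 ≤ A := (abs_nonneg _).trans (hA 0)
  obtain ⟨D, hD⟩ := ht.summable_delta
  have hlim : Tendsto (fun n => (t.m n : ℝ) * t.h n / n + A * D *
      (((t.ℓ n : ℝ) + (t.m n : ℝ) * (t.h n : ℝ)) / (n : ℝ))) atTop (𝓝 0) := by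
    have := ht.tendsto_edge.add (ht.negligible.const_mul (A * D))
    simpa using this
  have hdiff : Tendsto (fun n => noiseBias K t n (maNoise 0 1) -
      2 * ∑ s ∈ Finset.Icc 1 ⌊1 / t.ratio n⌋₊,
        delta (t.m n) (t.d n) (s : ℤ) * K (t.ratio n * s)) atTop (𝓝 0) := by
    refine squeeze_zero_norm' ?_ hlim
    filter_upwards [ht.eventually_basic, ht.normalized, hD] with n hb hd hDn
    have hn0 : (0 : ℝ) < n := by exact_mod_cast hb.1
    set e := ((t.ℓ n : ℝ) + (t.m n : ℝ) * (t.h n : ℝ)) / (n : ℝ) with he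
    have he0 : 0 ≤ e := by positivity
    rw [noiseBias_maNoise_zero K hK t hb.1, offWt_zero_eq hK hd,
      sum_unambiguous_eq hK t hb.2.1 hb.2.2.1, add_sub_assoc, ← mul_sub, ← Finset.sum_sub_distrib,
      Real.norm_eq_abs]
    refine (abs_add_le _ _).trans (add_le_add ?_ ?_)
    · rw [abs_neg, abs_of_nonneg (by positivity)]
    · rw [abs_mul, abs_two]
      have h1 : |∑ s ∈ Finset.Icc 1 (t.m n), (delta (t.m n) (t.d n) (s : ℤ) *
          (K (((s * t.h n : ℤ) : ℝ) / t.ℓ n) *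
            (((n : ℝ) - t.m n * t.h n - |((s * t.h n : ℤ) : ℝ)|) / n)) -
          delta (t.m n) (t.d n) (s : ℤ) * K (((s * t.h n : ℤ) : ℝ) / t.ℓ n))| ≤
          ∑ s ∈ Finset.Icc 1 (t.m n), |delta (t.m n) (t.d n) (s : ℤ)| * (A * e) := by
        refine (Finset.abs_sum_le_sum_abs _ _).trans (Finset.sum_le_sum fun s _ => ?_)
        rw [← mul_sub, abs_mul]
        refine mul_le_mul_of_nonneg_left ?_ (abs_nonneg _)
        by_cases hk : K (((s * t.h n : ℤ) : ℝ) / t.ℓ n) = 0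
        · rw [hk]; simp only [zero_mul, sub_zero, abs_zero]; positivity
        · have h2 := (factor_mem hK hb.2.1 hb.2.2.2.2 hk).2
          have h3 := factor_ge hK (m := t.m n) (h := t.h n) hb.2.1 hb.1 hk
          rw [← mul_sub_one, abs_mul]
          refine mul_le_mul (hA _) ?_ (abs_nonneg _) hA0
          rw [abs_le]
          constructor <;> linarith
      have h4 : 2 * ∑ s ∈ Finset.Icc 1 (t.m n), |delta (t.m n) (t.d n) (s : ℤ)| ≤ D := by
        rw [← sum_erase_zero_eq (t.m n) (F := fun s => |delta (t.m n) (t.d n) s|)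
          (fun s => by rw [delta_neg])]
        exact (Finset.sum_le_sum_of_subset_of_nonneg (Finset.erase_subset _ _)
          fun _ _ _ => abs_nonneg _).trans hDn
      calc _ ≤ 2 * ∑ s ∈ Finset.Icc 1 (t.m n), |delta (t.m n) (t.d n) (s : ℤ)| * (A * e) := by
            gcongr
        _ = (2 * ∑ s ∈ Finset.Icc 1 (t.m n), |delta (t.m n) (t.d n) (s : ℤ)|) * (A * e) := by
            rw [← Finset.sum_mul]; ring
        _ ≤ D * (A * e) := by gcongr
        _ = _ := by ring
  have := hdiff.add hΩ
  simpa using this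

theorem inconsistent_of_unambiguous {K : ℝ → ℝ} (hK : IsKernel K) {t : Tuning} (ht : t.Admissible)
    (hU : t.Unambiguous K) (q : ℕ) : Inconsistent K q t := by
  obtain ⟨Ω, hΩ0, hΩ⟩ := hU
  have h := (tendsto_noiseBias_of_unambiguous hK ht hΩ).abs
  have hpos : 0 < |Ω| := abs_pos.2 hΩ0
  exact inconsistent_of_noiseBias hK ht (half_pos hpos)
    ((h.eventually (lt_mem_nhds (half_lt_self hpos))).mono fun n hn => hn.le) q

/-! ### Monotone kernels -/

lemma kernel_nonneg {K : ℝ → ℝ} (hK : IsKernel K) (hmono : AntitoneOn K (Set.Icc 0 1)) (x : ℝ) :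
    0 ≤ K x := by
  rw [← hK.apply_abs]
  rcases le_total 1 |x| with h | h
  · rw [hK.support _ (by rwa [abs_abs])]
  · rw [← hK.support 1 (by simp)]
    exact hmono ⟨abs_nonneg x, h⟩ ⟨zero_le_one, le_rfl⟩ h

lemma kernel_le_one {K : ℝ → ℝ} (hK : IsKernel K) (hmono : AntitoneOn K (Set.Icc 0 1)) (x : ℝ) :
    K x ≤ 1 := by
  rw [← hK.apply_abs]
  rcases le_total 1 |x| with h | h
  · rw [hK.support _ (by rwa [abs_abs])]; exact zero_le_one
  · rw [← hK.zero]
    exact hmono ⟨le_rfl, zero_le_one⟩ ⟨abs_nonneg x, h⟩ (abs_nonneg x)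

lemma exists_half_le_kernel {K : ℝ → ℝ} (hK : IsKernel K) :
    ∃ e : ℝ, 0 < e ∧ e < 1 ∧ ∀ x : ℝ, 0 ≤ x → x ≤ e → 1 / 2 ≤ K x := by
  have hc : ContinuousAt K 0 := hK.continuousOn.continuousAt (Ioo_mem_nhds (by norm_num) one_pos)
  have h : ∀ᶠ x in 𝓝 (0 : ℝ), 1 / 2 < K x :=
    hc.eventually (lt_mem_nhds (by rw [hK.zero]; norm_num))
  obtain ⟨r, hr, hball⟩ := Metric.eventually_nhds_iff.1 h
  refine ⟨min (r / 2) (1 / 2), by positivity, lt_of_le_of_lt (min_le_right _ _) (by norm_num),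
    fun x h0 hx => (hball ?_).le⟩
  rw [Real.dist_eq, sub_zero, abs_of_nonneg h0]
  have := hx.trans (min_le_left _ _)
  linarith

/-- A monotone kernel is non-negative, since it ends at K(1) = 0, and it is at least 1/2 near the
origin. -/
lemma kappa_ne_zero {K : ℝ → ℝ} (hK : IsKernel K) (hmono : AntitoneOn K (Set.Icc 0 1)) :
    kappa K ≠ 0 := by
  obtain ⟨e, he0, he1, he⟩ := exists_half_le_kernel hK
  obtain ⟨A, hA⟩ := hK.bounded
  have hm : AEStronglyMeasurable K (volume.restrict (Set.Ioo (-1 : ℝ) 1)) :=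
    hK.continuousOn.aestronglyMeasurable measurableSet_Ioo
  have hintg : IntervalIntegrable K volume (-1) 1 := by
    rw [intervalIntegrable_iff_integrableOn_Ioo_of_le (by norm_num)]
    exact Integrable.of_bound hm A (Eventually.of_forall hA)
  have hsub : Set.uIcc 0 e ⊆ Set.uIcc (-1) 1 := by
    rw [Set.uIcc_of_le he0.le, Set.uIcc_of_le (by norm_num)]
    exact Set.Icc_subset_Icc (by norm_num) he1.le
  have h1 : ∫ x in (0 : ℝ)..e, K x ≤ kappa K :=
    intervalIntegral.integral_mono_interval (by norm_num) he0.le he1.le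
      (Eventually.of_forall fun x => kernel_nonneg hK hmono x) hintg
  have h2 : ∫ x in (0 : ℝ)..e, (1 / 2 : ℝ) ≤ ∫ x in (0 : ℝ)..e, K x :=
    intervalIntegral.integral_mono_on he0.le intervalIntegrable_const (hintg.mono_set hsub)
      fun x hx => he x hx.1 hx.2
  rw [intervalIntegral.integral_const, smul_eq_mul, sub_zero] at h2
  have : 0 < kappa K := by linarith [h1, h2, show 0 < e * (1 / 2) by positivity]
  exact this.ne'

lemma nearOrigin_neg {K : ℝ → ℝ} (hK : IsKernel K) (hmono : AntitoneOn K (Set.Icc 0 1)) {q : ℕ}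
    {B : ℝ} (hB0 : B ≠ 0)
    (hB : Tendsto (fun t : ℝ => (K t - K 0) / |t| ^ q) (𝓝[>] 0) (𝓝 B)) : B < 0 := by
  refine lt_of_le_of_ne (le_of_tendsto hB (Eventually.of_forall fun x => ?_)) hB0
  refine div_nonpos_of_nonpos_of_nonneg ?_ (by positivity)
  rw [hK.zero]
  linarith [kernel_le_one hK hmono x]

/-- With B < 0 from monotonicity and edge losses also negative, every bias term has the same sign
for noises with non-negative autocovariances. -/
lemma offWt_nonpos {K : ℝ → ℝ} (hK : IsKernel K) (hmono : AntitoneOn K (Set.Icc 0 1))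
    {n m ℓ h : ℕ} {d : ℕ → ℝ} (hd : ∑ j ∈ Finset.range (m + 1), d j ^ 2 = 1) (hℓ : 1 ≤ ℓ)
    (hn : m * h + ℓ ≤ n) (hδ : ∀ s : ℤ, 1 ≤ |s| → |s| ≤ m → delta m d s ≤ 0) (u : ℤ) :
    offWt K n m ℓ h d u ≤ 0 := by
  rw [offWt, wt_eq u hd, add_sub_cancel_left]
  refine Finset.sum_nonpos fun s hs => mul_nonpos_of_nonpos_of_nonneg ?_ ?_
  · rw [Finset.mem_erase, Finset.mem_Icc, ← abs_le] at hs
    exact hδ s (Int.one_le_abs hs.1) hs.2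
  · by_cases hk : K (((u + s * h : ℤ) : ℝ) / ℓ) = 0
    · rw [hk, zero_mul]
    · exact mul_nonneg (kernel_nonneg hK hmono _) (factor_mem hK hℓ hn hk).1

/-- All terms have one sign, so it is enough to keep the first N lags. The edge factor is at least
1/2, which the two signs of s compensate. -/
lemma offWt_zero_le {K : ℝ → ℝ} (hK : IsKernel K) (hmono : AntitoneOn K (Set.Icc 0 1))
    {n m ℓ h : ℕ} {d : ℕ → ℝ} (hd : ∑ j ∈ Finset.range (m + 1), d j ^ 2 = 1) (hℓ : 1 ≤ ℓ)
    (hn1 : 1 ≤ n) (hn : ((ℓ : ℝ) + m * h) / n ≤ 1 / 2) {c : ℝ} (hc : 0 ≤ c)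
    (hδ : ∀ s : ℤ, 1 ≤ |s| → |s| ≤ m → delta m d s ≤ -c / m) {N : ℕ} (hN : N ≤ m) {b : ℝ}
    (hb : ∀ s ∈ Finset.Icc 1 N, b ≤ K (((s * h : ℤ) : ℝ) / ℓ)) :
    offWt K n m ℓ h d 0 ≤ -(c / m * (N * b)) := by
  have h1 : ∑ s ∈ Finset.Icc 1 m, delta m d (s : ℤ) *
      (K (((s * h : ℤ) : ℝ) / ℓ) * (((n : ℝ) - m * h - |((s * h : ℤ) : ℝ)|) / n)) ≤
      ∑ s ∈ Finset.Icc 1 m, -(c / m * (1 / 2)) * K (((s * h : ℤ) : ℝ) / ℓ) := by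
    refine Finset.sum_le_sum fun s hs => ?_
    rw [Finset.mem_Icc] at hs
    by_cases hk : K (((s * h : ℤ) : ℝ) / ℓ) = 0
    · rw [hk]; simp
    · have h2 := factor_ge hK (m := m) (h := h) hℓ hn1 hk
      have h3 := hδ s (by rw [Nat.abs_cast]; omega) (by rw [Nat.abs_cast]; omega)
      have h4 := kernel_nonneg hK hmono (((s * h : ℤ) : ℝ) / ℓ)
      set f := ((n : ℝ) - m * h - |((s * h : ℤ) : ℝ)|) / n
      set k := K (((s * h : ℤ) : ℝ) / ℓ)
      have h5 : 1 / 2 ≤ f := by linarith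
      have h6 : 0 ≤ c / m := by positivity
      rw [neg_div] at h3
      calc delta m d s * (k * f) ≤ -(c / m) * (k * f) :=
            mul_le_mul_of_nonneg_right h3 (mul_nonneg h4 (by linarith))
        _ = -(c / m * (k * f)) := by ring
        _ ≤ -(c / m * (k * (1 / 2))) :=
            neg_le_neg (mul_le_mul_of_nonneg_left (mul_le_mul_of_nonneg_left h5 h4) h6)
        _ = _ := by ring
  have h2 : (N : ℝ) * b ≤ ∑ s ∈ Finset.Icc 1 m, K (((s * h : ℤ) : ℝ) / ℓ) := by
    calc (N : ℝ) * b = ∑ s ∈ Finset.Icc 1 N, b := by simp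
      _ ≤ ∑ s ∈ Finset.Icc 1 N, K (((s * h : ℤ) : ℝ) / ℓ) := Finset.sum_le_sum hb
      _ ≤ _ := Finset.sum_le_sum_of_subset_of_nonneg (Finset.Icc_subset_Icc le_rfl hN)
          fun s _ _ => kernel_nonneg hK hmono _
  rw [← Finset.mul_sum] at h1
  rw [offWt_zero_eq hK hd]
  have h3 := mul_le_mul_of_nonneg_left h2 (show 0 ≤ c / m by positivity)
  linarith

/-- With many lags within the bandwidth, the correlation of the differences shifts the weight at
the origin by at least the order `min(ℓ / (m h), 1)`. -/
lemma offWt_zero_le_of_ratio {K : ℝ → ℝ} (hK : IsKernel K) (hmono : AntitoneOn K (Set.Icc 0 1))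
    {t : Tuning} (ht : t.Admissible) (hA : t.ApproxUncorrelated)
    (hr : Tendsto t.ratio atTop (𝓝 0)) :
    ∃ c : ℝ, 0 < c ∧ ∀ᶠ n in atTop, offWt K n (t.m n) (t.ℓ n) (t.h n) (t.d n) 0 ≤
      -(c * min ((t.ℓ n : ℝ) / (t.m n * t.h n)) 1) := by
  obtain ⟨c', c'', hc', -, hδ⟩ := hA
  obtain ⟨e, he0, he1, he⟩ := exists_half_le_kernel hK
  refine ⟨c' * (1 / 2) * (e / 2), by positivity, ?_⟩
  filter_upwards [hδ, ht.eventually_basic, ht.normalized,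
    ht.negligible.eventually (gt_mem_nhds (show (0 : ℝ) < 1 / 2 by norm_num)),
    hr.eventually (gt_mem_nhds (show (0 : ℝ) < e / 2 by positivity))] with n h1 hb hd h2 h3
  have hℓ0 : (0 : ℝ) < t.ℓ n := by exact_mod_cast hb.2.1
  have hh0 : (0 : ℝ) < t.h n := by exact_mod_cast hb.2.2.1
  have hm0 : (0 : ℝ) < t.m n := by exact_mod_cast hb.2.2.2.1
  -- The lags with sh ≤ eℓ, where the kernel is at least 1/2, or all m lags if there are fewer.
  set N := min (t.m n) ⌊e * (t.ℓ n / t.h n)⌋₊ with hN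
  have hx1 : 2 ≤ e * ((t.ℓ n : ℝ) / t.h n) := by
    rw [Tuning.ratio, div_lt_div_iff₀ hℓ0 (by norm_num)] at h3
    rw [← mul_div_assoc, le_div_iff₀ hh0]
    linarith
  have hfl : e / 2 * ((t.ℓ n : ℝ) / t.h n) ≤ (⌊e * ((t.ℓ n : ℝ) / t.h n)⌋₊ : ℝ) := by
    have := Nat.lt_floor_add_one (e * ((t.ℓ n : ℝ) / t.h n))
    linarith
  have hNle : e / 2 * (t.m n * min ((t.ℓ n : ℝ) / (t.m n * t.h n)) 1) ≤ N := by
    rw [hN, Nat.cast_min, le_min_iff]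
    constructor
    · calc e / 2 * (t.m n * min ((t.ℓ n : ℝ) / (t.m n * t.h n)) 1) ≤ 1 * (t.m n * 1) := by
            gcongr
            · linarith
            · exact min_le_right _ _
        _ = t.m n := by ring
    · calc e / 2 * (t.m n * min ((t.ℓ n : ℝ) / (t.m n * t.h n)) 1)
          ≤ e / 2 * (t.m n * ((t.ℓ n : ℝ) / (t.m n * t.h n))) := by
            gcongr
            exact min_le_left _ _
        _ = e / 2 * ((t.ℓ n : ℝ) / t.h n) := by field_simp
        _ ≤ _ := hfl
  refine (offWt_zero_le hK hmono hd hb.2.1 hb.1 h2.le hc'.le (fun s hs hs' => (h1 s hs hs').2)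
    (N := N) (min_le_left _ _) (b := 1 / 2) fun s hs => ?_).trans ?_
  · refine he _ (by positivity) ?_
    rw [Finset.mem_Icc] at hs
    have h4 : (s : ℝ) ≤ e * ((t.ℓ n : ℝ) / t.h n) :=
      (Nat.le_floor_iff (by positivity)).1 (hs.2.trans (min_le_right _ _))
    rw [← mul_div_assoc, le_div_iff₀ hh0] at h4
    push_cast
    rwa [div_le_iff₀ hℓ0]
  · rw [neg_le_neg_iff]
    calc _ = c' / t.m n * (e / 2 * (t.m n * min ((t.ℓ n : ℝ) / (t.m n * t.h n)) 1) * (1 / 2)) := by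
          field_simp
      _ ≤ _ := by gcongr

/-- The assumption on m keeps ℓ/(mh) away from zero, so the weight at the origin is wrong by a
constant. -/
theorem inconsistent_of_ratio {K : ℝ → ℝ} (hK : IsKernel K) (hmono : AntitoneOn K (Set.Icc 0 1))
    {t : Tuning} (ht : t.Admissible) (hA : t.ApproxUncorrelated)
    (hr : Tendsto t.ratio atTop (𝓝 0))
    (hm : (fun n => (t.m n : ℝ)) =O[atTop] fun n => (t.ℓ n : ℝ) / (t.h n : ℝ)) (q : ℕ) :
    Inconsistent K q t := by
  obtain ⟨C, hC, hm⟩ := (isBigO_iff_le (Eventually.of_forall fun n => by positivity)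
    (Eventually.of_forall fun n => by positivity)).1 hm
  obtain ⟨c, hc, h⟩ := offWt_zero_le_of_ratio hK hmono ht hA hr
  refine inconsistent_of_noiseBias hK ht (M := 0) (ψ := 1) (c := c * min (1 / C) 1)
    (by positivity) ?_ q
  filter_upwards [h, hm, ht.eventually_basic] with n h1 h2 hb
  have hh0 : (0 : ℝ) < t.h n := by exact_mod_cast hb.2.2.1
  have hm0 : (0 : ℝ) < t.m n := by exact_mod_cast hb.2.2.2.1
  have h3 : 1 / C ≤ (t.ℓ n : ℝ) / (t.m n * t.h n) := by
    rw [← mul_div_assoc, le_div_iff₀ hh0] at h2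
    rw [div_le_div_iff₀ hC (by positivity)]
    linarith
  have h4 : c * min (1 / C) 1 ≤ c * min ((t.ℓ n : ℝ) / (t.m n * t.h n)) 1 := by gcongr
  have h5 : 0 ≤ (t.m n : ℝ) * t.h n / n := by positivity
  rw [noiseBias_maNoise_zero K hK t hb.1]
  refine le_abs.2 (Or.inr ?_)
  linarith

/-- A shift of the weight at the origin of order `ℓ / (m h)` is incompatible with the optimal
rate. -/
theorem rateSuboptimal_of_offWt_zero {K : ℝ → ℝ} (hK : IsKernel K)
    (hmono : AntitoneOn K (Set.Icc 0 1)) {q : ℕ} (hq : NearOrigin K q) {t : Tuning}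
    (ht : t.Admissible) (hA : t.ApproxUncorrelated)
    (hℓ : ∀ e : ℝ, 0 < e → ∀ᶠ n in atTop, (t.ℓ n : ℝ) ≤ e * (t.m n * t.h n)) {c : ℝ} (hc : 0 < c)
    (hoff : ∀ᶠ n in atTop, offWt K n (t.m n) (t.ℓ n) (t.h n) (t.d n) 0 ≤
      -(c * ((t.ℓ n : ℝ) / (t.m n * t.h n)))) : RateSuboptimal K q t := by
  intro hopt
  obtain ⟨hq1, B, hB0, hB⟩ := hq
  have hBneg := nearOrigin_neg hK hmono hB0 hB
  -- The noise e_i + e_{i-1} has autocovariances 2, 1, 1 ≥ 0. All its bias terms are non-positive,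
  -- so the rate bounds the smoothing bias and the shift at the origin separately.
  obtain ⟨C₁, hC₁, h₁⟩ := abs_noiseBias_le_of_rateOptimal hK ht hopt 1 1
  obtain ⟨C₂, hC₂, h₂⟩ := mean_effect_le_of_rateOptimal hK (kappa_ne_zero hK hmono) ht hA hℓ hopt
  have hψ : ∑ p ∈ Finset.range (1 + 1), (1 : ℕ → ℝ) p ≠ 0 := by
    norm_num [Finset.sum_range_succ]
  have hS : ∀ F : ℤ → ℝ, ∑ u ∈ Finset.Icc (-((1 : ℕ) : ℤ)) (1 : ℕ), delta 1 1 u * F u =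
      F (-1) + 2 * F 0 + F 1 := by
    intro F
    rw [← sum_sum_eq_sum_delta]
    simp [Finset.sum_range_succ]
    ring
  have h₃ := noiseBias_maNoise_le (M := 1) (ψ := 1) hK hq1 hB ht hψ (e := -B) (by linarith)
  simp only [hS] at h₃
  obtain ⟨c', c'', hc', -, hδ⟩ := hA
  set C₄ := C₁ / -B + 1 with hC₄
  have hC₄1 : 1 ≤ C₄ := by
    have : 0 ≤ C₁ / -B := div_nonneg hC₁.le (by linarith)
    linarith
  obtain ⟨n, g1, g2, g3, g4, g5, g6, g7, hb⟩ := (h₁.and (h₂.and (h₃.and (hoff.and (hδ.and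
    (ht.normalized.and ((ht.tendsto_bandwidth.eventually_gt_atTop (C₁ / c * C₂ * C₄)).and
      ht.eventually_basic))))))).exists
  have hs := scale_pos q hb.1
  have hℓ0 : (0 : ℝ) < t.ℓ n := by exact_mod_cast hb.2.1
  have hh0 : (0 : ℝ) < t.h n := by exact_mod_cast hb.2.2.1
  have hm0 : (0 : ℝ) < t.m n := by exact_mod_cast hb.2.2.2.1
  have hoffle := offWt_nonpos hK hmono g6 hb.2.1 hb.2.2.2.2 fun s hs hs' =>
    (g5 s hs hs').2.trans (by rw [neg_div]; exact neg_nonpos.2 (by positivity))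
  have k1 : (B * (|(((-1 : ℤ)) : ℝ)| ^ q + 2 * |((0 : ℤ) : ℝ)| ^ q + |((1 : ℤ) : ℝ)| ^ q) + -B) = B := by
    have : q ≠ 0 := by omega
    simp [this]
    ring
  rw [k1] at g3
  have k2 : 0 ≤ (∑ p ∈ Finset.range (1 + 1), (1 : ℕ → ℝ) p) ^ 2 / 2 *
      ((t.m n : ℝ) * t.h n / n) := by positivity
  have k3 := (abs_le.1 g1).1
  have k4 := hoffle 1
  have k5 := hoffle (-1)
  have k6 : 0 ≤ c * ((t.ℓ n : ℝ) / (t.m n * t.h n)) := by positivity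
  have k7 : 0 ≤ -B / (t.ℓ n : ℝ) ^ q := div_nonneg (by linarith) (by positivity)
  have k8 : -B / (t.ℓ n : ℝ) ^ q = -(B / (t.ℓ n : ℝ) ^ q) := neg_div _ _
  have k9 : -B / (t.ℓ n : ℝ) ^ q ≤ C₁ / scale q n ^ q := by linarith
  have k10 : c * ((t.ℓ n : ℝ) / (t.m n * t.h n)) ≤ C₁ / scale q n ^ q := by linarith
  have k11 : scale q n ≤ C₄ * t.ℓ n := by
    refine le_of_pow_le_pow_left₀ (show q ≠ 0 by omega) (by positivity) ?_
    rw [div_le_div_iff₀ (by positivity) (by positivity)] at k9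
    have : scale q n ^ q ≤ C₁ / -B * (t.ℓ n : ℝ) ^ q := by
      rw [div_mul_eq_mul_div, le_div_iff₀ (by linarith)]
      linarith
    rw [mul_pow]
    refine this.trans ?_
    gcongr
    exact le_trans (by linarith) (le_self_pow₀ hC₄1 (by omega))
  have k12 : (t.ℓ n : ℝ) * scale q n ^ q ≤ C₁ / c * (t.m n * t.h n) := by
    rw [← mul_div_assoc, div_le_div_iff₀ (by positivity) (by positivity)] at k10
    rw [div_mul_eq_mul_div, le_div_iff₀ hc]
    linarith
  -- The shift gives ℓx^q ≲ mh, the mean effect ℓmh ≲ x^{1+q} and the smoothing bias x ≲ ℓ; chained,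
  -- ℓ²x^q ≲ ℓx^q, against ℓ → ∞.
  have k13 : ((t.ℓ n : ℝ) * t.ℓ n) * scale q n ^ q ≤ C₁ / c * C₂ * C₄ * t.ℓ n * scale q n ^ q := by
    calc ((t.ℓ n : ℝ) * t.ℓ n) * scale q n ^ q = t.ℓ n * (t.ℓ n * scale q n ^ q) := by ring
      _ ≤ t.ℓ n * (C₁ / c * (t.m n * t.h n)) := by gcongr
      _ = C₁ / c * (t.ℓ n * (t.m n * t.h n)) := by ring
      _ ≤ C₁ / c * (C₂ * scale q n ^ (1 + q)) := by gcongr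
      _ = C₁ / c * C₂ * scale q n * scale q n ^ q := by ring
      _ ≤ C₁ / c * C₂ * (C₄ * t.ℓ n) * scale q n ^ q := by gcongr
      _ = _ := by ring
  have k14 := le_of_mul_le_mul_right (le_of_mul_le_mul_right k13 (by positivity)) hℓ0
  linarith

theorem rateSuboptimal_of_ratio {K : ℝ → ℝ} (hK : IsKernel K)
    (hmono : AntitoneOn K (Set.Icc 0 1)) {q : ℕ} (hq : NearOrigin K q) {t : Tuning}
    (ht : t.Admissible) (hA : t.ApproxUncorrelated) (hr : Tendsto t.ratio atTop (𝓝 0))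
    (hm : (fun n => (t.ℓ n : ℝ) / (t.h n : ℝ)) =o[atTop] fun n => (t.m n : ℝ)) :
    RateSuboptimal K q t := by
  rw [isLittleO_iff_le (Eventually.of_forall fun n => by positivity)
    (Eventually.of_forall fun n => by positivity)] at hm
  have hℓ : ∀ e : ℝ, 0 < e → ∀ᶠ n in atTop, (t.ℓ n : ℝ) ≤ e * (t.m n * t.h n) := by
    intro e he
    filter_upwards [hm e he, ht.eventually_basic] with n h1 hb
    have hh0 : (0 : ℝ) < t.h n := by exact_mod_cast hb.2.2.1
    rw [div_le_iff₀ hh0] at h1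
    linarith
  obtain ⟨c, hc, h⟩ := offWt_zero_le_of_ratio hK hmono ht hA hr
  refine rateSuboptimal_of_offWt_zero hK hmono hq ht hA hℓ hc ?_
  filter_upwards [h, hℓ 1 one_pos, ht.eventually_basic] with n h1 h2 hb
  have hh0 : (0 : ℝ) < t.h n := by exact_mod_cast hb.2.2.1
  have hm0 : (0 : ℝ) < t.m n := by exact_mod_cast hb.2.2.2.1
  rwa [min_eq_left (by rw [div_le_one (by positivity)]; linarith)] at h1

/-- Strict monotonicity gives K(λ) > 0, so the lag s = 1 alone shifts the weight at the origin by
order 1/m, which is of the order ℓ/(mh) here. -/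
theorem rateSuboptimal_of_ratio_lt_one {K : ℝ → ℝ} (hK : IsKernel K)
    (hmono : StrictAntiOn K (Set.Icc 0 1)) {q : ℕ} (hq : NearOrigin K q) {t : Tuning}
    (ht : t.Admissible) (hA : t.ApproxUncorrelated) {lam : ℝ} (h0 : 0 < lam) (h1 : lam < 1)
    (hr : Tendsto t.ratio atTop (𝓝 lam)) : RateSuboptimal K q t := by
  have hpos : 0 < K lam := by
    rw [← hK.support 1 (by simp)]
    exact hmono ⟨h0.le, h1.le⟩ ⟨zero_le_one, le_rfl⟩ h1
  have hlim : Tendsto (fun n => K (t.ratio n)) atTop (𝓝 (K lam)) :=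
    (hK.continuousOn.continuousAt (Ioo_mem_nhds (by linarith) h1)).tendsto.comp hr
  have hh : ∀ᶠ n in atTop, lam / 2 * t.ℓ n ≤ t.h n := by
    filter_upwards [hr.eventually (lt_mem_nhds (half_lt_self h0)), ht.eventually_basic] with n hn hb
    have hℓ0 : (0 : ℝ) < t.ℓ n := by exact_mod_cast hb.2.1
    rw [Tuning.ratio, lt_div_iff₀ hℓ0] at hn
    exact hn.le
  have hA' := hA
  obtain ⟨c', c'', hc', -, hδ⟩ := hA'
  refine rateSuboptimal_of_offWt_zero hK hmono.antitoneOn hq ht hA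
    (bandwidth_le_mul ht (half_pos h0) hh) (c := c' * (K lam / 2) * (lam / 2)) (by positivity) ?_
  filter_upwards [hδ, ht.eventually_basic, ht.normalized, hh,
    ht.negligible.eventually (gt_mem_nhds (show (0 : ℝ) < 1 / 2 by norm_num)),
    hlim.eventually (lt_mem_nhds (half_lt_self hpos))] with n g1 hb hd g2 g3 g4
  have hh0 : (0 : ℝ) < t.h n := by exact_mod_cast hb.2.2.1
  have hm0 : (0 : ℝ) < t.m n := by exact_mod_cast hb.2.2.2.1
  refine (offWt_zero_le hK hmono.antitoneOn hd hb.2.1 hb.1 g3.le hc'.le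
    (fun s hs hs' => (g1 s hs hs').2) (N := 1) hb.2.2.2.1 (b := K lam / 2) fun s hs => ?_).trans ?_
  · rw [Finset.Icc_self, Finset.mem_singleton] at hs
    subst hs
    rw [Tuning.ratio] at g4
    simpa using g4.le
  · rw [neg_le_neg_iff]
    calc c' * (K lam / 2) * (lam / 2) * ((t.ℓ n : ℝ) / (t.m n * t.h n))
        = c' * (K lam / 2) * (lam / 2 * t.ℓ n) / (t.m n * t.h n) := by ring
      _ ≤ c' * (K lam / 2) * t.h n / (t.m n * t.h n) := by gcongr
      _ = _ := by field_simp; simp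

end
end DiffLRV

/-! ### The five regimes of h/ℓ. -/

open DiffLRV in
theorem theorem2 (K : ℝ → ℝ) (hK : IsKernel K) (q : ℕ) (hq : NearOrigin K q)
    (t : Tuning) (ht : t.Admissible) :
    -- 1. `h/ℓ → 0`
    (Tendsto t.ratio atTop (𝓝 0) →
      (t.Unambiguous K → Inconsistent K q t) ∧
      (t.ApproxUncorrelated → AntitoneOn K (Set.Icc 0 1) →
        (((fun n => (t.m n : ℝ)) =O[atTop] fun n => (t.ℓ n : ℝ) / (t.h n : ℝ)) →
          Inconsistent K q t) ∧
        (((fun n => (t.ℓ n : ℝ) / (t.h n : ℝ)) =o[atTop] fun n => (t.m n : ℝ)) →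
          RateSuboptimal K q t))) ∧
    -- 2. `h/ℓ → lam ∈ (0,1)`
    (∀ lam : ℝ, 0 < lam → lam < 1 → Tendsto t.ratio atTop (𝓝 lam) →
      (t.Unambiguous K → Inconsistent K q t) ∧
      (t.ApproxUncorrelated → StrictAntiOn K (Set.Icc 0 1) → RateSuboptimal K q t)) ∧
    -- 3. `h/ℓ → 1`, `|h - ℓ| = O(1)`
    (∀ q' : ℕ, Tendsto t.ratio atTop (𝓝 1) →
      (∃ C : ℝ, ∀ᶠ n in atTop, |(t.h n : ℝ) - (t.ℓ n : ℝ)| ≤ C) →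
      t.ApproxUncorrelated → NearBoundary K q' →
      (q = 1 → kappa K ≠ 0 → RateSuboptimal K q t) ∧
      (((fun n => (t.m n : ℝ) * (t.ℓ n : ℝ) ^ q') =o[atTop] fun n => (t.ℓ n : ℝ) ^ q) →
        RateSuboptimal K q t) ∧
      (1 < q →
        ((fun n => (t.ℓ n : ℝ) ^ q) =O[atTop] fun n => (t.m n : ℝ) * (t.ℓ n : ℝ) ^ q') →
        NoBetterThanOpt K q t ∧
        (((fun n => (t.ℓ n : ℝ)) =Θ[atTop] nPow q 1) →
          (nPow q ((q : ℝ) - (q' : ℝ)) =O[atTop] fun n => (t.m n : ℝ)) →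
          ((fun n => (t.m n : ℝ)) =O[atTop] nPow q ((q : ℝ) - 1)) →
          AttainsOpt K q t) ∧
        (kappa K ≠ 0 → RateOptimal K q t →
          ((fun n => (t.ℓ n : ℝ)) =Θ[atTop] nPow q 1) ∧
          (nPow q ((q : ℝ) - (q' : ℝ)) =O[atTop] fun n => (t.m n : ℝ)) ∧
          ((fun n => (t.m n : ℝ)) =O[atTop] nPow q ((q : ℝ) - 1))))) ∧
    -- 4. `h/ℓ → lam ∈ (1,∞)`
    (∀ lam : ℝ, 1 < lam → Tendsto t.ratio atTop (𝓝 lam) → t.ApproxUncorrelated →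
      (q = 1 → kappa K ≠ 0 → RateSuboptimal K q t) ∧
      (1 < q →
        NoBetterThanOpt K q t ∧
        (((fun n => (t.ℓ n : ℝ)) =Θ[atTop] nPow q 1) →
          ((fun n => (t.m n : ℝ)) =O[atTop] nPow q ((q : ℝ) - 1)) →
          AttainsOpt K q t) ∧
        (kappa K ≠ 0 → RateOptimal K q t →
          ((fun n => (t.ℓ n : ℝ)) =Θ[atTop] nPow q 1) ∧
          ((fun n => (t.m n : ℝ)) =O[atTop] nPow q ((q : ℝ) - 1))))) ∧
    -- 5. `h/ℓ → ∞`
    (Tendsto t.ratio atTop atTop →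
      (q = 1 → kappa K ≠ 0 → RateSuboptimal K q t) ∧
      (1 < q →
        NoBetterThanOpt K q t ∧
        (((fun n => (t.ℓ n : ℝ)) =Θ[atTop] nPow q 1) →
          (nPow q 1 =o[atTop] fun n => (t.m n : ℝ) * (t.h n : ℝ)) →
          ((fun n => (t.m n : ℝ) * (t.h n : ℝ)) =O[atTop] nPow q (q : ℝ)) →
          AttainsOpt K q t) ∧
        (kappa K ≠ 0 → t.ApproxUncorrelated → RateOptimal K q t →
          ((fun n => (t.ℓ n : ℝ)) =Θ[atTop] nPow q 1) ∧
          (nPow q 1 =o[atTop] fun n => (t.m n : ℝ) * (t.h n : ℝ)) ∧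
          ((fun n => (t.m n : ℝ) * (t.h n : ℝ)) =O[atTop] nPow q (q : ℝ))))) := by
  have hq1 : 1 ≤ q := hq.1
  refine ⟨fun hr => ⟨fun hU => inconsistent_of_unambiguous hK ht hU q, fun hA hmono =>
      ⟨fun hm => inconsistent_of_ratio hK hmono ht hA hr hm q,
        fun hm => rateSuboptimal_of_ratio hK hmono hq ht hA hr hm⟩⟩,
    fun lam h0 h1 hr => ⟨fun hU => inconsistent_of_unambiguous hK ht hU q,
      fun hA hmono => rateSuboptimal_of_ratio_lt_one hK hmono hq ht hA h0 h1 hr⟩,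
    fun q' _ hC hA hq' => ⟨?_, fun ho => rateSuboptimal_near_boundary hK hq hq' ht hA hC ho,
      fun _ hO => ⟨noBetterThanOpt_of_riskLowerBound ht
          (riskLowerBound_of_near hK hq hq' ht hA hC (pow_isBigO_iff.1 hO)),
        fun hℓ _ hm => attainsOpt_near hK hq hq' ht hA hC hO hℓ hm,
        fun hκ hopt => conditions_of_rateOptimal_near hK hq hq' hκ ht hA hC hO hopt⟩⟩,
    fun lam hlam hr hA => ?_, fun hr => ⟨?_, fun _ => ⟨?_,
      fun hℓ _ hmh => attainsOpt_far hK hq ht hr hℓ hmh,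
      fun hκ hA hopt => conditions_of_rateOptimal_far hK hq hκ ht hA hr hopt⟩⟩⟩
  · rintro rfl hκ
    exact rateSuboptimal_near_one hK hq hq' hκ ht hA hC
  · obtain ⟨e, he, hgap⟩ := eventually_gap_of_tendsto ht hlam hr
    have hrisk := riskLowerBound_of_gap hK hq ht he hgap
    have hh : ∀ᶠ n in atTop, 1 * (t.ℓ n : ℝ) ≤ t.h n := by
      filter_upwards [hgap] with n hn
      refine le_trans ?_ hn
      gcongr
      linarith
    refine ⟨?_, fun _ => ⟨noBetterThanOpt_of_riskLowerBound ht hrisk, fun hℓ hm => ?_,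
      fun hκ hopt => ?_⟩⟩
    · rintro rfl hκ
      exact rateSuboptimal_of_one hK hκ ht hA one_pos hh hrisk
    · exact attainsOpt_of (rateOptimal_of_comparable hK hq ht (eventually_le_mul_of_tendsto ht hr)
        hℓ hm (exists_offDiag_gap hK ht he hgap q)) (noBetterThanOpt_of_riskLowerBound ht hrisk)
    · obtain ⟨C, hC, h⟩ := bandwidth_of_rateOptimal hq1 ht hrisk hopt
      exact ⟨isTheta_scale_of_bounds (by linarith) h,
        order_isBigO_iff.2 (order_le_of_rateOptimal hK hκ hq1 ht hA one_pos hh hrisk hopt)⟩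
  · rintro rfl hκ
    exact rateSuboptimal_far_one hK hq hκ ht hr
  · obtain ⟨e, he, hgap⟩ := eventually_gap ht (lam := 2) (by norm_num) (hr.eventually_gt_atTop 2)
    exact noBetterThanOpt_of_riskLowerBound ht (riskLowerBound_of_gap hK hq ht he hgap)
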